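/- Notation. Write $e(t)=e^{2\pi i t}$, let $\mathbb T^d=\mathbb R^d/\mathbb Z^d$ be identified with $[-1/2,1/2)^d$, and let $\log$ be the logarithm to base $2$. For a bounded measurable $\mathfrak m:\mathbb R^d\to\mathbb C$ and $f\in C_c^\infty(\mathbb R^d)$ put $$T_{\mathbb R^d}[\mathfrak m]f(x)=\int_{\mathbb R^d}e(-x\cdot\xi)\,\mathfrak m(\xi)\int_{\mathbb R^d}f(y)e(y\cdot\xi)\,dy\,d\xi .$$ For a finite set $\Sigma\subset\mathbb T^d$, a bounded measurable $\mathfrak m$ supported in $[-1/4,1/4]^d$ (regarded as a function on $\mathbb T^d$) and a finitely supported $f:\mathbb Z^d\to\mathbb C$ put $$T^{\Sigma}_{\mathbb Z^d}[\mathfrak m]f(x)=\int_{\mathbb T^d}e(-x\cdot\xi)\sum_{\theta\in\Sigma}\mathfrak m(\xi-\theta)\sum_{y\in\mathbb Z^d}f(y)e(y\cdot\xi)\,d\xi .$$ Operator norms are taken over these test functions and may be $+\infty$. The canonical fractions are $\mathcal R^d_{\le N}=\{a/q+\mathbb Z^d: a\in\mathbb Z^d,\ 1\le q\le N,\ \gcd(a_1,\dots,a_d,q)=1\}\subset\mathbb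 T^d$. For $r\in[1,\infty)$ and a complex sequence $(\mathfrak a_n)_{n\in\mathbb N}$, $\mathbb N=\{0,1,2,\dots\}$, let $$\mathbf V^r(\mathfrak a_n:n\in\mathbb N)=\sup_{n}|\mathfrak a_n|+\sup_{J\ge1}\ \sup_{t_0<\dots<t_J}\Big(\sum_{j=1}^J|\mathfrak a_{t_j}-\mathfrak a_{t_{j-1}}|^r\Big)^{1/r},$$ and $\mathbf V^\infty(\mathfrak a_n:n\in\mathbb N)=\sup_n|\mathfrak a_n|+\sup_{m,n}|\mathfrak a_m-\mathfrak a_n|$; the norm of $L^p(\mathbf V^r)$ is the $L^p$ norm of $x\mapsto\mathbf V^r(\mathfrak a_n(x):n\in\mathbb N)$. Theorem. Let $p_0\in\{2,4,6,\dots\}$ and $r\in(2,\infty]$. There is a constant $\mathbf C=\mathbf C(p_0,r)>0$ such that for every $p\in[p_0',p_0]$ (with $p_0'=p_0/(p_0-1)$), every integer $d\ge1$ and every $\lambda>1$ there is a constant $K=K(\lambda,d,p_0,p,r)>0$ with the following property. Let $N\ge1$ be an integer, let $(\lambda_n)_{n\in\mathbb N}$ be positive integers with $\lambda_{n+1}/\lambda_n\ge\lambda$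 for all $n$, let $$0<\vartheta_n\le\min\{(2p_0N^{p_0})^{-1},\lambda_n^{-1}\}\qquad(n\in\mathbb N),$$ and let $\mathfrak m_n:\mathbb R^d\to\mathbb C$ be bounded measurable functions supported on $[-\vartheta_n,\vartheta_n]^d$. Set $$\mathbf A_{p,r}=\big\|(T_{\mathbb R^d}[\mathfrak m_n])_{n\in\mathbb N}\big\|_{L^p(\mathbb R^d)\to L^p(\mathbb R^d;\mathbf V^r)},\qquad \mathbf B_{p_0}=\sup_{\omega\in\{-1,1\}^{\mathbb N}}\Big\|\sum_{n\in\mathbb N}\omega_nT_{\mathbb R^d}[\mathfrak m_{n+1}-\mathfrak m_n]\Big\|_{L^{p_0}(\mathbb R^d)\to L^{p_0}(\mathbb R^d)} .$$ Then $$\Big\|\big(T^{\mathcal R^d_{\le N}}_{\mathbb Z^d}[\mathfrak m_n]\big)_{n\in\mathbb N}\Big\|_{\ell^p(\mathbb Z^d)\to\ell^p(\mathbb Z^d;\mathbf V^r)}\le K\,N^{\mathbf C\frac{\log\log\log N}{\log\log N}}\,(\mathbf A_{p,r}+\mathbf B_{p_0}),$$ where for $N\in\{1,2\}$, for which the exponent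 is undefined, the power of $N$ is read as $1$. -/

import Mathlib

open MeasureTheory
open scoped ENNReal FourierTransform

noncomputable section

namespace IWVar

/-! ### Variational norms -/

/-- The `r`-variation seminorm `V^r(a_t : t ∈ ι)` of a complex family, for `r ∈ [1, ∞]`, with values
in `[0, ∞]`. For finite `r` the supremum runs over all finite increasing sequences
`t_0 < ⋯ < t_J` (the term `J = 0` contributes `0`); `V^∞` is the supremum of `|a_s - a_t|`. -/
def variation {ι : Type*} [Preorder ι] (r : ℝ≥0∞) (a : ι → ℂ) : ℝ≥0∞ :=
  if r = ⊤ then ⨆ (s : ι) (t : ι), ‖a s - a t‖ₑ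
  else ⨆ (J : ℕ) (t : Fin (J + 1) → ι) (_ : StrictMono t),
    (∑ j : Fin J, ‖a (t j.succ) - a (t j.castSucc)‖ₑ ^ r.toReal) ^ (1 / r.toReal)

/-- The `r`-variation norm `sup_t |a_t| + V^r(a_t : t ∈ ι)` (bold `V^r`). -/
def variationNorm {ι : Type*} [Preorder ι] (r : ℝ≥0∞) (a : ι → ℂ) : ℝ≥0∞ :=
  (⨆ t : ι, ‖a t‖ₑ) + variation r a

/-! ### Operator norms -/

/-- The `L^p` operator norm of `S`, defined a priori on the class `D` of test functions: the least
`C ∈ [0, ∞]` with `‖S f‖_p ≤ C ‖f‖_p` for all `f ∈ D`. The values of `S f` lie in `ℂ`, or in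
`[0, ∞]` when `S f x` is already the norm of a vector. -/
def opNorm {X ε : Type*} [MeasurableSpace X] [ENorm ε] (μ : Measure X) (D : Set (X → ℂ))
    (p : ℝ≥0∞) (S : (X → ℂ) → X → ε) : ℝ≥0∞ :=
  sInf {C : ℝ≥0∞ | ∀ f ∈ D, eLpNorm (S f) p μ ≤ C * eLpNorm f p μ}

/-- Test functions on `ℝ^d`: smooth with compact support. -/
def testR (d : ℕ) : Set (EuclideanSpace ℝ (Fin d) → ℂ) :=
  {f | ContDiff ℝ ((⊤ : ℕ∞) : WithTop ℕ∞) f ∧ HasCompactSupport f}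

/-- Test functions on `ℤ^d`: finitely supported. -/
def testZ (d : ℕ) : Set ((Fin d → ℤ) → ℂ) :=
  {f | f.support.Finite}

/-! ### Fourier multiplier operators -/

/-- The Fourier multiplier operator on `ℝ^d`,
`T[m] f (x) = ∫ e(-x·ξ) m(ξ) (∫ f(y) e(y·ξ) dy) dξ`, where `e(t) = exp(2πit)`.
The inner integral is Mathlib's `𝓕⁻ f`, the outer one is Mathlib's `𝓕`. -/
def TR {d : ℕ} (m : EuclideanSpace ℝ (Fin d) → ℂ) (f : EuclideanSpace ℝ (Fin d) → ℂ) :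
    EuclideanSpace ℝ (Fin d) → ℂ :=
  𝓕 (fun ξ : EuclideanSpace ℝ (Fin d) => m ξ * 𝓕⁻ f ξ)

/-- The Fourier multiplier operator on `ℤ^d` with symbol `M` on the torus `𝕋^d = (ℝ/ℤ)^d`,
`T[M] f (x) = ∫_{𝕋^d} e(-x·ξ) M(ξ) (∑_y f(y) e(y·ξ)) dξ`. -/
def TZ {d : ℕ} (M : UnitAddTorus (Fin d) → ℂ) (f : (Fin d → ℤ) → ℂ) (x : Fin d → ℤ) : ℂ :=
  ∫ ξ : UnitAddTorus (Fin d), UnitAddTorus.mFourier (-x) ξ * M ξ *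
    ∑' y : Fin d → ℤ, f y * UnitAddTorus.mFourier y ξ

/-- The representative in `[-1/2, 1/2)^d` of a point of the torus. -/
def torusRep {d : ℕ} (ξ : UnitAddTorus (Fin d)) : EuclideanSpace ℝ (Fin d) :=
  WithLp.toLp 2 fun i => (AddCircle.equivIco (1 : ℝ) (-1 / 2) (ξ i) : ℝ)

/-- The operator `T_{ℤ^d}^Σ[m]`, with symbol `∑_{θ ∈ Σ} m(ξ - θ)` on the torus, where `𝕋^d` is
identified with `[-1/2, 1/2)^d`. -/
def TZper {d : ℕ} (S : Finset (UnitAddTorus (Fin d))) (m : EuclideanSpace ℝ (Fin d) → ℂ)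
    (f : (Fin d → ℤ) → ℂ) : (Fin d → ℤ) → ℂ :=
  TZ (fun ξ => ∑ θ ∈ S, m (torusRep (ξ - θ))) f

/-! ### Canonical fractions -/

/-- The canonical fractions in `𝕋^d`: classes of `a/q` with `1 ≤ q ≤ N` and
`gcd(a_1, …, a_d, q) = 1`. -/
def canonicalFractions (d N : ℕ) : Set (UnitAddTorus (Fin d)) :=
  {θ | ∃ (q : ℕ) (a : Fin d → ℤ), 1 ≤ q ∧ q ≤ N ∧
    Nat.gcd (Finset.univ.gcd fun i => (a i).natAbs) q = 1 ∧
    θ = fun i => (((a i : ℝ) / (q : ℝ) : ℝ) : UnitAddCircle)}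

theorem canonicalFractions_finite (d N : ℕ) : (canonicalFractions d N).Finite := by
  have h : Set.Finite (⋃ q ∈ Set.Icc 1 N, Set.pi Set.univ fun _ : Fin d =>
      (fun b : ℤ => (((b : ℝ) / (q : ℝ) : ℝ) : UnitAddCircle)) '' Set.Ico (0 : ℤ) (q : ℤ)) :=
    (Set.finite_Icc 1 N).biUnion fun q _ =>
      Set.Finite.pi fun _ => (Set.finite_Ico _ _).image _
  refine h.subset ?_
  rintro θ ⟨q, a, hq1, hqN, -, rfl⟩
  have hq : (0 : ℤ) < q := by exact_mod_cast hq1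
  have hqR : (q : ℝ) ≠ 0 := by exact_mod_cast hq.ne'
  simp only [Set.mem_iUnion]
  refine ⟨q, ⟨hq1, hqN⟩, fun i _ => ⟨a i % q,
    ⟨Int.emod_nonneg _ hq.ne', Int.emod_lt_of_pos _ hq⟩, ?_⟩⟩
  have hdiv : (a i : ℝ) / q = ((a i % q : ℤ) : ℝ) / q + ((a i / q : ℤ) : ℝ) := by
    have h1 : ((a i % q : ℤ) : ℝ) + (q : ℝ) * ((a i / q : ℤ) : ℝ) = (a i : ℝ) := by
      exact_mod_cast Int.emod_add_mul_ediv (a i) q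
    rw [← h1]
    field_simp
  have hz : (((a i / q : ℤ) : ℝ) : UnitAddCircle) = 0 :=
    (AddCircle.coe_eq_zero_iff (1 : ℝ)).2 ⟨a i / q, by simp⟩
  change ((((a i % q : ℤ) : ℝ) / (q : ℝ) : ℝ) : UnitAddCircle) =
    (((a i : ℝ) / (q : ℝ) : ℝ) : UnitAddCircle)
  rw [hdiv, AddCircle.coe_add, hz, add_zero]

/-- The canonical fractions as a finite set. -/
def canonicalFinset (d N : ℕ) : Finset (UnitAddTorus (Fin d)) :=
  (canonicalFractions_finite d N).toFinset

/-! ### The quantities in the theorem -/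

/-- `(l n)` enumerates a `lam`-lacunary set of positive integers. -/
def IsLacunary (lam : ℝ) (l : ℕ → ℕ) : Prop :=
  (∀ n, 1 ≤ l n) ∧ ∀ n, lam ≤ (l (n + 1) : ℝ) / (l n : ℝ)

/-- The constant `A_{p,r}`: the norm of `(T_{ℝ^d}[m_n])_n` from `L^p` to `L^p(V^r)`. -/
def constA {d : ℕ} (p r : ℝ≥0∞) (m : ℕ → EuclideanSpace ℝ (Fin d) → ℂ) : ℝ≥0∞ :=
  opNorm volume (testR d) p fun f x => variationNorm r fun n : ℕ => TR (m n) f x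

/-- The constant `B_{p₀}`: the supremum over all signs of the `L^{p₀}` operator norm of
`∑_n ω_n T_{ℝ^d}[m_{n+1} - m_n]`; the series is summed
pointwise. It converges absolutely at every point when the `m_n` are uniformly bounded with supports
in shrinking boxes `[-ϑ_n, ϑ_n]^d` and `∑ ϑ_n^d < ∞`; finiteness of `A_{p,r}` forces the uniform
bound (a.e.), and in the other case the bound of the theorem is trivial. -/
def constB {d : ℕ} (p₀ : ℝ≥0∞) (m : ℕ → EuclideanSpace ℝ (Fin d) → ℂ) : ℝ≥0∞ :=
  ⨆ ω : ℕ → ℤˣ, opNorm volume (testR d) p₀ fun f x =>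
    ∑' n : ℕ, ((ω n : ℤ) : ℂ) * TR (m (n + 1) - m n) f x

/-- The norm of `(T_{ℤ^d}^{R_{≤N}}[m_n])_n` from `ℓ^p` to `ℓ^p(V^r)`. -/
def discreteNorm {d : ℕ} (N : ℕ) (p r : ℝ≥0∞) (m : ℕ → EuclideanSpace ℝ (Fin d) → ℂ) : ℝ≥0∞ :=
  opNorm Measure.count (testZ d) p fun f x =>
    variationNorm r fun n : ℕ => TZper (canonicalFinset d N) (m n) f x

/-- The factor `N^{C log log log N / log log N}`, logarithms to base `2`. The exponent is undefined
for `N ∈ {1, 2}`, where the factor is taken to be `1`. -/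
def growth (C : ℝ) (N : ℕ) : ℝ :=
  if N ≤ 2 then 1
  else (N : ℝ) ^ (C * (Real.logb 2 (Real.logb 2 (Real.logb 2 N)) / Real.logb 2 (Real.logb 2 N)))

end IWVar

end

/-! The core is a scalar theorem. Let `μ` be a multiplier on the torus supported within `δ` of `0`,
with `δ` of size `N^(-p₀)`, whose convolution operator is bounded on `ℓ^{p₀}`. Then the sum of its
translates to all fractions of denominator at most `N` is bounded on `ℓ^p` for `p₀' ≤ p ≤ p₀`, with
a loss `S^e` (`exists_convBdd_periodize`). Here `S` bounds the number of `u ≤ N` composed of the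
primes of a given `q ≤ N`. Rankin's trick gives `S = N^{O(log log log N / log log N)}`, and the
other losses `2^{ω(q)}`, `d(q)` and `log N` are at most powers of `S`.

For the scalar theorem, the fractions are placed in `G = (ℤ/Q)^d`, where every `q ≤ N` divides `Q`.
Let `f_a` be the part of `f` near the frequency `a/Q`, recentred at `0`. The output at `x` is the
character sum `∑ (μ * f_a)(x) χ(y, a)` at `y = -x`. For an even exponent `2(k+1)`, the `(k+1)`-th
power only involves sums of `k+1` fractions, which are still separated on the scale of `δ`.
Orthogonality then shows that the norm on the diagonal equals the mean over a free `y ∈ G`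
(`card_mul_tsum_diag`). For each fixed `y` the hypothesis on `μ` applies to one function, so it
remains to bound the lifted family of smoothly cut pieces (`exists_lift_bound`).

In the lifted family the primary components of `y` are independent. An inequality for one mean zero
perturbation, iterated over the primes (`exists_rho_decoupling`), bounds the moment of the family
with weights `ρ^ω` by a sum, over sets `D` of primes, of moments of square functions: the components
in `D` stay in a character sum, the others are summed in `ℓ²`. The square functions are bounded on
`L²` by Parseval and on `L^∞` by Bessel's inequality after Möbius inversion to torsion subgroups
(`squareFn_le`), hence on `L^{2(k+1)}` by real interpolation. Duality and Riesz–Thorin give the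
remaining exponents.

For the variation, the sequence is cut at `M` comparable to `N²`. For `n ≥ M` lacunarity makes the
supports smaller than a multiple of `1/N!`. The operators then factor as a scalar operator with a
fixed cutoff, followed by the periodisation over all of `(1/N!)ℤ^d`. The kernels of the latter live
on `N!·ℤ^d`, so a sampling argument transfers the bound `A_{p,r}` without loss
(`exists_large_scales`). For `n < M` the Rademacher–Menshov inequality bounds the variation by
`O(log N)` dyadic square functions, and Khinchine's inequality replaces these by signed sums of
differences. Their symbols obey the scalar theorem, with `B_{p₀}` as the bound on `ℝ^d`. -/

noncomputable section

namespace IWVar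

/-! ### Counting integers with prescribed prime factors -/

/-- The number of `u ∈ [1, N]` all of whose prime factors divide `q`. -/
def smoothCount (N q : ℕ) : ℕ :=
  ((Finset.Icc 1 N).filter fun u => u.primeFactors ⊆ q.primeFactors).card

/-- The completely multiplicative function `n ↦ n ^ (-ε)`. -/
def negPowHom (ε : ℝ) : ℕ →* ℝ where
  toFun n := (n : ℝ) ^ (-ε)
  map_one' := by simp
  map_mul' a b := by
    push_cast
    exact Real.mul_rpow (Nat.cast_nonneg _) (Nat.cast_nonneg _)

theorem negPowHom_prime_lt_one {ε : ℝ} (hε : 0 < ε) {p : ℕ} (hp : p.Prime) :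
    ‖negPowHom ε p‖ < 1 := by
  have h2 : (1 : ℝ) < p := by exact_mod_cast hp.one_lt
  change ‖(p : ℝ) ^ (-ε)‖ < 1
  rw [Real.norm_of_nonneg (by positivity)]
  exact Real.rpow_lt_one_of_one_lt_of_neg h2 (by linarith)

/-- Rankin's trick: every counted `u` satisfies `(N/u)^ε ≥ 1`, and the sum of `u^(-ε)` over all
numbers with prime factors in `S` is the Euler product. -/
theorem card_factored_le {ε : ℝ} (hε : 0 < ε) (N : ℕ) (S : Finset ℕ) :
    (((Finset.Icc 1 N).filter fun u => u.primeFactors ⊆ S).card : ℝ) ≤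
      (N : ℝ) ^ ε * ∏ p ∈ S with p.Prime, (1 - (p : ℝ) ^ (-ε))⁻¹ := by
  obtain ⟨hs, hh⟩ := EulerProduct.summable_and_hasSum_factoredNumbers_prod_filter_prime_geometric
    (fun {p} hp => negPowHom_prime_lt_one (p := p) hε hp) S
  have hprod : ∏ p ∈ S with p.Prime, (1 - (p : ℝ) ^ (-ε))⁻¹ =
      ∑' m : Nat.factoredNumbers S, negPowHom ε m := hh.tsum_eq.symm
  rw [hprod, ← tsum_mul_left]
  set F := (Finset.Icc 1 N).filter fun u => u.primeFactors ⊆ S with hF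
  have hmem : ∀ u ∈ F, u ∈ Nat.factoredNumbers S := by
    intro u hu
    simp only [hF, Finset.mem_filter, Finset.mem_Icc] at hu
    exact Nat.mem_factoredNumbers_of_primeFactors_subset (by omega) hu.2
  have hle : ∑ m ∈ F.attach.map ⟨fun u => (⟨u.1, hmem u.1 u.2⟩ : Nat.factoredNumbers S),
      fun a b h => Subtype.ext (by simpa using h)⟩, (N : ℝ) ^ ε * negPowHom ε m ≤
      ∑' m : Nat.factoredNumbers S, (N : ℝ) ^ ε * negPowHom ε m := by
    refine (hh.summable.mul_left _).sum_le_tsum _ fun m _ => ?_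
    have : 0 ≤ negPowHom ε m := Real.rpow_nonneg (Nat.cast_nonneg _) _
    positivity
  refine le_trans ?_ hle
  rw [Finset.sum_map]
  have : (F.card : ℝ) = ∑ u ∈ F.attach, (1 : ℝ) := by simp
  rw [this]
  refine Finset.sum_le_sum fun u _ => ?_
  have hu := u.2
  simp only [hF, Finset.mem_filter, Finset.mem_Icc] at hu
  change 1 ≤ (N : ℝ) ^ ε * ((u.1 : ℕ) : ℝ) ^ (-ε)
  have hu0 : (0 : ℝ) < (u.1 : ℕ) := by exact_mod_cast hu.1.1
  rw [Real.rpow_neg hu0.le, ← div_eq_mul_inv, one_le_div (by positivity)]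
  exact Real.rpow_le_rpow hu0.le (by exact_mod_cast hu.1.2) hε.le

theorem half_le_one_sub_two_rpow {ε : ℝ} (h0 : 0 < ε) (h1 : ε ≤ 1) :
    ε / 2 ≤ 1 - (2 : ℝ) ^ (-ε) := by
  have h := rpow_one_add_le_one_add_mul_self (s := -1 / 2) (p := ε) (by norm_num) h0.le h1
  have : (2 : ℝ) ^ (-ε) = (1 + -1 / 2) ^ ε := by
    rw [Real.rpow_neg (by norm_num), ← Real.inv_rpow (by norm_num)]
    norm_num
  rw [this]
  linarith

/-- Split the primes at `T = 2^(1/ε)`. Below `T` a factor is at most `2/ε`, and there are at most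
`T` of them. From `T` on, `p^ε ≥ 2`, so a factor is at most `2 ≤ p^ε`, and the product of these
primes divides `q ≤ N`. -/
theorem prod_one_sub_inv_le {ε : ℝ} (h0 : 0 < ε) (h1 : ε ≤ 1) {N q : ℕ} (hq : 1 ≤ q)
    (hqN : q ≤ N) :
    ∏ p ∈ q.primeFactors with p.Prime, (1 - (p : ℝ) ^ (-ε))⁻¹ ≤
      (2 / ε) ^ ((2 : ℝ) ^ (1 / ε)) * (N : ℝ) ^ ε := by
  set T : ℝ := (2 : ℝ) ^ (1 / ε) with hT
  have hfil : q.primeFactors.filter Nat.Prime = q.primeFactors := by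
    rw [Finset.filter_true_of_mem]
    exact fun p hp => Nat.prime_of_mem_primeFactors hp
  rw [hfil, ← Finset.prod_filter_mul_prod_filter_not _ (fun p : ℕ => (p : ℝ) < T)]
  have hpos : ∀ p ∈ q.primeFactors, 0 < 1 - (p : ℝ) ^ (-ε) := by
    intro p hp
    have := negPowHom_prime_lt_one h0 (Nat.prime_of_mem_primeFactors hp)
    change ‖(p : ℝ) ^ (-ε)‖ < 1 at this
    have := (le_abs_self _).trans_lt this
    linarith
  have hE : 1 ≤ 2 / ε := by rw [one_le_div h0]; linarith
  refine mul_le_mul ?_ ?_ (Finset.prod_nonneg fun p hp => ?_) (by positivity)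
  · have hc : ∏ p ∈ q.primeFactors with ((p : ℕ) : ℝ) < T, (1 - (p : ℝ) ^ (-ε))⁻¹ ≤
        ∏ p ∈ q.primeFactors with ((p : ℕ) : ℝ) < T, (2 / ε) := by
      refine Finset.prod_le_prod (fun p hp => ?_) fun p hp => ?_
      · exact (inv_pos.2 (hpos p (Finset.mem_filter.1 hp).1)).le
      · rw [Finset.mem_filter] at hp
        have h2 : (2 : ℝ) ≤ p := by
          exact_mod_cast (Nat.prime_of_mem_primeFactors hp.1).two_le
        have : (p : ℝ) ^ (-ε) ≤ (2 : ℝ) ^ (-ε) :=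
          Real.rpow_le_rpow_of_nonpos (by norm_num) h2 (by linarith)
        have h3 := half_le_one_sub_two_rpow h0 h1
        rw [show 2 / ε = (ε / 2)⁻¹ by rw [inv_div]]
        exact inv_anti₀ (by positivity) (by linarith)
    refine hc.trans ?_
    rw [Finset.prod_const, ← Real.rpow_natCast]
    refine Real.rpow_le_rpow_of_exponent_le hE ?_
    have hsub : (q.primeFactors.filter fun p : ℕ => (p : ℝ) < T) ⊆ Finset.Icc 1 ⌊T⌋₊ := by
      intro p hp
      rw [Finset.mem_filter] at hp
      rw [Finset.mem_Icc]
      exact ⟨(Nat.prime_of_mem_primeFactors hp.1).one_lt.le, Nat.le_floor hp.2.le⟩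
    have := Finset.card_le_card hsub
    rw [Nat.card_Icc] at this
    have hfl : ((⌊T⌋₊ : ℕ) : ℝ) ≤ T := Nat.floor_le (by positivity)
    refine le_trans ?_ hfl
    exact_mod_cast (by simpa using this)
  · have hc : ∏ p ∈ q.primeFactors with ¬ ((p : ℕ) : ℝ) < T, (1 - (p : ℝ) ^ (-ε))⁻¹ ≤
        ∏ p ∈ q.primeFactors with ¬ ((p : ℕ) : ℝ) < T, (p : ℝ) ^ ε := by
      refine Finset.prod_le_prod (fun p hp => ?_) fun p hp => ?_
      · exact (inv_pos.2 (hpos p (Finset.mem_filter.1 hp).1)).le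
      · rw [Finset.mem_filter, not_lt] at hp
        have hp0 : (0 : ℝ) < p := by
          exact_mod_cast (Nat.prime_of_mem_primeFactors hp.1).pos
        have h2 : 2 ≤ (p : ℝ) ^ ε := by
          have := Real.rpow_le_rpow (by positivity) hp.2 h0.le
          rwa [hT, ← Real.rpow_mul (by norm_num), one_div_mul_cancel h0.ne', Real.rpow_one] at this
        have h3 : (p : ℝ) ^ (-ε) ≤ 1 / 2 := by
          rw [Real.rpow_neg hp0.le, inv_eq_one_div]
          exact one_div_le_one_div_of_le (by norm_num) h2
        refine le_trans (inv_anti₀ (by norm_num) (show (1 : ℝ) / 2 ≤ 1 - (p : ℝ) ^ (-ε) by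
          linarith)) ?_
        norm_num
        exact h2
    refine hc.trans ?_
    rw [Real.finsetProd_rpow _ _ fun p _ => Nat.cast_nonneg _]
    refine Real.rpow_le_rpow (Finset.prod_nonneg fun p _ => Nat.cast_nonneg _) ?_ h0.le
    have hle : ∏ p ∈ q.primeFactors with ¬ ((p : ℕ) : ℝ) < T, p ≤ N := by
      refine le_trans (Nat.le_of_dvd (by omega) ?_) hqN
      exact (Finset.prod_dvd_prod_of_subset _ _ _ (Finset.filter_subset _ _)).trans
        (Nat.prod_primeFactors_dvd q)
    rw [← Nat.cast_prod]
    exact_mod_cast hle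
  · exact (inv_pos.2 (hpos p (Finset.mem_filter.1 hp).1)).le

theorem growth_pos (C : ℝ) {N : ℕ} (hN : 1 ≤ N) : 0 < growth C N := by
  unfold growth
  split_ifs
  · exact one_pos
  · have : (0 : ℝ) < N := by exact_mod_cast hN
    positivity

theorem growth_mul (C D : ℝ) {N : ℕ} (hN : 1 ≤ N) :
    growth C N * growth D N = growth (C + D) N := by
  unfold growth
  split_ifs
  · simp
  · have : (0 : ℝ) < N := by exact_mod_cast hN
    rw [← Real.rpow_add this]
    ring_nf

theorem growth_pow (C : ℝ) {N : ℕ} (hN : 1 ≤ N) (k : ℕ) : growth C N ^ k = growth (k * C) N := by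
  induction k with
  | zero => unfold growth; simp
  | succ k ih => rw [pow_succ, ih, growth_mul _ _ hN]; congr 1; push_cast; ring

/-- Take `ε = 2 / log log N` in the two bounds above, so that `2^(1/ε) = √(log N)`. The small primes
cost `(log log N)^√(log N)`, at most `N^(log log log N / log log N)`, and the two factors `N^ε` cost
`N^(4 / log log N)`. The sum of the exponents is within the constant `5` because `log log log N ≥
1`. -/
theorem smoothCount_le_growth_of_large {N q : ℕ} (hN : 2 ^ 16 ≤ N) (hq : 1 ≤ q) (hqN : q ≤ N) :
    (smoothCount N q : ℝ) ≤ growth 5 N := by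
  have hN0 : (0 : ℝ) < N := by exact_mod_cast (lt_of_lt_of_le (by norm_num) hN)
  set L : ℝ := Real.logb 2 N with hL
  have hL16 : 16 ≤ L := by
    rw [hL, Real.le_logb_iff_rpow_le (by norm_num) hN0]
    exact_mod_cast hN
  have hL0 : 0 < L := by linarith
  set L2 : ℝ := Real.logb 2 L with hL2
  have hL24 : 4 ≤ L2 := by
    rw [hL2, Real.le_logb_iff_rpow_le (by norm_num) hL0]
    norm_num
    exact hL16
  set L3 : ℝ := Real.logb 2 L2 with hL3
  have hL31 : 1 ≤ L3 := by
    rw [hL3, Real.le_logb_iff_rpow_le (by norm_num) (by linarith)]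
    norm_num
    linarith
  have hε0 : 0 < 2 / L2 := by positivity
  have hε1 : 2 / L2 ≤ 1 := by rw [div_le_one (by linarith)]; linarith
  have h1 := card_factored_le hε0 N q.primeFactors
  have h2 := prod_one_sub_inv_le hε0 hε1 hq hqN
  have hT : (2 : ℝ) ^ (1 / (2 / L2)) = Real.sqrt L := by
    rw [Real.sqrt_eq_rpow, one_div_div, ← Real.rpow_logb (b := 2) (by norm_num) (by norm_num) hL0,
      ← Real.rpow_mul (by norm_num), ← hL2]
    congr 1
    ring
  have hsq : L2 ≤ Real.sqrt L := by
    -- `log₂ L ≤ √L` for `L ≥ 16`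
    set x := Real.sqrt L with hx
    have hx4 : 4 ≤ x := by
      rw [hx, show (4 : ℝ) = Real.sqrt 16 by
        rw [show (16 : ℝ) = 4 ^ 2 by norm_num, Real.sqrt_sq (by norm_num)]]
      exact Real.sqrt_le_sqrt hL16
    have hLx : L = x ^ 2 := (Real.sq_sqrt hL0.le).symm
    have hx0 : 0 < x := by linarith
    rw [hL2, hLx, Real.logb_le_iff_le_rpow (by norm_num) (by positivity)]
    -- `log x / x` decreases beyond `e`; comparing `x = √L ≥ 4` with `4` gives `x² ≤ 2^x`.
    have hlog : Real.log 4 / 4 ≥ Real.log x / x :=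
      Real.log_div_self_antitoneOn (by
        exact (Real.exp_one_lt_d9.trans (by norm_num)).le) (by
        exact ((Real.exp_one_lt_d9.trans (by norm_num)).le.trans hx4)) hx4
    have hl4 : Real.log 4 = 2 * Real.log 2 := by
      rw [show (4 : ℝ) = 2 ^ 2 by norm_num, Real.log_pow]
      norm_num
    have h5 : 2 * Real.log x ≤ x * Real.log 2 := by
      rw [ge_iff_le, div_le_div_iff₀ hx0 (by norm_num)] at hlog
      nlinarith
    rw [← Real.log_le_log_iff (by positivity) (by positivity), Real.log_pow,
      Real.log_rpow (by norm_num)]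
    exact_mod_cast h5
  have hsq0 : 0 < Real.sqrt L := Real.sqrt_pos.2 hL0
  have h3 : (2 / (2 / L2)) ^ ((2 : ℝ) ^ (1 / (2 / L2))) ≤ (N : ℝ) ^ (L3 / L2) := by
    rw [hT, show 2 / (2 / L2) = L2 by field_simp]
    have e1 : L2 ^ Real.sqrt L = (2 : ℝ) ^ (L3 * Real.sqrt L) := by
      rw [Real.rpow_mul (by norm_num), hL3, Real.rpow_logb (by norm_num) (by norm_num)
        (by linarith)]
    have e2 : (N : ℝ) ^ (L3 / L2) = (2 : ℝ) ^ (L * (L3 / L2)) := by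
      rw [Real.rpow_mul (by norm_num), hL, Real.rpow_logb (by norm_num) (by norm_num) hN0]
    rw [e1, e2]
    refine Real.rpow_le_rpow_of_exponent_le (by norm_num) ?_
    have : Real.sqrt L ≤ L / L2 := by
      rw [le_div_iff₀ (by linarith)]
      calc Real.sqrt L * L2 ≤ Real.sqrt L * Real.sqrt L := by gcongr
        _ = L := Real.mul_self_sqrt hL0.le
    calc L3 * Real.sqrt L ≤ L3 * (L / L2) := by gcongr
      _ = L * (L3 / L2) := by ring
  have hNone : (1 : ℝ) ≤ N := by exact_mod_cast hq.trans hqN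
  have hgr : growth 5 N = (N : ℝ) ^ (5 * (L3 / L2)) := by
    unfold growth
    rw [if_neg (by omega)]
  rw [hgr]
  calc (smoothCount N q : ℝ) ≤ (N : ℝ) ^ (2 / L2) * ((N : ℝ) ^ (L3 / L2) * (N : ℝ) ^ (2 / L2)) :=
        h1.trans (mul_le_mul_of_nonneg_left (h2.trans (by gcongr)) (by positivity))
    _ = (N : ℝ) ^ (2 / L2 + (L3 / L2 + 2 / L2)) := by
        rw [Real.rpow_add hN0, Real.rpow_add hN0]
    _ ≤ (N : ℝ) ^ (5 * (L3 / L2)) := by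
        refine Real.rpow_le_rpow_of_exponent_le hNone ?_
        rw [show 2 / L2 + (L3 / L2 + 2 / L2) = (4 + L3) / L2 by ring,
          show 5 * (L3 / L2) = (5 * L3) / L2 by ring]
        gcongr
        linarith

theorem smoothCount_le (N q : ℕ) : smoothCount N q ≤ N := by
  refine (Finset.card_filter_le _ _).trans ?_
  simp

/-- All the counting losses are at most a constant times `growth 5 N`. -/
theorem exists_smoothCount_le_growth :
    ∃ K : ℝ, 1 ≤ K ∧ ∀ N q : ℕ, 1 ≤ q → q ≤ N → (smoothCount N q : ℝ) ≤ K * growth 5 N := by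
  have hpos : ∀ N ∈ Finset.range (2 ^ 16), 0 ≤ (N : ℝ) / growth 5 N := by
    intro N _
    rcases Nat.eq_zero_or_pos N with rfl | h
    · simp
    · have := growth_pos 5 h
      positivity
  -- The asymptotic bound holds from `2^16` on; the finitely many smaller `N` use the trivial count
  -- `N`, which the constant pays for.
  refine ⟨1 + ∑ N ∈ Finset.range (2 ^ 16), (N : ℝ) / growth 5 N, ?_, ?_⟩
  · linarith [Finset.sum_nonneg hpos]
  intro N q hq hqN
  have hg := growth_pos 5 (hq.trans hqN)
  rcases lt_or_ge N (2 ^ 16) with h | h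
  · have h1 := Finset.single_le_sum hpos (Finset.mem_range.2 h)
    have h2 : (N : ℝ) = (N : ℝ) / growth 5 N * growth 5 N := by field_simp
    calc (smoothCount N q : ℝ) ≤ N := by exact_mod_cast smoothCount_le N q
      _ = (N : ℝ) / growth 5 N * growth 5 N := h2
      _ ≤ _ := by gcongr; linarith
  · refine (smoothCount_le_growth_of_large h hq hqN).trans ?_
    have := Finset.sum_nonneg hpos
    nlinarith

theorem card_divisors_le_smoothCount {N q : ℕ} (hq : 1 ≤ q) (hqN : q ≤ N) :
    q.divisors.card ≤ smoothCount N q := by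
  refine Finset.card_le_card fun u hu => ?_
  rw [Nat.mem_divisors] at hu
  rw [Finset.mem_filter, Finset.mem_Icc]
  exact ⟨⟨Nat.pos_of_dvd_of_pos hu.1 hq, (Nat.le_of_dvd hq hu.1).trans hqN⟩,
    Nat.primeFactors_mono hu.1 hu.2⟩

/-- Subsets of the primes of `q` inject into its divisors by taking products. Weights exponential in
`ω(q)` thus cost only powers of the smooth count. -/
theorem two_pow_card_primeFactors_le {N q : ℕ} (hq : 1 ≤ q) (hqN : q ≤ N) :
    2 ^ q.primeFactors.card ≤ smoothCount N q := by
  refine le_trans ?_ (card_divisors_le_smoothCount hq hqN)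
  rw [← Finset.card_powerset]
  refine Finset.card_le_card_of_injOn (fun S => ∏ p ∈ S, p) ?_ ?_
  · intro S hS
    rw [Finset.mem_coe, Finset.mem_powerset] at hS
    simp only [Finset.mem_coe, Nat.mem_divisors]
    exact ⟨(Finset.prod_dvd_prod_of_subset _ _ _ hS).trans (Nat.prod_primeFactors_dvd q), by omega⟩
  · intro S hS T hT h
    rw [Finset.mem_coe, Finset.mem_powerset] at hS hT
    have e : ∀ S ⊆ q.primeFactors, (∏ p ∈ S, p).primeFactors = S := fun S hS =>
      Nat.primeFactors_prod fun p hp => Nat.prime_of_mem_primeFactors (hS hp)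
    rw [← e S hS, ← e T hT]
    exact congrArg _ h

/-- Count the powers of `2`. This puts the number of dyadic levels in the Rademacher–Menshov
argument under the same bound as the other losses. -/
theorem log_succ_le_smoothCount {N : ℕ} (hN : 2 ≤ N) : Nat.log 2 N + 1 ≤ smoothCount N 2 := by
  rw [← Finset.card_range (Nat.log 2 N + 1)]
  refine Finset.card_le_card_of_injOn (fun k => 2 ^ k) ?_ ?_
  · intro k hk
    simp only [Finset.coe_range, Set.mem_Iio] at hk
    simp only [Finset.mem_coe, Finset.mem_filter, Finset.mem_Icc]
    refine ⟨⟨Nat.one_le_two_pow, ?_⟩, ?_⟩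
    · exact Nat.pow_le_of_le_log (by omega) (by omega)
    · rcases Nat.eq_zero_or_pos k with rfl | h
      · simp
      · rw [Nat.primeFactors_pow 2 h.ne']
  · intro a _ b _ h
    exact Nat.pow_right_injective le_rfl h

/-! ### A contraction inequality for independent mean zero perturbations -/

theorem mul_sq_le_of_nonneg {P R : ℝ} (hP : 0 ≤ P) (hR : 0 ≤ R) (k : ℕ) :
    P ^ k * R ^ 2 ≤ P ^ (k + 1) * R + R ^ (k + 2) := by
  rcases le_total R P with h | h
  · have : P ^ k * R * R ≤ P ^ k * R * P := by gcongr
    nlinarith [pow_nonneg hR (k + 2), this, pow_succ P k]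
  · have : P ^ k * R ^ 2 ≤ R ^ k * R ^ 2 := by gcongr
    nlinarith [mul_nonneg (pow_nonneg hP (k + 1)) hR, this, pow_add R k 2]

theorem mul_pow_le_of_nonneg {P R : ℝ} (hP : 0 ≤ P) (hR : 0 ≤ R) (k : ℕ) :
    P * R ^ (k + 1) ≤ P ^ (k + 1) * R + R ^ (k + 2) := by
  rcases le_total R P with h | h
  · have : P * R * R ^ k ≤ P * R * P ^ k := by gcongr
    nlinarith [pow_nonneg hR (k + 2), this, pow_succ P k, pow_succ R k]
  · have : P * R ^ (k + 1) ≤ R * R ^ (k + 1) := by gcongr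
    nlinarith [mul_nonneg (pow_nonneg hP (k + 1)) hR, this, pow_succ R (k + 1)]

/-- The numbers stand for `P = ‖a‖²`, `R = ‖g‖²` and `i = Re ⟨a, g⟩`, so the base on the left is `‖a
+ ρ g‖²`. The term linear in `i` is kept exactly because it will average to zero. The rest is of
order `ρ²`, and mixed products of `P` and `R` are dominated by the two extreme ones. The induction
multiplies by the base, which is nonnegative since `P` times it is at least `(P + ρ i)²`. -/
theorem exists_pow_le_taylor (k : ℕ) : ∃ C : ℝ, 1 ≤ C ∧ ∀ ρ P R i : ℝ, 0 ≤ ρ → ρ ≤ 1 → 0 ≤ P →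
    0 ≤ R → i ^ 2 ≤ P * R → (P + 2 * ρ * i + ρ ^ 2 * R) ^ (k + 1) ≤
      P ^ (k + 1) + 2 * (k + 1) * ρ * P ^ k * i + C * ρ ^ 2 * (P ^ k * R + R ^ (k + 1)) := by
  induction k with
  | zero =>
    refine ⟨1, le_rfl, fun ρ P R i _ _ _ hR _ => ?_⟩
    have : 0 ≤ ρ ^ 2 * R := by positivity
    simp only [Nat.cast_zero, zero_add, pow_one, pow_zero, one_mul, mul_one]
    nlinarith
  | succ k ih =>
    obtain ⟨C, hC, h⟩ := ih
    refine ⟨1 + 6 * (k + 1) + 6 * C, by nlinarith [(Nat.cast_nonneg k : (0 : ℝ) ≤ k)],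
      fun ρ P R i h0 h1 hP hR hi => ?_⟩
    have hk : (0 : ℝ) ≤ k := Nat.cast_nonneg k
    have habs : |i| ≤ (P + R) / 2 := by
      refine abs_le_of_sq_le_sq ?_ (by positivity)
      nlinarith [sq_nonneg (P - R)]
    obtain ⟨hi1, hi2⟩ := abs_le.1 habs
    have hρi : ρ * i ≤ (P + R) / 2 := by
      calc ρ * i ≤ ρ * |i| := by gcongr; exact le_abs_self i
        _ ≤ 1 * |i| := by gcongr
        _ ≤ _ := by linarith
    have hw0 : 0 ≤ P + 2 * ρ * i + ρ ^ 2 * R := by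
      by_cases hP0 : P = 0
      · have : i = 0 := by
          rw [hP0, zero_mul] at hi
          exact pow_eq_zero_iff (n := 2) (by norm_num) |>.1 (le_antisymm hi (sq_nonneg i))
        rw [hP0, this]; positivity
      · have hPp : 0 < P := lt_of_le_of_ne hP (Ne.symm hP0)
        have : 0 ≤ P * (P + 2 * ρ * i + ρ ^ 2 * R) := by
          nlinarith [sq_nonneg (P + ρ * i), mul_le_mul_of_nonneg_left hi (sq_nonneg ρ)]
        exact nonneg_of_mul_nonneg_right this hPp
    have hρ2 : ρ ^ 2 ≤ 1 := by nlinarith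
    have hw2 : P + 2 * ρ * i + ρ ^ 2 * R ≤ 2 * (P + R) := by
      nlinarith [mul_le_mul_of_nonneg_right hρ2 hR]
    have hmain := mul_le_mul_of_nonneg_right (h ρ P R i h0 h1 hP hR hi) hw0
    rw [← pow_succ] at hmain
    refine hmain.trans ?_
    have e1 := mul_sq_le_of_nonneg hP hR k
    have e2 := mul_pow_le_of_nonneg hP hR k
    set Z := P ^ (k + 1) * R + R ^ (k + 2) with hZ
    have hPk : 0 ≤ P ^ k := pow_nonneg hP k
    have hRk : 0 ≤ R ^ (k + 2) := pow_nonneg hR _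
    have hPR : 0 ≤ P ^ (k + 1) * R := by positivity
    have hZ0 : 0 ≤ Z := by positivity
    have t1 : C * ρ ^ 2 * (P ^ k * R + R ^ (k + 1)) * (P + 2 * ρ * i + ρ ^ 2 * R) ≤
        6 * C * ρ ^ 2 * Z := by
      calc _ ≤ C * ρ ^ 2 * (P ^ k * R + R ^ (k + 1)) * (2 * (P + R)) := by gcongr
        _ = C * ρ ^ 2 * 2 * (P ^ (k + 1) * R + P ^ k * R ^ 2 + P * R ^ (k + 1) + R ^ (k + 2)) := by
            ring
        _ ≤ C * ρ ^ 2 * 2 * (3 * Z) := by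
            gcongr
            linarith
        _ = _ := by ring
    have t2 : 4 * (k + 1) * ρ ^ 2 * P ^ k * i ^ 2 ≤ 4 * (k + 1) * ρ ^ 2 * Z := by
      calc 4 * (k + 1) * ρ ^ 2 * P ^ k * i ^ 2 ≤ 4 * (k + 1) * ρ ^ 2 * P ^ k * (P * R) := by gcongr
        _ = 4 * (k + 1) * ρ ^ 2 * (P ^ (k + 1) * R) := by ring
        _ ≤ _ := by gcongr; linarith
    have t3 : 2 * (k + 1) * ρ ^ 2 * P ^ k * (ρ * i) * R ≤ 2 * (k + 1) * ρ ^ 2 * Z := by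
      calc 2 * (k + 1) * ρ ^ 2 * P ^ k * (ρ * i) * R ≤
          2 * (k + 1) * ρ ^ 2 * P ^ k * ((P + R) / 2) * R := by gcongr
        _ = (k + 1) * ρ ^ 2 * (P ^ (k + 1) * R + P ^ k * R ^ 2) := by ring
        _ ≤ (k + 1) * ρ ^ 2 * (2 * Z) := by
            gcongr
            linarith
        _ = _ := by ring
    have t4 : ρ ^ 2 * (P ^ (k + 1) * R) ≤ ρ ^ 2 * Z := by
      gcongr
      linarith
    have expand : (P ^ (k + 1) + 2 * (k + 1) * ρ * P ^ k * i +
        C * ρ ^ 2 * (P ^ k * R + R ^ (k + 1))) * (P + 2 * ρ * i + ρ ^ 2 * R) =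
        P ^ (k + 2) + 2 * (k + 2) * ρ * P ^ (k + 1) * i + ρ ^ 2 * (P ^ (k + 1) * R)
        + 4 * (k + 1) * ρ ^ 2 * P ^ k * i ^ 2 + 2 * (k + 1) * ρ ^ 2 * P ^ k * (ρ * i) * R
        + C * ρ ^ 2 * (P ^ k * R + R ^ (k + 1)) * (P + 2 * ρ * i + ρ ^ 2 * R) := by ring
    rw [expand]
    push_cast
    have : (1 + 6 * ((k : ℝ) + 1) + 6 * C) * ρ ^ 2 * Z = ρ ^ 2 * Z + 4 * (k + 1) * ρ ^ 2 * Z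
        + 2 * (k + 1) * ρ ^ 2 * Z + 6 * C * ρ ^ 2 * Z := by ring
    rw [show k + 1 + 1 = k + 2 from rfl, this]
    linarith

open Finset BigOperators in
/-- If `g` has mean zero, then `E ‖a + ρ g‖^{2(k+1)} ≤ (‖a‖² + E ‖g‖²)^{k+1} + E ‖g‖^{2(k+1)}` in a
finite dimensional Hilbert space, for some `ρ > 0` that depends on `k` only. -/
theorem exists_rho_expect_pow_le (k : ℕ) : ∃ ρ : ℝ, 0 < ρ ∧ ρ ≤ 1 ∧
    ∀ (ι T : Type) [Fintype ι] [Fintype T] [Nonempty T] (a : ι → ℂ) (g : T → ι → ℂ),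
      (∀ i, 𝔼 t, g t i = 0) →
      𝔼 t, (∑ i, ‖a i + ρ * g t i‖ ^ 2) ^ (k + 1) ≤
        (∑ i, (‖a i‖ ^ 2 + 𝔼 t, ‖g t i‖ ^ 2)) ^ (k + 1) +
          𝔼 t, (∑ i, ‖g t i‖ ^ 2) ^ (k + 1) := by
  obtain ⟨C, hC, hmain⟩ := exists_pow_le_taylor k
  have hC0 : 0 < C := by linarith
  -- With `ρ = 1/C` the remainder carries the factor `C ρ² = 1/C ≤ 1`.
  refine ⟨1 / C, by positivity, by rw [div_le_one hC0]; exact hC, ?_⟩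
  intro ι T _ _ _ a g hg
  set ρ : ℝ := 1 / C with hρ
  set P : ℝ := ∑ i, ‖a i‖ ^ 2 with hP
  let R : T → ℝ := fun t => ∑ i, ‖g t i‖ ^ 2
  let q : T → ℝ := fun t => ∑ i, (a i * (starRingEnd ℂ) (g t i)).re
  have hP0 : 0 ≤ P := sum_nonneg fun i _ => by positivity
  have hR0 : ∀ t, 0 ≤ R t := fun t => sum_nonneg fun i _ => by positivity
  have hexp : ∀ t, ∑ i, ‖a i + ρ * g t i‖ ^ 2 = P + 2 * ρ * q t + ρ ^ 2 * R t := by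
    intro t
    simp only [hP, q, R, mul_sum, ← sum_add_distrib]
    refine sum_congr rfl fun i _ => ?_
    rw [← Complex.normSq_eq_norm_sq, ← Complex.normSq_eq_norm_sq, ← Complex.normSq_eq_norm_sq,
      Complex.normSq_add, Complex.normSq_mul, Complex.normSq_ofReal, map_mul]
    simp only [Complex.conj_ofReal, Complex.mul_re, Complex.conj_re, Complex.conj_im,
      Complex.ofReal_re, Complex.ofReal_im, Complex.mul_im]
    ring
  have hq : ∀ t, q t ^ 2 ≤ P * R t := by
    intro t
    have h1 : |q t| ≤ ∑ i, ‖a i‖ * ‖g t i‖ := by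
      refine (abs_sum_le_sum_abs _ _).trans (sum_le_sum fun i _ => ?_)
      refine (Complex.abs_re_le_norm _).trans ?_
      rw [norm_mul, RCLike.norm_conj]
    calc q t ^ 2 = |q t| ^ 2 := (sq_abs _).symm
      _ ≤ (∑ i, ‖a i‖ * ‖g t i‖) ^ 2 := by gcongr
      _ ≤ P * R t := sum_mul_sq_le_sq_mul_sq _ _ _
  have hq0 : 𝔼 t, q t = 0 := by
    have h1 : 𝔼 t, q t = ∑ i, (𝔼 t, (a i * (starRingEnd ℂ) (g t i))).re := by
      simp only [q, expect, smul_sum, ← Complex.re_sum]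
      rw [sum_comm]
      simp [NNRat.smul_def, Finset.mul_sum]
    rw [h1]
    refine sum_eq_zero fun i _ => ?_
    rw [← mul_expect]
    have : 𝔼 t, (starRingEnd ℂ) (g t i) = (starRingEnd ℂ) (𝔼 t, g t i) := by
      rw [map_expect]
    rw [this, hg i, map_zero, mul_zero, Complex.zero_re]
  have hle : 𝔼 t, (∑ i, ‖a i + ρ * g t i‖ ^ 2) ^ (k + 1) ≤
      𝔼 t, (P ^ (k + 1) + 2 * (k + 1) * ρ * P ^ k * q t +
        C * ρ ^ 2 * (P ^ k * R t + R t ^ (k + 1))) := by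
    refine expect_le_expect fun t _ => ?_
    rw [hexp t]
    exact hmain ρ P (R t) (q t) (by positivity) (by rw [hρ, div_le_one hC0]; exact hC) hP0 (hR0 t)
      (hq t)
  refine hle.trans ?_
  rw [expect_add_distrib, expect_add_distrib, ← mul_expect, hq0, ← mul_expect, expect_add_distrib,
    ← mul_expect, expect_const univ_nonempty]
  have hER : 𝔼 t, R t = ∑ i, 𝔼 t, ‖g t i‖ ^ 2 := by
    simp only [R]
    rw [expect_sum_comm]
  have hER0 : 0 ≤ 𝔼 t, R t := expect_nonneg fun t _ => hR0 t
  have hERk : 0 ≤ 𝔼 t, R t ^ (k + 1) := expect_nonneg fun t _ => pow_nonneg (hR0 t) _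
  have hCρ : C * ρ ^ 2 ≤ 1 := by
    rw [hρ]
    field_simp
    exact hC
  -- The cross term is absorbed by the power of `P + E R`, so that only `E R^(k+1)` is left outside.
  have hb : P ^ (k + 1) + P ^ k * 𝔼 t, R t ≤ (P + 𝔼 t, R t) ^ (k + 1) := by
    rw [pow_succ, ← mul_add, pow_succ]
    gcongr
    linarith
  rw [sum_add_distrib, ← hER]
  have : C * ρ ^ 2 * (P ^ k * 𝔼 t, R t + 𝔼 t, R t ^ (k + 1)) ≤
      1 * (P ^ k * 𝔼 t, R t + 𝔼 t, R t ^ (k + 1)) := by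
    gcongr
  simp only [R] at *
  linarith

/-! ### Primary decomposition and characters of `(ℤ/Q)^d` -/

section FiniteGroup

open Finset BigOperators

variable {G : Type} [AddCommGroup G] [Fintype G]

/-- The primes that divide the order of `a`. -/
def pf (a : G) : Finset ℕ := (addOrderOf a).primeFactors

/-- The elements whose order has all its prime factors in `S`. -/
def primary (G : Type) [AddCommGroup G] [Fintype G] (S : Finset ℕ) : Finset G :=
  univ.filter fun a => pf a ⊆ S

/-- The elements whose order has exactly the prime factors `D`. -/
def exactPrimary (G : Type) [AddCommGroup G] [Fintype G] (D : Finset ℕ) :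
    Finset G :=
  univ.filter fun a => pf a = D

@[simp] theorem mem_primary {S : Finset ℕ} {a : G} : a ∈ primary G S ↔ pf a ⊆ S := by
  simp [primary]

@[simp] theorem mem_exactPrimary {S : Finset ℕ} {a : G} : a ∈ exactPrimary G S ↔ pf a = S := by
  simp [exactPrimary]

theorem pf_eq_empty {a : G} : pf a = ∅ ↔ a = 0 := by
  rw [pf, Nat.primeFactors_eq_empty]
  constructor
  · rintro (h | h)
    · exact absurd h (addOrderOf_pos a).ne'
    · exact AddMonoid.addOrderOf_eq_one_iff.1 h
  · rintro rfl
    exact Or.inr addOrderOf_zero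

theorem coprime_addOrderOf {a b : G} (h : Disjoint (pf a) (pf b)) :
    (addOrderOf a).Coprime (addOrderOf b) :=
  (Nat.disjoint_primeFactors (addOrderOf_pos a).ne' (addOrderOf_pos b).ne').1 h

theorem addOrderOf_add_of_disjoint {a b : G} (h : Disjoint (pf a) (pf b)) :
    addOrderOf (a + b) = addOrderOf a * addOrderOf b :=
  (AddCommute.all a b).addOrderOf_add_eq_mul_addOrderOf_of_coprime (coprime_addOrderOf h)

theorem pf_add_of_disjoint {a b : G} (h : Disjoint (pf a) (pf b)) :
    pf (a + b) = pf a ∪ pf b := by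
  rw [pf, addOrderOf_add_of_disjoint h,
    Nat.primeFactors_mul (addOrderOf_pos a).ne' (addOrderOf_pos b).ne']
  rfl

theorem pf_sub_subset {S : Finset ℕ} {a b : G} (ha : pf a ⊆ S) (hb : pf b ⊆ S) :
    pf (a - b) ⊆ S := by
  have h : addOrderOf (a - b) ∣ addOrderOf a * addOrderOf b := by
    rw [addOrderOf_dvd_iff_nsmul_eq_zero, nsmul_sub,
      addOrderOf_dvd_iff_nsmul_eq_zero.1 (dvd_mul_right (addOrderOf a) (addOrderOf b)),
      addOrderOf_dvd_iff_nsmul_eq_zero.1 (dvd_mul_left (addOrderOf b) (addOrderOf a)), sub_zero]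
  refine (Nat.primeFactors_mono h
    (mul_ne_zero (addOrderOf_pos a).ne' (addOrderOf_pos b).ne')).trans ?_
  rw [Nat.primeFactors_mul (addOrderOf_pos a).ne' (addOrderOf_pos b).ne']
  exact union_subset ha hb

theorem add_injOn_primary {S T : Finset ℕ} (hST : Disjoint S T) {a a' b b' : G} (ha : pf a ⊆ S)
    (ha' : pf a' ⊆ S) (hb : pf b ⊆ T) (hb' : pf b' ⊆ T) (h : a + b = a' + b') :
    a = a' ∧ b = b' := by
  have e : a - a' = b' - b := by
    rw [sub_eq_sub_iff_add_eq_add, h, add_comm]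
  have h1 : pf (a - a') = ∅ := by
    have h2 := pf_sub_subset ha ha'
    have h3 := pf_sub_subset hb' hb
    rw [← e] at h3
    exact subset_empty.1 (hST h2 h3)
  have h4 : a = a' := sub_eq_zero.1 (pf_eq_empty.1 h1)
  subst h4
  exact ⟨rfl, add_left_cancel h⟩

/-- Write the order as `u v` with `u` its `S`-part. Bézout's identity for the coprime numbers `u`,
`v` splits `a` into a multiple of `v • a`, killed by `u`, and a multiple of `u • a`, killed by `v`.
-/
theorem exists_primary_decomp {S T : Finset ℕ} {a : G} (ha : pf a ⊆ S ∪ T) :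
    ∃ b c : G, pf b ⊆ S ∧ pf c ⊆ T ∧ b + c = a := by
  set n := addOrderOf a with hn
  have hn0 : n ≠ 0 := (addOrderOf_pos a).ne'
  let u := n.primeFactors.filter (· ∈ S) |>.prod fun p => p ^ n.factorization p
  let v := n.primeFactors.filter (· ∉ S) |>.prod fun p => p ^ n.factorization p
  have huv : u * v = n := by
    rw [Finset.prod_filter_mul_prod_filter_not]
    exact Nat.prod_factorization_pow_eq_self hn0
  have hcop : Nat.Coprime u v := by
    refine Nat.Coprime.prod_left fun p hp => Nat.Coprime.prod_right fun q hq => ?_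
    rw [mem_filter] at hp hq
    refine Nat.Coprime.pow _ _ ((Nat.coprime_primes (Nat.prime_of_mem_primeFactors hp.1)
      (Nat.prime_of_mem_primeFactors hq.1)).2 ?_)
    rintro rfl
    exact hq.2 hp.2
  have hu0 : u ≠ 0 := by rintro h; rw [h, zero_mul] at huv; exact hn0 huv.symm
  have hv0 : v ≠ 0 := by rintro h; rw [h, mul_zero] at huv; exact hn0 huv.symm
  have hupf : u.primeFactors ⊆ S := by
    intro p hp
    have hpp := Nat.prime_of_mem_primeFactors hp
    obtain ⟨q, hq, hdvd⟩ := (hpp.prime.dvd_finsetProd_iff _).1 (Nat.dvd_of_mem_primeFactors hp)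
    rw [mem_filter] at hq
    have : p = q := (Nat.prime_dvd_prime_iff_eq hpp (Nat.prime_of_mem_primeFactors hq.1)).1
      (hpp.dvd_of_dvd_pow hdvd)
    exact this ▸ hq.2
  have hvpf : v.primeFactors ⊆ T := by
    intro p hp
    have hpp := Nat.prime_of_mem_primeFactors hp
    obtain ⟨q, hq, hdvd⟩ := (hpp.prime.dvd_finsetProd_iff _).1 (Nat.dvd_of_mem_primeFactors hp)
    rw [mem_filter] at hq
    have : p = q := (Nat.prime_dvd_prime_iff_eq hpp (Nat.prime_of_mem_primeFactors hq.1)).1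
      (hpp.dvd_of_dvd_pow hdvd)
    have h2 := ha (show q ∈ pf a from hq.1)
    rw [mem_union] at h2
    exact this ▸ h2.resolve_left hq.2
  have hbez := Nat.gcd_eq_gcd_ab u v
  rw [hcop.gcd_eq_one] at hbez
  refine ⟨(v * Nat.gcdB u v : ℤ) • a, (u * Nat.gcdA u v : ℤ) • a, ?_, ?_, ?_⟩
  · refine (Nat.primeFactors_mono ?_ hu0).trans hupf
    rw [addOrderOf_dvd_iff_nsmul_eq_zero, ← natCast_zsmul, smul_smul, ← mul_assoc,
      ← Nat.cast_mul, huv, mul_comm, mul_smul, natCast_zsmul, hn, addOrderOf_nsmul_eq_zero,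
      smul_zero]
  · refine (Nat.primeFactors_mono ?_ hv0).trans hvpf
    rw [addOrderOf_dvd_iff_nsmul_eq_zero, ← natCast_zsmul, smul_smul, ← mul_assoc,
      ← Nat.cast_mul, mul_comm v u, huv, mul_comm, mul_smul, natCast_zsmul, hn,
      addOrderOf_nsmul_eq_zero, smul_zero]
  · rw [← add_smul, add_comm, ← hbez]
    simp

theorem sum_primary_union {M : Type*} [AddCommMonoid M] {S T : Finset ℕ} (hST : Disjoint S T)
    (h : G → M) :
    ∑ a ∈ primary G (S ∪ T), h a = ∑ a ∈ primary G S, ∑ b ∈ primary G T, h (a + b) := by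
  rw [← sum_product']
  symm
  refine sum_bij (fun x _ => x.1 + x.2) ?_ ?_ ?_ ?_
  · rintro ⟨a, b⟩ hab
    simp only [mem_product, mem_primary] at hab ⊢
    rw [pf_add_of_disjoint (disjoint_of_subset_left hab.1 (disjoint_of_subset_right hab.2 hST))]
    exact union_subset_union hab.1 hab.2
  · rintro ⟨a, b⟩ hab ⟨a', b'⟩ hab' h
    simp only [mem_product, mem_primary] at hab hab' h
    obtain ⟨h1, h2⟩ := add_injOn_primary hST hab.1 hab'.1 hab.2 hab'.2 h
    rw [h1, h2]
  · intro a ha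
    obtain ⟨b, c, hb, hc, hbc⟩ := exists_primary_decomp (mem_primary.1 ha)
    exact ⟨(b, c), by simp [hb, hc], hbc⟩
  · simp

theorem sum_exactPrimary_union {M : Type*} [AddCommMonoid M] {S T : Finset ℕ}
    (hST : Disjoint S T) (h : G → M) :
    ∑ a ∈ exactPrimary G (S ∪ T), h a =
      ∑ a ∈ exactPrimary G S, ∑ b ∈ exactPrimary G T, h (a + b) := by
  have e : ∀ D, exactPrimary G D = (primary G D).filter fun a => pf a = D := by
    intro D
    ext a
    simp only [mem_exactPrimary, mem_filter, mem_primary]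
    exact ⟨fun h => ⟨h.le, h⟩, fun h => h.2⟩
  rw [e, e S, e T, sum_filter, sum_primary_union hST, sum_filter]
  refine sum_congr rfl fun a ha => ?_
  rw [sum_filter]
  rw [mem_primary] at ha
  by_cases haS : pf a = S
  · rw [if_pos haS]
    refine sum_congr rfl fun b hb => ?_
    rw [mem_primary] at hb
    rw [pf_add_of_disjoint (disjoint_of_subset_left ha (disjoint_of_subset_right hb hST)), haS]
    congr 1
    refine propext ⟨fun h => subset_antisymm hb fun p hp => ?_, fun h => by rw [h]⟩
    have h2 : p ∈ S ∪ pf b := h ▸ mem_union_right S hp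
    exact (mem_union.1 h2).resolve_left fun h3 => (Finset.disjoint_left.1 hST h3 hp)
  · rw [if_neg haS]
    refine sum_eq_zero fun b hb => ?_
    rw [mem_primary] at hb
    rw [pf_add_of_disjoint (disjoint_of_subset_left ha (disjoint_of_subset_right hb hST)), if_neg]
    intro h
    refine haS (subset_antisymm ha fun p hp => ?_)
    have h2 : p ∈ pf a ∪ pf b := h ▸ mem_union_left T hp
    exact (mem_union.1 h2).resolve_right fun h3 => (Finset.disjoint_left.1 hST hp (hb h3))

theorem primary_empty : primary G ∅ = {0} := by
  ext a
  simp [pf_eq_empty]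

theorem exactPrimary_empty : exactPrimary G ∅ = {0} := by
  ext a
  simp [pf_eq_empty]

/-- A function of two variables that is invariant under `c • G` in the first one and `c' • G` in
the second one, with `c` and `c'` coprime, has the same mean on `G × G` and on the diagonal. -/
theorem expect_diag {M : Type*} [AddCommMonoid M] [Module ℚ≥0 M] {c c' : ℕ} (hc : c.Coprime c')
    (F : G → G → M) (h1 : ∀ y z t, F (y + c • t) z = F y z)
    (h2 : ∀ y z t, F y (z + c' • t) = F y z) :
    𝔼 y, F y y = 𝔼 y, 𝔼 z, F y z := by
  have hbez := Nat.gcd_eq_gcd_ab c c'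
  rw [hc.gcd_eq_one] at hbez
  push_cast at hbez
  set u := Nat.gcdA c c'
  set v := Nat.gcdB c c'
  -- A Chinese remainder point: `w y z` agrees with `y` modulo `c • G` and, by Bézout, with `z`
  -- modulo `c' • G`.
  let w : G → G → G := fun y z => y + c • (u • (z - y))
  have hw : ∀ y z, F y z = F (w y z) (w y z) := by
    intro y z
    have e : w y z + c' • (v • (z - y)) = z := by
      have h3 : c • (u • (z - y)) + c' • (v • (z - y)) = z - y := by
        rw [← natCast_zsmul, ← natCast_zsmul, smul_smul, smul_smul, ← add_smul, ← hbez, one_smul]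
      simp only [w]
      rw [add_assoc, h3, add_sub_cancel]
    rw [← h2 (w y z) (w y z) (v • (z - y)), e, h1]
  have hshift : ∀ y z s, w (y + s) (z + s) = w y z + s := by
    intro y z s
    simp only [w]
    rw [add_sub_add_right_eq_sub]
    abel
  -- A common translation of `y` and `z` translates `w` by the same amount; averaging over `s` makes
  -- the diagonal point uniformly distributed.
  have hs : ∀ s : G, 𝔼 y, 𝔼 z, F y z = 𝔼 y, 𝔼 z, F (w y z + s) (w y z + s) := by
    intro s
    symm
    refine Fintype.expect_equiv (Equiv.addRight s) _ _ fun y => ?_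
    refine Fintype.expect_equiv (Equiv.addRight s) _ _ fun z => ?_
    rw [Equiv.coe_addRight, hw (y + s) (z + s), hshift]
  have h3 : 𝔼 y, 𝔼 z, F y z = 𝔼 _s : G, 𝔼 y, 𝔼 z, F y z :=
    (expect_const univ_nonempty _).symm
  rw [h3, expect_congr rfl fun s _ => hs s, expect_comm]
  have h4 : ∀ y, 𝔼 s, 𝔼 z, F (w y z + s) (w y z + s) = 𝔼 s, F s s := by
    intro y
    rw [expect_comm]
    have : ∀ z, 𝔼 s, F (w y z + s) (w y z + s) = 𝔼 s, F s s := fun z =>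
      Fintype.expect_equiv (Equiv.addLeft (w y z)) _ _ fun s => rfl
    rw [expect_congr rfl fun z _ => this z, expect_const univ_nonempty]
  rw [expect_congr rfl fun y _ => h4 y, expect_const univ_nonempty]

end FiniteGroup

/-! ### Characters of `(ℤ/Q)^d` and decoupling over the primes. -/

section Characters

open Finset BigOperators

variable {d Q : ℕ} [NeZero Q]

/-- The pairing `(y, a) ↦ e(y·a/Q)` on `(ℤ/Q)^d`. -/
def chi (y a : Fin d → ZMod Q) : ℂ := ZMod.stdAddChar (y ⬝ᵥ a)

theorem chi_add_left (y z a : Fin d → ZMod Q) : chi (y + z) a = chi y a * chi z a := by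
  rw [chi, add_dotProduct, AddChar.map_add_eq_mul]; rfl

theorem chi_add_right (y a b : Fin d → ZMod Q) : chi y (a + b) = chi y a * chi y b := by
  rw [chi, dotProduct_add, AddChar.map_add_eq_mul]; rfl

@[simp] theorem chi_zero_right (y : Fin d → ZMod Q) : chi y 0 = 1 := by
  rw [chi, dotProduct_zero, AddChar.map_zero_eq_one]

@[simp] theorem norm_chi (y a : Fin d → ZMod Q) : ‖chi y a‖ = 1 := by
  rw [chi, ZMod.stdAddChar_apply, Circle.norm_coe]

theorem chi_neg_right (y a : Fin d → ZMod Q) : chi y (-a) = (starRingEnd ℂ) (chi y a) := by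
  rw [chi, dotProduct_neg, AddChar.map_neg_eq_conj]; rfl

theorem chi_nsmul_left (n : ℕ) (y a : Fin d → ZMod Q) : chi (n • y) a = chi y (n • a) := by
  rw [chi, chi, smul_dotProduct, dotProduct_smul]

theorem chi_comm (y a : Fin d → ZMod Q) : chi y a = chi a y := by
  rw [chi, chi, dotProduct_comm]

theorem expect_chi (a : Fin d → ZMod Q) : 𝔼 y, chi y a = if a = 0 then 1 else 0 := by
  let ψ : AddChar (Fin d → ZMod Q) ℂ :=
    { toFun := fun y => chi y a
      map_zero_eq_one' := by rw [chi, zero_dotProduct, AddChar.map_zero_eq_one]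
      map_add_eq_mul' := fun y z => chi_add_left y z a }
  have h := AddChar.expect_eq_ite ψ
  have hψ : ψ = 0 ↔ a = 0 := by
    constructor
    · intro h0
      ext i
      have h1 := DFunLike.congr_fun h0 (Pi.single i 1)
      change chi (Pi.single i 1) a = (0 : AddChar (Fin d → ZMod Q) ℂ) _ at h1
      rw [chi, single_dotProduct, one_mul, AddChar.zero_apply] at h1
      exact ZMod.injective_stdAddChar (by rw [h1, Pi.zero_apply, AddChar.map_zero_eq_one])
    · rintro rfl
      ext y
      change chi y 0 = _
      simp
  change 𝔼 y, chi y a = _ at h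
  rw [h]
  simp only [hψ]

/-- Parseval's identity on `(ℤ/Q)^d`. -/
theorem expect_norm_sq_sum_chi (A : Finset (Fin d → ZMod Q)) (c : (Fin d → ZMod Q) → ℂ) :
    𝔼 y, ‖∑ a ∈ A, c a * chi y a‖ ^ 2 = ∑ a ∈ A, ‖c a‖ ^ 2 := by
  have h : (((𝔼 y : Fin d → ZMod Q, ‖∑ a ∈ A, c a * chi y a‖ ^ 2 : ℝ)) : ℂ) =
      ((∑ a ∈ A, ‖c a‖ ^ 2 : ℝ) : ℂ) := by
    have e1 : ∀ y : Fin d → ZMod Q, (((‖∑ a ∈ A, c a * chi y a‖ ^ 2 : ℝ)) : ℂ) =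
        ∑ a ∈ A, ∑ b ∈ A, c a * (starRingEnd ℂ) (c b) * chi y (a - b) := by
      intro y
      rw [Complex.ofReal_pow, ← Complex.mul_conj', map_sum, sum_mul_sum]
      refine sum_congr rfl fun a _ => sum_congr rfl fun b _ => ?_
      rw [map_mul, sub_eq_add_neg, chi_add_right, chi_neg_right]
      ring
    have e0 : (((𝔼 y : Fin d → ZMod Q, ‖∑ a ∈ A, c a * chi y a‖ ^ 2 : ℝ)) : ℂ) =
        𝔼 y : Fin d → ZMod Q, (((‖∑ a ∈ A, c a * chi y a‖ ^ 2 : ℝ)) : ℂ) :=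
      map_expect Complex.ofRealHom _ _
    rw [e0, expect_congr rfl fun y _ => e1 y, expect_sum_comm, Complex.ofReal_sum]
    refine sum_congr rfl fun a ha => ?_
    rw [expect_sum_comm, sum_eq_single a]
    · rw [← mul_expect, expect_chi, sub_self, if_pos rfl, mul_one, Complex.mul_conj']
      push_cast
      rfl
    · intro b _ hba
      rw [← mul_expect, expect_chi, if_neg (sub_ne_zero.2 hba.symm), mul_zero]
    · exact fun h => absurd ha h
  exact_mod_cast h

/-- Products of the orders serve as annihilators, and are coprime because the orders involve
disjoint sets of primes. This lets `expect_diag` treat the two parts of the variable as independent.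
-/
theorem exists_coprime_annihilators {S T : Finset ℕ} (hST : Disjoint S T) :
    ∃ c c' : ℕ, c.Coprime c' ∧
      (∀ a ∈ primary (Fin d → ZMod Q) S, ∀ y t, chi (y + c • t) a = chi y a) ∧
      (∀ a ∈ primary (Fin d → ZMod Q) T, ∀ y t, chi (y + c' • t) a = chi y a) := by
  have key : ∀ (U : Finset (Fin d → ZMod Q)), ∀ a ∈ U, ∀ y t,
      chi (y + (∏ b ∈ U, addOrderOf b) • t) a = chi y a := by
    intro U a ha y t
    have : (∏ b ∈ U, addOrderOf b) • a = 0 :=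
      addOrderOf_dvd_iff_nsmul_eq_zero.1 (dvd_prod_of_mem _ ha)
    rw [chi_add_left, chi_nsmul_left, this, chi_zero_right, mul_one]
  refine ⟨∏ b ∈ primary (Fin d → ZMod Q) S, addOrderOf b,
    ∏ b ∈ primary (Fin d → ZMod Q) T, addOrderOf b, ?_, key _, key _⟩
  refine Nat.Coprime.prod_left fun a ha => Nat.Coprime.prod_right fun b hb => ?_
  rw [mem_primary] at ha hb
  exact coprime_addOrderOf (disjoint_of_subset_left ha (disjoint_of_subset_right hb hST))

/-- The right side of the decoupling inequality: the coordinates in `D` are averaged in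
`L^{2(k+1)}`, the remaining ones in `L^2`. -/
def decoupled {ι : Type} [Fintype ι] (k : ℕ) (P D : Finset ℕ)
    (c : (Fin d → ZMod Q) → ι → ℂ) : ℝ :=
  𝔼 y : Fin d → ZMod Q, (∑ i, ∑ β ∈ primary (Fin d → ZMod Q) (P \ D),
    ‖∑ α ∈ exactPrimary (Fin d → ZMod Q) D, c (α + β) i * chi y α‖ ^ 2) ^ (k + 1)

-- Induction on the set of primes. Splitting off `p` writes `θ` as an element of the `P`-part plus
-- an element `b` of the `p`-part, and `expect_diag` gives the `p`-part its own variable `z`, in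
-- which the terms with `b ≠ 0` have mean zero. The inequality for one mean zero perturbation yields
-- two terms. In the first, `b` is summed in `ℓ²`: it becomes one more index, which is why a general
-- finite index type `ι` is carried along, and `p` stays outside `D`. In the second, `b` remains in
-- a character sum and `p` joins `D`.
set_option maxHeartbeats 400000 in
theorem exists_rho_decoupling (k : ℕ) : ∃ ρ : ℝ, 0 < ρ ∧ ρ ≤ 1 ∧
    ∀ (d Q : ℕ) [NeZero Q] (P : Finset ℕ) (ι : Type) [Fintype ι]
      (c : (Fin d → ZMod Q) → ι → ℂ),
      𝔼 y : Fin d → ZMod Q, (∑ i, ‖∑ θ ∈ primary (Fin d → ZMod Q) P,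
        (ρ : ℂ) ^ (pf θ).card * c θ i * chi y θ‖ ^ 2) ^ (k + 1) ≤
      ∑ D ∈ P.powerset, decoupled k P D c := by
  obtain ⟨ρ, hρ0, hρ1, hone⟩ := exists_rho_expect_pow_le k
  refine ⟨ρ, hρ0, hρ1, ?_⟩
  intro d Q _ P
  induction P using Finset.induction with
  | empty =>
    intro ι _ c
    simp [decoupled, primary_empty, exactPrimary_empty, pf_eq_empty.2]
  | insert p P hp ih =>
    intro ι _ c
    have hdisj : Disjoint P {p} := disjoint_singleton_right.2 hp
    have hins : insert p P = P ∪ {p} := by rw [union_comm, insert_eq]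
    set Cp := primary (Fin d → ZMod Q) {p} with hCp
    set Ap := exactPrimary (Fin d → ZMod Q) {p} with hAp
    have h0Cp : (0 : Fin d → ZMod Q) ∈ Cp := by
      rw [hCp, mem_primary, pf_eq_empty.2 rfl]; exact empty_subset _
    have hApCp : Ap = Cp.erase 0 := by
      ext a
      rw [mem_erase, hAp, hCp, mem_exactPrimary, mem_primary, subset_singleton_iff]
      constructor
      · intro h
        refine ⟨fun h0 => ?_, Or.inr h⟩
        rw [pf_eq_empty.2 h0] at h
        exact (singleton_ne_empty p) h.symm
      · rintro ⟨h0, h | h⟩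
        · exact absurd (pf_eq_empty.1 h) h0
        · exact h
    -- `H y b` collects the frequencies with `p`-part `b`, and `g` is the mean zero part in `z`. The
    -- factor `ρ` due to `p` is kept outside `g`.
    let H : (Fin d → ZMod Q) → (Fin d → ZMod Q) → ι → ℂ := fun y b i =>
      ∑ θ ∈ primary (Fin d → ZMod Q) P, (ρ : ℂ) ^ (pf θ).card * c (θ + b) i * chi y θ
    let g : (Fin d → ZMod Q) → (Fin d → ZMod Q) → ι → ℂ := fun y z i =>
      ∑ b ∈ Ap, H y b i * chi z b
    obtain ⟨n, n', hcop, hn, hn'⟩ := exists_coprime_annihilators (d := d) (Q := Q) hdisj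
    have hH : ∀ y t, H (y + n • t) = H y := by
      intro y t
      funext b i
      exact sum_congr rfl fun θ hθ => by rw [hn θ hθ]
    have hg' : ∀ y z t, g y (z + n' • t) = g y z := by
      intro y z t
      funext i
      refine sum_congr rfl fun b hb => ?_
      rw [hn' b]
      rw [hApCp] at hb
      exact mem_of_mem_erase hb
    have hsplit : ∀ y i, ∑ θ ∈ primary (Fin d → ZMod Q) (insert p P),
        (ρ : ℂ) ^ (pf θ).card * c θ i * chi y θ = H y 0 i + ρ * g y y i := by
      intro y i
      rw [hins, sum_primary_union hdisj, sum_comm, ← hCp, ← add_sum_erase _ _ h0Cp, ← hApCp]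
      congr 1
      · refine sum_congr rfl fun θ _ => by rw [add_zero]
      · simp only [g, H, mul_sum, sum_mul]
        refine sum_congr rfl fun b hb => sum_congr rfl fun θ hθ => ?_
        rw [hAp, mem_exactPrimary] at hb
        rw [mem_primary] at hθ
        have hd : Disjoint (pf θ) (pf b) := by
          rw [hb]
          exact disjoint_of_subset_left hθ hdisj
        rw [pf_add_of_disjoint hd, card_union_of_disjoint hd, hb, card_singleton, chi_add_right]
        ring
    have hsplit_eq : 𝔼 y : Fin d → ZMod Q, (∑ i, ‖∑ θ ∈ primary (Fin d → ZMod Q) (insert p P),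
        (ρ : ℂ) ^ (pf θ).card * c θ i * chi y θ‖ ^ 2) ^ (k + 1) =
        𝔼 y, 𝔼 z, (∑ i, ‖H y 0 i + ρ * g y z i‖ ^ 2) ^ (k + 1) := by
      simp only [hsplit]
      refine expect_diag hcop (fun y z => (∑ i, ‖H y 0 i + ρ * g y z i‖ ^ 2) ^ (k + 1)) ?_ ?_
      · intro y z t
        simp only [g, hH]
      · intro y z t
        simp only [hg']
    have hmean : ∀ y i, 𝔼 z, g y z i = 0 := by
      intro y i
      simp only [g]
      rw [expect_sum_comm]
      refine sum_eq_zero fun b hb => ?_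
      rw [hApCp, mem_erase] at hb
      rw [← mul_expect, expect_chi, if_neg hb.1, mul_zero]
    have hvar : ∀ y i, 𝔼 z, ‖g y z i‖ ^ 2 = ∑ b ∈ Ap, ‖H y b i‖ ^ 2 := fun y i =>
      expect_norm_sq_sum_chi Ap fun b => H y b i
    have hinner_le : ∀ y, 𝔼 z, (∑ i, ‖H y 0 i + ρ * g y z i‖ ^ 2) ^ (k + 1) ≤
        (∑ x : ι × Cp, ‖H y x.2 x.1‖ ^ 2) ^ (k + 1) +
          𝔼 z, (∑ i, ‖g y z i‖ ^ 2) ^ (k + 1) := by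
      intro y
      refine (hone ι _ (H y 0) (g y) (hmean y)).trans (le_of_eq ?_)
      congr 2
      rw [Fintype.sum_prod_type]
      refine sum_congr rfl fun i _ => ?_
      rw [hvar, hApCp, sum_coe_sort Cp fun b => ‖H y b i‖ ^ 2]
      exact add_sum_erase _ (fun b => ‖H y b i‖ ^ 2) h0Cp
    -- The induction hypothesis is used with the index set `ι × Cp`.
    have hinvariant_le : 𝔼 y, (∑ x : ι × Cp, ‖H y x.2 x.1‖ ^ 2) ^ (k + 1) ≤
        ∑ D ∈ P.powerset, decoupled k (insert p P) D c := by
      refine (ih (ι × Cp) fun θ x => c (θ + x.2) x.1).trans (le_of_eq ?_)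
      refine sum_congr rfl fun D hD => ?_
      have hpD : p ∉ D := fun h => hp (mem_powerset.1 hD h)
      unfold decoupled
      refine expect_congr rfl fun y _ => ?_
      congr 1
      rw [Fintype.sum_prod_type]
      refine sum_congr rfl fun i _ => ?_
      have e : insert p P \ D = (P \ D) ∪ {p} := by
        rw [insert_sdiff_of_notMem _ hpD, insert_eq, union_comm]
      rw [e, sum_primary_union (disjoint_of_subset_left sdiff_subset hdisj), ← hCp, sum_comm]
      refine sum_congr rfl fun β _ => ?_
      simp only [add_assoc]
      exact sum_coe_sort Cp fun b => ‖∑ α ∈ exactPrimary (Fin d → ZMod Q) D,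
        c (α + (β + b)) i * chi y α‖ ^ 2
    -- The induction hypothesis is used for each fixed `z`; afterwards `expect_diag` merges `y` and
    -- `z` again.
    have hmeanZero_le : 𝔼 y, 𝔼 z, (∑ i, ‖g y z i‖ ^ 2) ^ (k + 1) ≤
        ∑ D ∈ P.powerset, decoupled k (insert p P) (insert p D) c := by
      rw [expect_comm]
      have h1 : ∀ z, 𝔼 y, (∑ i, ‖g y z i‖ ^ 2) ^ (k + 1) ≤
          ∑ D ∈ P.powerset, decoupled k P D fun θ i => ∑ b ∈ Ap, c (θ + b) i * chi z b := by
        intro z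
        refine le_trans (le_of_eq ?_) (ih ι fun θ i => ∑ b ∈ Ap, c (θ + b) i * chi z b)
        refine expect_congr rfl fun y _ => ?_
        congr 1
        refine sum_congr rfl fun i _ => ?_
        congr 2
        simp only [g, H, sum_mul, mul_sum]
        rw [sum_comm]
        refine sum_congr rfl fun θ _ => sum_congr rfl fun b _ => ?_
        ring
      refine (expect_le_expect fun z _ => h1 z).trans (le_of_eq ?_)
      rw [expect_sum_comm]
      refine sum_congr rfl fun D hD => ?_
      have hDP := mem_powerset.1 hD
      have hpD : p ∉ D := fun h => hp (hDP h)
      unfold decoupled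
      have hset : insert p P \ insert p D = P \ D := by
        rw [insert_sdiff_insert, sdiff_insert_of_notMem hp]
      have hinsD : insert p D = D ∪ {p} := by rw [union_comm, insert_eq]
      rw [expect_comm]
      symm
      rw [hset]
      let F : (Fin d → ZMod Q) → (Fin d → ZMod Q) → ℝ := fun y z =>
        (∑ i, ∑ β ∈ primary (Fin d → ZMod Q) (P \ D), ‖∑ α ∈ exactPrimary (Fin d → ZMod Q) D,
          (∑ b ∈ Ap, c (α + β + b) i * chi z b) * chi y α‖ ^ 2) ^ (k + 1)
      have hF := expect_diag hcop F ?_ ?_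
      · refine Eq.trans ?_ hF
        refine expect_congr rfl fun y _ => ?_
        simp only [F]
        congr 1
        refine sum_congr rfl fun i _ => sum_congr rfl fun β _ => ?_
        congr 2
        rw [hinsD, sum_exactPrimary_union (disjoint_of_subset_left hDP hdisj)]
        refine sum_congr rfl fun α _ => ?_
        rw [sum_mul]
        refine sum_congr rfl fun b _ => ?_
        rw [chi_add_right, show α + b + β = α + β + b by abel]
        ring
      · intro y z t
        have e : ∀ i β, ∑ α ∈ exactPrimary (Fin d → ZMod Q) D,
            (∑ b ∈ Ap, c (α + β + b) i * chi z b) * chi (y + n • t) α =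
            ∑ α ∈ exactPrimary (Fin d → ZMod Q) D,
            (∑ b ∈ Ap, c (α + β + b) i * chi z b) * chi y α := by
          refine fun i β => sum_congr rfl fun α hα => ?_
          rw [mem_exactPrimary] at hα
          rw [hn α (mem_primary.2 (hα ▸ hDP))]
        simp only [F, e]
      · intro y z t
        have e : ∀ i x, ∑ b ∈ Ap, c (x + b) i * chi (z + n' • t) b =
            ∑ b ∈ Ap, c (x + b) i * chi z b := by
          refine fun i x => sum_congr rfl fun b hb => ?_
          rw [hApCp] at hb
          rw [hn' b (mem_of_mem_erase hb)]
        simp only [F, e]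
    rw [hsplit_eq, sum_powerset_insert hp]
    refine (expect_le_expect fun y _ => hinner_le y).trans ?_
    rw [expect_add_distrib]
    exact add_le_add hinvariant_le hmeanZero_le

end Characters

/-! ### Interpolation between `L²` and `L^∞` for sublinear operators -/

theorem setLIntegral_pow_indicator_le {c : ℝ} (hc : 0 ≤ c) (n : ℕ) :
    ∫⁻ t in Set.Ioi (0 : ℝ), (if t < c then ENNReal.ofReal (t ^ n) else 0) ≤
      ENNReal.ofReal (c ^ (n + 1)) := by
  calc ∫⁻ t in Set.Ioi (0 : ℝ), (if t < c then ENNReal.ofReal (t ^ n) else 0)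
      ≤ ∫⁻ t in Set.Ioi (0 : ℝ), (Set.Iio c).indicator (fun _ => ENNReal.ofReal (c ^ n)) t := by
        refine setLIntegral_mono (measurable_const.indicator measurableSet_Iio) fun t ht => ?_
        rw [Set.indicator_apply]
        simp only [Set.mem_Iio]
        split_ifs with h
        · exact ENNReal.ofReal_le_ofReal (pow_le_pow_left₀ (le_of_lt ht) h.le n)
        · exact le_rfl
    _ = ENNReal.ofReal (c ^ (n + 1)) := by
        rw [lintegral_indicator measurableSet_Iio, setLIntegral_const,
          Measure.restrict_apply measurableSet_Iio, Set.inter_comm, Set.Ioi_inter_Iio,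
          Real.volume_Ioo, sub_zero, ← ENNReal.ofReal_mul (by positivity), pow_succ]

/-- Marcinkiewicz interpolation. At height `t`, the part of `f` of size at most `t/(2b)` contributes
at most `t/2` to `U f` by the `L^∞` bound, and Chebyshev's inequality with the `L²` bound handles
the rest. In the layer cake formula each `x` is then charged only for `t < 2b‖f x‖`. -/
theorem lintegral_pow_le_of_sublinear {X Y : Type*} [Countable X] [MeasurableSpace Y]
    (μ : Measure Y) (U : (X → ℂ) → Y → ℝ) (A : ℝ≥0∞) (b : ℝ) (hb : 0 < b) (k : ℕ)
    (hmeas : ∀ f, Measurable (U f)) (hnn : ∀ f y, 0 ≤ U f y)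
    (hsub : ∀ f g : X → ℂ, f.support.Finite → g.support.Finite → ∀ y,
      U (f + g) y ≤ U f y + U g y)
    (h2 : ∀ f : X → ℂ, f.support.Finite →
      ∫⁻ y, ENNReal.ofReal (U f y ^ 2) ∂μ ≤ A * ∑' x, ENNReal.ofReal (‖f x‖ ^ 2))
    (hinf : ∀ f : X → ℂ, f.support.Finite → ∀ M : ℝ, 0 ≤ M → (∀ x, ‖f x‖ ≤ M) →
      ∀ y, U f y ≤ b * M)
    (f : X → ℂ) (hf : f.support.Finite) :
    ∫⁻ y, ENNReal.ofReal (U f y ^ (2 * (k + 1))) ∂μ ≤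
      ENNReal.ofReal (8 * (k + 1) * (2 * b) ^ (2 * k)) * A *
        ∑' x, ENNReal.ofReal (‖f x‖ ^ (2 * (k + 1))) := by
  rcases Nat.eq_zero_or_pos k with rfl | hk
  · have h1 : (1 : ℝ≥0∞) ≤ ENNReal.ofReal (8 * ((0 : ℕ) + 1) * (2 * b) ^ (2 * 0)) := by
      rw [ENNReal.one_le_ofReal]; norm_num
    calc _ = ∫⁻ y, ENNReal.ofReal (U f y ^ 2) ∂μ := by simp
      _ ≤ A * ∑' x, ENNReal.ofReal (‖f x‖ ^ 2) := h2 f hf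
      _ ≤ ENNReal.ofReal (8 * ((0 : ℕ) + 1) * (2 * b) ^ (2 * 0)) *
          (A * ∑' x, ENNReal.ofReal (‖f x‖ ^ 2)) := le_mul_of_one_le_left (zero_le) h1
      _ = _ := by rw [← mul_assoc]
  obtain ⟨j, rfl⟩ : ∃ j, k = j + 1 := ⟨k - 1, by omega⟩
  have hlc := lintegral_rpow_eq_lintegral_meas_lt_mul μ (f := U f)
    (Filter.Eventually.of_forall (hnn f)) (hmeas f).aemeasurable
    (p := ((2 * (j + 1 + 1) : ℕ) : ℝ)) (by positivity)
  have e1 : ∀ y, U f y ^ (2 * (j + 1 + 1)) = U f y ^ ((2 * (j + 1 + 1) : ℕ) : ℝ) := fun y =>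
    (Real.rpow_natCast _ _).symm
  simp only [e1]
  rw [hlc]
  -- truncation at height `t / (2 b)`
  let hi : ℝ → X → ℂ := fun t x => if t < 2 * b * ‖f x‖ then f x else 0
  let lo : ℝ → X → ℂ := fun t x => if t < 2 * b * ‖f x‖ then 0 else f x
  have hadd : ∀ t, f = hi t + lo t := by
    intro t
    funext x
    simp only [hi, lo, Pi.add_apply]
    split_ifs <;> simp
  have hhif : ∀ t, (hi t).support.Finite := fun t => hf.subset fun x hx => by
    simp only [hi, Function.mem_support] at hx ⊢
    intro h
    simp [h] at hx
  have hlof : ∀ t, (lo t).support.Finite := fun t => hf.subset fun x hx => by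
    simp only [lo, Function.mem_support] at hx ⊢
    intro h
    simp [h] at hx
  have hmeasle : ∀ t : ℝ, 0 < t → μ {y | t < U f y} ≤
      ENNReal.ofReal (4 / t ^ 2) * (A * ∑' x, ENNReal.ofReal (‖hi t x‖ ^ 2)) := by
    intro t ht
    have hlo : ∀ y, U (lo t) y ≤ t / 2 := by
      intro y
      have := hinf (lo t) (hlof t) (t / (2 * b)) (by positivity) (fun x => by
        simp only [lo]
        split_ifs with h
        · rw [norm_zero]; positivity
        · rw [le_div_iff₀ (by positivity)]
          linarith) y
      calc U (lo t) y ≤ b * (t / (2 * b)) := this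
        _ = t / 2 := by field_simp
    have hincl : {y | t < U f y} ⊆
        {y | 1 ≤ ENNReal.ofReal (4 / t ^ 2) * ENNReal.ofReal (U (hi t) y ^ 2)} := by
      intro y hy
      have hy' : t < U f y := hy
      have h3 := hsub (hi t) (lo t) (hhif t) (hlof t) y
      rw [← hadd t] at h3
      have h4 : t / 2 < U (hi t) y := by linarith [hlo y]
      change 1 ≤ ENNReal.ofReal (4 / t ^ 2) * ENNReal.ofReal (U (hi t) y ^ 2)
      rw [← ENNReal.ofReal_mul (by positivity), ENNReal.one_le_ofReal, div_mul_eq_mul_div,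
        one_le_div (by positivity)]
      nlinarith
    refine (measure_mono hincl).trans ?_
    refine (meas_ge_le_lintegral_div (((hmeas _).pow_const 2).ennreal_ofReal.const_mul
      _).aemeasurable one_ne_zero ENNReal.one_ne_top).trans ?_
    rw [div_one, lintegral_const_mul _ ((hmeas _).pow_const 2).ennreal_ofReal]
    gcongr
    exact h2 _ (hhif t)
  have hstep : ∀ t ∈ Set.Ioi (0 : ℝ), μ {y | t < U f y} *
      ENNReal.ofReal (t ^ (((2 * (j + 1 + 1) : ℕ) : ℝ) - 1)) ≤
      4 * A * ∑' x, ENNReal.ofReal (‖f x‖ ^ 2) *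
        (if t < 2 * b * ‖f x‖ then ENNReal.ofReal (t ^ (2 * j + 1)) else 0) := by
    intro t ht
    have ht0 : 0 < t := ht
    have e2 : t ^ (((2 * (j + 1 + 1) : ℕ) : ℝ) - 1) = t ^ (2 * j + 1) * t ^ 2 := by
      rw [← pow_add, ← Real.rpow_natCast]
      congr 1
      push_cast
      ring
    calc _ ≤ ENNReal.ofReal (4 / t ^ 2) * (A * ∑' x, ENNReal.ofReal (‖hi t x‖ ^ 2)) *
          ENNReal.ofReal (t ^ (2 * j + 1) * t ^ 2) := by
          rw [e2]
          gcongr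
          exact hmeasle t ht0
      _ = (ENNReal.ofReal (4 / t ^ 2) * ENNReal.ofReal (t ^ (2 * j + 1) * t ^ 2)) * A *
          ∑' x, ENNReal.ofReal (‖hi t x‖ ^ 2) := by ring
      _ = 4 * A * (ENNReal.ofReal (t ^ (2 * j + 1)) *
          ∑' x, ENNReal.ofReal (‖hi t x‖ ^ 2)) := by
          rw [← ENNReal.ofReal_mul (by positivity),
            show 4 / t ^ 2 * (t ^ (2 * j + 1) * t ^ 2) = 4 * t ^ (2 * j + 1) by field_simp,
            ENNReal.ofReal_mul (by norm_num), ENNReal.ofReal_ofNat]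
          ring
      _ = _ := by
          rw [← ENNReal.tsum_mul_left]
          congr 1
          refine tsum_congr fun x => ?_
          simp only [hi]
          split_ifs
          · rw [mul_comm]
          · simp
  refine (mul_le_mul_right (setLIntegral_mono' measurableSet_Ioi hstep) _).trans ?_
  rw [lintegral_const_mul, lintegral_tsum]
  rotate_left
  · intro x
    refine (Measurable.const_mul ?_ _).aemeasurable
    exact Measurable.ite (measurableSet_Iio) (by fun_prop) measurable_const
  · refine Measurable.tsum fun x => Measurable.const_mul ?_ _
    exact Measurable.ite (measurableSet_Iio) (by fun_prop) measurable_const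
  have hx : ∀ x, ∫⁻ t in Set.Ioi (0 : ℝ), ENNReal.ofReal (‖f x‖ ^ 2) *
      (if t < 2 * b * ‖f x‖ then ENNReal.ofReal (t ^ (2 * j + 1)) else 0) ≤
      ENNReal.ofReal ((2 * b) ^ (2 * (j + 1))) *
        ENNReal.ofReal (‖f x‖ ^ ((2 * (j + 1 + 1)))) := by
    intro x
    rw [lintegral_const_mul _ (Measurable.ite (measurableSet_Iio) (by fun_prop) measurable_const)]
    refine (mul_le_mul_right (setLIntegral_pow_indicator_le (by positivity) _) _).trans ?_
    rw [← ENNReal.ofReal_mul (by positivity), ← ENNReal.ofReal_mul (by positivity)]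
    refine le_of_eq (congrArg _ ?_)
    ring
  refine (mul_le_mul_right (mul_le_mul_right (ENNReal.tsum_le_tsum hx) _) _).trans ?_
  rw [ENNReal.tsum_mul_left]
  refine le_of_eq ?_
  rw [show (8 * (((j + 1 : ℕ) : ℝ) + 1) * (2 * b) ^ (2 * (j + 1))) =
    ((2 * (j + 1 + 1) : ℕ) : ℝ) * 4 * (2 * b) ^ (2 * (j + 1)) by push_cast; ring,
    ENNReal.ofReal_mul (by positivity), ENNReal.ofReal_mul (by positivity), ENNReal.ofReal_ofNat]
  ring

/-! ### Fourier coefficients on the torus -/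

section Torus

open UnitAddTorus
open scoped ComplexConjugate

theorem volume_torus_eq (d : ℕ) : (volume : Measure (UnitAddTorus (Fin d))) =
    Measure.pi fun _ => AddCircle.haarAddCircle := by
  rw [volume_pi]
  congr 1
  funext i
  rw [AddCircle.volume_eq_smul_haarAddCircle]
  simp

instance isProbabilityMeasure_torus (d : ℕ) :
    IsProbabilityMeasure (volume : Measure (UnitAddTorus (Fin d))) := by
  rw [volume_torus_eq]; infer_instance

variable {d : ℕ}

theorem mFourier_apply_add (n : Fin d → ℤ) (x y : UnitAddTorus (Fin d)) :
    mFourier n (x + y) = mFourier n x * mFourier n y := by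
  simp only [mFourier, ContinuousMap.coe_mk, ← Finset.prod_mul_distrib, Pi.add_apply,
    fourier_apply, smul_add, AddCircle.toCircle_add, Circle.coe_mul]

@[simp] theorem norm_mFourier_apply (n : Fin d → ℤ) (x : UnitAddTorus (Fin d)) :
    ‖mFourier n x‖ = 1 := by
  simp only [mFourier, ContinuousMap.coe_mk, norm_prod, fourier_apply, Circle.norm_coe,
    Finset.prod_const_one]

theorem mFourier_zero_apply (x : UnitAddTorus (Fin d)) : mFourier (0 : Fin d → ℤ) x = 1 := by
  rw [mFourier_zero]; rfl

/-- Bounded measurable functions. -/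
def BddMeas {X : Type*} [MeasurableSpace X] (g : X → ℂ) : Prop :=
  Measurable g ∧ ∃ C : ℝ, ∀ ξ, ‖g ξ‖ ≤ C

theorem BddMeas.memLp {X : Type*} [MeasurableSpace X] {μ : Measure X} [IsFiniteMeasure μ]
    {g : X → ℂ} (hg : BddMeas g) (p : ℝ≥0∞) : MemLp g p μ := by
  obtain ⟨hm, C, hC⟩ := hg
  exact MemLp.of_bound hm.aestronglyMeasurable C (Filter.Eventually.of_forall hC)

theorem BddMeas.integrable {X : Type*} [MeasurableSpace X] {μ : Measure X} [IsFiniteMeasure μ]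
    {g : X → ℂ} (hg : BddMeas g) : Integrable g μ :=
  memLp_one_iff_integrable.1 (hg.memLp 1)

theorem BddMeas.mul {X : Type*} [MeasurableSpace X] {g h : X → ℂ} (hg : BddMeas g)
    (hh : BddMeas h) : BddMeas fun x => g x * h x := by
  obtain ⟨hm, C, hC⟩ := hg
  obtain ⟨hm', C', hC'⟩ := hh
  refine ⟨hm.mul hm', C * C', fun ξ => ?_⟩
  rw [norm_mul]
  exact mul_le_mul (hC ξ) (hC' ξ) (norm_nonneg _) ((norm_nonneg _).trans (hC ξ))

theorem BddMeas.conj {X : Type*} [MeasurableSpace X] {g : X → ℂ} (hg : BddMeas g) :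
    BddMeas fun x => conj (g x) := by
  obtain ⟨hm, C, hC⟩ := hg
  exact ⟨Complex.continuous_conj.measurable.comp hm, C, fun ξ => by rw [RCLike.norm_conj]; exact hC ξ⟩

theorem BddMeas.sum {X ι : Type*} [MeasurableSpace X] (s : Finset ι) {g : ι → X → ℂ}
    (hg : ∀ i ∈ s, BddMeas (g i)) : BddMeas fun x => ∑ i ∈ s, g i x := by
  classical
  choose! C hC using fun i (hi : i ∈ s) => (hg i hi).2
  refine ⟨Finset.measurable_sum s fun i hi => (hg i hi).1, ∑ i ∈ s, C i, fun ξ => ?_⟩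
  exact (norm_sum_le _ _).trans (Finset.sum_le_sum fun i hi => hC i hi ξ)

theorem BddMeas.comp {X Y : Type*} [MeasurableSpace X] [MeasurableSpace Y] {g : X → ℂ}
    (hg : BddMeas g) {φ : Y → X} (hφ : Measurable φ) : BddMeas fun y => g (φ y) :=
  ⟨hg.1.comp hφ, hg.2.choose, fun _ => hg.2.choose_spec _⟩

theorem bddMeas_const {X : Type*} [MeasurableSpace X] (c : ℂ) : BddMeas fun _ : X => c :=
  ⟨measurable_const, ‖c‖, fun _ => le_rfl⟩

theorem bddMeas_mFourier (n : Fin d → ℤ) : BddMeas fun ξ => mFourier n ξ :=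
  ⟨(mFourier n).continuous.measurable, 1, fun ξ => (norm_mFourier_apply n ξ).le⟩

/-- The Fourier coefficients of a function on the torus. -/
def coef (g : UnitAddTorus (Fin d) → ℂ) (x : Fin d → ℤ) : ℂ :=
  ∫ ξ, mFourier (-x) ξ * g ξ

theorem hasSum_coef {g h : UnitAddTorus (Fin d) → ℂ} (hg : BddMeas g) (hh : BddMeas h) :
    HasSum (fun x => conj (coef g x) * coef h x) (∫ ξ, conj (g ξ) * h ξ) := by
  have hg2 : MemLp g 2 (volume : Measure (UnitAddTorus (Fin d))) := hg.memLp 2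
  have hh2 : MemLp h 2 (volume : Measure (UnitAddTorus (Fin d))) := hh.memLp 2
  unfold coef
  rw [volume_torus_eq] at *
  have := UnitAddTorus.hasSum_prod_mFourierCoeff (d := Fin d) (hg2.toLp g) (hh2.toLp h)
  convert this using 1
  · funext x
    unfold mFourierCoeff
    congr 1
    · congr 1
      refine integral_congr_ae ?_
      filter_upwards [hg2.coeFn_toLp] with ξ hξ
      rw [hξ, smul_eq_mul]
    · refine integral_congr_ae ?_
      filter_upwards [hh2.coeFn_toLp] with ξ hξ
      rw [hξ, smul_eq_mul]
  · refine integral_congr_ae ?_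
    filter_upwards [hg2.coeFn_toLp, hh2.coeFn_toLp] with ξ hξ hξ'
    rw [hξ, hξ']

theorem hasSum_norm_sq_coef {g : UnitAddTorus (Fin d) → ℂ} (hg : BddMeas g) :
    HasSum (fun x => ‖coef g x‖ ^ 2) (∫ ξ, ‖g ξ‖ ^ 2) := by
  have h := hasSum_coef hg hg
  have e : ∀ z : ℂ, conj z * z = ((‖z‖ ^ 2 : ℝ) : ℂ) := fun z => by
    rw [Complex.conj_mul']; push_cast; rfl
  simp only [e] at h
  have h2 : ∫ ξ, ((‖g ξ‖ ^ 2 : ℝ) : ℂ) = ((∫ ξ, ‖g ξ‖ ^ 2 : ℝ) : ℂ) := integral_ofReal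
  rw [h2] at h
  exact_mod_cast h

theorem coef_translate (g : UnitAddTorus (Fin d) → ℂ) (θ : UnitAddTorus (Fin d))
    (x : Fin d → ℤ) : coef (fun ξ => g (ξ - θ)) x = mFourier (-x) θ * coef g x := by
  unfold coef
  rw [← integral_sub_right_eq_self (fun ξ => mFourier (-x) ξ * g ξ) θ, ← integral_const_mul]
  refine integral_congr_ae (Filter.Eventually.of_forall fun ξ => ?_)
  simp only
  rw [← mul_assoc, ← mFourier_apply_add, add_sub_cancel]

theorem coef_sum {ι : Type*} (s : Finset ι) {g : ι → UnitAddTorus (Fin d) → ℂ}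
    (hg : ∀ i ∈ s, BddMeas (g i)) (x : Fin d → ℤ) :
    coef (fun ξ => ∑ i ∈ s, g i ξ) x = ∑ i ∈ s, coef (g i) x := by
  unfold coef
  simp only [Finset.mul_sum]
  exact integral_finsetSum _ fun i hi => ((bddMeas_mFourier _).mul (hg i hi)).integrable

theorem coef_const_mul (c : ℂ) (g : UnitAddTorus (Fin d) → ℂ) (x : Fin d → ℤ) :
    coef (fun ξ => c * g ξ) x = c * coef g x := by
  unfold coef
  rw [← integral_const_mul]
  congr 1
  funext ξ
  ring

theorem coef_conj_reflect (g : UnitAddTorus (Fin d) → ℂ) (x z : Fin d → ℤ) :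
    coef (fun ξ => mFourier x ξ * conj (g ξ)) z = conj (coef g (x - z)) := by
  unfold coef
  rw [← integral_conj]
  congr 1
  funext ξ
  rw [map_mul, ← mFourier_neg, neg_neg, ← mul_assoc, ← mFourier_add]
  congr 2
  rw [neg_add_eq_sub]

/-- The Fourier coefficients of a product are a convolution. -/
theorem hasSum_coef_mul {g h : UnitAddTorus (Fin d) → ℂ} (hg : BddMeas g) (hh : BddMeas h)
    (x : Fin d → ℤ) :
    HasSum (fun y => coef h y * coef g (x - y)) (coef (fun ξ => g ξ * h ξ) x) := by
  have h1 := hasSum_coef ((bddMeas_mFourier x).mul hg.conj) hh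
  simp only [coef_conj_reflect, Complex.conj_conj] at h1
  convert h1 using 1
  · funext y; ring
  · unfold coef
    congr 1
    funext ξ
    rw [map_mul, Complex.conj_conj, mFourier_neg]
    ring

/-! ### Convolution on the torus -/

/-- Convolution of functions on the torus. -/
def tconv (a b : UnitAddTorus (Fin d) → ℂ) (ξ : UnitAddTorus (Fin d)) : ℂ :=
  ∫ ζ, a (ξ - ζ) * b ζ

theorem bddMeas_tconv {a b : UnitAddTorus (Fin d) → ℂ} (ha : BddMeas a) (hb : BddMeas b) :
    BddMeas (tconv a b) := by
  have hm : BddMeas fun p : UnitAddTorus (Fin d) × UnitAddTorus (Fin d) => a (p.1 - p.2) * b p.2 :=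
    (ha.comp (measurable_fst.sub measurable_snd)).mul (hb.comp measurable_snd)
  obtain ⟨hm1, C, hC⟩ := hm
  refine ⟨(hm1.stronglyMeasurable.integral_prod_right (ν := volume)).measurable, C, fun ξ => ?_⟩
  have := norm_integral_le_of_norm_le_const (μ := (volume : Measure (UnitAddTorus (Fin d))))
    (f := fun ζ => a (ξ - ζ) * b ζ) (C := C)
    (Filter.Eventually.of_forall fun ζ => hC (ξ, ζ))
  simpa [tconv] using this

theorem coef_tconv {a b : UnitAddTorus (Fin d) → ℂ} (ha : BddMeas a) (hb : BddMeas b)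
    (x : Fin d → ℤ) : coef (tconv a b) x = coef a x * coef b x := by
  have hInt : Integrable (Function.uncurry fun ξ ζ : UnitAddTorus (Fin d) =>
      mFourier (-x) ξ * (a (ξ - ζ) * b ζ)) (volume.prod volume) := by
    refine BddMeas.integrable ?_
    exact ((bddMeas_mFourier (-x)).comp measurable_fst).mul
      ((ha.comp (measurable_fst.sub measurable_snd)).mul (hb.comp measurable_snd))
  calc coef (tconv a b) x = ∫ ξ, ∫ ζ, mFourier (-x) ξ * (a (ξ - ζ) * b ζ) := by
        unfold coef tconv
        simp only [integral_const_mul]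
    _ = ∫ ζ, ∫ ξ, mFourier (-x) ξ * (a (ξ - ζ) * b ζ) := integral_integral_swap hInt
    _ = ∫ ζ, coef a x * (mFourier (-x) ζ * b ζ) := by
        congr 1
        funext ζ
        have := coef_translate a ζ x
        unfold coef at this
        calc ∫ ξ, mFourier (-x) ξ * (a (ξ - ζ) * b ζ)
            = ∫ ξ, (mFourier (-x) ξ * a (ξ - ζ)) * b ζ := by simp only [mul_assoc]
          _ = (∫ ξ, mFourier (-x) ξ * a (ξ - ζ)) * b ζ := integral_mul_const _ _
          _ = _ := by rw [this]; unfold coef; ring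
    _ = coef a x * coef b x := by rw [integral_const_mul]; rfl

theorem tconv_support {a b : UnitAddTorus (Fin d) → ℂ} {c c' : UnitAddTorus (Fin d)} {r r' : ℝ}
    (ha : ∀ ξ, a ξ ≠ 0 → ‖ξ - c‖ ≤ r) (hb : ∀ ξ, b ξ ≠ 0 → ‖ξ - c'‖ ≤ r')
    (ξ : UnitAddTorus (Fin d)) (hξ : tconv a b ξ ≠ 0) : ‖ξ - (c + c')‖ ≤ r + r' := by
  by_contra hcon
  refine hξ ?_
  unfold tconv
  rw [show (fun ζ => a (ξ - ζ) * b ζ) = fun _ => 0 from ?_, integral_zero]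
  funext ζ
  by_contra hne
  have h1 := ha _ (left_ne_zero_of_mul hne)
  have h2 := hb _ (right_ne_zero_of_mul hne)
  refine hcon ?_
  calc ‖ξ - (c + c')‖ = ‖(ξ - ζ - c) + (ζ - c')‖ := by congr 1; abel
    _ ≤ r + r' := (norm_add_le _ _).trans (add_le_add h1 h2)

/-! ### Functions on `ℤ^d` with spectrum in a ball -/

/-- `h` is the sequence of Fourier coefficients of a bounded function supported in the ball of
radius `r` about `c`. -/
def Spec (h : (Fin d → ℤ) → ℂ) (c : UnitAddTorus (Fin d)) (r : ℝ) : Prop :=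
  ∃ g : UnitAddTorus (Fin d) → ℂ, BddMeas g ∧ (∀ ξ, g ξ ≠ 0 → ‖ξ - c‖ ≤ r) ∧ h = coef g

theorem Spec.mul {h h' : (Fin d → ℤ) → ℂ} {c c' : UnitAddTorus (Fin d)} {r r' : ℝ}
    (H : Spec h c r) (H' : Spec h' c' r') : Spec (fun x => h x * h' x) (c + c') (r + r') := by
  obtain ⟨g, hg, hs, rfl⟩ := H
  obtain ⟨g', hg', hs', rfl⟩ := H'
  exact ⟨tconv g g', bddMeas_tconv hg hg', tconv_support hs hs',
    funext fun x => (coef_tconv hg hg' x).symm⟩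

theorem Spec.sum {ι : Type*} (s : Finset ι) {h : ι → (Fin d → ℤ) → ℂ}
    {c : UnitAddTorus (Fin d)} {r : ℝ} (H : ∀ i ∈ s, Spec (h i) c r) :
    Spec (fun x => ∑ i ∈ s, h i x) c r := by
  classical
  choose! g hg hs he using H
  refine ⟨fun ξ => ∑ i ∈ s, g i ξ, BddMeas.sum s hg, fun ξ hξ => ?_, ?_⟩
  · obtain ⟨i, hi, hne⟩ := Finset.exists_ne_zero_of_sum_ne_zero hξ
    exact hs i hi ξ hne
  · funext x
    rw [coef_sum s hg]
    exact Finset.sum_congr rfl fun i hi => congrFun (he i hi) x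

theorem Spec.const_mul {h : (Fin d → ℤ) → ℂ} {c : UnitAddTorus (Fin d)} {r : ℝ}
    (H : Spec h c r) (a : ℂ) : Spec (fun x => a * h x) c r := by
  obtain ⟨g, hg, hs, rfl⟩ := H
  exact ⟨fun ξ => a * g ξ, (bddMeas_const a).mul hg, fun ξ hξ => hs ξ (right_ne_zero_of_mul hξ),
    funext fun x => (coef_const_mul a g x).symm⟩

theorem Spec.modulate {h : (Fin d → ℤ) → ℂ} {c : UnitAddTorus (Fin d)} {r : ℝ}
    (H : Spec h c r) (θ : UnitAddTorus (Fin d)) :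
    Spec (fun x => mFourier (-x) θ * h x) (c + θ) r := by
  obtain ⟨g, hg, hs, rfl⟩ := H
  refine ⟨fun ξ => g (ξ - θ), hg.comp (measurable_id.sub_const θ), fun ξ hξ => ?_,
    funext fun x => (coef_translate g θ x).symm⟩
  have := hs _ hξ
  rwa [show ξ - (c + θ) = ξ - θ - c by abel]

theorem Spec.conj_reflect {h : (Fin d → ℤ) → ℂ} {c : UnitAddTorus (Fin d)} {r : ℝ}
    (H : Spec h c r) (x : Fin d → ℤ) : Spec (fun z => conj (h (x - z))) c r := by
  obtain ⟨g, hg, hs, rfl⟩ := H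
  refine ⟨fun ξ => mFourier x ξ * conj (g ξ), (bddMeas_mFourier x).mul hg.conj, fun ξ hξ => ?_,
    funext fun z => (coef_conj_reflect g x z).symm⟩
  refine hs ξ fun h0 => hξ ?_
  simp only [h0, map_zero, mul_zero]

/-- Disjoint spectra are orthogonal, by Parseval. -/
theorem Spec.hasSum_zero {h h' : (Fin d → ℤ) → ℂ} {c c' : UnitAddTorus (Fin d)} {r r' : ℝ}
    (H : Spec h c r) (H' : Spec h' c' r') (hcc : r + r' < ‖c - c'‖) :
    HasSum (fun x => conj (h x) * h' x) 0 := by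
  obtain ⟨g, hg, hs, rfl⟩ := H
  obtain ⟨g', hg', hs', rfl⟩ := H'
  have h1 := hasSum_coef hg hg'
  rwa [show (fun ξ => conj (g ξ) * g' ξ) = fun _ => 0 from ?_, integral_zero] at h1
  funext ξ
  by_contra hne
  have h2 := hs ξ fun h0 => hne (by rw [h0, map_zero, zero_mul])
  have h3 := hs' ξ (right_ne_zero_of_mul hne)
  refine absurd hcc (not_lt.2 ?_)
  calc ‖c - c'‖ = ‖(ξ - c') - (ξ - c)‖ := by congr 1; abel
    _ ≤ r + r' := (norm_sub_le _ _).trans (by linarith)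

theorem Spec.summable {h : (Fin d → ℤ) → ℂ} {c : UnitAddTorus (Fin d)} {r : ℝ}
    (H : Spec h c r) : Summable fun x => ‖h x‖ ^ 2 := by
  obtain ⟨g, hg, -, rfl⟩ := H
  exact (hasSum_norm_sq_coef hg).summable

end Torus

/-! ### Orthogonal families in `ℓ²` -/

section Orthogonal

open scoped ComplexConjugate

theorem hasSum_norm_sq_sum {X ι : Type*} (s : Finset ι) (h : ι → X → ℂ) (n : ι → ℝ)
    (hn : ∀ i ∈ s, HasSum (fun x => ‖h i x‖ ^ 2) (n i))
    (hort : ∀ i ∈ s, ∀ j ∈ s, i ≠ j → HasSum (fun x => conj (h i x) * h j x) 0) :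
    HasSum (fun x => ‖∑ i ∈ s, h i x‖ ^ 2) (∑ i ∈ s, n i) := by
  classical
  have e : ∀ z : ℂ, conj z * z = ((‖z‖ ^ 2 : ℝ) : ℂ) := fun z => by
    rw [Complex.conj_mul']; push_cast; rfl
  have h1 : HasSum (fun x => ∑ i ∈ s, ∑ j ∈ s, conj (h i x) * h j x)
      (∑ i ∈ s, ∑ j ∈ s, if i = j then ((n i : ℝ) : ℂ) else 0) := by
    refine hasSum_sum fun i hi => hasSum_sum fun j hj => ?_
    split_ifs with hij
    · subst hij
      simp only [e]
      exact_mod_cast hn i hi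
    · exact hort i hi j hj hij
  have h2 : ∀ x, ∑ i ∈ s, ∑ j ∈ s, conj (h i x) * h j x =
      ((‖∑ i ∈ s, h i x‖ ^ 2 : ℝ) : ℂ) := by
    intro x
    rw [← e, map_sum, Finset.sum_mul_sum]
  simp only [h2] at h1
  have h3 : ∑ i ∈ s, ∑ j ∈ s, (if i = j then ((n i : ℝ) : ℂ) else 0) =
      ((∑ i ∈ s, n i : ℝ) : ℂ) := by
    push_cast
    refine Finset.sum_congr rfl fun i hi => ?_
    simp [hi]
  rw [h3] at h1
  exact_mod_cast h1

/-- Bessel's inequality for an orthogonal family of functions with norm `√n`. -/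
theorem sum_norm_sq_le_of_orthogonal {X ι : Type*} (s : Finset ι) (h : ι → X → ℂ) (n : ℝ) (hn0 : 0 ≤ n)
    (hn : ∀ i ∈ s, HasSum (fun x => ‖h i x‖ ^ 2) n)
    (hort : ∀ i ∈ s, ∀ j ∈ s, i ≠ j → HasSum (fun x => conj (h i x) * h j x) 0)
    (S : Finset X) (F : X → ℂ) :
    ∑ i ∈ s, ‖∑ x ∈ S, F x * conj (h i x)‖ ^ 2 ≤ n * ∑ x ∈ S, ‖F x‖ ^ 2 := by
  let c : ι → ℂ := fun i => ∑ x ∈ S, F x * conj (h i x)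
  set Z := ∑ i ∈ s, ‖c i‖ ^ 2 with hZ
  have hZ0 : 0 ≤ Z := Finset.sum_nonneg fun i _ => by positivity
  have h1 : HasSum (fun x => ‖∑ i ∈ s, c i * h i x‖ ^ 2) (∑ i ∈ s, ‖c i‖ ^ 2 * n) := by
    refine hasSum_norm_sq_sum s (fun i x => c i * h i x) (fun i => ‖c i‖ ^ 2 * n) ?_ ?_
    · intro i hi
      simp only [norm_mul, mul_pow]
      exact (hn i hi).mul_left _
    · intro i hi j hj hij
      have := (hort i hi j hj hij).mul_left (conj (c i) * c j)
      rw [mul_zero] at this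
      refine this.congr_fun fun x => ?_
      simp only [map_mul]
      ring
  have h2 : ∑ x ∈ S, ‖∑ i ∈ s, c i * h i x‖ ^ 2 ≤ Z * n := by
    rw [hZ, Finset.sum_mul, ← h1.tsum_eq]
    exact h1.summable.sum_le_tsum S fun x _ => by positivity
  -- `Z` is the pairing of `F` with `∑ c i * h i`, whose squared norm is `n Z`; Cauchy–Schwarz then
  -- gives `Z² ≤ n Z ‖F‖²`.
  have h3 : (Z : ℂ) = ∑ x ∈ S, F x * conj (∑ i ∈ s, c i * h i x) := by
    rw [hZ]
    push_cast
    simp only [map_sum, map_mul, Finset.mul_sum]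
    rw [Finset.sum_comm]
    refine Finset.sum_congr rfl fun i _ => ?_
    rw [← Complex.mul_conj']
    nth_rewrite 1 [show c i = ∑ x ∈ S, F x * conj (h i x) from rfl]
    rw [Finset.sum_mul]
    refine Finset.sum_congr rfl fun x _ => by ring
  have h4 : Z ≤ ∑ x ∈ S, ‖F x‖ * ‖∑ i ∈ s, c i * h i x‖ := by
    have : Z = ‖(Z : ℂ)‖ := by rw [Complex.norm_real, Real.norm_of_nonneg hZ0]
    rw [this, h3]
    refine (norm_sum_le _ _).trans (Finset.sum_le_sum fun x _ => ?_)
    rw [norm_mul, RCLike.norm_conj]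
  have h5 : Z ^ 2 ≤ (∑ x ∈ S, ‖F x‖ ^ 2) * (Z * n) := by
    calc Z ^ 2 ≤ (∑ x ∈ S, ‖F x‖ * ‖∑ i ∈ s, c i * h i x‖) ^ 2 := by gcongr
      _ ≤ (∑ x ∈ S, ‖F x‖ ^ 2) * ∑ x ∈ S, ‖∑ i ∈ s, c i * h i x‖ ^ 2 :=
          Finset.sum_mul_sq_le_sq_mul_sq _ _ _
      _ ≤ _ := by gcongr
  rcases hZ0.eq_or_lt with h0 | hpos
  · change Z ≤ _
    rw [← h0]
    exact mul_nonneg hn0 (Finset.sum_nonneg fun x _ => by positivity)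
  · change Z ≤ _
    nlinarith

end Orthogonal

section Eta

open UnitAddTorus
open scoped ComplexConjugate

variable {d : ℕ}

/-! ### A smooth cutoff on the torus whose kernel factors -/

/-- The indicator function of the ball of radius `r` about `0` in the torus. -/
def ballInd (r : ℝ) (ξ : UnitAddTorus (Fin d)) : ℂ :=
  (Metric.closedBall 0 r).indicator (fun _ => 1) ξ

theorem ballInd_of_le {r : ℝ} {ξ : UnitAddTorus (Fin d)} (h : ‖ξ‖ ≤ r) : ballInd r ξ = 1 :=
  Set.indicator_of_mem (mem_closedBall_zero_iff.2 h) _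

theorem norm_le_of_ballInd_ne_zero {r : ℝ} {ξ : UnitAddTorus (Fin d)} (h : ballInd r ξ ≠ 0) :
    ‖ξ‖ ≤ r :=
  mem_closedBall_zero_iff.1 (Set.mem_of_indicator_ne_zero h)

theorem norm_ballInd_le (r : ℝ) (ξ : UnitAddTorus (Fin d)) : ‖ballInd r ξ‖ ≤ 1 := by
  unfold ballInd
  refine (norm_indicator_le_norm_self _ _).trans ?_
  simp

theorem bddMeas_ballInd (r : ℝ) : BddMeas (ballInd r : UnitAddTorus (Fin d) → ℂ) :=
  ⟨measurable_const.indicator Metric.isClosed_closedBall.measurableSet, 1, norm_ballInd_le r⟩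

theorem volume_closedBall_torus {r : ℝ} (h0 : 0 ≤ r) (h1 : 2 * r ≤ 1) :
    (volume : Measure (UnitAddTorus (Fin d))).real (Metric.closedBall 0 r) = (2 * r) ^ d := by
  rw [measureReal_def, volume_pi_closedBall _ h0]
  simp only [AddCircle.volume_closedBall, min_eq_right h1, Finset.prod_const, Finset.card_univ,
    Fintype.card_fin]
  rw [ENNReal.toReal_pow, ENNReal.toReal_ofReal (by positivity)]

theorem integral_ballInd {r : ℝ} (h0 : 0 ≤ r) (h1 : 2 * r ≤ 1) :
    ∫ ξ : UnitAddTorus (Fin d), ballInd r ξ = ((2 * r) ^ d : ℝ) := by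
  unfold ballInd
  rw [integral_indicator Metric.isClosed_closedBall.measurableSet, setIntegral_const,
    volume_closedBall_torus h0 h1]
  simp

theorem integral_norm_sq_ballInd {r : ℝ} (h0 : 0 ≤ r) (h1 : 2 * r ≤ 1) :
    ∫ ξ : UnitAddTorus (Fin d), ‖ballInd r ξ‖ ^ 2 = (2 * r) ^ d := by
  have : (fun ξ : UnitAddTorus (Fin d) => ‖ballInd r ξ‖ ^ 2) =
      (Metric.closedBall 0 r).indicator fun _ => (1 : ℝ) := by
    funext ξ
    unfold ballInd
    by_cases h : ξ ∈ Metric.closedBall (0 : UnitAddTorus (Fin d)) r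
    · simp only [Set.indicator_of_mem h]; simp
    · simp only [Set.indicator_of_notMem h]; simp
  rw [this, integral_indicator Metric.isClosed_closedBall.measurableSet, setIntegral_const,
    volume_closedBall_torus h0 h1]
  simp

/-- The wide factor of `eta`. -/
def etaWide (δ : ℝ) : UnitAddTorus (Fin d) → ℂ := ballInd (5 * δ / 4)

/-- The narrow factor of `eta`, of integral `1`. -/
def etaNarrow (δ : ℝ) (ξ : UnitAddTorus (Fin d)) : ℂ := (((δ / 2) ^ d)⁻¹ : ℝ) * ballInd (δ / 4) ξ

/-- A cutoff that is `1` on the ball of radius `δ` and vanishes off the ball of radius `3δ/2`. -/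
def eta (δ : ℝ) : UnitAddTorus (Fin d) → ℂ := tconv (etaWide δ) (etaNarrow δ)

theorem bddMeas_etaWide (δ : ℝ) : BddMeas (etaWide δ : UnitAddTorus (Fin d) → ℂ) :=
  bddMeas_ballInd _

theorem bddMeas_etaNarrow (δ : ℝ) : BddMeas (etaNarrow δ : UnitAddTorus (Fin d) → ℂ) :=
  (bddMeas_const _).mul (bddMeas_ballInd _)

theorem bddMeas_eta (δ : ℝ) : BddMeas (eta δ : UnitAddTorus (Fin d) → ℂ) :=
  bddMeas_tconv (bddMeas_etaWide δ) (bddMeas_etaNarrow δ)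

/-- This is why the cutoff is built as a convolution: its kernel is a product of two functions with
explicit `ℓ²` norms. One factor can enter an orthogonal family and the other the function tested
against it, and their product is in `ℓ¹` uniformly in `δ`. -/
theorem coef_eta (δ : ℝ) (x : Fin d → ℤ) :
    coef (eta δ) x = coef (etaWide δ) x * coef (etaNarrow δ) x :=
  coef_tconv (bddMeas_etaWide δ) (bddMeas_etaNarrow δ) x

theorem spec_coef_etaWide (δ : ℝ) : Spec (coef (etaWide δ : UnitAddTorus (Fin d) → ℂ)) 0
    (5 * δ / 4) :=
  ⟨_, bddMeas_etaWide δ, fun ξ hξ => by rw [sub_zero]; exact norm_le_of_ballInd_ne_zero hξ, rfl⟩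

theorem spec_coef_etaNarrow (δ : ℝ) : Spec (coef (etaNarrow δ : UnitAddTorus (Fin d) → ℂ)) 0
    (δ / 4) :=
  ⟨_, bddMeas_etaNarrow δ, fun ξ hξ => by
    rw [sub_zero]; exact norm_le_of_ballInd_ne_zero (right_ne_zero_of_mul hξ), rfl⟩

variable {δ : ℝ}

theorem integral_etaNarrow (h0 : 0 < δ) (h1 : 3 * δ ≤ 1) :
    ∫ ξ : UnitAddTorus (Fin d), etaNarrow δ ξ = 1 := by
  unfold etaNarrow
  rw [integral_const_mul, integral_ballInd (by positivity) (by linarith), ← Complex.ofReal_mul,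
    show 2 * (δ / 4) = δ / 2 by ring, inv_mul_cancel₀ (by positivity), Complex.ofReal_one]

theorem eta_eq_one (h0 : 0 < δ) (h1 : 3 * δ ≤ 1) {ξ : UnitAddTorus (Fin d)} (hξ : ‖ξ‖ ≤ δ) :
    eta δ ξ = 1 := by
  unfold eta tconv
  rw [← integral_etaNarrow (d := d) h0 h1]
  congr 1
  funext ζ
  by_cases h : etaNarrow δ ζ = 0
  · rw [h, mul_zero]
  · have h2 := norm_le_of_ballInd_ne_zero (right_ne_zero_of_mul h)
    rw [etaWide, ballInd_of_le, one_mul]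
    exact (norm_sub_le _ _).trans (by linarith)

theorem norm_eta_le_one (h0 : 0 < δ) (h1 : 3 * δ ≤ 1) (ξ : UnitAddTorus (Fin d)) :
    ‖eta δ ξ‖ ≤ 1 := by
  unfold eta tconv
  refine (norm_integral_le_integral_norm _).trans ?_
  have e : ∀ ζ : UnitAddTorus (Fin d), ‖etaNarrow δ ζ‖ = (etaNarrow δ ζ).re := by
    intro ζ
    unfold etaNarrow ballInd
    have hd : (0 : ℝ) ≤ ((δ / 2) ^ d)⁻¹ := by positivity
    by_cases h : ζ ∈ Metric.closedBall (0 : UnitAddTorus (Fin d)) (δ / 4)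
    · simp only [Set.indicator_of_mem h, mul_one, Complex.norm_real, Real.norm_of_nonneg hd,
        Complex.ofReal_re]
    · simp only [Set.indicator_of_notMem h, mul_zero, norm_zero, Complex.zero_re]
  calc ∫ ζ, ‖etaWide δ (ξ - ζ) * etaNarrow δ ζ‖ ≤ ∫ ζ, ‖(etaNarrow δ ζ : ℂ)‖ := by
        refine integral_mono ?_ (bddMeas_etaNarrow δ).integrable.norm fun ζ => ?_
        · exact (((bddMeas_etaWide δ).comp (measurable_const.sub measurable_id)).mul
            (bddMeas_etaNarrow δ)).integrable.norm
        · simp only [norm_mul]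
          exact mul_le_of_le_one_left (norm_nonneg _) (norm_ballInd_le _ _)
    _ = (∫ ζ : UnitAddTorus (Fin d), etaNarrow δ ζ).re := by
        simp only [e]
        exact integral_re (bddMeas_etaNarrow δ).integrable
    _ ≤ 1 := by rw [integral_etaNarrow h0 h1, Complex.one_re]

theorem norm_le_of_eta_ne_zero {ξ : UnitAddTorus (Fin d)} (hξ : eta δ ξ ≠ 0) : ‖ξ‖ ≤ 3 * δ / 2 := by
  have := tconv_support (c := 0) (c' := 0) (r := 5 * δ / 4) (r' := δ / 4)
    (a := etaWide δ) (b := etaNarrow δ)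
    (fun ξ hξ => by rw [sub_zero]; exact norm_le_of_ballInd_ne_zero hξ)
    (fun ξ hξ => by rw [sub_zero]; exact norm_le_of_ballInd_ne_zero (right_ne_zero_of_mul hξ)) ξ hξ
  rw [add_zero, sub_zero] at this
  linarith

theorem hasSum_norm_sq_coef_etaWide (h0 : 0 < δ) (h1 : 3 * δ ≤ 1) :
    HasSum (fun x => ‖coef (etaWide δ : UnitAddTorus (Fin d) → ℂ) x‖ ^ 2) ((5 * δ / 2) ^ d) := by
  have := hasSum_norm_sq_coef (bddMeas_etaWide (d := d) δ)
  rwa [etaWide, integral_norm_sq_ballInd (by positivity) (by linarith),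
    show 2 * (5 * δ / 4) = 5 * δ / 2 by ring] at this

theorem hasSum_norm_sq_coef_etaNarrow (h0 : 0 < δ) (h1 : 3 * δ ≤ 1) :
    HasSum (fun x => ‖coef (etaNarrow δ : UnitAddTorus (Fin d) → ℂ) x‖ ^ 2) ((δ / 2) ^ d)⁻¹ := by
  have h := hasSum_norm_sq_coef (bddMeas_etaNarrow (d := d) δ)
  convert h using 1
  unfold etaNarrow
  simp only [norm_mul, mul_pow]
  rw [integral_const_mul, integral_norm_sq_ballInd (by positivity) (by linarith),
    Complex.norm_real, Real.norm_of_nonneg (by positivity), show 2 * (δ / 4) = δ / 2 by ring]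
  field_simp

/-- Weighted arithmetic–geometric mean: with `D = (δ/2)^d`, the product of the two factors is at
most half of `D⁻¹` times the square of the first plus `D` times the square of the second. The sums
give `(5^d + 1)/2`, free of `δ`. -/
theorem summable_norm_coef_eta (h0 : 0 < δ) (h1 : 3 * δ ≤ 1) :
    Summable (fun x => ‖coef (eta δ : UnitAddTorus (Fin d) → ℂ) x‖) ∧
      ∑' x, ‖coef (eta δ : UnitAddTorus (Fin d) → ℂ) x‖ ≤ 5 ^ d := by
  have hA := hasSum_norm_sq_coef_etaWide (d := d) h0 h1
  have hB := hasSum_norm_sq_coef_etaNarrow (d := d) h0 h1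
  have hle : ∀ x : Fin d → ℤ, ‖coef (eta δ : UnitAddTorus (Fin d) → ℂ) x‖ ≤
      (1 / 2) * (((δ / 2) ^ d)⁻¹ * ‖coef (etaWide δ : UnitAddTorus (Fin d) → ℂ) x‖ ^ 2 +
        (δ / 2) ^ d * ‖coef (etaNarrow δ : UnitAddTorus (Fin d) → ℂ) x‖ ^ 2) := by
    intro x
    rw [coef_eta, norm_mul]
    set u := ‖coef (etaWide δ : UnitAddTorus (Fin d) → ℂ) x‖
    set v := ‖coef (etaNarrow δ : UnitAddTorus (Fin d) → ℂ) x‖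
    have hδ : 0 < (δ / 2) ^ d := by positivity
    set D := (δ / 2) ^ d
    have : 0 ≤ D⁻¹ * (u - D * v) ^ 2 := by positivity
    have e : D⁻¹ * (u - D * v) ^ 2 = D⁻¹ * u ^ 2 + D * v ^ 2 - 2 * (u * v) := by
      field_simp
      ring
    rw [e] at this
    linarith
  have hs := ((hA.mul_left ((δ / 2) ^ d)⁻¹).add (hB.mul_left ((δ / 2) ^ d))).mul_left (1 / 2)
  have hsum := Summable.of_nonneg_of_le (fun x => norm_nonneg _) hle hs.summable
  refine ⟨hsum, (hsum.tsum_le_tsum hle hs.summable).trans ?_⟩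
  rw [hs.tsum_eq, show 5 * δ / 2 = 5 * (δ / 2) by ring, mul_pow]
  have hδ : 0 < (δ / 2) ^ d := by positivity
  have h3 : (1 : ℝ) ≤ 5 ^ d := one_le_pow₀ (by norm_num)
  have e1 : ((δ / 2) ^ d)⁻¹ * (5 ^ d * (δ / 2) ^ d) = 5 ^ d := by field_simp
  rw [e1, mul_inv_cancel₀ hδ.ne']
  linarith

end Eta

/-! ### Rational points of the torus -/

section Rational

open UnitAddTorus Finset

variable {d Q : ℕ}

/-- Reduction of integer vectors modulo `Q`. -/
def redQ (Q : ℕ) (x : Fin d → ℤ) : Fin d → ZMod Q := fun i => (x i : ZMod Q)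

theorem redQ_neg (x : Fin d → ℤ) : redQ Q (-x) = -redQ Q x := by
  funext i; simp [redQ]

theorem redQ_add (x y : Fin d → ℤ) : redQ Q (x + y) = redQ Q x + redQ Q y := by
  funext i; simp [redQ]

variable [NeZero Q]

/-- The embedding `a ↦ a/Q` of `(ℤ/Q)^d` into the torus. -/
def torusEmb (d Q : ℕ) [NeZero Q] : (Fin d → ZMod Q) →+ UnitAddTorus (Fin d) :=
  (ZMod.toAddCircle (N := Q)).compLeft (Fin d)

theorem torusEmb_apply (a : Fin d → ZMod Q) (i : Fin d) :
    torusEmb d Q a i = ZMod.toAddCircle (a i) := rfl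

theorem torusEmb_injective : Function.Injective (torusEmb d Q) := by
  intro a b h
  funext i
  exact ZMod.toAddCircle_injective Q (congrFun h i)

theorem mFourier_torusEmb (x : Fin d → ℤ) (a : Fin d → ZMod Q) :
    mFourier x (torusEmb d Q a) = chi (redQ Q x) a := by
  have h1 : ∀ i, fourier (x i) (torusEmb d Q a i) = ZMod.stdAddChar (redQ Q x i * a i) := by
    intro i
    rw [torusEmb_apply, redQ, ← ZMod.intCast_zmod_cast (a i), ← Int.cast_mul, ZMod.stdAddChar_coe,
      ZMod.toAddCircle_intCast, fourier_coe_apply]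
    congr 1
    push_cast
    ring
  rw [chi, dotProduct]
  simp only [mFourier, ContinuousMap.coe_mk, h1]
  exact (map_prod (AddChar.toMonoidHom ZMod.stdAddChar)
    (fun i => Multiplicative.ofAdd (redQ Q x i * a i)) univ).symm

theorem one_div_le_norm_torusEmb {a : Fin d → ZMod Q} (ha : a ≠ 0) {n : ℕ} (hn : 0 < n)
    (hna : n • a = 0) : 1 / (n : ℝ) ≤ ‖torusEmb d Q a‖ := by
  obtain ⟨i, hi⟩ := Function.ne_iff.1 ha
  have hne : torusEmb d Q a i ≠ 0 := by
    rw [torusEmb_apply]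
    intro h
    exact hi (ZMod.toAddCircle_injective Q (by rw [h, Pi.zero_apply, map_zero]))
  have hz : n • torusEmb d Q a i = 0 := by
    rw [← Pi.smul_apply, ← map_nsmul, hna, map_zero, Pi.zero_apply]
  have hfin : IsOfFinAddOrder (torusEmb d Q a i) := isOfFinAddOrder_iff_nsmul_eq_zero.2 ⟨n, hn, hz⟩
  have h1 := AddCircle.le_add_order_smul_norm_of_isOfFinAddOrder hfin hne
  have h2 : addOrderOf (torusEmb d Q a i) ≤ n :=
    Nat.le_of_dvd hn (addOrderOf_dvd_iff_nsmul_eq_zero.2 hz)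
  have hn' : (0 : ℝ) < n := by exact_mod_cast hn
  rw [div_le_iff₀ hn']
  calc (1 : ℝ) ≤ addOrderOf (torusEmb d Q a i) • ‖torusEmb d Q a i‖ := h1
    _ = (addOrderOf (torusEmb d Q a i) : ℝ) * ‖torusEmb d Q a i‖ := by rw [nsmul_eq_mul]
    _ ≤ n * ‖torusEmb d Q a‖ := by
        gcongr
        exact norm_le_pi_norm _ i
    _ = _ := mul_comm _ _

/-- The elements of order at most `N`. -/
def smallOrder (d Q N : ℕ) [NeZero Q] : Finset (Fin d → ZMod Q) :=
  univ.filter fun a => addOrderOf a ≤ N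

/-- A canonical fraction with denominator `q` is a point of exact order `q`. The fractions are
therefore the torsion points of order at most `N`, and all of them lie in `(1/Q)ℤ^d` once every `q ≤
N` divides `Q`. -/
theorem canonicalFinset_eq_map {N : ℕ} (hQ : ∀ q, 1 ≤ q → q ≤ N → q ∣ Q) :
    canonicalFinset d N = (smallOrder d Q N).map ⟨torusEmb d Q, torusEmb_injective⟩ := by
  have hQ0 : (Q : ℝ) ≠ 0 := by exact_mod_cast NeZero.ne Q
  ext θ
  simp only [canonicalFinset, Set.Finite.mem_toFinset, canonicalFractions, Set.mem_ofPred_eq,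
    Finset.mem_map, smallOrder, mem_filter, mem_univ, true_and, Function.Embedding.coeFn_mk]
  constructor
  · rintro ⟨q, a, hq1, hqN, -, rfl⟩
    obtain ⟨t, ht⟩ := hQ q hq1 hqN
    have hq0 : (q : ℝ) ≠ 0 := by
      have : q ≠ 0 := by omega
      exact_mod_cast this
    refine ⟨fun i => ((a i * t : ℤ) : ZMod Q), ?_, ?_⟩
    · refine (Nat.le_of_dvd hq1 (addOrderOf_dvd_iff_nsmul_eq_zero.2 ?_)).trans hqN
      funext i
      rw [Pi.smul_apply, nsmul_eq_mul, Pi.zero_apply]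
      have : ((q : ZMod Q)) * ((a i * t : ℤ) : ZMod Q) = ((a i : ℤ) : ZMod Q) * ((q * t : ℕ) : ZMod Q) := by
        push_cast; ring
      rw [this, ← ht, ZMod.natCast_self, mul_zero]
    · funext i
      rw [torusEmb_apply, ZMod.toAddCircle_intCast]
      congr 1
      have hQt : (Q : ℝ) = q * t := by exact_mod_cast ht
      have ht0 : (t : ℝ) ≠ 0 := by
        intro h
        rw [hQt, h, mul_zero] at hQ0
        exact hQ0 rfl
      rw [hQt]
      push_cast
      field_simp
  · rintro ⟨a, haN, rfl⟩
    set q := addOrderOf a with hq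
    have hq1 : 1 ≤ q := addOrderOf_pos a
    obtain ⟨t, ht⟩ := hQ q hq1 haN
    have ht0 : 0 < t := by
      rcases Nat.eq_zero_or_pos t with h | h
      · rw [h, mul_zero] at ht
        exact absurd ht (NeZero.ne Q)
      · exact h
    have hw : ∀ i, ∃ w : ℕ, (a i).val = t * w := by
      intro i
      have h1 : q • a i = 0 := by
        rw [← Pi.smul_apply, hq, addOrderOf_nsmul_eq_zero, Pi.zero_apply]
      have h2 : Q ∣ q * (a i).val := by
        rw [← ZMod.natCast_eq_zero_iff, Nat.cast_mul, ZMod.natCast_zmod_val, ← nsmul_eq_mul, h1]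
      have h3 : q * t ∣ q * (a i).val := ht ▸ h2
      exact Nat.dvd_of_mul_dvd_mul_left (by omega) h3
    choose w hw using hw
    refine ⟨q, fun i => (w i : ℤ), hq1, haN, ?_, ?_⟩
    -- As `g` divides `q` and all numerators, `q/g` already annihilates `a`; since `q` is the order
    -- of `a`, `g = 1`.
    · set g := Nat.gcd (univ.gcd fun i => ((w i : ℤ)).natAbs) q with hg
      obtain ⟨h, hh⟩ : g ∣ q := Nat.gcd_dvd_right _ _
      have hdvd : q ∣ h := by
        rw [hq, addOrderOf_dvd_iff_nsmul_eq_zero]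
        funext i
        have hgw : g ∣ w i := by
          have := (Nat.gcd_dvd_left (univ.gcd fun i => ((w i : ℤ)).natAbs) q).trans
            (Finset.gcd_dvd (mem_univ i))
          rwa [← hg, Int.natAbs_natCast] at this
        obtain ⟨w', hw'⟩ := hgw
        rw [Pi.smul_apply, Pi.zero_apply, nsmul_eq_mul, ← ZMod.natCast_zmod_val (a i), hw, hw',
          ← Nat.cast_mul, ZMod.natCast_eq_zero_iff, ht, hh]
        exact ⟨w', by ring⟩
      have hh0 : 0 < h := by
        rcases Nat.eq_zero_or_pos h with h0 | h0
        · rw [h0, mul_zero] at hh; omega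
        · exact h0
      have := Nat.le_of_dvd hh0 hdvd
      have hg0 : 0 < g := Nat.gcd_pos_of_pos_right _ hq1
      nlinarith
    · funext i
      rw [torusEmb_apply, ← ZMod.natCast_zmod_val (a i), hw, ← Int.cast_natCast,
        ZMod.toAddCircle_intCast]
      congr 1
      have hQt : (Q : ℝ) = q * t := by exact_mod_cast ht
      have ht0' : (t : ℝ) ≠ 0 := by exact_mod_cast ht0.ne'
      rw [hQt]
      push_cast
      field_simp

end Rational

/-! ### Pieces of a function near rational frequencies. -/

section ModulatedLift

open Finset BigOperators UnitAddTorus ComplexConjugate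

variable {d Q : ℕ} [NeZero Q]

theorem conj_mFourier_apply (x : Fin d → ℤ) (ξ : UnitAddTorus (Fin d)) :
    conj (mFourier x ξ) = mFourier (-x) ξ := by
  rw [← mFourier_neg]

theorem mem_smallOrder {N : ℕ} {a : Fin d → ZMod Q} : a ∈ smallOrder d Q N ↔ addOrderOf a ≤ N := by
  simp [smallOrder]

/-- A nonzero difference is killed by the product of the two orders. -/
theorem one_div_sq_le_norm_torusEmb_sub {N : ℕ} {a b : Fin d → ZMod Q} (ha : addOrderOf a ≤ N)
    (hb : addOrderOf b ≤ N) (hab : a ≠ b) :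
    1 / (N : ℝ) ^ 2 ≤ ‖torusEmb d Q a - torusEmb d Q b‖ := by
  have ha0 : 0 < addOrderOf a := addOrderOf_pos a
  have hb0 : 0 < addOrderOf b := addOrderOf_pos b
  have h := one_div_le_norm_torusEmb (d := d) (Q := Q) (sub_ne_zero.2 hab) (mul_pos ha0 hb0) (by
    rw [smul_sub, mul_smul _ _ b, addOrderOf_nsmul_eq_zero b, mul_comm, mul_smul,
      addOrderOf_nsmul_eq_zero a, smul_zero, smul_zero, sub_zero])
  rw [map_sub] at h
  refine le_trans ?_ h
  have h1 : ((addOrderOf a * addOrderOf b : ℕ) : ℝ) ≤ (N : ℝ) ^ 2 := by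
    rw [pow_two]; exact_mod_cast Nat.mul_le_mul ha hb
  have h2 : (0 : ℝ) < ((addOrderOf a * addOrderOf b : ℕ) : ℝ) := by exact_mod_cast mul_pos ha0 hb0
  exact one_div_le_one_div_of_le h2 h1

/-- The `ℓ²` theory of a kernel with small spectrum, reflected at `x` and modulated by a
combination of frequencies that are well separated. -/
theorem hasSum_modulated {κ : (Fin d → ℤ) → ℂ} {r n : ℝ} (hκ : Spec κ 0 r)
    (hn : HasSum (fun z => ‖κ z‖ ^ 2) n) (x : Fin d → ℤ) (H : Finset (Fin d → ZMod Q))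
    (c : (Fin d → ZMod Q) → ℂ) (hc : ∀ a, ‖c a‖ = 1) (β : Fin d → ZMod Q)
    (hsep : ∀ a ∈ H, ∀ b ∈ H, a ≠ b →
      r + r < ‖torusEmb d Q (a + β) - torusEmb d Q (b + β)‖) :
    HasSum (fun z => ‖∑ a ∈ H, c a * (mFourier (-z) (torusEmb d Q (a + β)) * conj (κ (x - z)))‖ ^ 2)
      (#H * n) := by
  have hs : ∀ a, Spec (fun z => c a * (mFourier (-z) (torusEmb d Q (a + β)) * conj (κ (x - z))))
      (torusEmb d Q (a + β)) r := fun a => by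
    have := ((hκ.conj_reflect x).modulate (torusEmb d Q (a + β))).const_mul (c a)
    rwa [zero_add] at this
  have := hasSum_norm_sq_sum H
    (fun a z => c a * (mFourier (-z) (torusEmb d Q (a + β)) * conj (κ (x - z)))) (fun _ => n)
    (fun a _ => by
      simp only [norm_mul, hc, norm_mFourier_apply, one_mul, RCLike.norm_conj]
      exact (Equiv.subLeft x).hasSum_iff.2 hn)
    (fun a ha b hb hab => (hs a).hasSum_zero (hs b) (hsep a ha b hb hab))
  rwa [sum_const, nsmul_eq_mul] at this

theorem hasSum_modulated_zero {κ : (Fin d → ℤ) → ℂ} {r : ℝ} (hκ : Spec κ 0 r)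
    (x : Fin d → ℤ) (H : Finset (Fin d → ZMod Q))
    (c : (Fin d → ZMod Q) → ℂ) (β β' : Fin d → ZMod Q)
    (hsep : ∀ a ∈ H, ∀ b ∈ H, r + r < ‖torusEmb d Q (a + β) - torusEmb d Q (b + β')‖) :
    HasSum (fun z =>
      conj (∑ a ∈ H, c a * (mFourier (-z) (torusEmb d Q (a + β)) * conj (κ (x - z)))) *
        ∑ a ∈ H, c a * (mFourier (-z) (torusEmb d Q (a + β')) * conj (κ (x - z)))) 0 := by
  have hs : ∀ a β, Spec (fun z => c a * (mFourier (-z) (torusEmb d Q (a + β)) * conj (κ (x - z))))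
      (torusEmb d Q (a + β)) r := fun a β => by
    have := ((hκ.conj_reflect x).modulate (torusEmb d Q (a + β))).const_mul (c a)
    rwa [zero_add] at this
  simp only [map_sum, sum_mul_sum]
  have := hasSum_sum (s := H) (f := fun a z => ∑ b ∈ H,
    conj (c a * (mFourier (-z) (torusEmb d Q (a + β)) * conj (κ (x - z)))) *
      (c b * (mFourier (-z) (torusEmb d Q (b + β')) * conj (κ (x - z))))) (a := fun _ => 0)
    fun a ha => by
      have := hasSum_sum (s := H) (f := fun b z =>
        conj (c a * (mFourier (-z) (torusEmb d Q (a + β)) * conj (κ (x - z)))) *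
        (c b * (mFourier (-z) (torusEmb d Q (b + β')) * conj (κ (x - z))))) (a := fun _ => 0)
        fun b hb => (hs a β).hasSum_zero (hs b β') (hsep a ha b hb)
      simpa using this
  simpa using this

/-- The convolution of `κ` with `f` modulated to the frequency `a`. -/
def modConv (κ f : (Fin d → ℤ) → ℂ) (a : Fin d → ZMod Q) (x : Fin d → ℤ) : ℂ :=
  ∑' z, f z * chi (redQ Q z) a * κ (x - z)

theorem modConv_eq_sum (κ : (Fin d → ℤ) → ℂ) {f : (Fin d → ℤ) → ℂ} {S : Finset (Fin d → ℤ)}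
    (hS : f.support ⊆ S) (a : Fin d → ZMod Q) (x : Fin d → ℤ) :
    modConv κ f a x = ∑ z ∈ S, f z * chi (redQ Q z) a * κ (x - z) := by
  refine tsum_eq_sum fun z hz => ?_
  have : f z = 0 := by
    by_contra h
    exact hz (hS h)
  rw [this, zero_mul, zero_mul]

theorem modConv_add (κ : (Fin d → ℤ) → ℂ) {f g : (Fin d → ℤ) → ℂ} (hf : f.support.Finite)
    (hg : g.support.Finite) (a : Fin d → ZMod Q) (x : Fin d → ℤ) :
    modConv κ (f + g) a x = modConv κ f a x + modConv κ g a x := by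
  classical
  have h1 : f.support ⊆ (hf.toFinset ∪ hg.toFinset : Finset _) := by simp
  have h2 : g.support ⊆ (hf.toFinset ∪ hg.toFinset : Finset _) := by simp
  have h3 : (f + g).support ⊆ (hf.toFinset ∪ hg.toFinset : Finset _) := by
    refine (Function.support_add f g).trans ?_
    simp
  rw [modConv_eq_sum κ h1, modConv_eq_sum κ h2, modConv_eq_sum κ h3, ← sum_add_distrib]
  refine sum_congr rfl fun z _ => ?_
  rw [Pi.add_apply]; ring

/-- The elements of `(ℤ/Q)^d` annihilated by `v`. -/
def torsionFinset (d Q v : ℕ) [NeZero Q] : Finset (Fin d → ZMod Q) := univ.filter fun a => v • a = 0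

theorem mem_torsionFinset {v : ℕ} {a : Fin d → ZMod Q} : a ∈ torsionFinset d Q v ↔ v • a = 0 := by
  simp [torsionFinset]

/-- The torsion elements form a subgroup, so their character sum is idempotent up to its
cardinality. Elements of one exact order lack this property, whence the Möbius inversion below. -/
theorem sum_chi_torsionFinset_mul_self (v : ℕ) (y : Fin d → ZMod Q) :
    (∑ a ∈ torsionFinset d Q v, chi y a) * ∑ a ∈ torsionFinset d Q v, chi y a =
      #(torsionFinset d Q v) * ∑ a ∈ torsionFinset d Q v, chi y a := by
  rw [sum_mul, ← nsmul_eq_mul, ← sum_const]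
  refine sum_congr rfl fun a ha => ?_
  rw [mul_sum]
  simp only [← chi_add_right]
  refine sum_bij (fun b _ => a + b) (fun b hb => ?_) (fun b _ c _ h => add_left_cancel h)
    (fun b hb => ⟨b - a, ?_, by simp⟩) fun b _ => rfl
  · rw [mem_torsionFinset] at *
    rw [smul_add, ha, hb, add_zero]
  · rw [mem_torsionFinset] at *
    rw [smul_sub, ha, hb, sub_zero]

variable {δ : ℝ}

/-- The pointwise bound for a sum over a torsion subgroup, by Bessel's inequality. -/
theorem sum_norm_sq_modConv_torsion_le (h0 : 0 < δ) (h1 : 3 * δ ≤ 1) {N v : ℕ}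
    (hN : 3 * δ < 1 / (N : ℝ) ^ 2) (B : Finset (Fin d → ZMod Q))
    (hord : ∀ a ∈ torsionFinset d Q v, ∀ β ∈ B, addOrderOf (a + β) ≤ N)
    (hordH : ∀ a ∈ torsionFinset d Q v, addOrderOf a ≤ N)
    (hinj : ∀ a ∈ torsionFinset d Q v, ∀ a' ∈ torsionFinset d Q v, ∀ β ∈ B, ∀ β' ∈ B,
      a + β = a' + β' → β = β')
    {f : (Fin d → ℤ) → ℂ} (hf : f.support.Finite) {M : ℝ} (hM : ∀ z, ‖f z‖ ≤ M)
    (x : Fin d → ℤ) (y : Fin d → ZMod Q) :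
    ∑ β ∈ B, ‖∑ a ∈ torsionFinset d Q v, modConv (coef (eta δ)) f (a + β) x * chi y a‖ ^ 2 ≤
      5 ^ d * M ^ 2 := by
  set H := torsionFinset d Q v with hH
  have hM0 : 0 ≤ M := (norm_nonneg _).trans (hM 0)
  have hH0 : (0 : (Fin d → ZMod Q)) ∈ H := by rw [hH, mem_torsionFinset, smul_zero]
  have hcard : (0 : ℝ) < #H := by exact_mod_cast card_pos.2 ⟨0, hH0⟩
  have hcardC : (#H : ℂ) ≠ 0 := by exact_mod_cast hcard.ne'
  set K1 := coef (etaWide δ : UnitAddTorus (Fin d) → ℂ) with hK1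
  set K2 := coef (etaNarrow δ : UnitAddTorus (Fin d) → ℂ) with hK2
  let W : (Fin d → ℤ) → ℂ := fun z => ∑ a ∈ H, chi (redQ Q z + y) a
  let c : (Fin d → ZMod Q) → ℂ := fun a => conj (chi y a)
  have hc : ∀ a, ‖c a‖ = 1 := fun a => by
    simp only [c, RCLike.norm_conj, norm_chi]
  let Φ : (Fin d → ZMod Q) → (Fin d → ℤ) → ℂ := fun β z =>
    ∑ a ∈ H, c a * (mFourier (-z) (torusEmb d Q (a + β)) * conj (K1 (x - z)))
  have hΦ : ∀ β z, conj (Φ β z) = chi (redQ Q z) β * K1 (x - z) * W z := by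
    intro β z
    simp only [Φ, W, c, map_sum, mul_sum, map_mul, Complex.conj_conj, conj_mFourier_apply, neg_neg]
    simp only [mFourier_torusEmb]
    refine sum_congr rfl fun a _ => ?_
    rw [chi_add_right, chi_add_left]; ring
  -- Since `W² = #H W`, one copy of `W` goes with the wide kernel `K1` into the orthogonal family
  -- `Φ`, and another, divided by `#H`, goes with the narrow kernel `K2` into `F`.
  let F : (Fin d → ℤ) → ℂ := fun z => f z * K2 (x - z) * (W z / #H)
  have hmain : ∀ β, ∑ a ∈ H, modConv (coef (eta δ)) f (a + β) x * chi y a =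
      ∑ z ∈ hf.toFinset, F z * conj (Φ β z) := by
    intro β
    simp only [modConv_eq_sum (coef (eta δ)) (f := f) (S := hf.toFinset) (by simp), sum_mul]
    rw [sum_comm]
    refine sum_congr rfl fun z _ => ?_
    rw [hΦ, coef_eta]
    have hWW : W z * W z = #H * W z := sum_chi_torsionFinset_mul_self v _
    have : ∀ a ∈ H, f z * chi (redQ Q z) (a + β) * (coef (etaWide δ) (x - z) *
        coef (etaNarrow δ) (x - z)) * chi y a =
        f z * chi (redQ Q z) β * (K1 (x - z) * K2 (x - z)) * chi (redQ Q z + y) a := by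
      intro a _
      rw [chi_add_right, chi_add_left]; ring
    rw [sum_congr rfl this, ← mul_sum]
    change _ * W z = _
    simp only [F]
    field_simp
    linear_combination (-(f z * chi (redQ Q z) β * K1 (x - z) * K2 (x - z))) * hWW
  have hsep : ∀ a b : Fin d → ZMod Q, addOrderOf a ≤ N → addOrderOf b ≤ N → a ≠ b →
      3 * δ < ‖torusEmb d Q a - torusEmb d Q b‖ := fun a b ha hb hab =>
    hN.trans_le (one_div_sq_le_norm_torusEmb_sub ha hb hab)
  have hB := sum_norm_sq_le_of_orthogonal B Φ (#H * (5 * δ / 2) ^ d) (by positivity)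
    (fun β hβ => hasSum_modulated (spec_coef_etaWide δ) (hasSum_norm_sq_coef_etaWide h0 h1) x H c hc
      β fun a ha b hb hab => by
        have := hsep (a + β) (b + β) (hord a ha β hβ) (hord b hb β hβ)
          (fun h => hab (add_right_cancel h))
        linarith)
    (fun β hβ β' hβ' hne => hasSum_modulated_zero (spec_coef_etaWide δ) x H c β β'
      fun a ha b hb => by
        have := hsep (a + β) (b + β') (hord a ha β hβ) (hord b hb β' hβ')
          (fun h => hne (hinj a ha b hb β hβ β' hβ' h))
        linarith) hf.toFinset F
  simp only [hmain]
  refine hB.trans ?_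
  have hK2sum := hasSum_modulated (spec_coef_etaNarrow δ) (hasSum_norm_sq_coef_etaNarrow h0 h1) x H
    c hc 0 (fun a ha b hb hab => by
      rw [add_zero, add_zero]
      have := hsep a b (hordH a ha) (hordH b hb) hab
      linarith)
  have hK2W : ∀ z, ‖∑ a ∈ H, c a * (mFourier (-z) (torusEmb d Q (a + 0)) * conj (K2 (x - z)))‖ =
      ‖K2 (x - z) * W z‖ := by
    intro z
    rw [← RCLike.norm_conj]
    congr 1
    simp only [W, c, map_sum, mul_sum, map_mul, Complex.conj_conj, conj_mFourier_apply, neg_neg]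
    simp only [mFourier_torusEmb, add_zero]
    refine sum_congr rfl fun a _ => ?_
    rw [chi_add_left]; ring
  rw [← hK2] at hK2sum
  simp only [hK2W] at hK2sum
  have hF : ∑ z ∈ hf.toFinset, ‖F z‖ ^ 2 ≤ M ^ 2 / #H ^ 2 * (#H * ((δ / 2) ^ d)⁻¹) := by
    calc ∑ z ∈ hf.toFinset, ‖F z‖ ^ 2
        ≤ ∑ z ∈ hf.toFinset, M ^ 2 / #H ^ 2 * ‖K2 (x - z) * W z‖ ^ 2 := by
          refine sum_le_sum fun z _ => ?_
          simp only [F, norm_mul, norm_div, Complex.norm_natCast, mul_pow, div_pow]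
          have : ‖f z‖ ^ 2 ≤ M ^ 2 := pow_le_pow_left₀ (norm_nonneg _) (hM z) 2
          calc ‖f z‖ ^ 2 * ‖K2 (x - z)‖ ^ 2 * (‖W z‖ ^ 2 / #H ^ 2)
              = ‖f z‖ ^ 2 * (‖K2 (x - z)‖ ^ 2 * (‖W z‖ ^ 2 / #H ^ 2)) := by ring
            _ ≤ M ^ 2 * (‖K2 (x - z)‖ ^ 2 * (‖W z‖ ^ 2 / #H ^ 2)) := by gcongr
            _ = _ := by ring
      _ = M ^ 2 / #H ^ 2 * ∑ z ∈ hf.toFinset, ‖K2 (x - z) * W z‖ ^ 2 := by rw [mul_sum]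
      _ ≤ _ := by
          gcongr
          rw [← hK2sum.tsum_eq]
          exact hK2sum.summable.sum_le_tsum _ fun z _ => by positivity
  -- All powers of `#H` and `δ` cancel: Bessel's constant is `#H (5δ/2)^d`, and the squared norm of
  -- `F` is at most `M² (#H)⁻¹ (δ/2)^(-d)`.
  calc (#H : ℝ) * (5 * δ / 2) ^ d * ∑ z ∈ hf.toFinset, ‖F z‖ ^ 2
      ≤ #H * (5 * δ / 2) ^ d * (M ^ 2 / #H ^ 2 * (#H * ((δ / 2) ^ d)⁻¹)) := by gcongr
    _ = 5 ^ d * M ^ 2 := by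
        rw [show 5 * δ / 2 = 5 * (δ / 2) by ring, mul_pow]
        field_simp

end ModulatedLift

/-! ### Finite Euclidean norms. -/

section EuclideanSums

open Finset BigOperators

/-- The Euclidean norm of a finite family of complex numbers. -/
def l2 {ι : Type*} (B : Finset ι) (v : ι → ℂ) : ℝ := Real.sqrt (∑ β ∈ B, ‖v β‖ ^ 2)

variable {ι : Type*} {B : Finset ι}

theorem l2_nonneg (v : ι → ℂ) : 0 ≤ l2 B v := Real.sqrt_nonneg _

theorem l2_sq (v : ι → ℂ) : l2 B v ^ 2 = ∑ β ∈ B, ‖v β‖ ^ 2 :=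
  Real.sq_sqrt (sum_nonneg fun _ _ => by positivity)

theorem l2_eq_norm (v : ι → ℂ) :
    l2 B v = ‖(WithLp.toLp 2 fun β : B => v β : EuclideanSpace ℂ B)‖ := by
  rw [EuclideanSpace.norm_eq, l2, ← sum_coe_sort B fun β => ‖v β‖ ^ 2]

theorem l2_add_le (v w : ι → ℂ) : l2 B (fun β => v β + w β) ≤ l2 B v + l2 B w := by
  rw [l2_eq_norm, l2_eq_norm, l2_eq_norm]
  exact norm_add_le (WithLp.toLp 2 fun β : B => v β : EuclideanSpace ℂ B) (WithLp.toLp 2 fun β : B => w β)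

theorem l2_zero : l2 B (fun _ => 0) = 0 := by simp [l2]

theorem l2_sum_le {κ : Type*} (s : Finset κ) (v : κ → ι → ℂ) :
    l2 B (fun β => ∑ j ∈ s, v j β) ≤ ∑ j ∈ s, l2 B (v j) := by
  classical
  induction s using Finset.induction_on with
  | empty => simp [l2_zero]
  | insert j s hj ih =>
    simp only [sum_insert hj]
    exact (l2_add_le _ _).trans (by gcongr)

theorem l2_le_of_sq_le {v : ι → ℂ} {M : ℝ} (hM : 0 ≤ M) (h : ∑ β ∈ B, ‖v β‖ ^ 2 ≤ M ^ 2) :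
    l2 B v ≤ M := Real.sqrt_le_iff.2 ⟨hM, h⟩

theorem l2_le_mul {v w : ι → ℂ} {c : ℝ} (hc : 0 ≤ c) (h : ∀ β ∈ B, ‖v β‖ ≤ c * ‖w β‖) :
    l2 B v ≤ c * l2 B w := by
  refine l2_le_of_sq_le (mul_nonneg hc (l2_nonneg _)) ?_
  rw [mul_pow, l2_sq, mul_sum]
  refine sum_le_sum fun β hβ => ?_
  rw [← mul_pow]
  exact pow_le_pow_left₀ (norm_nonneg _) (h β hβ) 2

theorem l2_filter {v : ι → ℂ} (p : ι → Prop) [DecidablePred p] (h : ∀ β ∈ B, ¬ p β → v β = 0) :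
    l2 B v = l2 (B.filter p) v := by
  unfold l2
  rw [sum_filter_of_ne]
  intro β hβ hne
  by_contra hp
  exact hne (by rw [h β hβ hp]; simp)

end EuclideanSums

/-! ### Pieces in `ℓ²` and pointwise bounds for the square functions. -/

section SquareFunction

open Finset BigOperators UnitAddTorus ComplexConjugate

variable {d Q : ℕ} [NeZero Q] {δ : ℝ}

theorem coef_mFourier_mul (g : UnitAddTorus (Fin d) → ℂ) (z x : Fin d → ℤ) :
    coef (fun ξ => mFourier z ξ * g ξ) x = coef g (x - z) := by
  unfold coef
  congr 1
  funext ξ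
  rw [← mul_assoc, ← mFourier_add]
  congr 3
  abel

theorem coef_one (x : Fin d → ℤ) :
    coef (fun _ : UnitAddTorus (Fin d) => (1 : ℂ)) x = if x = 0 then 1 else 0 := by
  have h := hasSum_norm_sq_coef (bddMeas_const (X := UnitAddTorus (Fin d)) 1)
  have h0 : coef (fun _ : UnitAddTorus (Fin d) => (1 : ℂ)) 0 = 1 := by
    unfold coef
    simp [mFourier_zero_apply]
  simp only [norm_one, one_pow, integral_const, probReal_univ, smul_eq_mul, mul_one] at h
  split_ifs with hx
  · rw [hx, h0]
  · have h2 := h.summable.sum_le_tsum {0, x} (fun z _ => by positivity)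
    rw [h.tsum_eq, sum_pair (Ne.symm hx), h0, norm_one, one_pow] at h2
    have : ‖coef (fun _ : UnitAddTorus (Fin d) => (1 : ℂ)) x‖ ^ 2 ≤ 0 := by linarith
    exact norm_eq_zero.1 (pow_eq_zero_iff two_ne_zero |>.1 (le_antisymm this (by positivity)))

/-- The trigonometric polynomial with coefficients `f`. -/
def trigPoly (f : (Fin d → ℤ) → ℂ) (S : Finset (Fin d → ℤ)) (ξ : UnitAddTorus (Fin d)) : ℂ :=
  ∑ z ∈ S, f z * mFourier z ξ

theorem bddMeas_trigPoly (f : (Fin d → ℤ) → ℂ) (S : Finset (Fin d → ℤ)) :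
    BddMeas (trigPoly f S) :=
  BddMeas.sum S fun z _ => (bddMeas_const (f z)).mul (bddMeas_mFourier z)

/-- Modulating `f` by the character of `a` translates its spectrum, so a cutoff near `0` isolates
the part of `f` near `a/Q`, recentred at `0`. -/
theorem modConv_eq_coef {g : UnitAddTorus (Fin d) → ℂ} (hg : BddMeas g) {f : (Fin d → ℤ) → ℂ}
    {S : Finset (Fin d → ℤ)} (hS : f.support ⊆ S) (a : Fin d → ZMod Q) :
    modConv (coef g) f a = coef fun ξ => g ξ * trigPoly f S (ξ + torusEmb d Q a) := by
  funext x
  have : (fun ξ => g ξ * trigPoly f S (ξ + torusEmb d Q a)) =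
      fun ξ => ∑ z ∈ S, f z * chi (redQ Q z) a * (mFourier z ξ * g ξ) := by
    funext ξ
    rw [trigPoly, mul_sum]
    refine sum_congr rfl fun z _ => ?_
    rw [mFourier_apply_add, mFourier_torusEmb]; ring
  rw [modConv_eq_sum _ hS, this, coef_sum S fun z _ =>
    (bddMeas_const _).mul ((bddMeas_mFourier z).mul hg)]
  refine sum_congr rfl fun z _ => ?_
  rw [coef_const_mul, coef_mFourier_mul]

theorem integral_norm_sq_trigPoly {f : (Fin d → ℤ) → ℂ} {S : Finset (Fin d → ℤ)}
    (hS : f.support ⊆ S) :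
    HasSum (fun x => ‖f x‖ ^ 2) (∫ ξ, ‖trigPoly f S ξ‖ ^ 2) := by
  have h := hasSum_norm_sq_coef (bddMeas_trigPoly f S)
  have e : f = coef (trigPoly f S) := by
    have := modConv_eq_coef (Q := 1) (bddMeas_const 1) hS 0
    simp only [map_zero, add_zero, one_mul] at this
    rw [show trigPoly f S = fun ξ => trigPoly f S ξ from rfl, ← this]
    funext x
    simp only [modConv, chi_zero_right, mul_one]
    rw [tsum_eq_single x, coef_one, if_pos (sub_self x), mul_one]
    intro z hz
    rw [coef_one, if_neg (sub_ne_zero.2 hz.symm), mul_zero]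
  rwa [← e] at h

/-- The supports have radius `3δ/2` and their centres are `1/N²` apart, so at most one term is
nonzero. -/
theorem sum_norm_sq_eta_le_one (h0 : 0 < δ) (h1 : 3 * δ ≤ 1) {N : ℕ}
    (hN : 3 * δ < 1 / (N : ℝ) ^ 2) (ξ : UnitAddTorus (Fin d)) :
    ∑ a ∈ smallOrder d Q N, ‖eta δ (ξ - torusEmb d Q a)‖ ^ 2 ≤ 1 := by
  by_cases h : ∃ a ∈ smallOrder d Q N, eta δ (ξ - torusEmb d Q a) ≠ 0
  · obtain ⟨a, ha, hne⟩ := h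
    rw [sum_eq_single_of_mem a ha]
    · exact pow_le_one₀ (norm_nonneg _) (norm_eta_le_one h0 h1 _)
    · intro b hb hba
      by_contra hcon
      have hb' : eta δ (ξ - torusEmb d Q b) ≠ 0 := fun h => hcon (by rw [h]; simp)
      have h2 := norm_le_of_eta_ne_zero hne
      have h3 := norm_le_of_eta_ne_zero hb'
      have h4 := one_div_sq_le_norm_torusEmb_sub (mem_smallOrder.1 hb) (mem_smallOrder.1 ha) hba
      have h5 : ‖torusEmb d Q b - torusEmb d Q a‖ ≤ 3 * δ / 2 + 3 * δ / 2 := by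
        rw [show torusEmb d Q b - torusEmb d Q a =
          (ξ - torusEmb d Q a) - (ξ - torusEmb d Q b) by abel]
        exact (norm_sub_le _ _).trans (add_le_add h2 h3)
      linarith
  · push Not at h
    rw [sum_congr rfl fun a ha => by rw [h a ha]]
    simp

/-- The `ℓ²` bound for the family of pieces at the fractions of small denominators. -/
theorem sum_tsum_norm_sq_modConv_le (h0 : 0 < δ) (h1 : 3 * δ ≤ 1) {N : ℕ}
    (hN : 3 * δ < 1 / (N : ℝ) ^ 2) {f : (Fin d → ℤ) → ℂ} (hf : f.support.Finite) :
    ∑ a ∈ smallOrder d Q N, ∑' x, ENNReal.ofReal (‖modConv (coef (eta δ)) f a x‖ ^ 2) ≤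
      ∑' x, ENNReal.ofReal (‖f x‖ ^ 2) := by
  have hS : f.support ⊆ hf.toFinset := by simp
  set P := trigPoly f hf.toFinset with hP
  have hPm : BddMeas P := bddMeas_trigPoly _ _
  have hb : ∀ a : Fin d → ZMod Q, BddMeas fun ξ => eta δ ξ * P (ξ + torusEmb d Q a) := fun a =>
    (bddMeas_eta δ).mul (hPm.comp (measurable_id.add_const _))
  have hb2 : ∀ a : Fin d → ZMod Q, BddMeas fun ξ => eta δ (ξ - torusEmb d Q a) * P ξ := fun a =>
    ((bddMeas_eta δ).comp (measurable_id.sub_const _)).mul hPm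
  have hInt : ∀ {g : UnitAddTorus (Fin d) → ℂ}, BddMeas g → Integrable fun ξ => ‖g ξ‖ ^ 2 :=
    fun {g} hg => by
      have := (hg.conj.mul hg).integrable (μ := volume)
      refine this.norm.congr (Filter.Eventually.of_forall fun ξ => ?_)
      simp only [norm_mul, RCLike.norm_conj]; ring
  have e1 : ∀ a : Fin d → ZMod Q, ∑' x, ENNReal.ofReal (‖modConv (coef (eta δ)) f a x‖ ^ 2) =
      ENNReal.ofReal (∫ ξ, ‖eta δ (ξ - torusEmb d Q a) * P ξ‖ ^ 2) := by
    intro a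
    rw [modConv_eq_coef (bddMeas_eta δ) hS]
    have h := hasSum_norm_sq_coef (hb a)
    rw [← ENNReal.ofReal_tsum_of_nonneg (fun x => by positivity) h.summable, h.tsum_eq,
      ← integral_sub_right_eq_self _ (torusEmb d Q a)]
    simp only [sub_add_cancel]
  simp only [e1]
  have h := integral_norm_sq_trigPoly hS
  rw [← ENNReal.ofReal_sum_of_nonneg fun a _ => integral_nonneg fun ξ => by positivity,
    ← ENNReal.ofReal_tsum_of_nonneg (fun x => by positivity) h.summable, h.tsum_eq,
    ← integral_finsetSum _ fun a _ => hInt (hb2 a)]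
  refine ENNReal.ofReal_le_ofReal (integral_mono (integrable_finsetSum _ fun a _ => hInt (hb2 a))
    (hInt hPm) fun ξ => ?_)
  simp only [norm_mul, mul_pow, ← sum_mul]
  exact mul_le_of_le_one_left (by positivity) (sum_norm_sq_eta_le_one h0 h1 hN ξ)

/-- The torsion subgroup of `v` is the disjoint union of the sets of elements of order `u`, over `u
∣ v`. Möbius inversion turns sums over an exact order into sums over subgroups. -/
theorem sum_addOrderOf_eq_moebius {u : ℕ} (hu : 0 < u) (h : (Fin d → ZMod Q) → ℂ) :
    ∑ a ∈ univ.filter (fun a : Fin d → ZMod Q => addOrderOf a = u), h a =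
      ∑ x ∈ u.divisorsAntidiagonal, (ArithmeticFunction.moebius x.1 : ℂ) *
        ∑ a ∈ torsionFinset d Q x.2, h a := by
  refine ((ArithmeticFunction.sum_eq_iff_sum_mul_moebius_eq (R := ℂ)
    (f := fun u => ∑ a ∈ univ.filter (fun a : Fin d → ZMod Q => addOrderOf a = u), h a)
    (g := fun v => ∑ a ∈ torsionFinset d Q v, h a)).1 ?_ u hu).symm
  intro n hn
  rw [← sum_fiberwise_of_maps_to (s := torsionFinset d Q n) (t := n.divisors) (g := addOrderOf)]
  · refine sum_congr rfl fun i hi => sum_congr ?_ fun _ _ => rfl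
    ext a
    simp only [mem_filter, mem_univ, true_and, mem_torsionFinset]
    constructor
    · intro h
      refine ⟨?_, h⟩
      rw [← addOrderOf_dvd_iff_nsmul_eq_zero, h]
      exact (Nat.mem_divisors.1 hi).1
    · exact fun h => h.2
  · intro a ha
    rw [mem_torsionFinset, ← addOrderOf_dvd_iff_nsmul_eq_zero] at ha
    exact Nat.mem_divisors.2 ⟨ha, hn.ne'⟩

/-- Each of the `d(u)` terms of the Möbius sum obeys the bound for torsion subgroups. The primes of
`u` are disjoint from `T`, so orders multiply: all frequencies `a + β` that occur have order at most
`N`, and they determine `β`. -/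
theorem l2_modConv_addOrderOf_le (h0 : 0 < δ) (h1 : 3 * δ ≤ 1) {N : ℕ}
    (hN : 3 * δ < 1 / (N : ℝ) ^ 2) {T : Finset ℕ} {u : ℕ} (hu : 0 < u) (huN : u ≤ N)
    (hT : Disjoint u.primeFactors T) {f : (Fin d → ℤ) → ℂ} (hf : f.support.Finite) {M : ℝ}
    (hM : ∀ z, ‖f z‖ ≤ M) (x : Fin d → ℤ) (y : Fin d → ZMod Q) :
    l2 ((primary (Fin d → ZMod Q) T).filter fun β => u * addOrderOf β ≤ N)
      (fun β => ∑ a ∈ univ.filter (fun a : Fin d → ZMod Q => addOrderOf a = u),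
        modConv (coef (eta δ)) f (a + β) x * chi y a) ≤ #u.divisors * (5 ^ d * M) := by
  have hM0 : 0 ≤ M := (norm_nonneg _).trans (hM 0)
  simp only [sum_addOrderOf_eq_moebius hu]
  refine (l2_sum_le _ _).trans ?_
  have hcard : #u.divisorsAntidiagonal = #u.divisors := by
    rw [← Nat.map_div_right_divisors, card_map]
  rw [← hcard, ← nsmul_eq_mul]
  refine sum_le_card_nsmul _ _ _ fun w hw => ?_
  obtain ⟨s, v⟩ := w
  rw [Nat.mem_divisorsAntidiagonal] at hw
  have hvu : v ∣ u := ⟨s, by rw [← hw.1, mul_comm]⟩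
  have hord : ∀ a ∈ torsionFinset d Q v, addOrderOf a ∣ u := fun a ha => by
    rw [mem_torsionFinset, ← addOrderOf_dvd_iff_nsmul_eq_zero] at ha
    exact ha.trans hvu
  have hpf : ∀ a ∈ torsionFinset d Q v, pf a ⊆ u.primeFactors := fun a ha =>
    Nat.primeFactors_mono (hord a ha) hu.ne'
  refine (l2_le_mul (c := 1) zero_le_one (w := fun β => ∑ a ∈ torsionFinset d Q v,
    modConv (coef (eta δ)) f (a + β) x * chi y a) fun β _ => ?_).trans ?_
  · rw [norm_mul]
    refine mul_le_mul_of_nonneg_right ?_ (norm_nonneg _)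
    have := ArithmeticFunction.abs_moebius_le_one (n := s)
    rw [Complex.norm_intCast]
    exact_mod_cast this
  · rw [one_mul]
    refine l2_le_of_sq_le (by positivity) ?_
    refine (sum_norm_sq_modConv_torsion_le h0 h1 hN _ ?_ ?_ ?_ hf hM x y).trans ?_
    · intro a ha β hβ
      rw [mem_filter, mem_primary] at hβ
      rw [addOrderOf_add_of_disjoint (disjoint_of_subset_left (hpf a ha)
        (disjoint_of_subset_right hβ.1 hT))]
      exact (Nat.mul_le_mul_right _ (Nat.le_of_dvd hu (hord a ha))).trans hβ.2
    · exact fun a ha => (Nat.le_of_dvd hu (hord a ha)).trans huN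
    · intro a ha a' ha' β hβ β' hβ' h
      rw [mem_filter, mem_primary] at hβ hβ'
      exact (add_injOn_primary hT (hpf a ha) (hpf a' ha') hβ.1 hβ'.1 h).2
    · rw [mul_pow]
      have : (1 : ℝ) ≤ 5 ^ d := one_le_pow₀ (by norm_num)
      gcongr
      nlinarith

/-- The pieces at the fractions of denominator at most `N`, divided by `ρ ^ ω`. -/
def weightedPiece (δ ρ : ℝ) (N : ℕ) (f : (Fin d → ℤ) → ℂ) (x : Fin d → ℤ) (a : Fin d → ZMod Q) : ℂ :=
  if addOrderOf a ≤ N then ((ρ⁻¹ : ℝ) : ℂ) ^ #(pf a) * modConv (coef (eta δ)) f a x else 0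

/-- The square functions produced by the decoupling inequality. -/
def squareFn (δ ρ : ℝ) (N : ℕ) (P D : Finset ℕ) (f : (Fin d → ℤ) → ℂ) (x : Fin d → ℤ)
    (y : Fin d → ZMod Q) : ℝ :=
  l2 (primary (Fin d → ZMod Q) (P \ D)) fun β =>
    ∑ α ∈ exactPrimary (Fin d → ZMod Q) D, weightedPiece δ ρ N f x (α + β) * chi y α

theorem squareFn_add_le {ρ : ℝ} {N : ℕ} {P D : Finset ℕ} {f g : (Fin d → ℤ) → ℂ}
    (hf : f.support.Finite) (hg : g.support.Finite) (x : Fin d → ℤ) (y : Fin d → ZMod Q) :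
    squareFn δ ρ N P D (f + g) x y ≤ squareFn δ ρ N P D f x y + squareFn δ ρ N P D g x y := by
  unfold squareFn
  have e : ∀ a : Fin d → ZMod Q, weightedPiece δ ρ N (f + g) x a =
      weightedPiece δ ρ N f x a + weightedPiece δ ρ N g x a := fun a => by
    unfold weightedPiece
    split_ifs
    · rw [modConv_add _ hf hg, mul_add]
    · rw [add_zero]
  simp only [e, add_mul, sum_add_distrib]
  exact l2_add_le _ _

/-- Group the `α` by their order `u`. At most `S` values of `u` occur, since they all have the prime
set `D`. For fixed `u` the weight `ρ^(-ω)` of `α + β` depends on `β` alone and costs `W`, and the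
remaining norm costs `d(u) ≤ S` by the previous bound. -/
theorem squareFn_le (h0 : 0 < δ) (h1 : 3 * δ ≤ 1) {N : ℕ}
    (hN : 3 * δ < 1 / (N : ℝ) ^ 2) {ρ W S : ℝ} (hρ : 0 < ρ) (hS1 : 1 ≤ S)
    (hS : ∀ q, 1 ≤ q → q ≤ N → (smoothCount N q : ℝ) ≤ S)
    (hW : ∀ q, 1 ≤ q → q ≤ N → ρ⁻¹ ^ #q.primeFactors ≤ W)
    {P D : Finset ℕ} {f : (Fin d → ℤ) → ℂ} (hf : f.support.Finite) {M : ℝ} (hM : ∀ z, ‖f z‖ ≤ M)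
    (x : Fin d → ℤ) (y : Fin d → ZMod Q) :
    squareFn δ ρ N P D f x y ≤ S * (W * (S * (5 ^ d * M))) := by
  have hM0 : 0 ≤ M := (norm_nonneg _).trans (hM 0)
  set U := (Icc 1 N).filter fun u => u.primeFactors = D with hU
  have hdisj : ∀ α β : Fin d → ZMod Q, pf α = D → β ∈ primary (Fin d → ZMod Q) (P \ D) →
      Disjoint (pf α) (pf β) := by
    intro α β hα hβ
    rw [mem_primary] at hβ
    rw [hα]
    exact disjoint_of_subset_right hβ disjoint_sdiff
  have hsplit : ∀ β ∈ primary (Fin d → ZMod Q) (P \ D),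
      ∑ α ∈ exactPrimary (Fin d → ZMod Q) D, weightedPiece δ ρ N f x (α + β) * chi y α =
      ∑ u ∈ U, ∑ α ∈ univ.filter (fun a : Fin d → ZMod Q => addOrderOf a = u),
        weightedPiece δ ρ N f x (α + β) * chi y α := by
    intro β hβ
    rw [← sum_filter_of_ne (p := fun α => addOrderOf α ≤ N), ← sum_fiberwise_of_maps_to (t := U)
      (g := addOrderOf)]
    · refine sum_congr rfl fun u hu => sum_congr ?_ fun _ _ => rfl
      ext α
      simp only [hU, mem_filter, mem_Icc] at hu
      simp only [mem_filter, mem_univ, true_and, mem_exactPrimary]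
      constructor
      · exact fun h => h.2
      · intro h
        exact ⟨⟨by rw [pf, h]; exact hu.2, by rw [h]; exact hu.1.2⟩, h⟩
    · intro α hα
      rw [mem_filter, mem_exactPrimary] at hα
      simp only [hU, mem_filter, mem_Icc]
      exact ⟨⟨addOrderOf_pos α, hα.2⟩, hα.1⟩
    · intro α hα hne
      rw [mem_exactPrimary] at hα
      by_contra hcon
      refine hne ?_
      rw [weightedPiece, if_neg, zero_mul]
      rw [addOrderOf_add_of_disjoint (hdisj α β hα hβ)]
      have := Nat.le_mul_of_pos_right (addOrderOf α) (addOrderOf_pos β)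
      omega
  have hstep : squareFn δ ρ N P D f x y ≤ ∑ u ∈ U, l2 (primary (Fin d → ZMod Q) (P \ D)) fun β =>
      ∑ α ∈ univ.filter (fun a : Fin d → ZMod Q => addOrderOf a = u),
        weightedPiece δ ρ N f x (α + β) * chi y α := by
    refine le_trans (le_of_eq ?_) (l2_sum_le _ _)
    unfold squareFn l2
    congr 1
    exact sum_congr rfl fun β hβ => by beta_reduce; rw [hsplit β hβ]
  refine hstep.trans ?_
  rcases U.eq_empty_or_nonempty with hemp | ⟨u0, hu0⟩
  · rw [hemp, sum_empty]
    have : 0 ≤ W := le_trans (by positivity) (hW 1 le_rfl (by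
      rcases Nat.eq_zero_or_pos N with h | h
      -- For `N = 0` the right side of `hN` is `1/0 = 0`, which contradicts `0 < δ`.
      · subst h; norm_num at hN; linarith
      · exact h))
    positivity
  have hu0' := hu0
  rw [hU, mem_filter, mem_Icc] at hu0'
  have hW0 : 0 ≤ W := le_trans (by positivity) (hW u0 hu0'.1.1 hu0'.1.2)
  have hcardU : (#U : ℝ) ≤ S := by
    refine le_trans ?_ (hS u0 hu0'.1.1 hu0'.1.2)
    rw [smoothCount]
    have : #U ≤ #((Icc 1 N).filter fun u => u.primeFactors ⊆ u0.primeFactors) := by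
      refine card_le_card fun u hu => ?_
      rw [hU, mem_filter] at hu
      rw [mem_filter]
      exact ⟨hu.1, by rw [hu.2, hu0'.2]⟩
    exact_mod_cast this
  refine (sum_le_card_nsmul U _ (W * (S * (5 ^ d * M))) fun u hu => ?_).trans ?_
  · rw [hU, mem_filter, mem_Icc] at hu
    obtain ⟨⟨hu1, huN⟩, huD⟩ := hu
    have hpfu : ∀ α : Fin d → ZMod Q, addOrderOf α = u → pf α = D := fun α h => by
      rw [pf, h, huD]
    -- The order of `α + β` is `u` times that of `β`, so pieces violating the constraint vanish by
    -- the definition of `weightedPiece`.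
    rw [l2_filter fun β => u * addOrderOf β ≤ N]
    · refine (l2_le_mul hW0 (w := fun β =>
        ∑ α ∈ univ.filter (fun a : Fin d → ZMod Q => addOrderOf a = u),
        modConv (coef (eta δ)) f (α + β) x * chi y α) fun β hβ => ?_).trans ?_
      · rw [mem_filter] at hβ
        have e : ∀ α ∈ univ.filter (fun a : Fin d → ZMod Q => addOrderOf a = u),
            weightedPiece δ ρ N f x (α + β) * chi y α =
            ((ρ⁻¹ ^ #(u * addOrderOf β).primeFactors : ℝ) : ℂ) *
              (modConv (coef (eta δ)) f (α + β) x * chi y α) := by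
          intro α hα
          rw [mem_filter] at hα
          have ho := addOrderOf_add_of_disjoint (hdisj α β (hpfu α hα.2) hβ.1)
          rw [hα.2] at ho
          rw [weightedPiece, if_pos (by rw [ho]; exact hβ.2), pf, ho]
          push_cast
          ring
        rw [sum_congr rfl e, ← mul_sum, norm_mul]
        refine mul_le_mul_of_nonneg_right ?_ (norm_nonneg _)
        rw [Complex.norm_real, Real.norm_of_nonneg (by positivity)]
        exact hW _ (Nat.mul_pos hu1 (addOrderOf_pos β)) hβ.2
      · refine mul_le_mul_of_nonneg_left ?_ hW0
        refine (l2_modConv_addOrderOf_le h0 h1 hN hu1 huN (by rw [huD]; exact disjoint_sdiff)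
          hf hM x y).trans ?_
        refine mul_le_mul_of_nonneg_right ?_ (by positivity)
        refine le_trans ?_ (hS u hu1 huN)
        exact_mod_cast card_divisors_le_smoothCount hu1 huN
    · intro β hβ hnot
      refine sum_eq_zero fun α hα => ?_
      rw [mem_filter] at hα
      rw [weightedPiece, if_neg, zero_mul]
      rw [addOrderOf_add_of_disjoint (hdisj α β (hpfu α hα.2) hβ), hα.2]
      exact hnot
  · rw [nsmul_eq_mul]
    exact mul_le_mul_of_nonneg_right hcardU (by positivity)

end SquareFunction

/-! ### The moment bound for the lifted family. -/

section LiftBound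

open Finset BigOperators UnitAddTorus ComplexConjugate

variable {d Q : ℕ} [NeZero Q] {δ : ℝ}

/-- For given `D` the splitting `θ = α + β` is unique and forces `D ⊆ pf θ`, so each `θ` is counted
at most once for every subset of its primes. -/
theorem sum_decomp_le (P : Finset ℕ) (h : (Fin d → ZMod Q) → ℝ) (hh : ∀ a, 0 ≤ h a) :
    ∑ D ∈ P.powerset, ∑ β ∈ primary (Fin d → ZMod Q) (P \ D),
      ∑ α ∈ exactPrimary (Fin d → ZMod Q) D, h (α + β) ≤ ∑ θ, 2 ^ #(pf θ) * h θ := by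
  have h1 : ∀ D, ∑ β ∈ primary (Fin d → ZMod Q) (P \ D),
      ∑ α ∈ exactPrimary (Fin d → ZMod Q) D, h (α + β) ≤
      ∑ θ, if D ⊆ pf θ then h θ else 0 := by
    intro D
    rw [← sum_product', ← sum_filter]
    rw [← sum_image (s := primary (Fin d → ZMod Q) (P \ D) ×ˢ exactPrimary (Fin d → ZMod Q) D)
      (g := fun p => p.2 + p.1) (f := h)]
    · refine sum_le_sum_of_subset_of_nonneg ?_ fun a _ _ => hh a
      intro θ hθ
      rw [mem_image] at hθ
      obtain ⟨⟨β, α⟩, hm, rfl⟩ := hθ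
      simp only [mem_product, mem_primary, mem_exactPrimary] at hm
      rw [mem_filter, pf_add_of_disjoint (by
        rw [hm.2]; exact disjoint_of_subset_right hm.1 disjoint_sdiff), hm.2]
      exact ⟨mem_univ _, subset_union_left⟩
    · rintro ⟨β, α⟩ hm ⟨β', α'⟩ hm' he
      simp only [mem_coe, mem_product, mem_primary, mem_exactPrimary] at hm hm'
      have := add_injOn_primary (disjoint_sdiff (s := D) (t := P)) hm.2.le hm'.2.le hm.1 hm'.1 he
      rw [this.1, this.2]
  refine (sum_le_sum fun D _ => h1 D).trans ?_
  rw [sum_comm]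
  refine sum_le_sum fun θ _ => ?_
  rw [← sum_filter, sum_const, nsmul_eq_mul]
  refine mul_le_mul_of_nonneg_right ?_ (hh θ)
  have : #(P.powerset.filter fun D => D ⊆ pf θ) ≤ 2 ^ #(pf θ) := by
    rw [← card_powerset]
    exact card_le_card fun D hD => mem_powerset.2 (mem_filter.1 hD).2
  exact_mod_cast this

/-- Parseval in `y` leaves the squares of the weighted pieces. Summing over all `D` counts a piece
at most `2^ω ≤ S` times, and its weight squared is at most `W²`. -/
theorem sum_squareFn_sq_le {N : ℕ} {ρ W S : ℝ} (hρ : 0 < ρ)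
    (hS : ∀ q, 1 ≤ q → q ≤ N → (smoothCount N q : ℝ) ≤ S)
    (hW : ∀ q, 1 ≤ q → q ≤ N → ρ⁻¹ ^ #q.primeFactors ≤ W)
    (P : Finset ℕ) (f : (Fin d → ℤ) → ℂ) (x : Fin d → ℤ) :
    ∑ D ∈ P.powerset, ∑ y : Fin d → ZMod Q, squareFn δ ρ N P D f x y ^ 2 ≤
      Fintype.card (Fin d → ZMod Q) *
        ∑ a ∈ smallOrder d Q N, (S * W ^ 2) * ‖modConv (coef (eta δ)) f a x‖ ^ 2 := by
  have hcard : (0 : ℝ) < Fintype.card (Fin d → ZMod Q) := by exact_mod_cast Fintype.card_pos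
  have e1 : ∀ D, ∑ y : Fin d → ZMod Q, squareFn δ ρ N P D f x y ^ 2 =
      Fintype.card (Fin d → ZMod Q) * ∑ β ∈ primary (Fin d → ZMod Q) (P \ D),
        ∑ α ∈ exactPrimary (Fin d → ZMod Q) D, ‖weightedPiece δ ρ N f x (α + β)‖ ^ 2 := by
    intro D
    simp only [squareFn, l2_sq]
    rw [sum_comm, mul_sum]
    refine sum_congr rfl fun β _ => ?_
    rw [← expect_norm_sq_sum_chi (exactPrimary (Fin d → ZMod Q) D)
      (fun α => weightedPiece δ ρ N f x (α + β)), Fintype.expect_eq_sum_div_card, mul_div_cancel₀ _ hcard.ne']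
  simp only [e1, ← mul_sum]
  refine mul_le_mul_of_nonneg_left ?_ hcard.le
  refine (sum_decomp_le P (fun a => ‖weightedPiece δ ρ N f x a‖ ^ 2)
    fun a => by positivity).trans ?_
  rw [mul_sum, smallOrder, sum_filter]
  refine sum_le_sum fun a _ => ?_
  unfold weightedPiece
  split_ifs with ha
  · rw [norm_mul, norm_pow, Complex.norm_real, Real.norm_of_nonneg (by positivity), mul_pow,
      ← mul_assoc]
    refine mul_le_mul_of_nonneg_right ?_ (by positivity)
    refine mul_le_mul ?_ (pow_le_pow_left₀ (by positivity) (hW _ (addOrderOf_pos a) ha) 2)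
      (by positivity) (le_trans (by positivity) (hS _ (addOrderOf_pos a) ha))
    refine le_trans ?_ (hS _ (addOrderOf_pos a) ha)
    exact_mod_cast two_pow_card_primeFactors_le (addOrderOf_pos a) ha
  · simp

theorem primary_primeFactors : primary (Fin d → ZMod Q) Q.primeFactors = univ := by
  ext a
  simp only [mem_primary, mem_univ, iff_true]
  refine Nat.primeFactors_mono ?_ (NeZero.ne Q)
  rw [addOrderOf_dvd_iff_nsmul_eq_zero]
  funext i
  simp

/-- The `ℓ^{2(k+1)}` bound for the family of pieces at the fractions of small denominators, lifted
to an independent variable of the finite group. -/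
theorem exists_lift_bound (k : ℕ) : ∃ (C : ℝ) (e : ℕ), 0 < C ∧
    ∀ (d Q N : ℕ) [NeZero Q] (δ S : ℝ), 0 < δ → 3 * δ ≤ 1 → 3 * δ < 1 / (N : ℝ) ^ 2 → 1 ≤ S →
      (∀ q, 1 ≤ q → q ≤ N → (smoothCount N q : ℝ) ≤ S) →
      ∀ f : (Fin d → ℤ) → ℂ, f.support.Finite →
      ∑' x, ∑ y : Fin d → ZMod Q, ENNReal.ofReal
        (‖∑ a ∈ smallOrder d Q N, modConv (coef (eta δ)) f a x * chi y a‖ ^ (2 * (k + 1))) ≤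
      Fintype.card (Fin d → ZMod Q) * ENNReal.ofReal (C * (5 ^ d) ^ (2 * k) * S ^ e) *
        ∑' x, ENNReal.ofReal (‖f x‖ ^ (2 * (k + 1))) := by
  obtain ⟨ρ, hρ, hρ1, hdec⟩ := exists_rho_decoupling k
  -- Since `ρ⁻¹ < 2^e0`, the weights `ρ^(-ω)` are at most `(2^ω)^e0 ≤ S^e0`.
  obtain ⟨e0, he0⟩ := pow_unbounded_of_one_lt ρ⁻¹ (one_lt_two (α := ℝ))
  refine ⟨8 * (k + 1) * 2 ^ (2 * k), (2 + e0) * (2 * k) + (1 + 2 * e0), by positivity, ?_⟩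
  intro d Q N _ δ S h0 h1 hN hS1 hS f hf
  have hW : ∀ q, 1 ≤ q → q ≤ N → ρ⁻¹ ^ #q.primeFactors ≤ S ^ e0 := by
    intro q hq hqN
    calc ρ⁻¹ ^ #q.primeFactors ≤ (2 ^ e0) ^ #q.primeFactors :=
          pow_le_pow_left₀ (by positivity) he0.le _
      _ = (2 ^ #q.primeFactors) ^ e0 := by rw [← pow_mul, ← pow_mul, mul_comm]
      _ ≤ S ^ e0 := by
          refine pow_le_pow_left₀ (by positivity) (le_trans ?_ (hS q hq hqN)) _
          exact_mod_cast two_pow_card_primeFactors_le hq hqN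
  set P := Q.primeFactors with hP
  -- All sets `D` are treated as coordinates of one operator. The sum over them is then part of the
  -- `L²` norm, and their number, which depends on `Q`, never enters.
  let Y := (Fin d → ℤ) × (P.powerset × (Fin d → ZMod Q))
  let _ : MeasurableSpace Y := ⊤
  let U : ((Fin d → ℤ) → ℂ) → Y → ℝ := fun f w => squareFn δ ρ N P w.2.1 f w.1 w.2.2
  have hcard : (0 : ℝ) < Fintype.card (Fin d → ZMod Q) := by exact_mod_cast Fintype.card_pos
  have hprod : ∀ F : Y → ℝ≥0∞, ∫⁻ w, F w ∂Measure.count =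
      ∑' x, ∑ D ∈ P.powerset.attach, ∑ y, F (x, (D, y)) := by
    intro F
    rw [lintegral_count, ENNReal.tsum_prod']
    refine tsum_congr fun x => ?_
    rw [tsum_fintype, Fintype.sum_prod_type, univ_eq_attach]
  set b : ℝ := S * (S ^ e0 * (S * 5 ^ d)) with hb
  have hb0 : 0 < b := by positivity
  have hmar := lintegral_pow_le_of_sublinear (Measure.count : Measure Y) U
    (Fintype.card (Fin d → ZMod Q) * ENNReal.ofReal (S * (S ^ e0) ^ 2)) b hb0 k
    (fun f => measurable_from_top) (fun f w => l2_nonneg _)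
    (fun f g hf hg w => squareFn_add_le hf hg _ _)
    (fun f hf => by
      rw [hprod]
      have h2 : ∀ x, ∑ D ∈ P.powerset.attach, ∑ y, ENNReal.ofReal (U f (x, (D, y)) ^ 2) ≤
          Fintype.card (Fin d → ZMod Q) * ENNReal.ofReal (S * (S ^ e0) ^ 2) *
            ∑ a ∈ smallOrder d Q N, ENNReal.ofReal (‖modConv (coef (eta δ)) f a x‖ ^ 2) := by
        intro x
        have := sum_squareFn_sq_le (Q := Q) (δ := δ) hρ hS hW P f x
        rw [← sum_attach] at this
        rw [← ENNReal.ofReal_natCast, ← ENNReal.ofReal_mul (by positivity),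
          ← ENNReal.ofReal_sum_of_nonneg (fun a _ => by positivity),
          ← ENNReal.ofReal_mul (by positivity)]
        simp only [← ENNReal.ofReal_sum_of_nonneg (fun y _ => sq_nonneg (U f (x, (_, y)))),
          ← ENNReal.ofReal_sum_of_nonneg (fun D _ => sum_nonneg fun y _ =>
            sq_nonneg (U f (x, (D, y))))]
        refine ENNReal.ofReal_le_ofReal (this.trans (le_of_eq ?_))
        rw [← mul_sum]; ring
      refine (ENNReal.tsum_le_tsum h2).trans ?_
      rw [ENNReal.tsum_mul_left]
      refine mul_le_mul_right ?_ _
      rw [Summable.tsum_finsetSum fun _ _ => ENNReal.summable]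
      exact sum_tsum_norm_sq_modConv_le h0 h1 hN hf)
    (fun f hf M hM0 hM w => by
      refine (squareFn_le h0 h1 hN hρ hS1 hS hW hf hM _ _).trans (le_of_eq ?_)
      rw [hb]; ring) f hf
  rw [hprod] at hmar
  have hkey : ∀ x, ∑ y : Fin d → ZMod Q, ENNReal.ofReal
        (‖∑ a ∈ smallOrder d Q N, modConv (coef (eta δ)) f a x * chi y a‖ ^ (2 * (k + 1))) ≤
      ∑ D ∈ P.powerset.attach, ∑ y, ENNReal.ofReal (U f (x, (D, y)) ^ (2 * (k + 1))) := by
    intro x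
    -- The pieces were divided by `ρ^ω` so that the weights in the decoupling inequality cancel.
    have h := hdec d Q P Unit fun a _ => weightedPiece δ ρ N f x a
    have e1 : ∀ y : Fin d → ZMod Q, ∑ θ ∈ primary (Fin d → ZMod Q) P,
        (ρ : ℂ) ^ #(pf θ) * weightedPiece δ ρ N f x θ * chi y θ =
        ∑ a ∈ smallOrder d Q N, modConv (coef (eta δ)) f a x * chi y a := by
      intro y
      rw [hP, primary_primeFactors, smallOrder, sum_filter]
      refine sum_congr rfl fun θ _ => ?_
      unfold weightedPiece
      split_ifs with ho
      · have : (ρ : ℂ) ^ #(pf θ) * ((ρ⁻¹ : ℝ) : ℂ) ^ #(pf θ) = 1 := by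
          rw [← mul_pow, ← Complex.ofReal_mul, mul_inv_cancel₀ hρ.ne', Complex.ofReal_one, one_pow]
        rw [← mul_assoc, this, one_mul]
      · simp
    have e2 : ∀ D, decoupled k P D (fun (a : Fin d → ZMod Q) (_ : Unit) => weightedPiece δ ρ N f x a) =
        𝔼 y : Fin d → ZMod Q, squareFn δ ρ N P D f x y ^ (2 * (k + 1)) := by
      intro D
      unfold decoupled
      refine expect_congr rfl fun y _ => ?_
      rw [pow_mul, squareFn, l2_sq]
      simp
    simp only [univ_unique, sum_singleton, e1, e2, ← pow_mul, Fintype.expect_eq_sum_div_card,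
      ← sum_div] at h
    rw [div_le_div_iff_of_pos_right hcard, ← sum_attach P.powerset] at h
    rw [← ENNReal.ofReal_sum_of_nonneg (fun a _ => by positivity)]
    have hU0 : ∀ D y, 0 ≤ U f (x, (D, y)) := fun D y => l2_nonneg _
    have e3 : ∀ D : P.powerset, ∑ y, ENNReal.ofReal (U f (x, (D, y)) ^ (2 * (k + 1))) =
        ENNReal.ofReal (∑ y, U f (x, (D, y)) ^ (2 * (k + 1))) := fun D =>
      (ENNReal.ofReal_sum_of_nonneg fun y _ => pow_nonneg (hU0 D y) _).symm
    rw [sum_congr rfl fun D _ => e3 D, ← ENNReal.ofReal_sum_of_nonneg fun D _ =>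
      sum_nonneg fun y _ => pow_nonneg (hU0 D y) _]
    exact ENNReal.ofReal_le_ofReal h
  refine (ENNReal.tsum_le_tsum hkey).trans (hmar.trans (le_of_eq ?_))
  congr 1
  rw [mul_left_comm, ← ENNReal.ofReal_mul (by positivity)]
  congr 2
  rw [hb]
  have : ((2 : ℝ) * (S * (S ^ e0 * (S * 5 ^ d)))) ^ (2 * k) =
      2 ^ (2 * k) * (5 ^ d) ^ (2 * k) * S ^ ((2 + e0) * (2 * k)) := by
    rw [pow_mul S, ← mul_pow, ← mul_pow]; congr 1; ring
  rw [this, pow_add S ((2 + e0) * (2 * k)), pow_add S 1, pow_one, mul_comm 2 e0, pow_mul S e0 2]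
  ring

end LiftBound

/-! ### The scalar multiplier theorem at even exponents. -/

section ScalarMultiplier

open Finset BigOperators UnitAddTorus ComplexConjugate Filter Topology

variable {d Q : ℕ} [NeZero Q] {δ : ℝ}

theorem Spec.prod_fin {r : ℝ} (k : ℕ) {h : Fin (k + 1) → (Fin d → ℤ) → ℂ}
    (H : ∀ i, Spec (h i) 0 r) : Spec (fun x => ∏ i, h i x) 0 ((k + 1) * r) := by
  induction k with
  | zero => simpa using H 0
  | succ k ih =>
    have h1 := (H 0).mul (ih fun i => H i.succ)
    rw [zero_add] at h1
    simp only [Fin.prod_univ_succ (n := k + 1)]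
    convert h1 using 1
    push_cast
    ring

/-- Sums of `k + 1` elements of small order. -/
def sumSet (d Q N k : ℕ) [NeZero Q] : Finset (Fin d → ZMod Q) :=
  (Fintype.piFinset fun _ : Fin (k + 1) => smallOrder d Q N).image fun φ => ∑ i, φ i

theorem exists_nsmul_eq_zero_of_mem_sumSet {N k : ℕ} {σ : Fin d → ZMod Q}
    (hσ : σ ∈ sumSet d Q N k) : ∃ n : ℕ, 0 < n ∧ n ≤ N ^ (k + 1) ∧ n • σ = 0 := by
  rw [sumSet, mem_image] at hσ
  obtain ⟨φ, hφ, rfl⟩ := hσ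
  rw [Fintype.mem_piFinset] at hφ
  refine ⟨∏ i, addOrderOf (φ i), prod_pos fun i _ => addOrderOf_pos _, ?_, ?_⟩
  · calc ∏ i, addOrderOf (φ i) ≤ ∏ _i : Fin (k + 1), N :=
        prod_le_prod' fun i _ => mem_smallOrder.1 (hφ i)
      _ = N ^ (k + 1) := by simp
  · rw [smul_sum]
    exact sum_eq_zero fun i _ => addOrderOf_dvd_iff_nsmul_eq_zero.1 (dvd_prod_of_mem _ (mem_univ i))

theorem lt_norm_torusEmb_sub_of_mem_sumSet {N k : ℕ} {σ τ : Fin d → ZMod Q} {r : ℝ}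
    (hr : r < 1 / (N : ℝ) ^ (2 * (k + 1))) (hσ : σ ∈ sumSet d Q N k) (hτ : τ ∈ sumSet d Q N k)
    (hne : σ ≠ τ) : r < ‖torusEmb d Q σ - torusEmb d Q τ‖ := by
  obtain ⟨m, hm0, hm, hmσ⟩ := exists_nsmul_eq_zero_of_mem_sumSet hσ
  obtain ⟨n, hn0, hn, hnτ⟩ := exists_nsmul_eq_zero_of_mem_sumSet hτ
  have h := one_div_le_norm_torusEmb (d := d) (Q := Q) (sub_ne_zero.2 hne) (mul_pos hm0 hn0) (by
    rw [smul_sub, mul_smul _ _ τ, hnτ, mul_comm, mul_smul, hmσ, smul_zero, smul_zero, sub_zero])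
  rw [map_sub] at h
  refine hr.trans_le (le_trans ?_ h)
  have h1 : ((m * n : ℕ) : ℝ) ≤ (N : ℝ) ^ (2 * (k + 1)) := by
    rw [two_mul, pow_add]; exact_mod_cast Nat.mul_le_mul hm hn
  have h2 : (0 : ℝ) < ((m * n : ℕ) : ℝ) := by exact_mod_cast mul_pos hm0 hn0
  exact one_div_le_one_div_of_le h2 h1

/-- Turns a moment of order `2(k+1)` into a second moment of a character sum over the sumset, where
orthogonality is available. -/
theorem sum_chi_pow_eq (A : Finset (Fin d → ZMod Q)) (k : ℕ) (g : (Fin d → ZMod Q) → ℂ)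
    (y : Fin d → ZMod Q) :
    (∑ a ∈ A, g a * chi y a) ^ (k + 1) =
      ∑ σ ∈ (Fintype.piFinset fun _ : Fin (k + 1) => A).image (fun φ => ∑ i, φ i),
        (∑ φ ∈ (Fintype.piFinset fun _ : Fin (k + 1) => A).filter (fun φ => ∑ i, φ i = σ),
          ∏ i, g (φ i)) * chi y σ := by
  have hchi : ∀ φ : Fin (k + 1) → Fin d → ZMod Q, ∏ i, chi y (φ i) = chi y (∑ i, φ i) := by
    intro φ
    have : ∀ s : Finset (Fin (k + 1)), ∏ i ∈ s, chi y (φ i) = chi y (∑ i ∈ s, φ i) := by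
      intro s
      induction s using Finset.induction_on with
      | empty => simp
      | insert i s hi ih => rw [prod_insert hi, sum_insert hi, chi_add_right, ih]
    exact this univ
  calc (∑ a ∈ A, g a * chi y a) ^ (k + 1) = ∏ _i : Fin (k + 1), ∑ a ∈ A, g a * chi y a := by simp
    _ = ∑ φ ∈ Fintype.piFinset fun _ : Fin (k + 1) => A, ∏ i, (g (φ i) * chi y (φ i)) :=
        prod_univ_sum _ _
    _ = _ := by
        rw [← sum_fiberwise_of_maps_to (g := fun φ : Fin (k + 1) → Fin d → ZMod Q => ∑ i, φ i)
          fun φ hφ => mem_image_of_mem _ hφ]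
        refine sum_congr rfl fun σ _ => ?_
        rw [sum_mul]
        refine sum_congr rfl fun φ hφ => ?_
        rw [prod_mul_distrib, hchi, (mem_filter.1 hφ).2]

/-- For pieces with small spectra, the diagonal values of the lifted family have the same
`ℓ^{2(k+1)}` norm as the lifted family. -/
theorem card_mul_tsum_diag {N k : ℕ} (hδ : (2 * (k + 1)) * δ < 1 / (N : ℝ) ^ (2 * (k + 1)))
    {g : (Fin d → ZMod Q) → (Fin d → ℤ) → ℂ} (hg : ∀ a, Spec (g a) 0 δ) :
    (Fintype.card (Fin d → ZMod Q) : ℝ≥0∞) * ∑' x, ENNReal.ofReal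
        (‖∑ a ∈ smallOrder d Q N, g a x * chi (redQ Q (-x)) a‖ ^ (2 * (k + 1))) =
      ∑' x, ∑ y : Fin d → ZMod Q, ENNReal.ofReal
        (‖∑ a ∈ smallOrder d Q N, g a x * chi y a‖ ^ (2 * (k + 1))) := by
  have hcard : (0 : ℝ) < Fintype.card (Fin d → ZMod Q) := by exact_mod_cast Fintype.card_pos
  set T := sumSet d Q N k with hT
  let W : (Fin d → ZMod Q) → (Fin d → ℤ) → ℂ := fun σ x =>
    ∑ φ ∈ (Fintype.piFinset fun _ : Fin (k + 1) => smallOrder d Q N).filter (fun φ => ∑ i, φ i = σ),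
          ∏ i, g (φ i) x
  have hW : ∀ σ, Spec (W σ) 0 ((k + 1) * δ) := fun σ =>
    Spec.sum _ fun φ _ => Spec.prod_fin k fun i => hg (φ i)
  have e : ∀ (x : Fin d → ℤ) (y : Fin d → ZMod Q),
      ‖∑ a ∈ smallOrder d Q N, g a x * chi y a‖ ^ (2 * (k + 1)) =
        ‖∑ σ ∈ T, W σ x * chi y σ‖ ^ 2 := by
    intro x y
    rw [mul_comm 2 (k + 1), pow_mul, ← norm_pow, sum_chi_pow_eq]
    rfl
  have hn : ∀ σ, ∃ n, HasSum (fun x => ‖W σ x‖ ^ 2) n := fun σ => (hW σ).summable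
  choose n hn using hn
  have hmod : ∀ σ, Spec (fun x => W σ x * chi (redQ Q (-x)) σ) (torusEmb d Q σ) ((k + 1) * δ) := by
    intro σ
    have := (hW σ).modulate (torusEmb d Q σ)
    rw [zero_add] at this
    convert this using 1
    funext x
    rw [mFourier_torusEmb, mul_comm]
  -- On the diagonal the coefficients, of spectral radius `(k+1)δ`, are moved to distinct points of
  -- the sumset, which are `N^(-2(k+1))` apart. Orthogonality in `x` gives the same sum of the `n σ`
  -- as Parseval in a free `y` does in `h2`.
  have h1 := hasSum_norm_sq_sum T (fun σ x => W σ x * chi (redQ Q (-x)) σ) n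
    (fun σ _ => by simpa using hn σ)
    (fun σ hσ τ hτ hne => (hmod σ).hasSum_zero (hmod τ) (by
      refine lt_norm_torusEmb_sub_of_mem_sumSet (lt_of_eq_of_lt ?_ hδ) hσ hτ hne
      ring))
  have h2 : HasSum (fun x => 𝔼 y, ‖∑ σ ∈ T, W σ x * chi y σ‖ ^ 2) (∑ σ ∈ T, n σ) := by
    simp only [expect_norm_sq_sum_chi T fun σ => W σ _]
    exact hasSum_sum fun σ _ => hn σ
  simp only [e]
  have e2 : ∀ x, ∑ y : Fin d → ZMod Q, ENNReal.ofReal (‖∑ σ ∈ T, W σ x * chi y σ‖ ^ 2) =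
      Fintype.card (Fin d → ZMod Q) * ENNReal.ofReal (𝔼 y, ‖∑ σ ∈ T, W σ x * chi y σ‖ ^ 2) := by
    intro x
    rw [← ENNReal.ofReal_sum_of_nonneg fun _ _ => by positivity, ← ENNReal.ofReal_natCast,
      ← ENNReal.ofReal_mul hcard.le, Fintype.expect_eq_sum_div_card, mul_div_cancel₀ _ hcard.ne']
  simp only [e2, ENNReal.tsum_mul_left]
  congr 1
  rw [← ENNReal.ofReal_tsum_of_nonneg (fun x => by positivity) h1.summable, h1.tsum_eq,
    ← ENNReal.ofReal_tsum_of_nonneg (fun x => by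
      rw [Fintype.expect_eq_sum_div_card]; positivity) h2.summable, h2.tsum_eq]

/-- The convolution on `ℤ^d`. -/
def zconv (κ f : (Fin d → ℤ) → ℂ) (x : Fin d → ℤ) : ℂ := ∑' z, f z * κ (x - z)

theorem zconv_eq_sum (κ : (Fin d → ℤ) → ℂ) {f : (Fin d → ℤ) → ℂ} {S : Finset (Fin d → ℤ)}
    (hS : f.support ⊆ S) (x : Fin d → ℤ) : zconv κ f x = ∑ z ∈ S, f z * κ (x - z) := by
  refine tsum_eq_sum fun z hz => ?_
  have : f z = 0 := by
    by_contra h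
    exact hz (hS h)
  rw [this, zero_mul]

/-- A bound for a convolution operator on finitely supported functions extends to all functions for
which the convolution converges. -/
theorem tsum_le_of_hasSum {κ : (Fin d → ℤ) → ℂ} {B : ℝ≥0∞} (Φ : ℂ → ℝ≥0∞) (hΦ : Continuous Φ)
    (hΦ0 : Φ 0 = 0)
    (hB : ∀ f : (Fin d → ℤ) → ℂ, f.support.Finite →
      ∑' x, Φ (zconv κ f x) ≤ B * ∑' x, Φ (f x))
    {h u : (Fin d → ℤ) → ℂ} (hu : ∀ x, HasSum (fun z => h z * κ (x - z)) (u x)) :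
    ∑' x, Φ (u x) ≤ B * ∑' x, Φ (h x) := by
  rw [ENNReal.tsum_eq_iSup_sum]
  refine iSup_le fun F => ?_
  have hlim : Tendsto (fun S : Finset (Fin d → ℤ) =>
      ∑ x ∈ F, Φ (∑ z ∈ S, h z * κ (x - z))) atTop (𝓝 (∑ x ∈ F, Φ (u x))) :=
    tendsto_finsetSum _ fun x _ => (hΦ.tendsto _).comp (hu x)
  refine le_of_tendsto' hlim fun S => ?_
  let hS : (Fin d → ℤ) → ℂ := fun z => if z ∈ S then h z else 0
  have hsupp : hS.support ⊆ S := fun z hz => by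
    by_contra hcon
    exact hz (if_neg hcon)
  have e : ∀ x, ∑ z ∈ S, h z * κ (x - z) = zconv κ hS x := fun x => by
    rw [zconv_eq_sum κ hsupp]
    exact sum_congr rfl fun z hz => by simp only [hS, if_pos hz]
  simp only [e]
  refine (ENNReal.sum_le_tsum F).trans ((hB hS (S.finite_toSet.subset hsupp)).trans ?_)
  refine mul_le_mul_right (ENNReal.tsum_le_tsum fun z => ?_) _
  simp only [hS]
  split_ifs
  · exact le_rfl
  · rw [hΦ0]; exact zero_le

theorem spec_modConv {μ : UnitAddTorus (Fin d) → ℂ} (hμ : BddMeas μ)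
    (hsupp : ∀ ξ, μ ξ ≠ 0 → ‖ξ‖ ≤ δ) {f : (Fin d → ℤ) → ℂ} (hf : f.support.Finite)
    (a : Fin d → ZMod Q) : Spec (modConv (coef μ) f a) 0 δ := by
  refine ⟨_, hμ.mul ((bddMeas_trigPoly f hf.toFinset).comp (measurable_id.add_const (torusEmb d Q a))),
    fun ξ hξ => ?_, modConv_eq_coef hμ (by simp) a⟩
  rw [sub_zero]
  exact hsupp ξ (left_ne_zero_of_mul hξ)

/-- `eta δ` is `1` on the support of `μ`, so the piece cut by `μ` is the `μ`-convolution of the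
piece cut by `eta δ`. -/
theorem hasSum_modConv_eta (h0 : 0 < δ) (h1 : 3 * δ ≤ 1) {μ : UnitAddTorus (Fin d) → ℂ}
    (hμ : BddMeas μ) (hsupp : ∀ ξ, μ ξ ≠ 0 → ‖ξ‖ ≤ δ) {f : (Fin d → ℤ) → ℂ}
    (hf : f.support.Finite) (a : Fin d → ZMod Q) (x : Fin d → ℤ) :
    HasSum (fun z => modConv (coef (eta δ)) f a z * coef μ (x - z)) (modConv (coef μ) f a x) := by
  have hS : f.support ⊆ hf.toFinset := by simp
  have hb : BddMeas fun ξ => trigPoly f hf.toFinset (ξ + torusEmb d Q a) :=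
    (bddMeas_trigPoly f hf.toFinset).comp (measurable_id.add_const (torusEmb d Q a))
  rw [modConv_eq_coef hμ hS, modConv_eq_coef (bddMeas_eta δ) hS]
  have h := hasSum_coef_mul hμ ((bddMeas_eta δ).mul hb) x
  rwa [show (fun ξ => μ ξ * (eta δ ξ * trigPoly f hf.toFinset (ξ + torusEmb d Q a))) =
    fun ξ => μ ξ * trigPoly f hf.toFinset (ξ + torusEmb d Q a) from ?_] at h
  funext ξ
  by_cases h : μ ξ = 0
  · rw [h, zero_mul, zero_mul]
  · rw [eta_eq_one h0 h1 (hsupp ξ h), one_mul]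

/-- On the diagonal `y = -x` the characters undo the recentring of the pieces, and the lifted family
becomes the operator with the periodised symbol. -/
theorem sum_modConv_eq_zconv {μ : UnitAddTorus (Fin d) → ℂ} (hμ : BddMeas μ)
    (A : Finset (Fin d → ZMod Q)) {f : (Fin d → ℤ) → ℂ} (hf : f.support.Finite) (x : Fin d → ℤ) :
    ∑ a ∈ A, modConv (coef μ) f a x * chi (redQ Q (-x)) a =
      zconv (coef fun ξ => ∑ a ∈ A, μ (ξ - torusEmb d Q a)) f x := by
  have hS : f.support ⊆ hf.toFinset := by simp
  rw [zconv_eq_sum _ hS]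
  simp only [modConv_eq_sum (coef μ) hS, sum_mul]
  rw [sum_comm]
  refine sum_congr rfl fun z _ => ?_
  rw [coef_sum A (g := fun a ξ => μ (ξ - torusEmb d Q a)) fun a _ =>
    hμ.comp (measurable_id.sub_const _), mul_sum]
  refine sum_congr rfl fun a _ => ?_
  rw [coef_translate, mFourier_torusEmb, show -(x - z) = z + -x by abel, redQ_add, chi_add_left]
  ring

/-- The scalar multiplier theorem at even exponents. -/
theorem exists_scalar_bound (k : ℕ) : ∃ (C : ℝ) (e : ℕ), 0 < C ∧
    ∀ (d Q N : ℕ) [NeZero Q] (δ S : ℝ), 0 < δ → 3 * δ ≤ 1 → 3 * δ < 1 / (N : ℝ) ^ 2 →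
      (2 * (k + 1)) * δ < 1 / (N : ℝ) ^ (2 * (k + 1)) → 1 ≤ S →
      (∀ q, 1 ≤ q → q ≤ N → (smoothCount N q : ℝ) ≤ S) →
      ∀ (μ : UnitAddTorus (Fin d) → ℂ), BddMeas μ → (∀ ξ, μ ξ ≠ 0 → ‖ξ‖ ≤ δ) →
      ∀ B : ℝ≥0∞, (∀ f : (Fin d → ℤ) → ℂ, f.support.Finite →
        ∑' x, ENNReal.ofReal (‖zconv (coef μ) f x‖ ^ (2 * (k + 1))) ≤
          B * ∑' x, ENNReal.ofReal (‖f x‖ ^ (2 * (k + 1)))) →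
      ∀ f : (Fin d → ℤ) → ℂ, f.support.Finite →
        ∑' x, ENNReal.ofReal (‖zconv (coef fun ξ => ∑ a ∈ smallOrder d Q N,
          μ (ξ - torusEmb d Q a)) f x‖ ^ (2 * (k + 1))) ≤
        B * ENNReal.ofReal (C * (5 ^ d) ^ (2 * k) * S ^ e) *
          ∑' x, ENNReal.ofReal (‖f x‖ ^ (2 * (k + 1))) := by
  obtain ⟨C, e, hC, hlift⟩ := exists_lift_bound k
  refine ⟨C, e, hC, ?_⟩
  intro d Q N _ δ S h0 h1 hN hN2 hS1 hS μ hμ hsupp B hB f hf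
  have hl := hlift d Q N δ S h0 h1 hN hS1 hS f hf
  have hcard : (Fintype.card (Fin d → ZMod Q) : ℝ≥0∞) ≠ 0 := by
    exact_mod_cast Fintype.card_ne_zero
  simp only [← sum_modConv_eq_zconv hμ _ hf]
  rw [← ENNReal.mul_le_mul_iff_right hcard (ENNReal.natCast_ne_top _),
    card_mul_tsum_diag hN2 fun a => spec_modConv hμ hsupp hf a,
    Summable.tsum_finsetSum fun _ _ => ENNReal.summable]
  rw [Summable.tsum_finsetSum fun _ _ => ENNReal.summable] at hl
  -- For fixed `y` the sum over `a` is a single function on the lattice, to which the bound for `μ`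
  -- applies, after its extension beyond finitely supported functions.
  have hy : ∀ y : Fin d → ZMod Q, ∑' x, ENNReal.ofReal
      (‖∑ a ∈ smallOrder d Q N, modConv (coef μ) f a x * chi y a‖ ^ (2 * (k + 1))) ≤
      B * ∑' x, ENNReal.ofReal (‖∑ a ∈ smallOrder d Q N,
        modConv (coef (eta δ)) f a x * chi y a‖ ^ (2 * (k + 1))) := by
    intro y
    refine tsum_le_of_hasSum (κ := coef μ) (fun z => ENNReal.ofReal (‖z‖ ^ (2 * (k + 1))))
      (ENNReal.continuous_ofReal.comp (by fun_prop)) (by simp) hB fun x => ?_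
    have := hasSum_sum (s := smallOrder d Q N) fun a _ =>
      (hasSum_modConv_eta h0 h1 hμ hsupp hf a x).mul_right (chi y a)
    refine this.congr_fun ?_
    intro z
    rw [sum_mul]
    exact sum_congr rfl fun a _ => by ring
  refine (sum_le_sum fun y _ => hy y).trans ?_
  rw [← mul_sum]
  refine (mul_le_mul_right hl _).trans (le_of_eq ?_)
  ring

end ScalarMultiplier

/-! ### Riesz–Thorin interpolation and duality for convolutions. -/

section Interpolation

open Finset BigOperators ComplexConjugate

/-- The bilinear form of a matrix is bounded by `B` on the product of the unit balls of `ℓ^p` and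
`ℓ^q`. -/
def BilBdd {X Y : Type*} (S : Finset X) (F : Finset Y) (k : Y → X → ℂ) (p q B : ℝ) : Prop :=
  ∀ (f : X → ℂ) (g : Y → ℂ), ∑ x ∈ S, ‖f x‖ ^ p ≤ 1 → ∑ y ∈ F, ‖g y‖ ^ q ≤ 1 →
    ‖∑ y ∈ F, ∑ x ∈ S, g y * f x * k y x‖ ≤ B

/-- The analytic family through `w` used in the proof of the Riesz–Thorin theorem. -/
def phasePow (w s : ℂ) : ℂ := if w = 0 then 0 else w / ‖w‖ * (‖w‖ : ℂ) ^ s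

theorem differentiable_phasePow (w : ℂ) : Differentiable ℂ (phasePow w) := by
  unfold phasePow
  split_ifs with h
  · exact differentiable_const 0
  · refine (differentiable_const _).mul (differentiable_id.const_cpow (Or.inl ?_))
    exact_mod_cast norm_ne_zero_iff.2 h

/-- At `w = 0` the value is `0` while `0^0 = 1`, hence the condition on `s.re`. -/
theorem norm_phasePow (w s : ℂ) (hs : s.re ≠ 0) : ‖phasePow w s‖ = ‖w‖ ^ s.re := by
  unfold phasePow
  split_ifs with h
  · rw [h, norm_zero, Real.zero_rpow hs]
  · have hw : 0 < ‖w‖ := norm_pos_iff.2 h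
    rw [norm_mul, norm_div, Complex.norm_real, norm_norm, div_self hw.ne', one_mul,
      Complex.norm_cpow_eq_rpow_re_of_pos hw]

theorem phasePow_one (w : ℂ) : phasePow w 1 = w := by
  unfold phasePow
  split_ifs with h
  · rw [h]
  · rw [Complex.cpow_one, div_mul_cancel₀]
    exact_mod_cast norm_ne_zero_iff.2 h

theorem norm_le_one_of_sum_rpow_le_one {X : Type*} {S : Finset X} {f : X → ℂ} {p : ℝ} (hp : 0 < p)
    (h : ∑ x ∈ S, ‖f x‖ ^ p ≤ 1) {x : X} (hx : x ∈ S) : ‖f x‖ ≤ 1 := by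
  have h1 := (single_le_sum (f := fun x => ‖f x‖ ^ p) (fun i _ => by positivity) hx).trans h
  by_contra hcon
  push Not at hcon
  have := Real.one_lt_rpow hcon hp
  linarith

/-- The Riesz–Thorin theorem between two dual exponents with equal bounds. -/
theorem BilBdd.interp {X Y : Type*} {S : Finset X} {F : Finset Y} {k : Y → X → ℂ} {a a' p q B : ℝ}
    (haa : a.HolderConjugate a') (hpq : p.HolderConjugate q) (h1 : a' ≤ p) (h2 : p ≤ a) (hB : 0 < B)
    (H : BilBdd S F k a a' B) (H' : BilBdd S F k a' a B) : BilBdd S F k p q B := by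
  intro f g hf hg
  have ha0 := haa.pos
  have ha'0 := haa.symm.pos
  have hp0 := hpq.pos
  have hq0 := hpq.symm.pos
  have hasum : a'⁻¹ + a⁻¹ = 1 := haa.symm.inv_add_inv_eq_one
  have hpsum : p⁻¹ + q⁻¹ = 1 := hpq.inv_add_inv_eq_one
  have hmem : p⁻¹ ∈ segment ℝ a⁻¹ a'⁻¹ := by
    rw [segment_eq_Icc (inv_anti₀ ha'0 (h1.trans h2))]
    exact ⟨inv_anti₀ hp0 h2, inv_anti₀ ha'0 h1⟩
  obtain ⟨t, u, ht0, hu0, htu, hcomb⟩ := hmem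
  simp only [smul_eq_mul] at hcomb
  have hu : u = 1 - t := by linarith
  subst hu
  -- `α` is affine with values `1/a'` at `0`, `1/a` at `1` and `1/p` at `t`, so that both phase
  -- powers have exponent `1` at `t`.
  let α : ℂ → ℂ := fun ζ => (1 - ζ) * ((a'⁻¹ : ℝ) : ℂ) + ζ * ((a⁻¹ : ℝ) : ℂ)
  have hαre : ∀ ζ, (α ζ).re = (1 - ζ.re) * a'⁻¹ + ζ.re * a⁻¹ := by
    intro ζ
    simp only [α, Complex.add_re, Complex.mul_re, Complex.sub_re, Complex.one_re, Complex.ofReal_re,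
      Complex.ofReal_im, mul_zero, sub_zero]
  have hα : Differentiable ℂ α := by
    simp only [α]; fun_prop
  let H0 : ℂ → ℂ := fun ζ => ∑ y ∈ F, ∑ x ∈ S,
    phasePow (g y) ((q : ℂ) * (1 - α ζ)) * phasePow (f x) ((p : ℂ) * α ζ) * k y x
  have hH0 : Differentiable ℂ H0 := by
    refine Differentiable.fun_sum fun y _ => Differentiable.fun_sum fun x _ => ?_
    refine Differentiable.mul (Differentiable.mul ?_ ?_) (differentiable_const _)
    · exact (differentiable_phasePow (g y)).comp ((differentiable_const _).mul
        ((differentiable_const _).sub hα))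
    · exact (differentiable_phasePow (f x)).comp ((differentiable_const _).mul hα)
  have hret : ∀ ζ, ((q : ℂ) * (1 - α ζ)).re = q * (ζ.re * a'⁻¹ + (1 - ζ.re) * a⁻¹) := by
    intro ζ
    rw [Complex.re_ofReal_mul, Complex.sub_re, Complex.one_re, hαre]
    linear_combination (-q) * hasum
  have hrep : ∀ ζ, ((p : ℂ) * α ζ).re = p * ((1 - ζ.re) * a'⁻¹ + ζ.re * a⁻¹) := by
    intro ζ
    rw [Complex.re_ofReal_mul, hαre]
  have hpos : ∀ s : ℝ, 0 ≤ s → s ≤ 1 → 0 < (1 - s) * a'⁻¹ + s * a⁻¹ := by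
    intro s hs0 hs1
    rcases hs0.eq_or_lt with rfl | hs
    · simp [ha'0]
    · have : 0 ≤ (1 - s) * a'⁻¹ := mul_nonneg (by linarith) (by positivity)
      have : 0 < s * a⁻¹ := by positivity
      linarith
  have hpos' : ∀ s : ℝ, 0 ≤ s → s ≤ 1 → 0 < s * a'⁻¹ + (1 - s) * a⁻¹ := by
    intro s hs0 hs1
    have := hpos (1 - s) (by linarith) (by linarith)
    rwa [sub_sub_cancel] at this
  have hval : H0 t = ∑ y ∈ F, ∑ x ∈ S, g y * f x * k y x := by
    have e1 : (p : ℂ) * α t = 1 := by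
      have : α t = ((p⁻¹ : ℝ) : ℂ) := by
        rw [← hcomb]; simp only [α]; push_cast; ring
      rw [this, ← Complex.ofReal_mul, mul_inv_cancel₀ hp0.ne', Complex.ofReal_one]
    have e2 : (q : ℂ) * (1 - α t) = 1 := by
      have : 1 - α t = ((q⁻¹ : ℝ) : ℂ) := by
        have e3 : α t = ((p⁻¹ : ℝ) : ℂ) := by
          rw [← hcomb]; simp only [α]; push_cast; ring
        rw [e3, eq_sub_of_add_eq' hpsum]; push_cast; ring
      rw [this, ← Complex.ofReal_mul, mul_inv_cancel₀ hq0.ne', Complex.ofReal_one]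
    simp only [H0, e1, e2, phasePow_one]
  have hthree := Complex.HadamardThreeLines.norm_le_interp_of_mem_verticalClosedStrip₀₁' H0
    (z := (t : ℂ)) (a := B) (b := B) ?_ hH0.diffContOnCl ?_ ?_ ?_
  · rw [hval, Complex.ofReal_re, ← Real.rpow_add hB, sub_add_cancel, Real.rpow_one] at hthree
    exact hthree
  · simp only [Complex.HadamardThreeLines.verticalClosedStrip, Set.mem_preimage, Complex.ofReal_re,
      Set.mem_Icc]
    exact ⟨ht0, by linarith⟩
  · refine ⟨∑ y ∈ F, ∑ x ∈ S, ‖k y x‖, ?_⟩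
    rintro _ ⟨ζ, hζ, rfl⟩
    simp only [Complex.HadamardThreeLines.verticalClosedStrip, Set.mem_preimage, Set.mem_Icc] at hζ
    refine (norm_sum_le _ _).trans (sum_le_sum fun y hy => (norm_sum_le _ _).trans
      (sum_le_sum fun x hx => ?_))
    have p1 := hpos _ hζ.1 hζ.2
    have p2 := hpos' _ hζ.1 hζ.2
    rw [norm_mul, norm_mul, norm_phasePow _ _ (by rw [hret]; positivity),
      norm_phasePow _ _ (by rw [hrep]; positivity)]
    refine mul_le_of_le_one_left (norm_nonneg _) (mul_le_one₀ ?_ (by positivity) ?_)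
    · exact Real.rpow_le_one (norm_nonneg _) (norm_le_one_of_sum_rpow_le_one hq0 hg hy)
        (by rw [hret]; positivity)
    · exact Real.rpow_le_one (norm_nonneg _) (norm_le_one_of_sum_rpow_le_one hp0 hf hx)
        (by rw [hrep]; positivity)
  · intro ζ hζ
    rw [Set.mem_preimage, Set.mem_singleton_iff] at hζ
    refine H' _ _ (le_of_eq_of_le ?_ hf) (le_of_eq_of_le ?_ hg)
    · refine sum_congr rfl fun x _ => ?_
      rw [norm_phasePow _ _ (by rw [hrep, hζ]; simp [hp0.ne', ha'0.ne']), hrep, hζ,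
        ← Real.rpow_mul (norm_nonneg _)]
      congr 1
      field_simp
      ring
    · refine sum_congr rfl fun x _ => ?_
      rw [norm_phasePow _ _ (by rw [hret, hζ]; simp [hq0.ne', ha0.ne']), hret, hζ,
        ← Real.rpow_mul (norm_nonneg _)]
      congr 1
      field_simp
      ring
  · intro ζ hζ
    rw [Set.mem_preimage, Set.mem_singleton_iff] at hζ
    refine H _ _ (le_of_eq_of_le ?_ hf) (le_of_eq_of_le ?_ hg)
    · refine sum_congr rfl fun x _ => ?_
      rw [norm_phasePow _ _ (by rw [hrep, hζ]; simp [hp0.ne', ha0.ne']), hrep, hζ,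
        ← Real.rpow_mul (norm_nonneg _)]
      congr 1
      field_simp
      ring
    · refine sum_congr rfl fun x _ => ?_
      rw [norm_phasePow _ _ (by rw [hret, hζ]; simp [hq0.ne', ha'0.ne']), hret, hζ,
        ← Real.rpow_mul (norm_nonneg _)]
      congr 1
      field_simp
      ring

variable {d : ℕ}

/-- Convolution with `κ` is bounded on `ℓ^p` with constant `B`. -/
def ConvBdd (κ : (Fin d → ℤ) → ℂ) (p : ℝ) (B : ℝ) : Prop :=
  ∀ f : (Fin d → ℤ) → ℂ, f.support.Finite →
    ∑' x, ‖zconv κ f x‖ₑ ^ p ≤ ENNReal.ofReal B ^ p * ∑' x, ‖f x‖ₑ ^ p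

theorem enorm_rpow_eq_ofReal (z : ℂ) {p : ℝ} (hp : 0 ≤ p) : ‖z‖ₑ ^ p = ENNReal.ofReal (‖z‖ ^ p) := by
  rw [← ofReal_norm, ENNReal.ofReal_rpow_of_nonneg (norm_nonneg _) hp]

theorem sum_enorm_rpow_eq_ofReal {X : Type*} (S : Finset X) (f : X → ℂ) {p : ℝ} (hp : 0 ≤ p) :
    ∑ x ∈ S, ‖f x‖ₑ ^ p = ENNReal.ofReal (∑ x ∈ S, ‖f x‖ ^ p) := by
  rw [ENNReal.ofReal_sum_of_nonneg fun x _ => by positivity]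
  exact sum_congr rfl fun x _ => enorm_rpow_eq_ofReal _ hp

theorem tsum_enorm_rpow_eq_sum {X : Type*} {f : X → ℂ} {S : Finset X} (hS : f.support ⊆ S) {p : ℝ}
    (hp : 0 < p) : ∑' x, ‖f x‖ₑ ^ p = ∑ x ∈ S, ‖f x‖ₑ ^ p := by
  refine tsum_eq_sum fun x hx => ?_
  have : f x = 0 := by
    by_contra h
    exact hx (hS h)
  rw [this, enorm_zero, ENNReal.zero_rpow_of_pos hp]

theorem ConvBdd.bilBdd {κ : (Fin d → ℤ) → ℂ} {p q B : ℝ} (hpq : p.HolderConjugate q) (hB : 0 ≤ B)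
    (H : ConvBdd κ p B) (S F : Finset (Fin d → ℤ)) :
    BilBdd S F (fun x z => κ (x - z)) p q B := by
  intro f g hf hg
  let fS : (Fin d → ℤ) → ℂ := fun z => if z ∈ S then f z else 0
  have hsupp : fS.support ⊆ S := fun z hz => by
    by_contra hcon
    exact hz (if_neg hcon)
  have h1 := H fS (S.finite_toSet.subset hsupp)
  rw [tsum_enorm_rpow_eq_sum hsupp hpq.pos, sum_enorm_rpow_eq_ofReal _ _ hpq.nonneg,
    sum_congr rfl fun x hx => show ‖fS x‖ ^ p = ‖f x‖ ^ p by simp only [fS, if_pos hx]] at h1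
  have h2 : ∑ x ∈ F, ‖zconv κ fS x‖ ^ p ≤ B ^ p := by
    have h3 := (ENNReal.sum_le_tsum F).trans h1
    rw [sum_enorm_rpow_eq_ofReal _ _ hpq.nonneg, ENNReal.ofReal_rpow_of_nonneg hB hpq.nonneg,
      ← ENNReal.ofReal_mul (by positivity), ENNReal.ofReal_le_ofReal_iff (by positivity)] at h3
    exact h3.trans (mul_le_of_le_one_right (by positivity) hf)
  have e : ∀ x, ∑ z ∈ S, g x * f z * κ (x - z) = zconv κ fS x * g x := by
    intro x
    rw [zconv_eq_sum κ hsupp, sum_mul]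
    refine sum_congr rfl fun z hz => ?_
    simp only [fS, if_pos hz]; ring
  simp only [e]
  calc ‖∑ x ∈ F, zconv κ fS x * g x‖ ≤ ∑ x ∈ F, ‖zconv κ fS x‖ * ‖g x‖ :=
        (norm_sum_le _ _).trans (sum_le_sum fun x _ => norm_mul_le _ _)
    _ ≤ (∑ x ∈ F, ‖zconv κ fS x‖ ^ p) ^ (1 / p) * (∑ x ∈ F, ‖g x‖ ^ q) ^ (1 / q) :=
        Real.inner_le_Lp_mul_Lq_of_nonneg F hpq (fun _ _ => norm_nonneg _) fun _ _ => norm_nonneg _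
    _ ≤ (B ^ p) ^ (1 / p) * 1 := by
        refine mul_le_mul (Real.rpow_le_rpow (by positivity) h2 (by have := hpq.pos; positivity))
          (Real.rpow_le_one (by positivity) hg (by have := hpq.symm.pos; positivity))
          (by positivity) (by positivity)
    _ = B := by
        rw [mul_one, ← Real.rpow_mul hB, mul_one_div_cancel hpq.ne_zero, Real.rpow_one]

/-- Duality: `f` is normalised and tested against the nonnegative extremiser of Hölder's inequality
times the conjugate phase of the output. -/
theorem convBdd_of_bilBdd {κ : (Fin d → ℤ) → ℂ} {p q B : ℝ} (hpq : p.HolderConjugate q) (hB : 0 ≤ B)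
    (H : ∀ S F : Finset (Fin d → ℤ), BilBdd S F (fun x z => κ (x - z)) p q B) : ConvBdd κ p B := by
  intro f hf
  have hS : f.support ⊆ hf.toFinset := by simp
  rw [tsum_enorm_rpow_eq_sum hS hpq.pos, ENNReal.tsum_eq_iSup_sum]
  refine iSup_le fun F => ?_
  rw [sum_enorm_rpow_eq_ofReal _ _ hpq.nonneg, sum_enorm_rpow_eq_ofReal _ _ hpq.nonneg,
    ENNReal.ofReal_rpow_of_nonneg hB hpq.nonneg, ← ENNReal.ofReal_mul (by positivity)]
  refine ENNReal.ofReal_le_ofReal ?_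
  set m := ∑ x ∈ hf.toFinset, ‖f x‖ ^ p with hm
  have hm0 : 0 ≤ m := sum_nonneg fun x _ => by positivity
  rcases hm0.eq_or_lt with h0 | hmpos
  · have hf0 : ∀ x ∈ hf.toFinset, f x = 0 := by
      intro x hx
      have := (sum_eq_zero_iff_of_nonneg fun x _ => by positivity).1 h0.symm x hx
      exact norm_eq_zero.1 ((Real.rpow_eq_zero (norm_nonneg _) hpq.ne_zero).1 this)
    rw [← h0, mul_zero]
    refine le_of_eq (sum_eq_zero fun x _ => ?_)
    rw [zconv_eq_sum κ hS, sum_eq_zero fun z hz => by rw [hf0 z hz, zero_mul], norm_zero,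
      Real.zero_rpow hpq.ne_zero]
  set n := m ^ (1 / p) with hn
  have hn0 : 0 < n := by positivity
  have hnp : n ^ p = m := by
    rw [hn, ← Real.rpow_mul hm0, one_div_mul_cancel hpq.ne_zero, Real.rpow_one]
  have hnC : (n : ℂ) ≠ 0 := by exact_mod_cast hn0.ne'
  obtain ⟨φ, hφ, hφeq⟩ := (NNReal.isGreatest_Lp F (fun x => ‖zconv κ f x‖₊) hpq).1
  simp only at hφeq
  have hφ' : ∑ x ∈ F, ((φ x : ℝ)) ^ q ≤ 1 := by exact_mod_cast hφ
  have hφeq' : ∑ x ∈ F, ‖zconv κ f x‖ * (φ x : ℝ) = (∑ x ∈ F, ‖zconv κ f x‖ ^ p) ^ (1 / p) := by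
    have := congrArg (fun r : NNReal => (r : ℝ)) hφeq
    simpa using this
  have hb := H hf.toFinset F (fun z => f z / n)
    (fun x => (φ x : ℂ) * (conj (zconv κ f x) / ‖zconv κ f x‖)) ?_ ?_
  · have e : ∀ x, ∑ z ∈ hf.toFinset, (φ x : ℂ) * (conj (zconv κ f x) / ‖zconv κ f x‖) * (f z / n) *
        κ (x - z) = ((‖zconv κ f x‖ * (φ x : ℝ) / n : ℝ) : ℂ) := by
      intro x
      have e1 : ∑ z ∈ hf.toFinset, (φ x : ℂ) * (conj (zconv κ f x) / ‖zconv κ f x‖) * (f z / n) *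
        κ (x - z) = (φ x : ℂ) * (conj (zconv κ f x) / ‖zconv κ f x‖) / n * zconv κ f x := by
        conv_rhs => rw [zconv_eq_sum κ hS x, mul_sum]
        rw [← zconv_eq_sum κ hS x]
        refine sum_congr rfl fun z _ => ?_
        ring
      rw [e1]
      by_cases h : zconv κ f x = 0
      · simp [h]
      · have hne : (‖zconv κ f x‖ : ℂ) ≠ 0 := by exact_mod_cast norm_ne_zero_iff.2 h
        have h3 : conj (zconv κ f x) * zconv κ f x = (‖zconv κ f x‖ : ℂ) ^ 2 := Complex.conj_mul' _
        push_cast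
        field_simp
        linear_combination ((φ x : ℝ) : ℂ) * h3
    simp only [e] at hb
    rw [← Complex.ofReal_sum, Complex.norm_real, Real.norm_of_nonneg
      (sum_nonneg fun x _ => by positivity), ← sum_div, hφeq', div_le_iff₀ hn0] at hb
    calc ∑ x ∈ F, ‖zconv κ f x‖ ^ p = ((∑ x ∈ F, ‖zconv κ f x‖ ^ p) ^ (1 / p)) ^ p := by
          rw [← Real.rpow_mul (by positivity), one_div_mul_cancel hpq.ne_zero, Real.rpow_one]
      _ ≤ (B * n) ^ p := Real.rpow_le_rpow (by positivity) hb hpq.nonneg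
      _ = B ^ p * m := by rw [Real.mul_rpow hB hn0.le, hnp]
  · simp only [norm_div, Complex.norm_real, Real.norm_of_nonneg hn0.le]
    rw [sum_congr rfl fun x _ => Real.div_rpow (norm_nonneg (f x)) hn0.le p, ← sum_div, hnp,
      div_self hmpos.ne']
  · refine (sum_le_sum fun x _ => ?_).trans hφ'
    refine Real.rpow_le_rpow (norm_nonneg _) ?_ hpq.symm.nonneg
    have : ‖(φ x : ℂ)‖ = (φ x : ℝ) := by
      exact Complex.norm_of_nonneg (φ x).2
    rw [norm_mul, norm_div, RCLike.norm_conj, this, Complex.norm_real, norm_norm]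
    exact mul_le_of_le_one_right (φ x).2 (div_self_le_one _)

/-- The kernel `κ(x - z)` is invariant under `(x, z) ↦ (-z, -x)`, so reflection exchanges the two
exponents. -/
theorem bilBdd_reflect {κ : (Fin d → ℤ) → ℂ} {p q B : ℝ}
    (H : ∀ S F : Finset (Fin d → ℤ), BilBdd S F (fun x z => κ (x - z)) p q B)
    (S F : Finset (Fin d → ℤ)) : BilBdd S F (fun x z => κ (x - z)) q p B := by
  intro f g hf hg
  have h := H (F.map (Equiv.neg _).toEmbedding) (S.map (Equiv.neg _).toEmbedding)
    (fun x => g (-x)) (fun z => f (-z)) (by simpa [sum_map] using hg) (by simpa [sum_map] using hf)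
  simp only [sum_map, Equiv.coe_toEmbedding, Equiv.neg_apply, neg_neg] at h
  rw [sum_comm] at h
  refine le_of_eq_of_le (congrArg norm (sum_congr rfl fun y _ => sum_congr rfl fun x _ => ?_)) h
  rw [show -x - -y = y - x by abel]
  ring

/-- A convolution operator bounded on `ℓ^a` is bounded, with the same constant, on `ℓ^p` for all `p`
between the exponent `a` and its dual. -/
theorem ConvBdd.interp {κ : (Fin d → ℤ) → ℂ} {a a' p B : ℝ} (haa : a.HolderConjugate a')
    (h1 : a' ≤ p) (h2 : p ≤ a) (hB : 0 < B) (H : ConvBdd κ a B) : ConvBdd κ p B := by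
  have hp1 : 1 < p := haa.symm.lt.trans_le h1
  have hpq := Real.HolderConjugate.conjExponent hp1
  have Hb := H.bilBdd haa hB.le
  exact convBdd_of_bilBdd hpq hB.le fun S F =>
    (Hb S F).interp haa hpq h1 h2 hB (bilBdd_reflect Hb S F)

end Interpolation

/-! ### Variation norms and the Rademacher–Menshov inequality. -/

section Variation

open Finset BigOperators

variable {r : ℝ≥0∞}

/-- The `r`-sum of the increments along a finite sequence. -/
def jumpSum (r : ℝ) (a : ℕ → ℂ) {J : ℕ} (t : Fin (J + 1) → ℕ) : ℝ≥0∞ :=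
  (∑ j : Fin J, ‖a (t j.succ) - a (t j.castSucc)‖ₑ ^ r) ^ (1 / r)

theorem variation_of_ne_top (hr : r ≠ ⊤) (a : ℕ → ℂ) : variation r a =
    ⨆ (J : ℕ) (t : Fin (J + 1) → ℕ) (_ : StrictMono t), jumpSum r.toReal a t := by
  rw [variation, if_neg hr]; rfl

theorem variation_top (a : ℕ → ℂ) : variation ⊤ a = ⨆ (s : ℕ) (t : ℕ), ‖a s - a t‖ₑ := by
  rw [variation, if_pos rfl]

theorem jumpSum_le_variation (hr : r ≠ ⊤) (a : ℕ → ℂ) {J : ℕ} {t : Fin (J + 1) → ℕ}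
    (ht : StrictMono t) : jumpSum r.toReal a t ≤ variation r a := by
  rw [variation_of_ne_top hr]
  exact le_iSup_of_le J (le_iSup_of_le t (le_iSup_of_le ht le_rfl))

theorem one_le_toReal (hr : 1 ≤ r) (h : r ≠ ⊤) : 1 ≤ r.toReal := by
  rw [← ENNReal.toReal_one]
  exact (ENNReal.toReal_le_toReal ENNReal.one_ne_top h).2 hr

theorem variationNorm_add_le (hr : 1 ≤ r) (a b : ℕ → ℂ) :
    variationNorm r (fun n => a n + b n) ≤ variationNorm r a + variationNorm r b := by
  unfold variationNorm
  rw [add_add_add_comm]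
  refine add_le_add ?_ ?_
  · refine iSup_le fun n => (enorm_add_le _ _).trans (add_le_add ?_ ?_)
    · exact le_iSup (fun n => ‖a n‖ₑ) n
    · exact le_iSup (fun n => ‖b n‖ₑ) n
  · by_cases h : r = ⊤
    · subst h
      simp only [variation_top]
      refine iSup_le fun s => iSup_le fun t => ?_
      rw [add_sub_add_comm]
      refine (enorm_add_le _ _).trans (add_le_add ?_ ?_)
      · exact le_iSup₂ (f := fun s t => ‖a s - a t‖ₑ) s t
      · exact le_iSup₂ (f := fun s t => ‖b s - b t‖ₑ) s t
    · have h1 := one_le_toReal hr h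
      rw [variation_of_ne_top h]
      refine iSup_le fun J => iSup_le fun t => iSup_le fun ht => ?_
      refine le_trans ?_ (add_le_add (jumpSum_le_variation h a ht) (jumpSum_le_variation h b ht))
      refine le_trans ?_ (ENNReal.Lp_add_le univ _ _ h1)
      unfold jumpSum
      gcongr with j
      rw [add_sub_add_comm]
      exact enorm_add_le _ _

theorem variationNorm_zero (hr : 1 ≤ r) : variationNorm r (fun _ : ℕ => (0 : ℂ)) = 0 := by
  unfold variationNorm
  by_cases h : r = ⊤
  · subst h; rw [variation_top]; simp
  · have h1 := one_le_toReal hr h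
    rw [variation_of_ne_top h]
    have : (0 : ℝ) < r.toReal := by linarith
    simp [jumpSum, this]

theorem variationNorm_sum_le (hr : 1 ≤ r) {ι : Type*} (s : Finset ι) (a : ι → ℕ → ℂ) :
    variationNorm r (fun n => ∑ i ∈ s, a i n) ≤ ∑ i ∈ s, variationNorm r (a i) := by
  classical
  induction s using Finset.induction_on with
  | empty => simp [variationNorm_zero hr]
  | insert i s hi ih =>
    simp only [sum_insert hi]
    exact (variationNorm_add_le hr _ _).trans (by gcongr)

theorem enorm_le_variationNorm (a : ℕ → ℂ) (n : ℕ) : ‖a n‖ₑ ≤ variationNorm r a :=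
  (le_iSup (fun n => ‖a n‖ₑ) n).trans le_self_add

theorem variationNorm_top_const (z : ℂ) : variationNorm ⊤ (fun _ : ℕ => z) = ‖z‖ₑ := by
  unfold variationNorm
  rw [variation_top]
  simp

/-- A supremum of functions of finitely many coordinates. Used to pass bounds to pointwise limits,
where continuity is not to be expected. -/
theorem lowerSemicontinuous_variationNorm (r : ℝ≥0∞) :
    LowerSemicontinuous fun a : ℕ → ℂ => variationNorm r a := by
  change LowerSemicontinuous fun a : ℕ → ℂ => (⨆ t : ℕ, ‖a t‖ₑ) + variation r a
  refine LowerSemicontinuous.add ?_ ?_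
  · exact lowerSemicontinuous_iSup fun n =>
      (continuous_enorm.comp (continuous_apply n)).lowerSemicontinuous
  · by_cases h : r = ⊤
    · subst h
      rw [show (variation ⊤ : (ℕ → ℂ) → ℝ≥0∞) = _ from funext variation_top]
      exact lowerSemicontinuous_iSup fun s => lowerSemicontinuous_iSup fun t =>
        (continuous_enorm.comp ((continuous_apply s).sub (continuous_apply t))).lowerSemicontinuous
    · rw [show (variation r : (ℕ → ℂ) → ℝ≥0∞) = _ from funext (variation_of_ne_top h)]
      refine lowerSemicontinuous_iSup fun J => lowerSemicontinuous_iSup fun t =>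
        lowerSemicontinuous_iSup fun _ => Continuous.lowerSemicontinuous ?_
      unfold jumpSum
      refine ENNReal.continuous_rpow_const.comp (continuous_finsetSum _ fun j _ => ?_)
      exact ENNReal.continuous_rpow_const.comp
        (continuous_enorm.comp ((continuous_apply _).sub (continuous_apply _)))

theorem variationNorm_max_le (hr : 1 ≤ r) (a : ℕ → ℂ) (M : ℕ) :
    variationNorm r (fun n => a (max n M)) ≤ variationNorm r a := by
  unfold variationNorm
  refine add_le_add (iSup_le fun n => le_iSup (fun n => ‖a n‖ₑ) (max n M)) ?_
  by_cases h : r = ⊤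
  · subst h
    simp only [variation_top]
    exact iSup_le fun s => iSup_le fun t =>
      le_iSup₂ (f := fun s t => ‖a s - a t‖ₑ) (max s M) (max t M)
  · have h1 := one_le_toReal hr h
    have hr0 : (0 : ℝ) < r.toReal := by linarith
    rw [variation_of_ne_top h]
    refine iSup_le fun J => iSup_le fun t => iSup_le fun ht => ?_
    induction J with
    | zero => simp [jumpSum, hr0]
    | succ J ih =>
      -- If the first two times are both at most `M`, the first increment is zero and `t 0` is
      -- dropped; otherwise the capped times are still strictly increasing.
      by_cases h1 : t 1 ≤ M
      · refine le_trans (le_of_eq ?_) (ih (t ∘ Fin.succ) (ht.comp (Fin.strictMono_succ)))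
        unfold jumpSum
        rw [Fin.sum_univ_succ]
        have h0 : t 0 ≤ M := ((ht (by simp : (0 : Fin (J + 2)) < 1)).le).trans h1
        have e : max (t (Fin.succ 0)) M = max (t (Fin.castSucc 0)) M := by
          rw [Fin.succ_zero_eq_one, Fin.castSucc_zero, max_eq_right h1, max_eq_right h0]
        beta_reduce
        rw [e, sub_self, enorm_zero, ENNReal.zero_rpow_of_pos hr0, zero_add]
        rfl
      · push Not at h1
        have hst : StrictMono fun j => max (t j) M := by
          intro i j hij
          have hj : t 1 ≤ t j := ht.monotone (Fin.one_le_of_ne_zero (Fin.ne_zero_of_lt hij))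
          have h2 := ht hij
          exact max_lt (lt_max_of_lt_left h2) (lt_max_of_lt_left (h1.trans_le hj))
        have h3 := jumpSum_le_variation h a hst
        unfold jumpSum at h3 ⊢
        exact h3

theorem sum_rpow_rpow_le_of_two_le {ι : Type*} (s : Finset ι) (x : ι → ℝ≥0∞) {q : ℝ} (hq : 2 ≤ q) :
    (∑ i ∈ s, x i ^ q) ^ (1 / q) ≤ (∑ i ∈ s, x i ^ (2 : ℝ)) ^ (1 / 2 : ℝ) := by
  set y := (∑ i ∈ s, x i ^ (2 : ℝ)) ^ (1 / 2 : ℝ) with hy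
  have hy2 : y ^ (2 : ℝ) = ∑ i ∈ s, x i ^ (2 : ℝ) := by
    rw [hy, ← ENNReal.rpow_mul]; norm_num
  have hx : ∀ i ∈ s, x i ≤ y := fun i hi => by
    have : x i ^ (2 : ℝ) ≤ y ^ (2 : ℝ) := by
      rw [hy2]; exact single_le_sum (f := fun i => x i ^ (2 : ℝ)) (fun _ _ => zero_le) hi
    exact (ENNReal.rpow_le_rpow_iff (by norm_num)).1 this
  have h : ∑ i ∈ s, x i ^ q ≤ y ^ q := by
    calc ∑ i ∈ s, x i ^ q ≤ ∑ i ∈ s, x i ^ (2 : ℝ) * y ^ (q - 2) := by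
          refine sum_le_sum fun i hi => ?_
          conv_lhs => rw [show q = 2 + (q - 2) by ring,
            ENNReal.rpow_add_of_nonneg _ _ (by norm_num) (by linarith)]
          exact mul_le_mul_right (ENNReal.rpow_le_rpow (hx i hi) (by linarith)) _
      _ = y ^ q := by
          rw [← sum_mul, ← hy2, ← ENNReal.rpow_add_of_nonneg _ _ (by norm_num) (by linarith)]
          congr 1; ring
  calc (∑ i ∈ s, x i ^ q) ^ (1 / q) ≤ (y ^ q) ^ (1 / q) := by gcongr
    _ = y := by rw [← ENNReal.rpow_mul, mul_one_div_cancel (by linarith), ENNReal.rpow_one]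

/-- The Euclidean norm of a sequence. -/
def seqL2 (v : ℕ → ℂ) : ℝ≥0∞ := (∑' b, ‖v b‖ₑ ^ (2 : ℝ)) ^ (1 / 2 : ℝ)

theorem seqL2_rpow_two (v : ℕ → ℂ) : seqL2 v ^ (2 : ℝ) = ∑' b, ‖v b‖ₑ ^ (2 : ℝ) := by
  rw [seqL2, ← ENNReal.rpow_mul]; norm_num

theorem enorm_le_seqL2 (v : ℕ → ℂ) (b : ℕ) : ‖v b‖ₑ ≤ seqL2 v := by
  have : ‖v b‖ₑ ^ (2 : ℝ) ≤ seqL2 v ^ (2 : ℝ) := by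
    rw [seqL2_rpow_two]; exact ENNReal.le_tsum (f := fun b => ‖v b‖ₑ ^ (2 : ℝ)) b
  exact (ENNReal.rpow_le_rpow_iff (by norm_num)).1 this

/-- Only steps that change the block contribute, and along such steps each block is entered at most
once and left at most once. -/
theorem sum_jump_block_le (v : ℕ → ℂ) (L : ℕ) {J : ℕ} {t : Fin (J + 1) → ℕ} (ht : StrictMono t) :
    ∑ j : Fin J, ‖v (t j.succ / L) - v (t j.castSucc / L)‖ₑ ^ (2 : ℝ) ≤ 4 * seqL2 v ^ (2 : ℝ) := by
  let g : Fin (J + 1) → ℕ := fun j => t j / L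
  have hg : Monotone g := fun i j hij => Nat.div_le_div_right (ht.monotone hij)
  set I := univ.filter fun j : Fin J => g j.castSucc < g j.succ with hI
  have hinj1 : Set.InjOn (fun j : Fin J => g j.succ) I := by
    intro i hi j hj hij
    simp only [hI, coe_filter, mem_univ, true_and, Set.mem_ofPred_eq] at hi hj
    simp only at hij
    by_contra hne
    rcases lt_or_gt_of_ne hne with h | h
    · have : g i.succ ≤ g j.castSucc := hg (Fin.succ_le_castSucc_iff.2 h)
      omega
    · have : g j.succ ≤ g i.castSucc := hg (Fin.succ_le_castSucc_iff.2 h)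
      omega
  have hinj2 : Set.InjOn (fun j : Fin J => g j.castSucc) I := by
    intro i hi j hj hij
    simp only [hI, coe_filter, mem_univ, true_and, Set.mem_ofPred_eq] at hi hj
    simp only at hij
    by_contra hne
    rcases lt_or_gt_of_ne hne with h | h
    · have : g i.succ ≤ g j.castSucc := hg (Fin.succ_le_castSucc_iff.2 h)
      omega
    · have : g j.succ ≤ g i.castSucc := hg (Fin.succ_le_castSucc_iff.2 h)
      omega
  have hbound : ∀ φ : Fin J → ℕ, Set.InjOn φ I →
      ∑ j ∈ I, ‖v (φ j)‖ₑ ^ (2 : ℝ) ≤ seqL2 v ^ (2 : ℝ) := by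
    intro φ hφ
    rw [seqL2_rpow_two, ← sum_image (f := fun b => ‖v b‖ₑ ^ (2 : ℝ)) hφ]
    exact ENNReal.sum_le_tsum _
  have hpt : ∀ a b : ℂ, ‖a - b‖ₑ ^ (2 : ℝ) ≤ 2 * (‖a‖ₑ ^ (2 : ℝ) + ‖b‖ₑ ^ (2 : ℝ)) := by
    intro a b
    rw [enorm_rpow_eq_ofReal _ (by norm_num), enorm_rpow_eq_ofReal _ (by norm_num),
      enorm_rpow_eq_ofReal _ (by norm_num), ← ENNReal.ofReal_add (by positivity) (by positivity),
      show (2 : ℝ≥0∞) = ENNReal.ofReal 2 by simp, ← ENNReal.ofReal_mul (by norm_num)]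
    refine ENNReal.ofReal_le_ofReal ?_
    rw [Real.rpow_two, Real.rpow_two, Real.rpow_two]
    have h1 := norm_sub_le a b
    have h2 := norm_nonneg (a - b)
    nlinarith [sq_nonneg (‖a‖ - ‖b‖)]
  calc ∑ j : Fin J, ‖v (t j.succ / L) - v (t j.castSucc / L)‖ₑ ^ (2 : ℝ)
      = ∑ j ∈ I, ‖v (g j.succ) - v (g j.castSucc)‖ₑ ^ (2 : ℝ) := by
        rw [hI, sum_filter_of_ne]
        intro j _ hne
        have hle : g j.castSucc ≤ g j.succ := hg (Fin.castSucc_le_succ j)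
        refine lt_of_le_of_ne hle fun heq => hne ?_
        rw [heq, sub_self, enorm_zero, ENNReal.zero_rpow_of_pos (by norm_num)]
    _ ≤ ∑ j ∈ I, 2 * (‖v (g j.succ)‖ₑ ^ (2 : ℝ) + ‖v (g j.castSucc)‖ₑ ^ (2 : ℝ)) :=
        sum_le_sum fun j _ => hpt _ _
    _ = 2 * (∑ j ∈ I, ‖v (g j.succ)‖ₑ ^ (2 : ℝ) + ∑ j ∈ I, ‖v (g j.castSucc)‖ₑ ^ (2 : ℝ)) := by
        rw [← mul_sum, sum_add_distrib]
    _ ≤ 2 * (seqL2 v ^ (2 : ℝ) + seqL2 v ^ (2 : ℝ)) := by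
        gcongr
        · exact hbound _ hinj1
        · exact hbound _ hinj2
    _ = 4 * seqL2 v ^ (2 : ℝ) := by ring

theorem variationNorm_block_le (hr : 2 ≤ r) (v : ℕ → ℂ) (L : ℕ) :
    variationNorm r (fun n => v (n / L)) ≤ 3 * seqL2 v := by
  unfold variationNorm
  have h1 : ⨆ n, ‖v (n / L)‖ₑ ≤ seqL2 v := iSup_le fun n => enorm_le_seqL2 v _
  have h2 : variation r (fun n => v (n / L)) ≤ 2 * seqL2 v := by
    by_cases h : r = ⊤
    · subst h
      simp only [variation_top]
      refine iSup_le fun s => iSup_le fun t => (enorm_sub_le).trans ?_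
      rw [two_mul]
      exact add_le_add (enorm_le_seqL2 v _) (enorm_le_seqL2 v _)
    · rw [variation_of_ne_top h]
      refine iSup_le fun J => iSup_le fun t => iSup_le fun ht => ?_
      have hr2 : 2 ≤ r.toReal := by
        have := (ENNReal.toReal_le_toReal (by norm_num) h).2 hr
        simpa using this
      refine (sum_rpow_rpow_le_of_two_le _ _ hr2).trans ?_
      calc _ ≤ (4 * seqL2 v ^ (2 : ℝ)) ^ (1 / 2 : ℝ) :=
            ENNReal.rpow_le_rpow (sum_jump_block_le v L ht) (by norm_num)
        _ = 2 * seqL2 v := by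
            rw [show (4 : ℝ≥0∞) = 2 ^ (2 : ℝ) by norm_num, ← ENNReal.mul_rpow_of_nonneg _ _
              (by norm_num), ← ENNReal.rpow_mul]
            norm_num
  calc _ ≤ seqL2 v + 2 * seqL2 v := add_le_add h1 h2
    _ = 3 * seqL2 v := by ring

/-- The increments of `c` over the dyadic intervals of length `2 ^ i` that are left halves. -/
def dyadicJump (c : ℕ → ℂ) (i b : ℕ) : ℂ :=
  if b % 2 = 1 then c (b * 2 ^ i) - c ((b - 1) * 2 ^ i) else 0

/-- Clear the binary digits of `n` from the lowest up: a digit `1` at place `i` moves the argument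
back over one dyadic interval of length `2^i`. -/
theorem sum_dyadicJump (c : ℕ → ℂ) (J n : ℕ) :
    c n = ∑ i ∈ range J, dyadicJump c i (n / 2 ^ i) + c (n / 2 ^ J * 2 ^ J) := by
  induction J with
  | zero => simp
  | succ J ih =>
    rw [sum_range_succ, add_assoc]
    have : dyadicJump c J (n / 2 ^ J) + c (n / 2 ^ (J + 1) * 2 ^ (J + 1)) =
        c (n / 2 ^ J * 2 ^ J) := by
      set b := n / 2 ^ J with hb
      have h2 : n / 2 ^ (J + 1) = b / 2 := by
        rw [pow_succ, ← Nat.div_div_eq_div_mul]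
      rw [h2, dyadicJump]
      split_ifs with h
      · have : b / 2 * 2 ^ (J + 1) = (b - 1) * 2 ^ J := by
          rw [pow_succ, mul_comm (2 ^ J) 2, ← mul_assoc]; congr 1; omega
        rw [this, sub_add_cancel]
      · have : b / 2 * 2 ^ (J + 1) = b * 2 ^ J := by
          rw [pow_succ, mul_comm (2 ^ J) 2, ← mul_assoc]; congr 1; omega
        rw [this, zero_add]
    rw [this]
    exact ih

/-- The Rademacher–Menshov bound: the variation of a sequence that vanishes from `2 ^ J` on. -/
theorem variationNorm_le_dyadic (hr : 2 ≤ r) (c : ℕ → ℂ) (J : ℕ) (hc : ∀ n, 2 ^ J ≤ n → c n = 0) :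
    variationNorm r c ≤ 3 * (∑ i ∈ range J, seqL2 (dyadicJump c i) + ‖c 0‖ₑ) := by
  have hr1 : 1 ≤ r := le_trans (by norm_num) hr
  have e : c = fun n => ∑ i ∈ range J, dyadicJump c i (n / 2 ^ i) +
      (fun b => c (b * 2 ^ J)) (n / 2 ^ J) := funext fun n => sum_dyadicJump c J n
  have hlast : seqL2 (fun b => c (b * 2 ^ J)) = ‖c 0‖ₑ := by
    rw [seqL2, tsum_eq_single 0]
    · rw [zero_mul, ← ENNReal.rpow_mul]; norm_num
    · intro b hb
      rw [hc _ (Nat.le_mul_of_pos_left _ (Nat.pos_of_ne_zero hb)), enorm_zero,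
        ENNReal.zero_rpow_of_pos (by norm_num)]
  conv_lhs => rw [e]
  refine (variationNorm_add_le hr1 _ _).trans ?_
  rw [mul_add, mul_sum]
  refine add_le_add ?_ ?_
  · refine (variationNorm_sum_le hr1 _ _).trans (sum_le_sum fun i _ => ?_)
    exact variationNorm_block_le hr (dyadicJump c i) (2 ^ i)
  · rw [← hlast]
    exact variationNorm_block_le hr (fun b => c (b * 2 ^ J)) (2 ^ J)

/-- The triangle inequality for the integral of a function with values in a finite dimensional
`ℓ^q`. -/
theorem rpow_sum_enorm_integral_le {X : Type*} [MeasurableSpace X] {μ : Measure X} {J : ℕ}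
    {g : Fin J → X → ℂ} (hg : ∀ j, Integrable (g j) μ) {q : ℝ} (hq : 1 ≤ q) :
    (∑ j, ‖∫ t, g j t ∂μ‖ₑ ^ q) ^ (1 / q) ≤ ∫⁻ t, (∑ j, ‖g j t‖ₑ ^ q) ^ (1 / q) ∂μ := by
  have hq0 : 0 < q := by linarith
  have : Fact (1 ≤ ENNReal.ofReal q) := ⟨by rwa [ENNReal.one_le_ofReal]⟩
  have htr : (ENNReal.ofReal q).toReal = q := ENNReal.toReal_ofReal hq0.le
  have hen : ∀ w : PiLp (ENNReal.ofReal q) (fun _ : Fin J => ℂ),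
      ‖w‖ₑ = (∑ j, ‖w j‖ₑ ^ q) ^ (1 / q) := by
    intro w
    rw [← ofReal_norm, PiLp.norm_eq_sum (by rwa [htr]), htr, sum_enorm_rpow_eq_ofReal _ _ hq0.le,
      ENNReal.ofReal_rpow_of_nonneg (by positivity) (by positivity)]
  have h := enorm_integral_le_lintegral_enorm (μ := μ)
    fun t => (WithLp.toLp (ENNReal.ofReal q) fun j => g j t : PiLp (ENNReal.ofReal q)
      (fun _ : Fin J => ℂ))
  rw [hen] at h
  simp only [hen] at h
  refine le_trans (le_of_eq ?_) h
  congr 1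
  refine sum_congr rfl fun j _ => ?_
  rw [eval_integral_piLp (f := fun t => WithLp.toLp (ENNReal.ofReal q) fun j => g j t) hg j]

/-- Minkowski's inequality for the variation norm of an integral. -/
theorem variationNorm_integral_le (hr : 1 ≤ r) {X : Type*} [MeasurableSpace X] {μ : Measure X}
    {h : ℕ → X → ℂ} (hh : ∀ n, Integrable (h n) μ) :
    variationNorm r (fun n => ∫ t, h n t ∂μ) ≤ ∫⁻ t, variationNorm r (fun n => h n t) ∂μ := by
  unfold variationNorm
  refine le_trans (add_le_add ?_ ?_) (le_lintegral_add _ _)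
  · refine iSup_le fun n => (enorm_integral_le_lintegral_enorm _).trans ?_
    exact lintegral_mono fun t => le_iSup (fun n => ‖h n t‖ₑ) n
  · by_cases ht : r = ⊤
    · subst ht
      simp only [variation_top]
      refine iSup_le fun s => iSup_le fun u => ?_
      rw [← integral_sub (hh s) (hh u)]
      refine (enorm_integral_le_lintegral_enorm _).trans (lintegral_mono fun t => ?_)
      exact le_iSup₂ (f := fun s u => ‖h s t - h u t‖ₑ) s u
    · conv_lhs => rw [variation_of_ne_top ht]
      refine iSup_le fun J => iSup_le fun t => iSup_le fun hst => ?_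
      unfold jumpSum
      have e : ∀ j : Fin J, ∫ s, h (t j.succ) s ∂μ - ∫ s, h (t j.castSucc) s ∂μ =
          ∫ s, (h (t j.succ) s - h (t j.castSucc) s) ∂μ := fun j =>
        (integral_sub (hh _) (hh _)).symm
      simp only [e]
      refine (rpow_sum_enorm_integral_le (fun j => (hh _).sub (hh _))
        (one_le_toReal hr ht)).trans (lintegral_mono fun s => ?_)
      exact jumpSum_le_variation ht (fun n => h n s) hst

theorem measurable_variationNorm {X : Type*} [MeasurableSpace X] {h : ℕ → X → ℂ}
    (hh : ∀ n, Measurable (h n)) (r : ℝ≥0∞) : Measurable fun x => variationNorm r fun n => h n x := by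
  unfold variationNorm
  refine Measurable.add (Measurable.iSup fun n => (hh n).enorm) ?_
  by_cases ht : r = ⊤
  · subst ht
    simp only [variation_top]
    exact Measurable.iSup fun s => Measurable.iSup fun u => ((hh s).sub (hh u)).enorm
  · simp only [variation_of_ne_top ht]
    refine Measurable.iSup fun J => Measurable.iSup fun t => Measurable.iSup fun _ => ?_
    unfold jumpSum
    refine (Finset.measurable_sum _ fun j _ => ?_).pow_const _
    exact ((hh _).sub (hh _)).enorm.pow_const _

end Variation

/-! ### Khinchine's inequality. -/

section Khinchine

open Finset BigOperators

variable {ι : Type*} [DecidableEq ι]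

/-- A random sign sum. -/
def signSum (v : ι → ℂ) (s : Finset ι) (ω : ι → ℤˣ) : ℂ := ∑ b ∈ s, ((ω b : ℤ) : ℂ) * v b

/-- Changing one sign. -/
def flipSign (b : ι) : (ι → ℤˣ) ≃ (ι → ℤˣ) where
  toFun ω := Function.update ω b (-ω b)
  invFun ω := Function.update ω b (-ω b)
  left_inv ω := by simp
  right_inv ω := by simp

theorem expect_flipSign [Fintype ι] (b : ι) (F : (ι → ℤˣ) → ℝ) :
    𝔼 ω, F ω = 𝔼 ω, (F ω + F (flipSign b ω)) / 2 := by
  have h : 𝔼 ω, F (flipSign b ω) = 𝔼 ω, F ω := Fintype.expect_equiv (flipSign b) _ _ fun _ => rfl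
  rw [← expect_div, expect_add_distrib, h]
  ring

theorem signSum_insert (v : ι → ℂ) {s : Finset ι} {b : ι} (hb : b ∉ s) (ω : ι → ℤˣ) :
    signSum v (insert b s) ω = ((ω b : ℤ) : ℂ) * v b + signSum v s ω ∧
    signSum v (insert b s) (flipSign b ω) = -(((ω b : ℤ) : ℂ) * v b) + signSum v s ω := by
  unfold signSum
  rw [sum_insert hb, sum_insert hb]
  refine ⟨rfl, ?_⟩
  congr 1
  · simp [flipSign]
  · refine sum_congr rfl fun j hj => ?_
    have : j ≠ b := fun h => hb (h ▸ hj)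
    simp [flipSign, this]

variable [Fintype ι]

theorem norm_sign_mul (ε : ℤˣ) (z : ℂ) : ‖((ε : ℤ) : ℂ) * z‖ = ‖z‖ := by
  rcases Int.units_eq_one_or ε with h | h <;> simp [h]

theorem norm_sq_add_norm_sq_neg (w z : ℂ) : ‖w + z‖ ^ 2 + ‖-w + z‖ ^ 2 = 2 * (‖w‖ ^ 2 + ‖z‖ ^ 2) := by
  have h1 := parallelogram_law_with_norm ℝ z w
  rw [neg_add_eq_sub, add_comm w z]
  nlinarith [h1]

/-- For the squares `s = ‖w + z‖²` and `t = ‖-w + z‖²`, the parallelogram law gives `s + t` and the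
triangle inequality bounds `s - t` by `4‖w‖‖z‖`; then `2(s² + t²) = (s + t)² + (s - t)²`. -/
theorem norm_pow_four_add_le (w z : ℂ) : ‖w + z‖ ^ 4 + ‖-w + z‖ ^ 4 ≤
    2 * (‖z‖ ^ 4 + 6 * ‖z‖ ^ 2 * ‖w‖ ^ 2 + ‖w‖ ^ 4) := by
  have h1 := norm_sq_add_norm_sq_neg w z
  have h2 : |‖w + z‖ ^ 2 - ‖-w + z‖ ^ 2| ≤ 4 * (‖w‖ * ‖z‖) := by
    have a1 := norm_add_le w z
    have a2 : ‖-w + z‖ ≤ ‖w‖ + ‖z‖ := by simpa using norm_add_le (-w) z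
    have b1 : ‖w‖ - ‖z‖ ≤ ‖w + z‖ := by
      have := norm_sub_norm_le w (-z); simpa using this
    have b2 : ‖w‖ - ‖z‖ ≤ ‖-w + z‖ := by
      have := norm_sub_norm_le (-w) (-z); simpa using this
    have c1 : ‖z‖ - ‖w‖ ≤ ‖w + z‖ := by
      have := norm_sub_norm_le z (-w); simpa [add_comm] using this
    have c2 : ‖z‖ - ‖w‖ ≤ ‖-w + z‖ := by
      have := norm_sub_norm_le z w; rwa [neg_add_eq_sub]
    have d1 : (‖w‖ - ‖z‖) ^ 2 ≤ ‖w + z‖ ^ 2 := by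
      rw [sq_le_sq, abs_of_nonneg (norm_nonneg (w + z)), abs_le]; constructor <;> linarith
    have d2 : (‖w‖ - ‖z‖) ^ 2 ≤ ‖-w + z‖ ^ 2 := by
      rw [sq_le_sq, abs_of_nonneg (norm_nonneg (-w + z)), abs_le]; constructor <;> linarith
    have e1 : ‖w + z‖ ^ 2 ≤ (‖w‖ + ‖z‖) ^ 2 := pow_le_pow_left₀ (norm_nonneg _) a1 2
    have e2 : ‖-w + z‖ ^ 2 ≤ (‖w‖ + ‖z‖) ^ 2 := pow_le_pow_left₀ (norm_nonneg _) a2 2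
    rw [abs_le]; constructor <;> nlinarith
  have h3 : (‖w + z‖ ^ 2 - ‖-w + z‖ ^ 2) ^ 2 ≤ (4 * (‖w‖ * ‖z‖)) ^ 2 := by
    rw [sq_le_sq, abs_of_nonneg (by positivity : 0 ≤ 4 * (‖w‖ * ‖z‖))]; exact h2
  nlinarith [h1, h3]

theorem expect_signSum_sq (v : ι → ℂ) (s : Finset ι) :
    𝔼 ω, ‖signSum v s ω‖ ^ 2 = ∑ b ∈ s, ‖v b‖ ^ 2 := by
  induction s using Finset.induction_on with
  | empty => simp [signSum]
  | insert b s hb ih =>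
    rw [expect_flipSign b, sum_insert hb, ← ih]
    have : ∀ ω, (‖signSum v (insert b s) ω‖ ^ 2 + ‖signSum v (insert b s) (flipSign b ω)‖ ^ 2) / 2 =
        ‖v b‖ ^ 2 + ‖signSum v s ω‖ ^ 2 := fun ω => by
      rw [(signSum_insert v hb ω).1, (signSum_insert v hb ω).2, norm_sq_add_norm_sq_neg,
        norm_sign_mul]
      ring
    simp only [this, expect_add_distrib, expect_const univ_nonempty]

theorem expect_signSum_pow_four_le (v : ι → ℂ) (s : Finset ι) :
    𝔼 ω, ‖signSum v s ω‖ ^ 4 ≤ 3 * (∑ b ∈ s, ‖v b‖ ^ 2) ^ 2 := by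
  induction s using Finset.induction_on with
  | empty => simp [signSum]
  | insert b s hb ih =>
    rw [expect_flipSign b, sum_insert hb]
    have : ∀ ω, (‖signSum v (insert b s) ω‖ ^ 4 + ‖signSum v (insert b s) (flipSign b ω)‖ ^ 4) / 2 ≤
        ‖signSum v s ω‖ ^ 4 + 6 * ‖v b‖ ^ 2 * ‖signSum v s ω‖ ^ 2 + ‖v b‖ ^ 4 := fun ω => by
      rw [(signSum_insert v hb ω).1, (signSum_insert v hb ω).2]
      have := norm_pow_four_add_le (((ω b : ℤ) : ℂ) * v b) (signSum v s ω)
      rw [norm_sign_mul] at this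
      linarith
    refine (expect_le_expect fun ω _ => this ω).trans ?_
    rw [expect_add_distrib, expect_add_distrib, ← mul_expect, expect_signSum_sq,
      expect_const univ_nonempty]
    nlinarith [ih, sq_nonneg (‖v b‖ ^ 2)]

/-- For `p ≥ 2` this is Jensen's inequality. For `p < 2` use `u² ≤ T^(2-p) u^p + u⁴/(6σ)` with `T² =
6σ`: by the fourth moment bound the last term averages to at most `σ/2`, which is absorbed on the
left. -/
theorem rpow_le_expect_signSum (v : ι → ℂ) {p : ℝ} (hp : 0 < p) :
    (∑ b, ‖v b‖ ^ 2) ^ (p / 2) ≤ 12 * 𝔼 ω, ‖signSum v univ ω‖ ^ p := by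
  set σ := ∑ b, ‖v b‖ ^ 2 with hσ
  have hσ0 : 0 ≤ σ := by positivity
  have h2 := expect_signSum_sq v univ
  have h4 := expect_signSum_pow_four_le v univ
  rw [← hσ] at h2 h4
  have hEp : 0 ≤ 𝔼 ω, ‖signSum v univ ω‖ ^ p := expect_nonneg fun ω _ => by positivity
  rcases hσ0.eq_or_lt with h0 | hpos
  · rw [← h0, Real.zero_rpow (by positivity)]
    positivity
  rcases le_total 2 p with hp2 | hp2
  · have hJ := Real.rpow_arith_mean_le_arith_mean_rpow (univ : Finset (ι → ℤˣ))
      (fun _ => (1 : ℝ) / Fintype.card (ι → ℤˣ)) (fun ω => ‖signSum v univ ω‖ ^ 2)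
      (fun _ _ => by positivity) (by simp) (fun _ _ => by positivity)
      (p := p / 2) (by linarith)
    have e : ∀ F : (ι → ℤˣ) → ℝ, ∑ ω, 1 / (Fintype.card (ι → ℤˣ) : ℝ) * F ω = 𝔼 ω, F ω := by
      intro F
      rw [Fintype.expect_eq_sum_div_card, ← mul_sum, one_div_mul_eq_div]
    rw [e, e, h2] at hJ
    have e2 : ∀ ω, (‖signSum v univ ω‖ ^ 2) ^ (p / 2) = ‖signSum v univ ω‖ ^ p := fun ω => by
      rw [← Real.rpow_two, ← Real.rpow_mul (norm_nonneg _)]; congr 1; ring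
    simp only [e2] at hJ
    linarith
  · set T := Real.sqrt (6 * σ) with hT
    have hT0 : 0 < T := Real.sqrt_pos.2 (by positivity)
    have hT2 : T ^ 2 = 6 * σ := Real.sq_sqrt (by positivity)
    have hpt : ∀ u : ℝ, 0 ≤ u → u ^ 2 ≤ T ^ (2 - p) * u ^ p + (6 * σ)⁻¹ * u ^ 4 := by
      intro u hu
      rcases hu.eq_or_lt with rfl | hu0
      · have : 0 ≤ T ^ (2 - p) * (0 : ℝ) ^ p := by positivity
        simpa using this
      rcases le_total u T with h | h
      · have : u ^ 2 ≤ T ^ (2 - p) * u ^ p := by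
          calc u ^ 2 = u ^ (2 - p) * u ^ p := by
                rw [← Real.rpow_add hu0, ← Real.rpow_two]; congr 1; ring
            _ ≤ _ := by
                refine mul_le_mul_of_nonneg_right (Real.rpow_le_rpow hu h (by linarith))
                  (by positivity)
        have : 0 ≤ (6 * σ)⁻¹ * u ^ 4 := by positivity
        linarith
      · have h5 : 6 * σ ≤ u ^ 2 := by rw [← hT2]; exact pow_le_pow_left₀ hT0.le h 2
        have : u ^ 2 ≤ (6 * σ)⁻¹ * u ^ 4 := by
          rw [inv_mul_eq_div, le_div_iff₀ (by positivity)]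
          nlinarith [sq_nonneg u]
        have : 0 ≤ T ^ (2 - p) * u ^ p := by positivity
        linarith
    have hE : σ ≤ T ^ (2 - p) * (𝔼 ω, ‖signSum v univ ω‖ ^ p) + (6 * σ)⁻¹ * (3 * σ ^ 2) := by
      calc σ = 𝔼 ω, ‖signSum v univ ω‖ ^ 2 := h2.symm
        _ ≤ 𝔼 ω, (T ^ (2 - p) * ‖signSum v univ ω‖ ^ p + (6 * σ)⁻¹ * ‖signSum v univ ω‖ ^ 4) :=
            expect_le_expect fun ω _ => hpt _ (norm_nonneg _)
        _ = T ^ (2 - p) * (𝔼 ω, ‖signSum v univ ω‖ ^ p) +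
            (6 * σ)⁻¹ * 𝔼 ω, ‖signSum v univ ω‖ ^ 4 := by
            rw [expect_add_distrib, ← mul_expect, ← mul_expect]
        _ ≤ _ := by gcongr
    have e1 : (6 * σ)⁻¹ * (3 * σ ^ 2) = σ / 2 := by field_simp; norm_num
    have e2 : T ^ (2 - p) ≤ 6 * σ ^ ((2 - p) / 2) := by
      have : T ^ (2 - p) = (6 * σ) ^ ((2 - p) / 2) := by
        rw [hT, Real.sqrt_eq_rpow, ← Real.rpow_mul (by positivity)]; congr 1; ring
      rw [this, Real.mul_rpow (by norm_num) hσ0]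
      refine mul_le_mul_of_nonneg_right ?_ (by positivity)
      calc (6 : ℝ) ^ ((2 - p) / 2) ≤ 6 ^ (1 : ℝ) :=
            Real.rpow_le_rpow_of_exponent_le (by norm_num) (by linarith)
        _ = 6 := Real.rpow_one 6
    have e3 : σ = σ ^ (p / 2) * σ ^ ((2 - p) / 2) := by
      rw [← Real.rpow_add hpos]
      conv_lhs => rw [← Real.rpow_one σ]
      congr 1; ring
    have h6 : σ ^ (p / 2) * σ ^ ((2 - p) / 2) ≤
        (12 * 𝔼 ω, ‖signSum v univ ω‖ ^ p) * σ ^ ((2 - p) / 2) := by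
      rw [← e3]
      have := mul_le_mul_of_nonneg_right e2 hEp
      linarith
    exact le_of_mul_le_mul_right h6 (by positivity)

/-- Khinchine's inequality for the square function of a family of functions. -/
theorem tsum_seqL2_rpow_le {X : Type*} {p : ℝ} (hp : 0 < p) {v : X → ℕ → ℂ} {K : ℕ}
    (hv : ∀ x b, K ≤ b → v x b = 0) {D : ℝ≥0∞}
    (h : ∀ ω : ℕ → ℤˣ, ∑' x, ‖∑ b ∈ range K, ((ω b : ℤ) : ℂ) * v x b‖ₑ ^ p ≤ D) :
    ∑' x, seqL2 (v x) ^ p ≤ 12 * D := by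
  have hcard : (0 : ℝ) < Fintype.card (Fin K → ℤˣ) := by exact_mod_cast Fintype.card_pos
  have hpt : ∀ x, seqL2 (v x) ^ p ≤ ∑ ω : Fin K → ℤˣ,
      ENNReal.ofReal (12 / Fintype.card (Fin K → ℤˣ)) *
        ‖signSum (fun b : Fin K => v x b) univ ω‖ₑ ^ p := by
    intro x
    have e1 : seqL2 (v x) ^ p = ENNReal.ofReal ((∑ b : Fin K, ‖v x b‖ ^ 2) ^ (p / 2)) := by
      rw [seqL2, ← ENNReal.rpow_mul, tsum_eq_sum (s := range K) (fun b hb => by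
        rw [hv x b (by simpa using hb), enorm_zero, ENNReal.zero_rpow_of_pos (by norm_num)]),
        sum_enorm_rpow_eq_ofReal _ _ (by norm_num),
        ENNReal.ofReal_rpow_of_nonneg (by positivity) (by positivity), ← Fin.sum_univ_eq_sum_range
          (fun b => ‖v x b‖ ^ (2 : ℝ))]
      simp only [Real.rpow_two]
      congr 2
      ring
    rw [e1, ← mul_sum, sum_enorm_rpow_eq_ofReal _ _ hp.le, ← ENNReal.ofReal_mul (by positivity)]
    refine ENNReal.ofReal_le_ofReal ((rpow_le_expect_signSum _ hp).trans (le_of_eq ?_))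
    rw [Fintype.expect_eq_sum_div_card]
    ring
  refine (ENNReal.tsum_le_tsum hpt).trans ?_
  rw [Summable.tsum_finsetSum fun _ _ => ENNReal.summable]
  have hω : ∀ ω : Fin K → ℤˣ, ∑' x, ENNReal.ofReal (12 / Fintype.card (Fin K → ℤˣ)) *
      ‖signSum (fun b : Fin K => v x b) univ ω‖ₑ ^ p ≤
      ENNReal.ofReal (12 / Fintype.card (Fin K → ℤˣ)) * D := by
    intro ω
    rw [ENNReal.tsum_mul_left]
    refine mul_le_mul_right ?_ _
    refine le_trans (le_of_eq ?_) (h fun b => if hb : b < K then ω ⟨b, hb⟩ else 1)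
    refine tsum_congr fun x => ?_
    rw [signSum, ← Fin.sum_univ_eq_sum_range (fun b =>
      (((if hb : b < K then ω ⟨b, hb⟩ else 1 : ℤˣ) : ℤ) : ℂ) * v x b)]
    simp
  refine (sum_le_sum fun ω _ => hω ω).trans ?_
  rw [sum_const, card_univ, nsmul_eq_mul, ← mul_assoc, ← ENNReal.ofReal_natCast,
    ← ENNReal.ofReal_mul hcard.le, mul_div_cancel₀ _ hcard.ne']
  simp

end Khinchine

/-! ### Sums over the integer lattice -/

/-- The embedding of `ℤ^d` into `ℝ^d`. -/
def lat {d : ℕ} (n : Fin d → ℤ) : EuclideanSpace ℝ (Fin d) := WithLp.toLp 2 fun i => (n i : ℝ)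

theorem lat_sub {d : ℕ} (n k : Fin d → ℤ) : lat (n - k) = lat n - lat k := by
  ext i; simp [lat]

theorem lat_neg {d : ℕ} (n : Fin d → ℤ) : lat (-n) = -lat n := by
  ext i; simp [lat]

theorem lat_zero {d : ℕ} : lat (0 : Fin d → ℤ) = 0 := by
  ext i; simp [lat]

theorem one_le_norm_lat {d : ℕ} {n : Fin d → ℤ} (hn : n ≠ 0) : 1 ≤ ‖lat n‖ := by
  obtain ⟨i, hi⟩ := Function.ne_iff.1 hn
  refine le_trans ?_ (PiLp.norm_apply_le (lat n) i)
  have : (1 : ℤ) ≤ |n i| := Int.one_le_abs hi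
  simpa [lat] using (by exact_mod_cast this : (1 : ℝ) ≤ |(n i : ℝ)|)

/-- Comparison with the integral over the disjoint balls of radius `1/2` about the shifted lattice
points, on which `1 + ‖x‖` at most doubles. -/
theorem tsum_lat_one_add_norm_le (d : ℕ) : ∃ C : ℝ≥0∞, C ≠ ⊤ ∧ ∀ u : EuclideanSpace ℝ (Fin d),
    ∑' n : Fin d → ℤ, ENNReal.ofReal ((1 + ‖lat n + u‖) ^ (-((d : ℝ) + 1))) ≤ C := by
  set h : EuclideanSpace ℝ (Fin d) → ℝ := fun x => (1 + ‖x‖) ^ (-((d : ℝ) + 1)) with hh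
  have hInt : ∫⁻ x, ENNReal.ofReal (h x) < ⊤ :=
    finite_integral_one_add_norm (by simp)
  set v : ℝ≥0∞ := volume (Metric.ball (0 : EuclideanSpace ℝ (Fin d)) (1 / 2)) with hv
  have hv0 : v ≠ 0 := (Metric.measure_ball_pos volume _ (by norm_num)).ne'
  have hvt : v ≠ ⊤ := measure_ball_lt_top.ne
  refine ⟨v⁻¹ * (ENNReal.ofReal (2 ^ ((d : ℝ) + 1)) * ∫⁻ x, ENNReal.ofReal (h x)), ?_, fun u => ?_⟩
  · exact ENNReal.mul_ne_top (ENNReal.inv_ne_top.2 hv0)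
      (ENNReal.mul_ne_top ENNReal.ofReal_ne_top hInt.ne)
  have hpt : ∀ n : Fin d → ℤ, v * ENNReal.ofReal (h (lat n + u)) ≤
      ENNReal.ofReal (2 ^ ((d : ℝ) + 1)) * ∫⁻ x in Metric.ball (lat n + u) (1 / 2),
        ENNReal.ofReal (h x) := by
    intro n
    rw [← lintegral_const_mul' _ _ ENNReal.ofReal_ne_top,
      hv, ← Measure.addHaar_ball_center volume (lat n + u), mul_comm, ← setLIntegral_const]
    refine setLIntegral_mono' measurableSet_ball fun x hx => ?_
    rw [← ENNReal.ofReal_mul (by positivity)]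
    refine ENNReal.ofReal_le_ofReal ?_
    have hx' : ‖x‖ ≤ ‖lat n + u‖ + 1 / 2 := by
      have := norm_le_norm_add_norm_sub' x (lat n + u)
      rw [Metric.mem_ball, dist_eq_norm] at hx
      linarith
    have h1 : 1 + ‖x‖ ≤ 2 * (1 + ‖lat n + u‖) := by
      have := norm_nonneg (lat n + u)
      linarith
    have h2 : (2 * (1 + ‖lat n + u‖)) ^ (-((d : ℝ) + 1)) ≤ (1 + ‖x‖) ^ (-((d : ℝ) + 1)) :=
      Real.rpow_le_rpow_of_nonpos (by positivity) h1 (by linarith [(Nat.cast_nonneg d : (0 : ℝ) ≤ d)])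
    rw [Real.mul_rpow (by norm_num) (by positivity), Real.rpow_neg (by norm_num)] at h2
    have h3 : (0 : ℝ) < 2 ^ ((d : ℝ) + 1) := by positivity
    calc (1 + ‖lat n + u‖) ^ (-((d : ℝ) + 1)) = 2 ^ ((d : ℝ) + 1) *
        ((2 ^ ((d : ℝ) + 1))⁻¹ * (1 + ‖lat n + u‖) ^ (-((d : ℝ) + 1))) := by
          field_simp
      _ ≤ _ := by gcongr
  have hdisj : Pairwise (Function.onFun Disjoint
      fun n : Fin d → ℤ => Metric.ball (lat n + u) (1 / 2)) := by
    intro n k hnk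
    refine Metric.ball_disjoint_ball ?_
    rw [dist_eq_norm, add_sub_add_right_eq_sub, ← lat_sub]
    have := one_le_norm_lat (sub_ne_zero.2 hnk)
    linarith
  have hsum : v * ∑' n : Fin d → ℤ, ENNReal.ofReal (h (lat n + u)) ≤
      ENNReal.ofReal (2 ^ ((d : ℝ) + 1)) * ∫⁻ x, ENNReal.ofReal (h x) := by
    rw [← ENNReal.tsum_mul_left]
    refine (ENNReal.tsum_le_tsum hpt).trans ?_
    rw [ENNReal.tsum_mul_left, ← lintegral_iUnion (fun n => measurableSet_ball) hdisj]
    gcongr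
    exact Measure.restrict_le_self
  calc ∑' n : Fin d → ℤ, ENNReal.ofReal (h (lat n + u))
      = v⁻¹ * (v * ∑' n : Fin d → ℤ, ENNReal.ofReal (h (lat n + u))) := by
        rw [← mul_assoc, ENNReal.inv_mul_cancel hv0 hvt, one_mul]
    _ ≤ _ := by gcongr

theorem tsum_lat_schwartz_le {d : ℕ} (W : SchwartzMap (EuclideanSpace ℝ (Fin d)) ℂ) :
    ∃ C : ℝ≥0∞, C ≠ ⊤ ∧ ∀ u : EuclideanSpace ℝ (Fin d),
      ∑' n : Fin d → ℤ, ‖W (lat n + u)‖ₑ ≤ C := by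
  obtain ⟨C, hC, h⟩ := tsum_lat_one_add_norm_le d
  set D : ℝ := 2 ^ (d + 1) * (Finset.Iic (d + 1, 0)).sup
    (fun m => SchwartzMap.seminorm ℝ m.1 m.2) W with hD
  refine ⟨ENNReal.ofReal D * C, ENNReal.mul_ne_top ENNReal.ofReal_ne_top hC, fun u => ?_⟩
  refine le_trans ?_ (mul_le_mul_right (h u) _)
  rw [← ENNReal.tsum_mul_left]
  refine ENNReal.tsum_le_tsum fun n => ?_
  have h1 := SchwartzMap.one_add_le_sup_seminorm_apply (𝕜 := ℝ) (m := (d + 1, 0))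
    (k := d + 1) (n := 0) le_rfl le_rfl W (lat n + u)
  rw [norm_iteratedFDeriv_zero] at h1
  have hpos : 0 < 1 + ‖lat n + u‖ := by positivity
  have h0 : 0 ≤ D := le_trans (by positivity) h1
  rw [← ENNReal.ofReal_mul h0, ← ofReal_norm]
  refine ENNReal.ofReal_le_ofReal ?_
  rw [Real.rpow_neg hpos.le, ← div_eq_mul_inv, le_div_iff₀ (by positivity), mul_comm]
  have h2 : (1 + ‖lat n + u‖) ^ ((d : ℝ) + 1) = (1 + ‖lat n + u‖) ^ (d + 1) := by
    exact_mod_cast Real.rpow_natCast (1 + ‖lat n + u‖) (d + 1)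
  rw [h2]
  exact h1

/-- Jensen's inequality for the weight `w`, not normalised; Hölder applied to `f w^(1/p)` and
`w^(1/q)`. -/
theorem rpow_lintegral_mul_le {X : Type*} [MeasurableSpace X] {μ : Measure X} {p : ℝ} (hp : 1 < p)
    {f w : X → ℝ≥0∞} (hf : AEMeasurable f μ) (hw : AEMeasurable w μ) :
    (∫⁻ x, f x * w x ∂μ) ^ p ≤ (∫⁻ x, w x ∂μ) ^ (p - 1) * ∫⁻ x, f x ^ p * w x ∂μ := by
  have hpq := Real.HolderConjugate.conjExponent hp
  set q := Real.conjExponent p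
  have hp0 : 0 < p := by linarith
  have hqp := hpq.symm.pos
  have h := ENNReal.lintegral_mul_le_Lp_mul_Lq μ hpq (f := fun x => f x * w x ^ (1 / p))
    (g := fun x => w x ^ (1 / q)) (hf.mul (hw.pow_const _)) (hw.pow_const _)
  have e1 : ∀ x, ((fun x => f x * w x ^ (1 / p)) * fun x => w x ^ (1 / q)) x = f x * w x := by
    intro x
    simp only [Pi.mul_apply]
    rw [mul_assoc, ← ENNReal.rpow_add_of_nonneg _ _ (by positivity) (by positivity)]
    have : 1 / p + 1 / q = 1 := by simpa using hpq.inv_add_inv_eq_one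
    rw [this, ENNReal.rpow_one]
  simp_rw [e1] at h
  have e2 : ∀ x, (f x * w x ^ (1 / p)) ^ p = f x ^ p * w x := by
    intro x
    rw [ENNReal.mul_rpow_of_nonneg _ _ hp0.le, ← ENNReal.rpow_mul, one_div_mul_cancel hp0.ne',
      ENNReal.rpow_one]
  have e3 : ∀ x, (w x ^ (1 / q)) ^ q = w x := by
    intro x
    rw [← ENNReal.rpow_mul, one_div_mul_cancel hqp.ne', ENNReal.rpow_one]
  simp_rw [e2, e3] at h
  refine (ENNReal.rpow_le_rpow h hp0.le).trans (le_of_eq ?_)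
  rw [ENNReal.mul_rpow_of_nonneg _ _ hp0.le, ← ENNReal.rpow_mul, ← ENNReal.rpow_mul,
    one_div_mul_cancel hp0.ne', ENNReal.rpow_one, mul_comm]
  congr 2
  have : 1 / q = 1 - 1 / p := by
    have := hpq.inv_add_inv_eq_one
    simp only [one_div]; linarith
  rw [this]; field_simp

theorem variationNorm_const_mul_le (r : ℝ≥0∞) (hr : 1 ≤ r) (c : ℂ) (a : ℕ → ℂ) :
    variationNorm r (fun n => c * a n) ≤ ‖c‖ₑ * variationNorm r a := by
  unfold variationNorm
  rw [mul_add]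
  refine add_le_add ?_ ?_
  · refine iSup_le fun n => ?_
    rw [enorm_mul]
    exact mul_le_mul_right (le_iSup (fun n => ‖a n‖ₑ) n) _
  · by_cases ht : r = ⊤
    · subst ht
      rw [variation_top, variation_top]
      refine iSup_le fun s => iSup_le fun t => ?_
      rw [← mul_sub, enorm_mul]
      exact mul_le_mul_right (le_iSup₂ (f := fun s t => ‖a s - a t‖ₑ) s t) _
    · have hr1 : 0 < r.toReal := by linarith [one_le_toReal hr ht]
      rw [variation, if_neg ht]
      refine iSup_le fun J => iSup_le fun t => iSup_le fun hmono => ?_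
      have : (∑ j : Fin J, ‖c * a (t j.succ) - c * a (t j.castSucc)‖ₑ ^ r.toReal) ^ (1 / r.toReal)
          = ‖c‖ₑ * (∑ j : Fin J, ‖a (t j.succ) - a (t j.castSucc)‖ₑ ^ r.toReal) ^
            (1 / r.toReal) := by
        simp_rw [← mul_sub, enorm_mul, ENNReal.mul_rpow_of_nonneg _ _ hr1.le]
        rw [← Finset.mul_sum, ENNReal.mul_rpow_of_nonneg _ _ (by positivity), ← ENNReal.rpow_mul,
          mul_one_div_cancel hr1.ne', ENNReal.rpow_one]
      rw [this]
      gcongr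
      rw [variation, if_neg ht]
      exact le_iSup_of_le J (le_iSup_of_le t (le_iSup_of_le hmono le_rfl))

/-! ### A sampling pair -/

theorem norm_le_of_abs_le_one {d : ℕ} {ξ : EuclideanSpace ℝ (Fin d)} (h : ∀ i, |ξ i| ≤ 1) :
    ‖ξ‖ ≤ d + 1 := by
  rw [EuclideanSpace.norm_eq]
  have h1 : ∑ i, ‖ξ i‖ ^ 2 ≤ (d : ℝ) := by
    calc ∑ i, ‖ξ i‖ ^ 2 ≤ ∑ _i : Fin d, (1 : ℝ) :=
          Finset.sum_le_sum fun i _ => by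
            have := h i
            rw [Real.norm_eq_abs]
            exact pow_le_one₀ (abs_nonneg _) this
      _ = d := by simp
  have h2 : (d : ℝ) ≤ (d + 1) ^ 2 := by nlinarith [(Nat.cast_nonneg d : (0 : ℝ) ≤ d)]
  exact Real.sqrt_le_iff.2 ⟨by positivity, h1.trans h2⟩

/-- For `‖v‖‖ξ‖ ≤ 1/6` the phase is at most `π/3`, so the real part of the transform is at least
half the integral of the bump. -/
theorem fourierInv_bump_ne_zero {d : ℕ} {R : ℝ} (φ : ContDiffBump (0 : EuclideanSpace ℝ (Fin d)))
    (hφ : φ.rOut * R ≤ 1 / 6) {ξ : EuclideanSpace ℝ (Fin d)} (hξ : ‖ξ‖ ≤ R) :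
    𝓕⁻ (fun x => (φ x : ℂ)) ξ ≠ 0 := by
  intro h0
  have hInt : Integrable (fun x => (φ x : ℂ)) := φ.integrable.ofReal
  have hint2 : Integrable (fun v : EuclideanSpace ℝ (Fin d) =>
      Complex.exp (↑(2 * Real.pi * inner ℝ v ξ) * Complex.I) • (φ v : ℂ)) := by
    refine hInt.bdd_mul (c := 1) ?_ (ae_of_all _ fun v => ?_)
    · exact Continuous.aestronglyMeasurable (by fun_prop)
    · rw [Complex.norm_exp_ofReal_mul_I]
  rw [Real.fourierInv_eq'] at h0
  have h1 := congrArg Complex.re h0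
  rw [← Complex.reCLM_apply, ← Complex.reCLM.integral_comp_comm hint2, Complex.zero_re] at h1
  have h2 : ∫ v, (1 / 2) * φ v ≤ ∫ v : EuclideanSpace ℝ (Fin d), Complex.reCLM
      (Complex.exp (↑(2 * Real.pi * inner ℝ v ξ) * Complex.I) • (φ v : ℂ)) := by
    refine integral_mono (φ.integrable.const_mul _) (Complex.reCLM.integrable_comp hint2) fun v => ?_
    simp only [Complex.reCLM_apply, smul_eq_mul, Complex.re_mul_ofReal, Complex.exp_ofReal_mul_I_re]
    rcases lt_or_ge ‖v‖ φ.rOut with hv | hv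
    · refine mul_le_mul_of_nonneg_right ?_ φ.nonneg
      have hin : |inner ℝ v ξ| ≤ 1 / 6 := by
        refine (abs_real_inner_le_norm v ξ).trans (le_trans ?_ hφ)
        exact mul_le_mul hv.le hξ (norm_nonneg _) φ.rOut_pos.le
      rw [← Real.cos_pi_div_three, ← Real.cos_abs (2 * Real.pi * inner ℝ v ξ)]
      refine Real.cos_le_cos_of_nonneg_of_le_pi (abs_nonneg _) (by linarith [Real.pi_pos]) ?_
      rw [abs_mul, abs_of_pos (by positivity : 0 < 2 * Real.pi)]
      nlinarith [Real.pi_pos]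
    · have : φ v = 0 := φ.zero_of_le_dist (by simpa using hv)
      simp [this]
  rw [integral_const_mul, h1] at h2
  linarith [φ.integral_pos (μ := volume)]

/-- `φ` spreads lattice data to a test function on `ℝ^d`, and convolution with `W` undoes its effect
on frequencies in the unit cube. `φ` is a bump so narrow that its transform has no zero on a ball
containing the cube, and `W` is the transform of a cutoff divided by that function. -/
theorem exists_sampling_pair (d : ℕ) : ∃ φ W : SchwartzMap (EuclideanSpace ℝ (Fin d)) ℂ,
    HasCompactSupport φ ∧ ∀ ξ : EuclideanSpace ℝ (Fin d), (∀ i, |ξ i| ≤ 1) →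
      𝓕⁻ (φ : EuclideanSpace ℝ (Fin d) → ℂ) ξ * 𝓕⁻ (W : EuclideanSpace ℝ (Fin d) → ℂ) ξ = 1 := by
  have hd : (0 : ℝ) < d + 2 := by positivity
  let b : ContDiffBump (0 : EuclideanSpace ℝ (Fin d)) :=
    ⟨1 / (12 * (d + 2)), 1 / (6 * (d + 2)), by positivity, by gcongr; norm_num⟩
  let c : ContDiffBump (0 : EuclideanSpace ℝ (Fin d)) :=
    ⟨d + 1, d + 2, by positivity, by linarith⟩
  have hbR : b.rOut * (d + 2) ≤ 1 / 6 := by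
    change 1 / (6 * ((d : ℝ) + 2)) * (d + 2) ≤ 1 / 6
    field_simp; rfl
  have hbs : HasCompactSupport fun x => (b x : ℂ) := b.hasCompactSupport.comp_left (g := Complex.ofReal) rfl
  have hbc : ContDiff ℝ ((⊤ : ℕ∞) : WithTop ℕ∞) fun x => (b x : ℂ) :=
    Complex.ofRealCLM.contDiff.comp b.contDiff
  let φ : SchwartzMap (EuclideanSpace ℝ (Fin d)) ℂ := hbs.toSchwartzMap hbc
  let w : EuclideanSpace ℝ (Fin d) → ℂ := fun ξ => (c ξ : ℂ) / 𝓕⁻ (fun x => (b x : ℂ)) ξ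
  have hws : HasCompactSupport w := by
    have : HasCompactSupport fun ξ => (c ξ : ℂ) := c.hasCompactSupport.comp_left (g := Complex.ofReal) rfl
    simp only [w, div_eq_mul_inv]
    exact this.mul_right
  have hden : ContDiff ℝ ((⊤ : ℕ∞) : WithTop ℕ∞) (𝓕⁻ fun x => (b x : ℂ)) := by
    have := (𝓕⁻ φ).smooth ⊤
    rwa [SchwartzMap.fourierInv_coe] at this
  have hwc : ContDiff ℝ ((⊤ : ℕ∞) : WithTop ℕ∞) w := by
    rw [contDiff_iff_contDiffAt]
    intro ξ
    rcases le_or_gt ‖ξ‖ (d + 2) with hξ | hξ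
    · have h1 : ContDiff ℝ ((⊤ : ℕ∞) : WithTop ℕ∞) fun ξ => (c ξ : ℂ) :=
        Complex.ofRealCLM.contDiff.comp c.contDiff
      simp only [w, div_eq_mul_inv]
      exact h1.contDiffAt.mul (hden.contDiffAt.inv (fourierInv_bump_ne_zero b hbR hξ))
    · refine (contDiffAt_const (c := (0 : ℂ))).congr_of_eventuallyEq ?_
      have : ∀ᶠ η in nhds ξ, (d : ℝ) + 2 < ‖η‖ := continuous_norm.continuousAt.eventually_const_lt hξ
      filter_upwards [this] with η hη
      have : c η = 0 := c.zero_of_le_dist (by simpa using hη.le)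
      simp [w, this]
  let ws : SchwartzMap (EuclideanSpace ℝ (Fin d)) ℂ := hws.toSchwartzMap hwc
  refine ⟨φ, 𝓕 ws, hbs, fun ξ hξ => ?_⟩
  have h1 : 𝓕⁻ ((𝓕 ws : SchwartzMap (EuclideanSpace ℝ (Fin d)) ℂ) :
      EuclideanSpace ℝ (Fin d) → ℂ) = w := by
    rw [← SchwartzMap.fourierInv_coe, FourierTransform.fourierInv_fourier_eq]
    rfl
  have hle := norm_le_of_abs_le_one hξ
  have h2 : c ξ = 1 := c.one_of_mem_closedBall (by simpa using hle)
  rw [h1]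
  change 𝓕⁻ (fun x => (b x : ℂ)) ξ * w ξ = 1
  simp only [w, h2, Complex.ofReal_one]
  exact mul_one_div_cancel (fourierInv_bump_ne_zero b hbR (by linarith))

/-! ### Multiplier operators on `ℝ^d` -/

/-- Bounded measurable symbols supported in the cube of side `2ρ`. -/
structure CubeSymbol {d : ℕ} (ρ : ℝ) (m : EuclideanSpace ℝ (Fin d) → ℂ) : Prop where
  measurable : Measurable m
  bounded : ∃ M : ℝ, ∀ ξ, ‖m ξ‖ ≤ M
  abs_le : ∀ ξ, m ξ ≠ 0 → ∀ i, |ξ i| ≤ ρ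

theorem CubeSymbol.integrable {d : ℕ} {ρ : ℝ} {m : EuclideanSpace ℝ (Fin d) → ℂ}
    (hm : CubeSymbol ρ m) : Integrable m := by
  obtain ⟨M, hM⟩ := hm.bounded
  have hcpt : IsCompact (WithLp.ofLp ⁻¹' (Set.pi Set.univ fun _ => Set.Icc (-ρ) ρ) :
      Set (EuclideanSpace ℝ (Fin d))) :=
    (EuclideanSpace.equiv (Fin d) ℝ).toHomeomorph.isCompact_preimage.2
      (isCompact_univ_pi fun _ => isCompact_Icc)
  rw [← integrableOn_iff_integrable_of_support_subset (s := WithLp.ofLp ⁻¹'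
    (Set.pi Set.univ fun _ => Set.Icc (-ρ) ρ))]
  · refine Measure.integrableOn_of_bounded (M := M) hcpt.measure_lt_top.ne
      hm.measurable.aestronglyMeasurable (ae_of_all _ hM)
  · intro ξ hξ i _
    exact _root_.abs_le.1 (hm.abs_le ξ hξ i)

theorem CubeSymbol.mul {d : ℕ} {ρ : ℝ} {m h : EuclideanSpace ℝ (Fin d) → ℂ} (hm : CubeSymbol ρ m)
    (hh : Measurable h) (hb : ∃ M : ℝ, ∀ ξ, ‖h ξ‖ ≤ M) : CubeSymbol ρ fun ξ => m ξ * h ξ := by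
  refine ⟨hm.measurable.mul hh, ?_, fun ξ h => hm.abs_le ξ (left_ne_zero_of_mul h)⟩
  obtain ⟨M, hM⟩ := hm.bounded
  obtain ⟨K, hK⟩ := hb
  refine ⟨M * K, fun ξ => ?_⟩
  rw [norm_mul]
  exact mul_le_mul (hM ξ) (hK ξ) (norm_nonneg _) ((norm_nonneg _).trans (hM ξ))

theorem norm_fourierInv_le {d : ℕ} (F : EuclideanSpace ℝ (Fin d) → ℂ) (ξ : EuclideanSpace ℝ (Fin d)) :
    ‖𝓕⁻ F ξ‖ ≤ ∫ x, ‖F x‖ := by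
  rw [Real.fourierInv_eq_fourier_neg]
  exact VectorFourier.norm_fourierIntegral_le_integral_norm _ _ _ _ _

theorem continuous_fourier {d : ℕ} {F : EuclideanSpace ℝ (Fin d) → ℂ} (hF : Integrable F) :
    Continuous (𝓕 F) :=
  VectorFourier.fourierIntegral_continuous Real.continuous_fourierChar continuous_inner hF

theorem continuous_fourierInv {d : ℕ} {F : EuclideanSpace ℝ (Fin d) → ℂ} (hF : Integrable F) :
    Continuous (𝓕⁻ F) := by
  rw [show 𝓕⁻ F = fun w => 𝓕 F (-w) from funext fun w => Real.fourierInv_eq_fourier_neg F w]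
  exact (continuous_fourier hF).comp continuous_neg

theorem integrable_of_mem_testR {d : ℕ} {F : EuclideanSpace ℝ (Fin d) → ℂ} (hF : F ∈ testR d) :
    Integrable F := hF.1.continuous.integrable_of_hasCompactSupport hF.2

theorem CubeSymbol.mul_fourierInv {d : ℕ} {ρ : ℝ} {m F : EuclideanSpace ℝ (Fin d) → ℂ}
    (hm : CubeSymbol ρ m) (hF : Integrable F) : CubeSymbol ρ fun ξ => m ξ * 𝓕⁻ F ξ :=
  hm.mul (continuous_fourierInv hF).measurable ⟨_, norm_fourierInv_le F⟩

theorem continuous_TR {d : ℕ} {ρ : ℝ} {m F : EuclideanSpace ℝ (Fin d) → ℂ} (hm : CubeSymbol ρ m)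
    (hF : Integrable F) : Continuous (TR m F) :=
  continuous_fourier (hm.mul_fourierInv hF).integrable

theorem fourier_reflect {d : ℕ} (W : EuclideanSpace ℝ (Fin d) → ℂ) (x ξ : EuclideanSpace ℝ (Fin d)) :
    𝓕 (fun s => W (x - s)) ξ = Real.fourierChar (-inner ℝ x ξ) • 𝓕⁻ W ξ := by
  rw [Real.fourier_eq, Real.fourierInv_eq, Circle.smul_def, ← integral_smul,
    ← integral_sub_left_eq_self (fun s => Real.fourierChar (-inner ℝ s ξ) • W (x - s)) volume x]
  refine integral_congr_ae (ae_of_all _ fun s => ?_)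
  simp only [sub_sub_cancel]
  rw [← Circle.smul_def, smul_smul, ← AddChar.map_add_eq_mul, inner_sub_left]
  congr 2; ring_nf

/-- The superposition of lattice translates of `φ` with coefficients `g`. -/
def latSum {d : ℕ} (S : Finset (Fin d → ℤ)) (g : (Fin d → ℤ) → ℂ)
    (φ : EuclideanSpace ℝ (Fin d) → ℂ) (y : EuclideanSpace ℝ (Fin d)) : ℂ :=
  ∑ k ∈ S, g k * φ (y - lat k)

theorem fourierInv_latSum {d : ℕ} (S : Finset (Fin d → ℤ)) (g : (Fin d → ℤ) → ℂ)
    {φ : EuclideanSpace ℝ (Fin d) → ℂ} (hφ : Integrable φ) (ξ : EuclideanSpace ℝ (Fin d)) :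
    𝓕⁻ (latSum S g φ) ξ = ∑ k ∈ S, g k * (Real.fourierChar (inner ℝ (lat k) ξ) * 𝓕⁻ φ ξ) := by
  have hi : ∀ k : Fin d → ℤ, Integrable fun v : EuclideanSpace ℝ (Fin d) =>
      Real.fourierChar (inner ℝ v ξ) • φ (v - lat k) := by
    intro k
    have h1 : Integrable fun v : EuclideanSpace ℝ (Fin d) => φ (v - lat k) := hφ.comp_sub_right _
    have := (Real.fourierIntegral_convergent_iff (-ξ)).2 h1
    simpa [inner_neg_right] using this
  rw [Real.fourierInv_eq]
  have : ∀ v : EuclideanSpace ℝ (Fin d), Real.fourierChar (inner ℝ v ξ) • latSum S g φ v =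
      ∑ k ∈ S, g k * (Real.fourierChar (inner ℝ v ξ) • φ (v - lat k)) := by
    intro v
    rw [latSum, Finset.smul_sum]
    refine Finset.sum_congr rfl fun k _ => ?_
    rw [mul_smul_comm]
  simp_rw [this]
  rw [integral_finsetSum _ fun k _ => (hi k).const_mul _]
  refine Finset.sum_congr rfl fun k _ => ?_
  rw [integral_const_mul, Real.fourierInv_eq,
    ← integral_add_right_eq_self (fun v => Real.fourierChar (inner ℝ v ξ) • φ (v - lat k)) (lat k)]
  congr 1
  rw [← integral_const_mul]
  refine integral_congr_ae (ae_of_all _ fun v => ?_)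
  simp only [add_sub_cancel_right, inner_add_left, AddChar.map_add_eq_mul, Circle.smul_def,
    smul_eq_mul, Circle.coe_mul]
  ring

theorem latSum_mem_testR {d : ℕ} (S : Finset (Fin d → ℤ)) (g : (Fin d → ℤ) → ℂ)
    {φ : EuclideanSpace ℝ (Fin d) → ℂ} (hφ : φ ∈ testR d) : latSum S g φ ∈ testR d := by
  have e : latSum S g φ = fun y => ∑ k ∈ S, g k * φ (y - lat k) := rfl
  obtain ⟨hφ1, hφ2⟩ := hφ
  refine ⟨?_, ?_⟩
  · rw [e]
    have h : ∀ k : Fin d → ℤ, ContDiff ℝ ((⊤ : ℕ∞) : WithTop ℕ∞) fun y => g k * φ (y - lat k) :=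
      fun k => (contDiff_const (c := g k)).mul
        (ContDiff.comp hφ1 (contDiff_id.sub (contDiff_const (c := lat k))))
    exact ContDiff.sum fun k _ => h k
  · have : ∀ k ∈ S, HasCompactSupport fun y => g k * φ (y - lat k) := fun k _ =>
      (hφ2.comp_homeomorph (Homeomorph.subRight (lat k))).mul_left
    rw [e]
    clear e
    induction S using Finset.induction_on with
    | empty => exact HasCompactSupport.zero
    | insert a s ha ih =>
      simp only [Finset.sum_insert ha]
      exact (this a (by simp)).add (ih fun k hk => this k (by simp [hk]))

/-- On the support of `m` the transforms of `φ` and `W` multiply to `1`, so smearing with `φ`,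
applying the multiplier and convolving with `W` reproduces the kernel of `m` acting on lattice data.
-/
theorem sampling_identity {d : ℕ} {φ W : SchwartzMap (EuclideanSpace ℝ (Fin d)) ℂ}
    (hφW : ∀ ξ : EuclideanSpace ℝ (Fin d), (∀ i, |ξ i| ≤ 1) →
      𝓕⁻ (φ : EuclideanSpace ℝ (Fin d) → ℂ) ξ * 𝓕⁻ (W : EuclideanSpace ℝ (Fin d) → ℂ) ξ = 1)
    {m : EuclideanSpace ℝ (Fin d) → ℂ} (hm : CubeSymbol 1 m) (S : Finset (Fin d → ℤ))
    (g : (Fin d → ℤ) → ℂ) (x : EuclideanSpace ℝ (Fin d)) :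
    ∑ k ∈ S, g k * 𝓕 m (x - lat k) = ∫ s, W (x - s) * TR m (latSum S g φ) s := by
  have hF : Integrable (latSum S g φ) := by
    refine integrable_finsetSum _ fun k _ => ?_
    exact (φ.integrable.comp_sub_right _).const_mul _
  have hG := (hm.mul_fourierInv hF).integrable
  have hW : Integrable fun s => W (x - s) := W.integrable.comp_sub_left x
  have h := VectorFourier.integral_fourierIntegral_smul_eq_flip (e := Real.fourierChar)
    (μ := volume) (ν := volume) (L := innerₗ (EuclideanSpace ℝ (Fin d))) (f := fun ξ => m ξ * 𝓕⁻ (latSum S g φ) ξ)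
    (g := fun s => W (x - s)) Real.continuous_fourierChar continuous_inner hG hW
  rw [flip_innerₗ] at h
  have e1 : ∫ s, W (x - s) * TR m (latSum S g φ) s = ∫ ξ, (m ξ * 𝓕⁻ (latSum S g φ) ξ) *
      𝓕 (fun s => W (x - s)) ξ := by
    refine Eq.trans ?_ h
    refine integral_congr_ae (ae_of_all _ fun s => ?_)
    exact mul_comm _ _
  rw [e1]
  have e2 : ∀ ξ, (m ξ * 𝓕⁻ (latSum S g φ) ξ) * 𝓕 (fun s => W (x - s)) ξ =
      ∑ k ∈ S, g k * (Real.fourierChar (-inner ℝ ξ (x - lat k)) • m ξ) := by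
    intro ξ
    rw [fourierInv_latSum S g φ.integrable, fourier_reflect]
    by_cases hξ : m ξ = 0
    · simp [hξ]
    have h1 := hφW ξ (hm.abs_le ξ hξ)
    rw [Finset.mul_sum, Finset.sum_mul]
    refine Finset.sum_congr rfl fun k _ => ?_
    have h2 : (Real.fourierChar (-inner ℝ ξ (x - lat k)) : ℂ) =
        Real.fourierChar (inner ℝ (lat k) ξ) * Real.fourierChar (-inner ℝ x ξ) := by
      rw [← Circle.coe_mul, ← AddChar.map_add_eq_mul, inner_sub_right, real_inner_comm x ξ,
        real_inner_comm (lat k) ξ]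
      congr 2; ring
    rw [Circle.smul_def, Circle.smul_def, h2, smul_eq_mul, smul_eq_mul]
    linear_combination (g k * Real.fourierChar (inner ℝ (lat k) ξ) * Real.fourierChar (-inner ℝ x ξ) * m ξ) * h1
  simp_rw [e2]
  rw [integral_finsetSum]
  · refine Finset.sum_congr rfl fun k _ => ?_
    rw [integral_const_mul, Real.fourier_eq]
  · intro k _
    exact ((Real.fourierIntegral_convergent_iff (x - lat k)).2 hm.integrable).const_mul _

/-! ### Transference from `ℝ^d` to the lattice -/

/-- The `L^p → L^p(V^r)` bound for a sequence of multiplier operators on `ℝ^d`. -/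
def VarBdd {d : ℕ} (p : ℝ) (r : ℝ≥0∞) (m : ℕ → EuclideanSpace ℝ (Fin d) → ℂ) (A : ℝ≥0∞) : Prop :=
  ∀ F ∈ testR d, ∫⁻ x, variationNorm r (fun n => TR (m n) F x) ^ p ≤ A ^ p * ∫⁻ x, ‖F x‖ₑ ^ p

/-- The infimum defining the norm is attained: divide by the norm of `f` if it is not zero, and use
any admissible constant if it is. -/
theorem eLpNorm_le_opNorm_mul {X ε : Type*} [MeasurableSpace X] [ENorm ε] {μ : Measure X}
    {D : Set (X → ℂ)} {p : ℝ≥0∞} {S : (X → ℂ) → X → ε} (hS : opNorm μ D p S ≠ ⊤) {f : X → ℂ}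
    (hf : f ∈ D) (hfp : eLpNorm f p μ ≠ ⊤) :
    eLpNorm (S f) p μ ≤ opNorm μ D p S * eLpNorm f p μ := by
  set T : Set ℝ≥0∞ := {C : ℝ≥0∞ | ∀ f ∈ D, eLpNorm (S f) p μ ≤ C * eLpNorm f p μ} with hT
  have hne : T.Nonempty := by
    by_contra h
    rw [Set.not_nonempty_iff_eq_empty] at h
    exact hS (by change sInf T = ⊤; rw [h, sInf_empty])
  rcases eq_or_ne (eLpNorm f p μ) 0 with h0 | h0
  · obtain ⟨C, hC⟩ := hne
    have := hC f hf
    rw [h0, mul_zero] at this ⊢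
    exact this
  · rw [← ENNReal.div_le_iff h0 hfp]
    exact le_sInf fun C hC => (ENNReal.div_le_iff h0 hfp).2 (hC f hf)

theorem eLpNorm_ne_top_of_mem_testR {d : ℕ} {F : EuclideanSpace ℝ (Fin d) → ℂ} (hF : F ∈ testR d)
    (p : ℝ≥0∞) : eLpNorm F p volume ≠ ⊤ :=
  (hF.1.continuous.memLp_of_hasCompactSupport hF.2).2.ne

theorem eLpNorm_ofReal_rpow {X ε : Type*} [MeasurableSpace X] [ENorm ε] {μ : Measure X} {p : ℝ}
    (hp : 0 < p) (f : X → ε) : eLpNorm f (ENNReal.ofReal p) μ ^ p = ∫⁻ x, ‖f x‖ₑ ^ p ∂μ := by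
  rw [eLpNorm_eq_lintegral_rpow_enorm_toReal (by simpa using hp) ENNReal.ofReal_ne_top,
    ENNReal.toReal_ofReal hp.le, ← ENNReal.rpow_mul, one_div_mul_cancel hp.ne', ENNReal.rpow_one]

theorem lintegral_le_of_opNorm {d : ℕ} {p : ℝ} (hp : 0 < p) {ε : Type*} [ENorm ε]
    {S : (EuclideanSpace ℝ (Fin d) → ℂ) → EuclideanSpace ℝ (Fin d) → ε}
    (hS : opNorm volume (testR d) (ENNReal.ofReal p) S ≠ ⊤) {F : EuclideanSpace ℝ (Fin d) → ℂ}
    (hF : F ∈ testR d) : ∫⁻ x, ‖S F x‖ₑ ^ p ≤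
      opNorm volume (testR d) (ENNReal.ofReal p) S ^ p * ∫⁻ x, ‖F x‖ₑ ^ p := by
  rw [← eLpNorm_ofReal_rpow hp, ← eLpNorm_ofReal_rpow hp, ← ENNReal.mul_rpow_of_nonneg _ _ hp.le]
  exact ENNReal.rpow_le_rpow (eLpNorm_le_opNorm_mul hS hF (eLpNorm_ne_top_of_mem_testR hF _)) hp.le

theorem varBdd_constA {d : ℕ} {p : ℝ} (hp : 0 < p) {r : ℝ≥0∞}
    {m : ℕ → EuclideanSpace ℝ (Fin d) → ℂ} (hA : constA (ENNReal.ofReal p) r m ≠ ⊤) :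
    VarBdd p r m (constA (ENNReal.ofReal p) r m) := fun _ hF => by
  simpa [constA] using lintegral_le_of_opNorm hp hA hF

theorem lintegral_latSum_rpow_le {d : ℕ} {p : ℝ} (hp : 1 < p)
    (φ : SchwartzMap (EuclideanSpace ℝ (Fin d)) ℂ) : ∃ C : ℝ≥0∞, C ≠ ⊤ ∧
      ∀ (S : Finset (Fin d → ℤ)) (g : (Fin d → ℤ) → ℂ),
        ∫⁻ y, ‖latSum S g φ y‖ₑ ^ p ≤ C * ∑ k ∈ S, ‖g k‖ₑ ^ p := by
  obtain ⟨C, hC, hφ⟩ := tsum_lat_schwartz_le φ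
  have hI : ∫⁻ y, ‖φ y‖ₑ ≠ ⊤ := φ.integrable.2.ne
  refine ⟨C ^ (p - 1) * ∫⁻ y, ‖φ y‖ₑ,
    ENNReal.mul_ne_top (ENNReal.rpow_ne_top_of_nonneg (by linarith) hC) hI, fun S g => ?_⟩
  have hpt : ∀ y, ‖latSum S g φ y‖ₑ ^ p ≤ C ^ (p - 1) * ∑ k ∈ S, ‖g k‖ₑ ^ p * ‖φ (y - lat k)‖ₑ := by
    intro y
    let f : (Fin d → ℤ) → ℝ≥0∞ := fun k => if k ∈ S then ‖g k‖ₑ else 0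
    have h := rpow_lintegral_mul_le (μ := Measure.count) hp (f := f)
      (w := fun k => ‖φ (y - lat k)‖ₑ) (measurable_of_countable _).aemeasurable
      (measurable_of_countable _).aemeasurable
    rw [lintegral_count, lintegral_count, lintegral_count] at h
    have e1 : ∑' k, f k * ‖φ (y - lat k)‖ₑ = ∑ k ∈ S, ‖g k‖ₑ * ‖φ (y - lat k)‖ₑ := by
      rw [tsum_eq_sum (s := S) fun k hk => by simp [f, hk]]
      exact Finset.sum_congr rfl fun k hk => by simp [f, hk]
    have e2 : ∑' k, f k ^ p * ‖φ (y - lat k)‖ₑ = ∑ k ∈ S, ‖g k‖ₑ ^ p * ‖φ (y - lat k)‖ₑ := by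
      rw [tsum_eq_sum (s := S) fun k hk => by
        simp [f, hk, ENNReal.zero_rpow_of_pos (by linarith : 0 < p)]]
      exact Finset.sum_congr rfl fun k hk => by simp [f, hk]
    have e3 : ∑' k, ‖φ (y - lat k)‖ₑ ≤ C := by
      refine le_trans (le_of_eq ?_) (hφ y)
      rw [← (Equiv.neg (Fin d → ℤ)).tsum_eq]
      refine tsum_congr fun k => ?_
      rw [Equiv.neg_apply, lat_neg, sub_neg_eq_add, add_comm]
    rw [e1, e2] at h
    refine le_trans (ENNReal.rpow_le_rpow ?_ (by linarith)) (h.trans ?_)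
    · refine (enorm_sum_le _ _).trans (le_of_eq ?_)
      exact Finset.sum_congr rfl fun k _ => enorm_mul _ _
    · exact mul_le_mul_left (ENNReal.rpow_le_rpow e3 (by linarith)) _
  refine (lintegral_mono hpt).trans ?_
  rw [lintegral_const_mul' _ _ (ENNReal.rpow_ne_top_of_nonneg (by linarith) hC),
    lintegral_finsetSum' _ fun k _ => ?_, mul_assoc]
  · refine mul_le_mul_right ?_ _
    rw [Finset.mul_sum]
    refine Finset.sum_le_sum fun k _ => ?_
    rw [lintegral_const_mul' _ _ (by simp [ENNReal.rpow_eq_top_iff]; intro; linarith),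
      lintegral_sub_right_eq_self (fun y => ‖φ y‖ₑ), mul_comm]
  · exact ((φ.continuous.comp (continuous_id.sub continuous_const)).enorm.measurable.const_mul
      _).aemeasurable

/-- By `sampling_identity` the lattice operators are averages, with weight `W`, of the operators on
`ℝ^d` applied to one test function. Minkowski's inequality moves the variation norm inside, Jensen's
the power, and the sum of `W` over lattice translates is bounded. -/
theorem exists_transference (d : ℕ) {p : ℝ} (hp : 1 < p) : ∃ C : ℝ≥0∞, C ≠ ⊤ ∧
    ∀ r : ℝ≥0∞, 1 ≤ r → ∀ m : ℕ → EuclideanSpace ℝ (Fin d) → ℂ, (∀ n, CubeSymbol 1 (m n)) →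
    ∀ A : ℝ≥0∞, VarBdd p r m A → ∀ (u : EuclideanSpace ℝ (Fin d)) (S : Finset (Fin d → ℤ))
      (g : (Fin d → ℤ) → ℂ),
      ∑' x : Fin d → ℤ, variationNorm r (fun n => ∑ k ∈ S, g k * 𝓕 (m n) (lat x + u - lat k)) ^ p ≤
        C * A ^ p * ∑ k ∈ S, ‖g k‖ₑ ^ p := by
  obtain ⟨φ, W, hφc, hφW⟩ := exists_sampling_pair d
  obtain ⟨C₁, hC₁, h₁⟩ := lintegral_latSum_rpow_le hp φ
  obtain ⟨C₂, hC₂, h₂⟩ := tsum_lat_schwartz_le W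
  have hI : ∫⁻ y, ‖W y‖ₑ ≠ ⊤ := W.integrable.2.ne
  have hp0 : 0 ≤ p - 1 := by linarith
  refine ⟨(∫⁻ y, ‖W y‖ₑ) ^ (p - 1) * (C₂ * C₁), ENNReal.mul_ne_top
    (ENNReal.rpow_ne_top_of_nonneg hp0 hI) (ENNReal.mul_ne_top hC₂ hC₁),
    fun r hr m hm A hA u S g => ?_⟩
  have hF : latSum S g φ ∈ testR d := latSum_mem_testR S g ⟨φ.smooth ⊤, hφc⟩
  have hFi := integrable_of_mem_testR hF
  set f : EuclideanSpace ℝ (Fin d) → ℝ≥0∞ :=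
    fun s => variationNorm r fun n => TR (m n) (latSum S g φ) s with hf
  have hfm : Measurable f :=
    measurable_variationNorm (fun n => (continuous_TR (hm n) hFi).measurable) r
  have hpt : ∀ X : EuclideanSpace ℝ (Fin d),
      variationNorm r (fun n => ∑ k ∈ S, g k * 𝓕 (m n) (X - lat k)) ^ p ≤
      (∫⁻ y, ‖W y‖ₑ) ^ (p - 1) * ∫⁻ s, f s ^ p * ‖W (X - s)‖ₑ := by
    intro X
    simp_rw [sampling_identity hφW (hm _) S g X]
    have hbd : ∀ n, ∃ M : ℝ, ∀ s, ‖TR (m n) (latSum S g φ) s‖ ≤ M := fun n =>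
      ⟨_, fun s => VectorFourier.norm_fourierIntegral_le_integral_norm _ _ _ _ s⟩
    have hInt : ∀ n, Integrable fun s => W (X - s) * TR (m n) (latSum S g φ) s := by
      intro n
      obtain ⟨M, hM⟩ := hbd n
      exact (W.integrable.comp_sub_left X).mul_bdd (c := M)
        (continuous_TR (hm n) hFi).aestronglyMeasurable (ae_of_all _ hM)
    have h3 : variationNorm r (fun n => ∫ s, W (X - s) * TR (m n) (latSum S g φ) s) ≤
        ∫⁻ s, f s * ‖W (X - s)‖ₑ := by
      refine (variationNorm_integral_le hr hInt).trans (lintegral_mono fun s => ?_)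
      rw [mul_comm]
      exact variationNorm_const_mul_le r hr _ _
    refine (ENNReal.rpow_le_rpow h3 (by linarith)).trans ?_
    refine (rpow_lintegral_mul_le hp hfm.aemeasurable ?_).trans ?_
    · exact (W.continuous.comp (continuous_const.sub continuous_id)).enorm.measurable.aemeasurable
    · rw [lintegral_sub_left_eq_self (fun y => ‖W y‖ₑ)]
  calc ∑' x : Fin d → ℤ,
        variationNorm r (fun n => ∑ k ∈ S, g k * 𝓕 (m n) (lat x + u - lat k)) ^ p
      ≤ ∑' x : Fin d → ℤ,
        (∫⁻ y, ‖W y‖ₑ) ^ (p - 1) * ∫⁻ s, f s ^ p * ‖W (lat x + u - s)‖ₑ :=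
        ENNReal.tsum_le_tsum fun x => hpt _
    _ = (∫⁻ y, ‖W y‖ₑ) ^ (p - 1) * ∫⁻ s, f s ^ p * ∑' x : Fin d → ℤ, ‖W (lat x + u - s)‖ₑ := by
        rw [ENNReal.tsum_mul_left, ← lintegral_tsum]
        · simp_rw [ENNReal.tsum_mul_left]
        · intro x
          exact ((hfm.pow_const p).mul
            (W.continuous.comp (continuous_const.sub continuous_id)).enorm.measurable).aemeasurable
    _ ≤ (∫⁻ y, ‖W y‖ₑ) ^ (p - 1) * ∫⁻ s, f s ^ p * C₂ := by
        gcongr with s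
        simpa [add_sub_assoc] using h₂ (u - s)
    _ ≤ (∫⁻ y, ‖W y‖ₑ) ^ (p - 1) * ((A ^ p * (C₁ * ∑ k ∈ S, ‖g k‖ₑ ^ p)) * C₂) := by
        rw [lintegral_mul_const' _ _ hC₂]
        gcongr
        exact (hA _ hF).trans (mul_le_mul_right (h₁ S g) _)
    _ = _ := by ring

/-! ### Dilations -/

theorem lintegral_comp_smul_pos {d : ℕ} {R : ℝ} (hR : 0 < R) (f : EuclideanSpace ℝ (Fin d) → ℝ≥0∞) :
    ENNReal.ofReal (R ^ d) * ∫⁻ x, f (R • x) = ∫⁻ x, f x := by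
  have h1 := lintegral_map_equiv (μ := volume) f (Homeomorph.smulOfNeZero R hR.ne' :
    EuclideanSpace ℝ (Fin d) ≃ₜ EuclideanSpace ℝ (Fin d)).toMeasurableEquiv
  have h2 : Measure.map (Homeomorph.smulOfNeZero R hR.ne' :
      EuclideanSpace ℝ (Fin d) ≃ₜ EuclideanSpace ℝ (Fin d)).toMeasurableEquiv volume =
      ENNReal.ofReal |(R ^ Module.finrank ℝ (EuclideanSpace ℝ (Fin d)))⁻¹| • volume :=
    Measure.map_addHaar_smul volume hR.ne'
  rw [h2, lintegral_smul_measure, finrank_euclideanSpace_fin] at h1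
  change _ = ∫⁻ x, f (R • x) at h1
  rw [← h1, abs_of_pos (by positivity), smul_eq_mul, ← mul_assoc, ← ENNReal.ofReal_mul (by positivity),
    mul_inv_cancel₀ (by positivity), ENNReal.ofReal_one, one_mul]

theorem fourier_comp_smul {d : ℕ} {R : ℝ} (hR : 0 < R) (h : EuclideanSpace ℝ (Fin d) → ℂ)
    (y : EuclideanSpace ℝ (Fin d)) :
    𝓕 (fun ξ => h (R⁻¹ • ξ)) y = (R : ℂ) ^ d * 𝓕 h (R • y) := by
  rw [Real.fourier_eq, Real.fourier_eq]
  have h1 := Measure.integral_comp_inv_smul (volume : Measure (EuclideanSpace ℝ (Fin d)))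
    (fun ξ => Real.fourierChar (-inner ℝ ξ (R • y)) • h ξ) R
  rw [finrank_euclideanSpace_fin, abs_of_pos (by positivity)] at h1
  have h2 : ∀ ξ : EuclideanSpace ℝ (Fin d), inner ℝ (R⁻¹ • ξ) (R • y) = inner ℝ ξ y := by
    intro ξ
    rw [real_inner_smul_left, real_inner_smul_right, ← mul_assoc, inv_mul_cancel₀ hR.ne', one_mul]
  simp_rw [h2] at h1
  rw [h1, Complex.real_smul]
  simp

theorem fourierInv_comp_smul {d : ℕ} {R : ℝ} (hR : 0 < R) (h : EuclideanSpace ℝ (Fin d) → ℂ)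
    (y : EuclideanSpace ℝ (Fin d)) :
    𝓕⁻ (fun ξ => h (R⁻¹ • ξ)) y = (R : ℂ) ^ d * 𝓕⁻ h (R • y) := by
  rw [Real.fourierInv_eq_fourier_neg, Real.fourierInv_eq_fourier_neg, fourier_comp_smul hR, smul_neg]

theorem TR_comp_smul {d : ℕ} {R : ℝ} (hR : 0 < R) (m F : EuclideanSpace ℝ (Fin d) → ℂ)
    (x : EuclideanSpace ℝ (Fin d)) :
    TR (fun ξ => m (R⁻¹ • ξ)) F x = TR m (fun y => F (R⁻¹ • y)) (R • x) := by
  unfold TR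
  have hRc : (R : ℂ) ^ d ≠ 0 := pow_ne_zero _ (by exact_mod_cast hR.ne')
  have h1 := fourier_comp_smul hR (fun η => m η * 𝓕⁻ F (R • η)) x
  simp only [smul_smul, mul_inv_cancel₀ hR.ne', one_smul] at h1
  rw [h1]
  simp_rw [fourierInv_comp_smul hR]
  rw [Real.fourier_eq, Real.fourier_eq, ← integral_const_mul]
  refine integral_congr_ae (ae_of_all _ fun ξ => ?_)
  simp only [Circle.smul_def, smul_eq_mul]
  ring

theorem comp_smul_mem_testR {d : ℕ} {R : ℝ} (hR : R ≠ 0) {F : EuclideanSpace ℝ (Fin d) → ℂ}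
    (hF : F ∈ testR d) : (fun y => F (R • y)) ∈ testR d := by
  obtain ⟨h1, h2⟩ := hF
  exact ⟨ContDiff.comp h1 (contDiff_const_smul R), h2.comp_homeomorph (Homeomorph.smulOfNeZero R hR)⟩

theorem VarBdd.comp_smul {d : ℕ} {p : ℝ} {r : ℝ≥0∞} {m : ℕ → EuclideanSpace ℝ (Fin d) → ℂ}
    {A : ℝ≥0∞} (h : VarBdd p r m A) {R : ℝ} (hR : 0 < R) :
    VarBdd p r (fun n ξ => m n (R⁻¹ • ξ)) A := by
  intro F hF
  have h1 := h _ (comp_smul_mem_testR (inv_ne_zero hR.ne') hF)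
  simp_rw [TR_comp_smul hR]
  have h2 := lintegral_comp_smul_pos hR
    fun y => variationNorm r (fun n => TR (m n) (fun y => F (R⁻¹ • y)) y) ^ p
  have h3 := lintegral_comp_smul_pos hR fun y => ‖F (R⁻¹ • y)‖ₑ ^ p
  simp only [smul_smul, inv_mul_cancel₀ hR.ne', one_smul] at h3
  rw [← h2, ← h3, mul_left_comm] at h1
  exact (ENNReal.mul_le_mul_iff_right (by simpa using by positivity) ENNReal.ofReal_ne_top).1 h1

theorem CubeSymbol.comp_smul {d : ℕ} {ρ R : ℝ} (hR : 0 < R) {m : EuclideanSpace ℝ (Fin d) → ℂ}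
    (hm : CubeSymbol ρ m) : CubeSymbol (R * ρ) fun ξ => m (R⁻¹ • ξ) := by
  refine ⟨hm.measurable.comp (measurable_const_smul R⁻¹), ?_, fun ξ hξ i => ?_⟩
  · obtain ⟨M, hM⟩ := hm.bounded
    exact ⟨M, fun ξ => hM _⟩
  · have := hm.abs_le _ hξ i
    rw [PiLp.smul_apply, smul_eq_mul, abs_mul, abs_of_pos (inv_pos.2 hR)] at this
    rwa [inv_mul_le_iff₀ hR] at this

theorem CubeSymbol.mono {d : ℕ} {ρ σ : ℝ} (h : ρ ≤ σ) {m : EuclideanSpace ℝ (Fin d) → ℂ}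
    (hm : CubeSymbol ρ m) : CubeSymbol σ m :=
  ⟨hm.measurable, hm.bounded, fun ξ hξ i => (hm.abs_le ξ hξ i).trans h⟩

theorem exists_transference_smul (d : ℕ) {p : ℝ} (hp : 1 < p) : ∃ C : ℝ≥0∞, C ≠ ⊤ ∧
    ∀ r : ℝ≥0∞, 1 ≤ r → ∀ m : ℕ → EuclideanSpace ℝ (Fin d) → ℂ, ∀ R ρ : ℝ, 0 < R → R * ρ ≤ 1 →
    (∀ n, CubeSymbol ρ (m n)) →
    ∀ A : ℝ≥0∞, VarBdd p r m A → ∀ (u : EuclideanSpace ℝ (Fin d)) (S : Finset (Fin d → ℤ))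
      (g : (Fin d → ℤ) → ℂ),
      ∑' x : Fin d → ℤ, variationNorm r (fun n => ∑ k ∈ S, g k *
        ((R : ℂ) ^ d * 𝓕 (m n) (R • (lat x + u - lat k)))) ^ p ≤
        C * A ^ p * ∑ k ∈ S, ‖g k‖ₑ ^ p := by
  obtain ⟨C, hC, h⟩ := exists_transference d hp
  refine ⟨C, hC, fun r hr m R ρ hR hρ hm A hA u S g => ?_⟩
  have := h r hr (fun n ξ => m n (R⁻¹ • ξ)) (fun n => ((hm n).comp_smul hR).mono hρ) A
    (hA.comp_smul hR) u S g
  simp_rw [fourier_comp_smul hR] at this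
  exact this

/-! ### Pointwise bounds for the kernels -/

theorem VarBdd.single {d : ℕ} {p : ℝ} (hp : 0 ≤ p) {r : ℝ≥0∞}
    {m : ℕ → EuclideanSpace ℝ (Fin d) → ℂ} {A : ℝ≥0∞} (h : VarBdd p r m A) (n : ℕ) :
    VarBdd p ⊤ (fun _ => m n) A := fun F hF => by
  refine le_trans (lintegral_mono fun x => ?_) (h F hF)
  rw [variationNorm_top_const]
  exact ENNReal.rpow_le_rpow (enorm_le_variationNorm (fun n => TR (m n) F x) n) hp

/-- Rescaled transference for a unit mass, looking at a single lattice point, with the offset chosen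
to reach `y`. This bound makes the series in `constB` converge absolutely. -/
theorem exists_enorm_fourier_le (d : ℕ) {p : ℝ} (hp : 1 < p) : ∃ C : ℝ≥0∞, C ≠ ⊤ ∧
    ∀ (m : EuclideanSpace ℝ (Fin d) → ℂ) (ρ : ℝ), 0 < ρ → CubeSymbol ρ m →
    ∀ A : ℝ≥0∞, VarBdd p ⊤ (fun _ => m) A → ∀ y, ‖𝓕 m y‖ₑ ≤ C * A * ENNReal.ofReal (ρ ^ d) := by
  obtain ⟨C, hC, h⟩ := exists_transference_smul d hp
  have hp0 : 0 < p := by linarith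
  refine ⟨C ^ (1 / p), ENNReal.rpow_ne_top_of_nonneg (by positivity) hC, fun m ρ hρ hm A hA y => ?_⟩
  have h1 := h ⊤ le_top (fun _ => m) ρ⁻¹ ρ (inv_pos.2 hρ) (by rw [inv_mul_cancel₀ hρ.ne'])
    (fun _ => hm) A hA (ρ • y) {0} (fun _ => 1)
  simp only [Finset.sum_singleton, variationNorm_top_const, lat_zero, sub_zero, one_mul,
    enorm_one, ENNReal.one_rpow, mul_one] at h1
  have h2 := (ENNReal.le_tsum (0 : Fin d → ℤ)).trans h1
  rw [lat_zero, zero_add, smul_smul, inv_mul_cancel₀ hρ.ne', one_smul] at h2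
  have h3 := ENNReal.rpow_le_rpow h2 (by positivity : 0 ≤ 1 / p)
  rw [← ENNReal.rpow_mul, mul_one_div_cancel hp0.ne', ENNReal.rpow_one,
    ENNReal.mul_rpow_of_nonneg _ _ (by positivity), ← ENNReal.rpow_mul, mul_one_div_cancel hp0.ne',
    ENNReal.rpow_one, enorm_mul] at h3
  have h4 : ‖((ρ⁻¹ : ℝ) : ℂ) ^ d‖ₑ = (ENNReal.ofReal (ρ ^ d))⁻¹ := by
    rw [← ofReal_norm, norm_pow, Complex.norm_real, Real.norm_of_nonneg (by positivity), inv_pow,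
      ENNReal.ofReal_inv_of_pos (by positivity)]
  rw [h4] at h3
  have h5 : ENNReal.ofReal (ρ ^ d) ≠ 0 := by simpa using by positivity
  rw [mul_comm, ← div_eq_mul_inv] at h3
  exact (ENNReal.div_le_iff h5 ENNReal.ofReal_ne_top).1 h3

theorem enorm_TR_le {d : ℕ} {ρ : ℝ} {m : EuclideanSpace ℝ (Fin d) → ℂ} (hm : CubeSymbol ρ m)
    {D : ℝ≥0∞} (hD : ∀ y, ‖𝓕 m y‖ₑ ≤ D) {F : EuclideanSpace ℝ (Fin d) → ℂ} (hF : Integrable F)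
    (x : EuclideanSpace ℝ (Fin d)) : ‖TR m F x‖ₑ ≤ D * ∫⁻ y, ‖F y‖ₑ := by
  have hW : Integrable fun s => F (x - s) := hF.comp_sub_left x
  have h := VectorFourier.integral_fourierIntegral_smul_eq_flip (e := Real.fourierChar)
    (μ := volume) (ν := volume) (L := innerₗ (EuclideanSpace ℝ (Fin d))) (f := m)
    (g := fun s => F (x - s)) Real.continuous_fourierChar continuous_inner hm.integrable hW
  rw [flip_innerₗ] at h
  have e1 : TR m F x = ∫ s, 𝓕 m s * F (x - s) := by
    refine Eq.trans ?_ h.symm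
    unfold TR
    rw [Real.fourier_eq]
    refine integral_congr_ae (ae_of_all _ fun ξ => ?_)
    change Real.fourierChar (-inner ℝ ξ x) • (m ξ * 𝓕⁻ F ξ) = m ξ * 𝓕 (fun s => F (x - s)) ξ
    rw [fourier_reflect, mul_smul_comm, real_inner_comm]
  rw [e1]
  refine (enorm_integral_le_lintegral_enorm _).trans ?_
  rw [← lintegral_sub_left_eq_self (fun y => ‖F y‖ₑ) x,
    ← lintegral_const_mul'' _ hW.1.enorm]
  refine lintegral_mono fun s => ?_
  rw [enorm_mul]
  exact mul_le_mul_left (hD s) _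

/-! ### Randomised sums of differences -/

theorem CubeSymbol.const_mul {d : ℕ} {ρ : ℝ} {m : EuclideanSpace ℝ (Fin d) → ℂ}
    (hm : CubeSymbol ρ m) (c : ℂ) : CubeSymbol ρ fun ξ => c * m ξ := by
  simpa only [mul_comm] using hm.mul (h := fun _ => c) measurable_const ⟨‖c‖, fun _ => le_rfl⟩

theorem CubeSymbol.sub {d : ℕ} {ρ : ℝ} {m m' : EuclideanSpace ℝ (Fin d) → ℂ}
    (hm : CubeSymbol ρ m) (hm' : CubeSymbol ρ m') : CubeSymbol ρ (m - m') := by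
  obtain ⟨M, hM⟩ := hm.bounded
  obtain ⟨M', hM'⟩ := hm'.bounded
  refine ⟨hm.measurable.sub hm'.measurable, ⟨M + M', fun ξ =>
    (norm_sub_le _ _).trans (add_le_add (hM ξ) (hM' ξ))⟩, fun ξ hξ => ?_⟩
  by_cases h : m ξ = 0
  · exact hm'.abs_le ξ fun h' => hξ (by simp [h, h'])
  · exact hm.abs_le ξ h

theorem CubeSymbol.sum {d : ℕ} {ρ : ℝ} {ι : Type*} {s : Finset ι}
    {m : ι → EuclideanSpace ℝ (Fin d) → ℂ} (hm : ∀ i, CubeSymbol ρ (m i)) :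
    CubeSymbol ρ fun ξ => ∑ i ∈ s, m i ξ := by
  choose M hM using fun i => (hm i).bounded
  refine ⟨Finset.measurable_sum _ fun i _ => (hm i).measurable, ⟨∑ i ∈ s, M i, fun ξ =>
    (norm_sum_le _ _).trans (Finset.sum_le_sum fun i _ => hM i ξ)⟩, fun ξ hξ => ?_⟩
  obtain ⟨i, -, hi⟩ := Finset.exists_ne_zero_of_sum_ne_zero hξ
  exact (hm i).abs_le ξ hi

theorem TR_sum {d : ℕ} {ρ : ℝ} {ι : Type*} (s : Finset ι)
    {m : ι → EuclideanSpace ℝ (Fin d) → ℂ} (hm : ∀ i, CubeSymbol ρ (m i)) (c : ι → ℂ)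
    {F : EuclideanSpace ℝ (Fin d) → ℂ} (hF : Integrable F) (x : EuclideanSpace ℝ (Fin d)) :
    TR (fun ξ => ∑ i ∈ s, c i * m i ξ) F x = ∑ i ∈ s, c i * TR (m i) F x := by
  unfold TR
  simp_rw [Real.fourier_eq]
  have : ∀ ξ : EuclideanSpace ℝ (Fin d), Real.fourierChar (-inner ℝ ξ x) •
      ((∑ i ∈ s, c i * m i ξ) * 𝓕⁻ F ξ) =
      ∑ i ∈ s, c i * (Real.fourierChar (-inner ℝ ξ x) • (m i ξ * 𝓕⁻ F ξ)) := by
    intro ξ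
    rw [Finset.sum_mul, Finset.smul_sum]
    refine Finset.sum_congr rfl fun i _ => ?_
    simp only [Circle.smul_def, smul_eq_mul]
    ring
  simp_rw [this]
  rw [integral_finsetSum _ fun i _ => ((Real.fourierIntegral_convergent_iff x).2
    ((hm i).mul_fourierInv hF).integrable).const_mul _]
  exact Finset.sum_congr rfl fun i _ => integral_const_mul _ _

theorem TR_sub {d : ℕ} {ρ : ℝ} {m m' : EuclideanSpace ℝ (Fin d) → ℂ} (hm : CubeSymbol ρ m)
    (hm' : CubeSymbol ρ m') {F : EuclideanSpace ℝ (Fin d) → ℂ} (hF : Integrable F)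
    (x : EuclideanSpace ℝ (Fin d)) : TR (m - m') F x = TR m F x - TR m' F x := by
  have h := TR_sum (Finset.univ : Finset (Fin 2)) (m := ![m, m']) (ρ := ρ)
    (fun i => by fin_cases i <;> assumption) ![1, -1] hF x
  simp only [Fin.sum_univ_two, Matrix.cons_val_zero, Matrix.cons_val_one, one_mul, neg_one_mul,
    ← sub_eq_add_neg] at h
  exact h

theorem exists_summable_norm_TR_sub_le {d : ℕ} {p : ℝ} (hp : 1 < p) {r : ℝ≥0∞}
    {m : ℕ → EuclideanSpace ℝ (Fin d) → ℂ} {ϑ : ℕ → ℝ} (hϑ : ∀ n, 0 < ϑ n)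
    (hsum : Summable fun n => ϑ n ^ d) (hm : ∀ n, CubeSymbol (ϑ n) (m n)) {A : ℝ≥0∞} (hA : A ≠ ⊤)
    (hV : VarBdd p r m A) {F : EuclideanSpace ℝ (Fin d) → ℂ} (hF : Integrable F) :
    ∃ v : ℕ → ℝ, Summable v ∧ ∀ n x, ‖TR (m (n + 1) - m n) F x‖ ≤ v n := by
  obtain ⟨C, hC, h⟩ := exists_enorm_fourier_le d hp
  set I : ℝ≥0∞ := ∫⁻ y, ‖F y‖ₑ with hI
  have hIt : I ≠ ⊤ := hF.2.ne
  set D : ℝ := (C * A * I).toReal with hD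
  have hDt : C * A * I ≠ ⊤ := ENNReal.mul_ne_top (ENNReal.mul_ne_top hC hA) hIt
  have hb : ∀ n x, ‖TR (m n) F x‖ ≤ D * ϑ n ^ d := by
    intro n x
    have h1 := enorm_TR_le (hm n)
      (h (m n) (ϑ n) (hϑ n) (hm n) A (hV.single (by linarith) n)) hF x
    rw [← ofReal_norm, ← hI, mul_right_comm, ← ENNReal.ofReal_toReal hDt,
      ← ENNReal.ofReal_mul ENNReal.toReal_nonneg] at h1
    exact (ENNReal.ofReal_le_ofReal_iff
      (mul_nonneg ENNReal.toReal_nonneg (pow_nonneg (hϑ n).le _))).1 h1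
  refine ⟨fun n => D * ϑ (n + 1) ^ d + D * ϑ n ^ d, ?_, fun n x => ?_⟩
  · exact (((summable_nat_add_iff 1).2 hsum).mul_left D).add (hsum.mul_left D)
  · rw [TR_sub ((hm (n + 1)).mono (le_max_left _ (ϑ n))) ((hm n).mono (le_max_right _ _)) hF]
    exact (norm_sub_le _ _).trans (add_le_add (hb _ _) (hb _ _))

theorem exists_units_add_eq (c : ℤ) (hc : |c| ≤ 1) : ∃ u v : ℤˣ, (u : ℤ) + v = 2 * c := by
  obtain ⟨h1, h2⟩ := abs_le.1 hc
  interval_cases c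
  · exact ⟨-1, -1, by simp⟩
  · exact ⟨1, -1, by simp⟩
  · exact ⟨1, 1, by simp⟩

/-- `constB` controls only full series with signs. A finite sum with coefficients in `{-1, 0, 1}` is
the average of two such series, whose terms cancel wherever the coefficient is `0`, and convexity of
the `q`-th power finishes. The bound for the sequence serves only to make the series converge. -/
theorem varBdd_sum_sub {d : ℕ} {p q : ℝ} (hp : 1 < p) (hq : 1 ≤ q) {r : ℝ≥0∞}
    {m : ℕ → EuclideanSpace ℝ (Fin d) → ℂ} {ϑ : ℕ → ℝ} {δ : ℝ} (hϑ : ∀ n, 0 < ϑ n)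
    (hδ : ∀ n, ϑ n ≤ δ)
    (hsum : Summable fun n => ϑ n ^ d) (hm : ∀ n, CubeSymbol (ϑ n) (m n)) {A : ℝ≥0∞} (hA : A ≠ ⊤)
    (hV : VarBdd p r m A) (hB : constB (ENNReal.ofReal q) m ≠ ⊤) (κ : ℕ → ℤ) (hκ : ∀ n, |κ n| ≤ 1)
    (s : Finset ℕ) :
    VarBdd q ⊤ (fun _ ξ => ∑ n ∈ s, (κ n : ℂ) * (m (n + 1) - m n) ξ)
      (constB (ENNReal.ofReal q) m) := by
  intro F hF
  have hFi := integrable_of_mem_testR hF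
  obtain ⟨v, hv, hvb⟩ := exists_summable_norm_TR_sub_le hp hϑ hsum hm hA hV hFi
  have hcs : ∀ n, CubeSymbol δ (m (n + 1) - m n) := fun n =>
    ((hm (n + 1)).mono (hδ _)).sub ((hm n).mono (hδ n))
  set κ' : ℕ → ℤ := fun n => if n ∈ s then κ n else 0 with hκ'
  have hκ1 : ∀ n, |κ' n| ≤ 1 := by
    intro n
    by_cases h : n ∈ s
    · simpa [hκ', h] using hκ n
    · simp [hκ', h]
  choose ω₁ ω₂ hω using fun n => exists_units_add_eq (κ' n) (hκ1 n)
  let G : (ℕ → ℤˣ) → EuclideanSpace ℝ (Fin d) → ℂ := fun ω x =>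
    ∑' n : ℕ, ((ω n : ℤ) : ℂ) * TR (m (n + 1) - m n) F x
  have hterm : ∀ (ω : ℕ → ℤˣ) n x, ‖((ω n : ℤ) : ℂ) * TR (m (n + 1) - m n) F x‖ ≤ v n := by
    intro ω n x
    rw [norm_mul]
    have : ‖((ω n : ℤ) : ℂ)‖ = 1 := by
      rcases Int.units_eq_one_or (ω n) with h | h <;> simp [h]
    rw [this, one_mul]
    exact hvb n x
  have hsm : ∀ (ω : ℕ → ℤˣ) x, Summable fun n => ((ω n : ℤ) : ℂ) * TR (m (n + 1) - m n) F x :=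
    fun ω x => Summable.of_norm_bounded hv fun n => hterm ω n x
  have hGc : ∀ ω, Continuous (G ω) := fun ω =>
    continuous_tsum (fun n => continuous_const.mul (continuous_TR (hcs n) hFi)) hv (hterm ω)
  have hGb : ∀ ω, ∫⁻ x, ‖G ω x‖ₑ ^ q ≤ constB (ENNReal.ofReal q) m ^ q * ∫⁻ x, ‖F x‖ₑ ^ q := by
    intro ω
    have hle : (opNorm volume (testR d) (ENNReal.ofReal q) fun f x =>
        ∑' n : ℕ, ((ω n : ℤ) : ℂ) * TR (m (n + 1) - m n) f x) ≤ constB (ENNReal.ofReal q) m :=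
      le_iSup (fun ω : ℕ → ℤˣ => opNorm volume (testR d) (ENNReal.ofReal q) fun f x =>
        ∑' n : ℕ, ((ω n : ℤ) : ℂ) * TR (m (n + 1) - m n) f x) ω
    refine (lintegral_le_of_opNorm (by linarith) (ne_top_of_le_ne_top hB hle) hF).trans ?_
    exact mul_le_mul_left (ENNReal.rpow_le_rpow hle (by linarith)) _
  have hTR : ∀ x, TR (fun ξ => ∑ n ∈ s, (κ n : ℂ) * (m (n + 1) - m n) ξ) F x =
      2⁻¹ * G ω₁ x + 2⁻¹ * G ω₂ x := by
    intro x
    rw [TR_sum s hcs (fun n => (κ n : ℂ)) hFi, ← mul_add]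
    change _ = 2⁻¹ * (∑' n, _ + ∑' n, _)
    rw [← (hsm ω₁ x).tsum_add (hsm ω₂ x), ← tsum_mul_left,
      tsum_eq_sum (s := s) fun n hn => ?_]
    · refine Finset.sum_congr rfl fun n hn => ?_
      have := hω n
      simp only [hκ', if_pos hn] at this
      rw [← add_mul, ← Int.cast_add, this]
      push_cast; ring
    · have := hω n
      simp only [hκ', if_neg hn] at this
      rw [← add_mul, ← Int.cast_add, this]
      simp
  have hhalf : ‖(2⁻¹ : ℂ)‖ₑ = 2⁻¹ := by
    rw [← ofReal_norm, norm_inv, Complex.norm_ofNat, ENNReal.ofReal_inv_of_pos (by norm_num)]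
    simp
  calc ∫⁻ x, variationNorm ⊤ (fun _ : ℕ => TR (fun ξ => ∑ n ∈ s, (κ n : ℂ) * (m (n + 1) - m n) ξ) F x) ^ q
      ≤ ∫⁻ x, (2⁻¹ * ‖G ω₁ x‖ₑ ^ q + 2⁻¹ * ‖G ω₂ x‖ₑ ^ q) := by
        refine lintegral_mono fun x => ?_
        rw [variationNorm_top_const, hTR]
        refine le_trans (ENNReal.rpow_le_rpow (enorm_add_le _ _) (by linarith)) ?_
        rw [enorm_mul, enorm_mul, hhalf]
        exact ENNReal.rpow_arith_mean_le_arith_mean2_rpow _ _ _ _ ENNReal.inv_two_add_inv_two hq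
    _ = 2⁻¹ * (∫⁻ x, ‖G ω₁ x‖ₑ ^ q) + 2⁻¹ * (∫⁻ x, ‖G ω₂ x‖ₑ ^ q) := by
        rw [lintegral_add_left (((hGc ω₁).enorm.measurable.pow_const q).const_mul _),
          lintegral_const_mul' _ _ (by simp), lintegral_const_mul' _ _ (by simp)]
    _ ≤ 2⁻¹ * (constB (ENNReal.ofReal q) m ^ q * ∫⁻ x, ‖F x‖ₑ ^ q) +
        2⁻¹ * (constB (ENNReal.ofReal q) m ^ q * ∫⁻ x, ‖F x‖ₑ ^ q) := by
        gcongr <;> exact hGb _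
    _ = _ := by rw [← add_mul, ENNReal.inv_two_add_inv_two, one_mul]

/-! ### Symbols on the torus -/

section TorusSymbol

open UnitAddTorus

variable {d : ℕ}

theorem measurable_torusRep : Measurable (torusRep : UnitAddTorus (Fin d) → EuclideanSpace ℝ (Fin d)) := by
  refine (MeasurableEquiv.toLp 2 (Fin d → ℝ)).measurable.comp (measurable_pi_lambda _ fun i => ?_)
  exact measurable_subtype_coe.comp
    ((AddCircle.measurableEquivIco 1 (-1 / 2)).measurable.comp (measurable_pi_apply i))

theorem CubeSymbol.bddMeas_torusRep {ρ : ℝ} {m : EuclideanSpace ℝ (Fin d) → ℂ}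
    (hm : CubeSymbol ρ m) : BddMeas fun ξ : UnitAddTorus (Fin d) => m (torusRep ξ) :=
  BddMeas.comp ⟨hm.measurable, hm.bounded⟩ measurable_torusRep

theorem coe_torusRep (ξ : UnitAddTorus (Fin d)) (i : Fin d) :
    ((torusRep ξ i : ℝ) : UnitAddCircle) = ξ i := AddCircle.coe_equivIco

theorem torusRep_coe {y : Fin d → ℝ} (hy : ∀ i, y i ∈ Set.Ico (-1 / 2 : ℝ) (-1 / 2 + 1)) :
    torusRep (fun i => (y i : UnitAddCircle)) = WithLp.toLp 2 y := by
  unfold torusRep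
  congr 1
  funext i
  rw [AddCircle.equivIco_coe_eq (hy i)]

theorem CubeSymbol.norm_le_of_ne_zero {ρ : ℝ} (hρ : 0 ≤ ρ) {m : EuclideanSpace ℝ (Fin d) → ℂ}
    (hm : CubeSymbol ρ m) {ξ : UnitAddTorus (Fin d)} (h : m (torusRep ξ) ≠ 0) : ‖ξ‖ ≤ ρ := by
  refine (pi_norm_le_iff_of_nonneg hρ).2 fun i => ?_
  rw [← coe_torusRep ξ i]
  refine le_trans ?_ (hm.abs_le _ h i)
  rw [AddCircle.norm_eq]
  simpa using round_le (torusRep ξ i) 0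

theorem mFourier_coe (x : Fin d → ℤ) (y : Fin d → ℝ) :
    mFourier (-x) (fun i => (y i : UnitAddCircle)) =
      Real.fourierChar (-inner ℝ (WithLp.toLp 2 y : EuclideanSpace ℝ (Fin d)) (lat x)) := by
  rw [Real.fourierChar_apply]
  simp only [mFourier, ContinuousMap.coe_mk, fourier_coe_apply, Pi.neg_apply]
  rw [← Complex.exp_sum]
  congr 1
  simp only [PiLp.inner_apply, lat, RCLike.inner_apply, conj_trivial]
  push_cast
  rw [mul_neg, Finset.mul_sum, neg_mul, Finset.sum_mul, ← Finset.sum_neg_distrib]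
  refine Finset.sum_congr rfl fun i _ => ?_
  ring

theorem CubeSymbol.coef_torusRep {ρ : ℝ} (hρ : ρ < 1 / 2) {m : EuclideanSpace ℝ (Fin d) → ℂ}
    (hm : CubeSymbol ρ m) (x : Fin d → ℤ) :
    coef (fun ξ => m (torusRep ξ)) x = 𝓕 m (lat x) := by
  unfold coef
  have h0 := integral_preimage (fun ξ : UnitAddTorus (Fin d) => mFourier (-x) ξ * m (torusRep ξ))
    fun _ => (-1 / 2 : ℝ)
  rw [volume_torus_eq]
  refine h0.trans ?_
  rw [Real.fourier_eq,
    ← (PiLp.volume_preserving_toLp (Fin d)).integral_comp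
      (MeasurableEquiv.toLp 2 (Fin d → ℝ)).measurableEmbedding]
  refine Eq.trans ?_ (setIntegral_eq_integral_of_forall_compl_eq_zero
    (s := {y : Fin d → ℝ | ∀ i, y i ∈ Set.Ioc (-1 / 2 : ℝ) (-1 / 2 + 1)}) ?_)
  · refine setIntegral_congr_fun ?_ fun y hy => ?_
    · exact MeasurableSet.univ_pi' fun i => measurableSet_Ioc
    rw [mFourier_coe, Circle.smul_def, smul_eq_mul]
    congr 1
    -- The two fundamental boxes are half-open at opposite ends. If some coordinate is `1/2`, the
    -- torus representative has `-1/2` there, and `m` vanishes at both points because `ρ < 1/2`.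
    by_cases h : ∀ i, y i ∈ Set.Ico (-1 / 2 : ℝ) (-1 / 2 + 1)
    · rw [torusRep_coe h]
    · push Not at h
      obtain ⟨i, hi⟩ := h
      have h1 : y i = 1 / 2 := by
        have h2 := hy i
        simp only [Set.mem_Ioc, Set.mem_Ico, not_and, not_lt] at h2 hi
        linarith [hi h2.1.le]
      have h3 : m (WithLp.toLp 2 y) = 0 := by
        by_contra h0
        have h4 := hm.abs_le _ h0 i
        change |y i| ≤ ρ at h4
        rw [h1, abs_of_pos (by norm_num)] at h4
        linarith
      rw [h3]
      by_contra h0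
      have h4 := hm.abs_le _ h0 i
      have h5 : torusRep (fun i => (y i : UnitAddCircle)) i = -1 / 2 := by
        have h6 : (y i : UnitAddCircle) = ((-1 / 2 : ℝ) : UnitAddCircle) := by
          rw [h1, show (1 / 2 : ℝ) = -1 / 2 + 1 by norm_num]
          exact AddCircle.coe_add_period 1 _
        change ((AddCircle.equivIco (1 : ℝ) (-1 / 2) (y i : UnitAddCircle) : ℝ)) = _
        rw [h6, AddCircle.equivIco_coe_eq (by constructor <;> norm_num)]
      rw [h5, abs_of_neg (by norm_num)] at h4
      linarith
  · intro y hy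
    have : m (WithLp.toLp 2 y) = 0 := by
      by_contra h0
      refine hy fun i => ?_
      have h4 := _root_.abs_le.1 (hm.abs_le _ h0 i)
      change -ρ ≤ y i ∧ y i ≤ ρ at h4
      constructor <;> linarith
    rw [this, smul_zero]

theorem TZ_eq_zconv {M : UnitAddTorus (Fin d) → ℂ} (hM : BddMeas M) {f : (Fin d → ℤ) → ℂ}
    (hf : f.support.Finite) (x : Fin d → ℤ) : TZ M f x = zconv (coef M) f x := by
  rw [zconv_eq_sum _ (S := hf.toFinset) (by simp)]
  unfold TZ
  have h1 : ∀ ξ : UnitAddTorus (Fin d), ∑' y : Fin d → ℤ, f y * mFourier y ξ =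
      ∑ y ∈ hf.toFinset, f y * mFourier y ξ := fun ξ => tsum_eq_sum fun y hy => by
    have : f y = 0 := by simpa using hy
    rw [this, zero_mul]
  have h2 : ∀ ξ : UnitAddTorus (Fin d), mFourier (-x) ξ * M ξ * ∑' y : Fin d → ℤ, f y * mFourier y ξ =
      ∑ y ∈ hf.toFinset, f y * (mFourier (-x) ξ * (mFourier y ξ * M ξ)) := by
    intro ξ
    rw [h1, Finset.mul_sum]
    refine Finset.sum_congr rfl fun y _ => ?_
    ring
  simp_rw [h2]
  rw [integral_finsetSum _ fun y _ => ?_]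
  · refine Finset.sum_congr rfl fun y _ => ?_
    rw [integral_const_mul, ← coef_mFourier_mul]
    rfl
  · exact ((bddMeas_mFourier (-x)).mul ((bddMeas_mFourier y).mul hM)).integrable.const_mul _

end TorusSymbol

/-! ### Convolution operators on the lattice -/

section Lattice

open UnitAddTorus Finset

variable {d : ℕ}

/-- Young's inequality, from Jensen's with weight `‖κ (x - z)‖`. -/
theorem ConvBdd.of_summable {κ : (Fin d → ℤ) → ℂ} {D : ℝ} (hκ : Summable fun x => ‖κ x‖)
    (hD : ∑' x, ‖κ x‖ ≤ D) {p : ℝ} (hp : 1 < p) : ConvBdd κ p D := by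
  intro f hf
  have hp0 : 0 ≤ p - 1 := by linarith
  have hD' : ∑' x, ‖κ x‖ₑ ≤ ENNReal.ofReal D := by
    simp_rw [← ofReal_norm]
    rw [← ENNReal.ofReal_tsum_of_nonneg (fun _ => norm_nonneg _) hκ]
    exact ENNReal.ofReal_le_ofReal hD
  have hsub : ∀ x, ∑' z, ‖κ (x - z)‖ₑ = ∑' z, ‖κ z‖ₑ := fun x =>
    (Equiv.subLeft x).tsum_eq fun z => ‖κ z‖ₑ
  have hsub' : ∀ z, ∑' x, ‖κ (x - z)‖ₑ = ∑' x, ‖κ x‖ₑ := fun z =>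
    (Equiv.subRight z).tsum_eq fun z => ‖κ z‖ₑ
  have hpt : ∀ x, ‖zconv κ f x‖ₑ ^ p ≤
      ENNReal.ofReal D ^ (p - 1) * ∑' z, ‖f z‖ₑ ^ p * ‖κ (x - z)‖ₑ := by
    intro x
    have h := rpow_lintegral_mul_le (μ := Measure.count) hp (f := fun z => ‖f z‖ₑ)
      (w := fun z => ‖κ (x - z)‖ₑ) (measurable_of_countable _).aemeasurable
      (measurable_of_countable _).aemeasurable
    rw [lintegral_count, lintegral_count, lintegral_count, hsub] at h
    refine le_trans (ENNReal.rpow_le_rpow ?_ (by linarith)) (h.trans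
      (mul_le_mul_left (ENNReal.rpow_le_rpow hD' hp0) _))
    rw [zconv_eq_sum κ (S := hf.toFinset) (by simp)]
    refine (enorm_sum_le _ _).trans ?_
    simp_rw [enorm_mul]
    exact ENNReal.sum_le_tsum _
  refine (ENNReal.tsum_le_tsum hpt).trans ?_
  rw [ENNReal.tsum_mul_left, ENNReal.tsum_comm]
  simp_rw [ENNReal.tsum_mul_left, hsub']
  rw [ENNReal.tsum_mul_right, mul_comm (∑' x, ‖f x‖ₑ ^ p), ← mul_assoc]
  refine mul_le_mul_left ?_ _
  have e : ENNReal.ofReal D ^ p = ENNReal.ofReal D ^ (p - 1) * ENNReal.ofReal D := by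
    conv_rhs => rw [← ENNReal.rpow_one (ENNReal.ofReal D), ← ENNReal.rpow_mul, one_mul]
    rw [← ENNReal.rpow_add_of_nonneg _ _ hp0 zero_le_one, sub_add_cancel]
  rw [e]
  exact mul_le_mul_right hD' _

theorem convBdd_eta {δ : ℝ} (h0 : 0 < δ) (h1 : 3 * δ ≤ 1) {p : ℝ} (hp : 1 < p) :
    ConvBdd (coef (eta δ : UnitAddTorus (Fin d) → ℂ)) p (5 ^ d) :=
  ConvBdd.of_summable (summable_norm_coef_eta h0 h1).1 (summable_norm_coef_eta h0 h1).2 hp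

/-- The scalar multiplier theorem for all exponents between `2(k+1)` and its conjugate. -/
theorem exists_convBdd_periodize (k : ℕ) : ∃ (C : ℝ) (e : ℕ), 1 ≤ C ∧
    ∀ (d Q N : ℕ) [NeZero Q] (δ S : ℝ), 0 < δ → 3 * δ ≤ 1 → 3 * δ < 1 / (N : ℝ) ^ 2 →
      (2 * (k + 1)) * δ < 1 / (N : ℝ) ^ (2 * (k + 1)) → 1 ≤ S →
      (∀ q, 1 ≤ q → q ≤ N → (smoothCount N q : ℝ) ≤ S) →
      ∀ (μ : UnitAddTorus (Fin d) → ℂ), BddMeas μ → (∀ ξ, μ ξ ≠ 0 → ‖ξ‖ ≤ δ) →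
      ∀ B : ℝ, 0 < B → ConvBdd (coef μ) (2 * (k + 1) : ℕ) B →
      ∀ p : ℝ, Real.conjExponent (2 * (k + 1) : ℕ) ≤ p → p ≤ (2 * (k + 1) : ℕ) →
      ConvBdd (coef fun ξ => ∑ a ∈ smallOrder d Q N, μ (ξ - torusEmb d Q a)) p
        (B * (C * (5 ^ d) ^ (2 * k) * S ^ e)) := by
  obtain ⟨C, e, hC, h⟩ := exists_scalar_bound k
  refine ⟨max C 1, e, le_max_right _ _, ?_⟩
  intro d Q N _ δ S h0 h1 hN hN2 hS1 hS μ hμ hsupp B hB hconv p hp1 hp2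
  have hp0 : (1 : ℝ) < (2 * (k + 1) : ℕ) := by
    have : 1 < 2 * (k + 1) := by omega
    exact_mod_cast this
  have h5 : (1 : ℝ) ≤ (5 ^ d) ^ (2 * k) := one_le_pow₀ (one_le_pow₀ (by norm_num))
  have hSe : 1 ≤ S ^ e := one_le_pow₀ hS1
  -- The loss multiplies a power of the norm. Being at least `1`, it is at most its own `2(k+1)`-th
  -- power and may be counted inside the operator norm, where it survives the interpolation.
  set L : ℝ := max C 1 * (5 ^ d) ^ (2 * k) * S ^ e with hL
  have hL1 : 1 ≤ L := one_le_mul_of_one_le_of_one_le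
    (one_le_mul_of_one_le_of_one_le (le_max_right _ _) h5) hSe
  refine ConvBdd.interp (Real.HolderConjugate.conjExponent hp0) hp1 hp2 (by positivity) ?_
  intro f hf
  have key : ∀ z : ℂ, ENNReal.ofReal (‖z‖ ^ (2 * (k + 1))) = ‖z‖ₑ ^ ((2 * (k + 1) : ℕ) : ℝ) := by
    intro z
    rw [enorm_rpow_eq_ofReal z (by positivity), Real.rpow_natCast]
  have h2 := h d Q N δ S h0 h1 hN hN2 hS1 hS μ hμ hsupp
    (ENNReal.ofReal B ^ ((2 * (k + 1) : ℕ) : ℝ)) (fun f hf => by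
      simp only [key]; exact hconv f hf) f hf
  simp only [key] at h2
  refine h2.trans (mul_le_mul_left ?_ _)
  rw [ENNReal.ofReal_mul hB.le, ENNReal.mul_rpow_of_nonneg _ _ (by positivity)]
  refine mul_le_mul_right ?_ _
  rw [ENNReal.ofReal_rpow_of_nonneg (by linarith) (by positivity)]
  refine ENNReal.ofReal_le_ofReal ?_
  calc C * (5 ^ d) ^ (2 * k) * S ^ e ≤ L := by
        rw [hL]; gcongr; exact le_max_left _ _
    _ ≤ _ := Real.self_le_rpow_of_one_le hL1 hp0.le

/-- A variational bound on finitely supported functions extends to all functions for which the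
convolutions converge. -/
theorem tsum_variationNorm_le_of_hasSum {κ : ℕ → (Fin d → ℤ) → ℂ} {B r : ℝ≥0∞} {p : ℝ} (hp : 0 < p)
    (hB : ∀ f : (Fin d → ℤ) → ℂ, f.support.Finite →
      ∑' x, variationNorm r (fun n => zconv (κ n) f x) ^ p ≤ B * ∑' x, ‖f x‖ₑ ^ p)
    {h : (Fin d → ℤ) → ℂ} {u : ℕ → (Fin d → ℤ) → ℂ}
    (hu : ∀ n x, HasSum (fun z => h z * κ n (x - z)) (u n x)) :
    ∑' x, variationNorm r (fun n => u n x) ^ p ≤ B * ∑' x, ‖h x‖ₑ ^ p := by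
  rw [ENNReal.tsum_eq_iSup_sum]
  refine iSup_le fun F => ?_
  have hV : LowerSemicontinuous fun a : ℕ → ℂ => variationNorm r a ^ p :=
    (ENNReal.continuous_rpow_const (y := p)).comp_lowerSemicontinuous
      (lowerSemicontinuous_variationNorm r) (ENNReal.monotone_rpow_of_nonneg hp.le)
  have hlsc : LowerSemicontinuous fun a : (Fin d → ℤ) → ℕ → ℂ =>
      ∑ x ∈ F, variationNorm r (a x) ^ p :=
    lowerSemicontinuous_sum fun x _ => hV.comp (continuous_apply x)
  have hcl := hlsc.isClosed_preimage (B * ∑' x, ‖h x‖ₑ ^ p)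
  have hlim : Filter.Tendsto (fun (S : Finset (Fin d → ℤ)) (x : Fin d → ℤ) (n : ℕ) =>
      ∑ z ∈ S, h z * κ n (x - z)) Filter.atTop (nhds fun x n => u n x) :=
    tendsto_pi_nhds.2 fun x => tendsto_pi_nhds.2 fun n => hu n x
  refine hcl.mem_of_tendsto hlim (Filter.Eventually.of_forall fun S => ?_)
  let hS : (Fin d → ℤ) → ℂ := fun z => if z ∈ S then h z else 0
  have hsupp : hS.support ⊆ S := fun z hz => by
    by_contra hcon
    exact hz (if_neg hcon)
  have e : ∀ n x, ∑ z ∈ S, h z * κ n (x - z) = zconv (κ n) hS x := fun n x => by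
    rw [zconv_eq_sum (κ n) hsupp]
    exact sum_congr rfl fun z hz => by simp only [hS, if_pos hz]
  simp only [Set.mem_preimage, Set.mem_Iic, e]
  refine (ENNReal.sum_le_tsum F).trans ((hB hS (S.finite_toSet.subset hsupp)).trans ?_)
  refine mul_le_mul_right (ENNReal.tsum_le_tsum fun z => ?_) _
  simp only [hS]
  split_ifs
  · exact le_rfl
  · simp [ENNReal.zero_rpow_of_pos hp]

/-! ### Periodic symbols -/

variable {Q : ℕ} [NeZero Q]

theorem sum_mFourier_torusEmb (x : Fin d → ℤ) :
    ∑ a, mFourier x (torusEmb d Q a) = if redQ Q x = 0 then (Q : ℂ) ^ d else 0 := by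
  have h := expect_chi (redQ Q x)
  have hcard : (Fintype.card (Fin d → ZMod Q) : ℂ) = (Q : ℂ) ^ d := by
    simp [ZMod.card]
  have hQ : (Q : ℂ) ^ d ≠ 0 := pow_ne_zero _ (by exact_mod_cast NeZero.ne Q)
  rw [Fintype.expect_eq_sum_div_card, hcard, div_eq_iff hQ] at h
  simp_rw [mFourier_torusEmb, chi_comm (redQ Q x)]
  rw [h]
  split_ifs <;> simp

theorem coef_periodic {μ : UnitAddTorus (Fin d) → ℂ} (hμ : BddMeas μ) (x : Fin d → ℤ) :
    coef (fun ξ => ∑ a, μ (ξ - torusEmb d Q a)) x =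
      if redQ Q x = 0 then (Q : ℂ) ^ d * coef μ x else 0 := by
  have hb : ∀ a : Fin d → ZMod Q, BddMeas fun ξ => μ (ξ - torusEmb d Q a) := fun a =>
    hμ.comp (measurable_id.sub_const _)
  rw [coef_sum _ fun a _ => hb a]
  simp_rw [coef_translate]
  rw [← sum_mul, sum_mFourier_torusEmb]
  simp only [redQ_neg, neg_eq_zero]
  split_ifs <;> simp

/-- Division with remainder by `Q` in each coordinate. -/
def divModPi (d Q : ℕ) [NeZero Q] : (Fin d → ℤ) ≃ (Fin d → ℤ) × (Fin d → Fin Q) :=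
  (Equiv.piCongrRight fun _ => Int.divModEquiv Q).trans
    (Equiv.arrowProdEquivProdArrow (Fin d) (fun _ => ℤ) fun _ => Fin Q)

theorem divModPi_symm_apply (n : Fin d → ℤ) (c : Fin d → Fin Q) (i : Fin d) :
    (divModPi d Q).symm (n, c) i = n i * Q + (c i : ℕ) := by
  simp [divModPi, Equiv.arrowProdEquivProdArrow, Int.divModEquiv_symm_apply]

theorem redQ_divModPi_symm_sub (n k : Fin d → ℤ) (c b : Fin d → Fin Q) :
    redQ Q ((divModPi d Q).symm (n, c) - (divModPi d Q).symm (k, b)) = 0 ↔ c = b := by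
  rw [funext_iff, funext_iff]
  refine forall_congr' fun i => ?_
  simp only [redQ, Pi.sub_apply, divModPi_symm_apply, Pi.zero_apply]
  push_cast
  rw [ZMod.natCast_self, mul_zero, mul_zero, zero_add, zero_add, sub_eq_zero, ZMod.natCast_eq_natCast_iff',
    Nat.mod_eq_of_lt (c i).2, Nat.mod_eq_of_lt (b i).2, Fin.ext_iff]

theorem lat_divModPi_symm_sub (n k : Fin d → ℤ) (c : Fin d → Fin Q) :
    lat ((divModPi d Q).symm (n, c) - (divModPi d Q).symm (k, c)) =
      (Q : ℝ) • (lat n + 0 - lat k) := by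
  ext i
  simp [lat, divModPi_symm_apply]
  ring

/-- The symbol periodised over all of `(1/Q)ℤ^d` has its kernel on `Q ℤ^d`, so the residue classes
modulo `Q` do not interact. On each class the operator is the one on `ℝ^d` sampled with spacing `Q`,
and the constant does not depend on `Q`. -/
theorem exists_periodic_transference (d : ℕ) {p : ℝ} (hp : 1 < p) : ∃ C : ℝ, 0 < C ∧
    ∀ (Q : ℕ) [NeZero Q] (r : ℝ≥0∞), 1 ≤ r → ∀ (m : ℕ → EuclideanSpace ℝ (Fin d) → ℂ) (ρ : ℝ),
    ρ < 1 / 2 → Q * ρ ≤ 1 → (∀ n, CubeSymbol ρ (m n)) →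
    ∀ A : ℝ≥0∞, VarBdd p r m A → ∀ f : (Fin d → ℤ) → ℂ, f.support.Finite →
      ∑' x, variationNorm r (fun n => zconv (coef fun ξ => ∑ a, m n (torusRep (ξ - torusEmb d Q a)))
        f x) ^ p ≤ (ENNReal.ofReal C * A) ^ p * ∑' x, ‖f x‖ₑ ^ p := by
  obtain ⟨C, hC, h⟩ := exists_transference_smul d hp
  have hp0 : 0 < p := by linarith
  have hCC : C ≤ ENNReal.ofReal ((C.toReal + 1) ^ (1 / p)) ^ p := by
    rw [ENNReal.ofReal_rpow_of_nonneg (by positivity) hp0.le, ← Real.rpow_mul (by positivity),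
      one_div_mul_cancel hp0.ne', Real.rpow_one]
    exact (ENNReal.le_ofReal_iff_toReal_le hC (by positivity)).2 (by linarith)
  refine ⟨(C.toReal + 1) ^ (1 / p), by positivity, ?_⟩
  intro Q _ r hr m ρ hρ hQρ hm A hA f hf
  have hQ : (0 : ℝ) < Q := by exact_mod_cast NeZero.pos Q
  let e := divModPi d Q
  have hfin : ∀ c : Fin d → Fin Q, (fun k => f (e.symm (k, c))).support.Finite := fun c =>
    hf.preimage (f := fun k => e.symm (k, c)) fun k _ k' _ hk => by
      simpa using e.symm.injective hk
  have hz : ∀ n k c, zconv (coef fun ξ => ∑ a, m n (torusRep (ξ - torusEmb d Q a))) f (e.symm (k, c)) =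
      ∑ j ∈ (hfin c).toFinset, f (e.symm (j, c)) *
        (((Q : ℝ) : ℂ) ^ d * 𝓕 (m n) ((Q : ℝ) • (lat k + 0 - lat j))) := by
    intro n k c
    rw [zconv_eq_sum _ (S := hf.toFinset) (by simp)]
    have hterm : ∀ z, f z * coef (fun ξ => ∑ a, m n (torusRep (ξ - torusEmb d Q a)))
        (e.symm (k, c) - z) = if (e z).2 = c then f z *
        (((Q : ℝ) : ℂ) ^ d * 𝓕 (m n) ((Q : ℝ) • (lat k + 0 - lat (e z).1))) else 0 := by
      intro z
      rw [coef_periodic (hm n).bddMeas_torusRep, (hm n).coef_torusRep hρ]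
      obtain ⟨⟨j, b⟩, rfl⟩ := e.symm.surjective z
      rw [Equiv.apply_symm_apply]
      by_cases hb : b = c
      · subst hb
        rw [if_pos ((redQ_divModPi_symm_sub k j b b).2 rfl), if_pos rfl, lat_divModPi_symm_sub]
        push_cast; rfl
      · rw [if_neg fun h' => hb ((redQ_divModPi_symm_sub k j c b).1 h').symm, if_neg hb, mul_zero]
    rw [sum_congr rfl fun z _ => hterm z, ← sum_filter]
    symm
    refine sum_bij (fun j _ => e.symm (j, c)) ?_ ?_ ?_ ?_
    · intro j hj
      simp only [mem_filter, Set.Finite.mem_toFinset, Function.mem_support, Equiv.apply_symm_apply,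
        and_true] at hj ⊢
      exact hj
    · intro j _ j' _ hjj
      simpa using e.symm.injective hjj
    · intro z hz
      simp only [mem_filter, Set.Finite.mem_toFinset, Function.mem_support] at hz
      have hz' : e.symm ((e z).1, c) = z := by
        rw [← hz.2, Prod.mk.eta, Equiv.symm_apply_apply]
      refine ⟨(e z).1, ?_, hz'⟩
      simp only [Set.Finite.mem_toFinset, Function.mem_support, hz']
      exact hz.1
    · intro j _
      rw [Equiv.apply_symm_apply]
  have hsplit : ∀ G : (Fin d → ℤ) → ℝ≥0∞, ∑' x, G x = ∑' c, ∑' k, G (e.symm (k, c)) := by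
    intro G
    rw [← e.symm.tsum_eq, ENNReal.tsum_prod', ENNReal.tsum_comm]
  rw [hsplit, hsplit fun x => ‖f x‖ₑ ^ p, ← ENNReal.tsum_mul_left]
  refine ENNReal.tsum_le_tsum fun c => ?_
  simp only [hz]
  refine (h r hr m Q ρ hQ hQρ hm A hA 0 (hfin c).toFinset fun j => f (e.symm (j, c))).trans ?_
  rw [tsum_enorm_rpow_eq_sum (S := (hfin c).toFinset) (by simp) hp0,
    ENNReal.mul_rpow_of_nonneg _ _ hp0.le]
  gcongr

end Lattice

/-! ### Large scales -/

section LargeScales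

open UnitAddTorus Finset

variable {d Q : ℕ} [NeZero Q]

theorem BddMeas.periodize {μ : UnitAddTorus (Fin d) → ℂ} (hμ : BddMeas μ)
    (s : Finset (Fin d → ZMod Q)) : BddMeas fun ξ => ∑ a ∈ s, μ (ξ - torusEmb d Q a) :=
  BddMeas.sum s fun _ _ => hμ.comp (measurable_id.sub_const _)

/-- Distinct `a`, `b` are `1/Q` apart, more than the total radius `τ + 3τ/2` of the two supports, so
only the terms `a = b` survive; there `eta τ` is `1`. -/
theorem periodize_mul_periodize_eta {τ : ℝ} (h0 : 0 < τ) (h1 : 3 * τ ≤ 1) (hτ : 5 * τ < 2 / Q)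
    {μ : UnitAddTorus (Fin d) → ℂ} (hμ : ∀ ξ, μ ξ ≠ 0 → ‖ξ‖ ≤ τ) (s : Finset (Fin d → ZMod Q))
    (ξ : UnitAddTorus (Fin d)) :
    (∑ a, μ (ξ - torusEmb d Q a)) * ∑ b ∈ s, eta τ (ξ - torusEmb d Q b) =
      ∑ a ∈ s, μ (ξ - torusEmb d Q a) := by
  classical
  have hQ : 0 < Q := NeZero.pos Q
  rw [sum_mul_sum, sum_comm]
  refine sum_congr rfl fun b _ => ?_
  rw [sum_eq_single b]
  · by_cases h : μ (ξ - torusEmb d Q b) = 0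
    · rw [h, zero_mul]
    · rw [eta_eq_one h0 h1 (hμ _ h), mul_one]
  · intro a _ hab
    by_contra hne
    have ha := hμ _ (left_ne_zero_of_mul hne)
    have hb := norm_le_of_eta_ne_zero (right_ne_zero_of_mul hne)
    have hd : torusEmb d Q (a - b) = (ξ - torusEmb d Q b) - (ξ - torusEmb d Q a) := by
      rw [map_sub]; abel
    have h2 := one_div_le_norm_torusEmb (sub_ne_zero.2 hab) hQ (by
      funext i; simp : Q • (a - b) = 0)
    rw [hd] at h2
    have h3 := h2.trans (norm_sub_le _ _)
    have h4 : 2 / (Q : ℝ) = 2 * (1 / Q) := by ring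
    linarith
  · simp

theorem hasSum_zconv_mul {g h : UnitAddTorus (Fin d) → ℂ} (hg : BddMeas g) (hh : BddMeas h)
    {f : (Fin d → ℤ) → ℂ} (hf : f.support.Finite) (x : Fin d → ℤ) :
    HasSum (fun z => zconv (coef h) f z * coef g (x - z)) (zconv (coef fun ξ => g ξ * h ξ) f x) := by
  rw [zconv_eq_sum _ (S := hf.toFinset) (by simp)]
  have h1 : ∀ y, HasSum (fun z => f y * (coef h (z - y) * coef g (x - z)))
      (f y * coef (fun ξ => g ξ * h ξ) (x - y)) := by
    intro y
    refine HasSum.mul_left _ ?_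
    have := hasSum_coef_mul hg hh (x - y)
    rw [← (Equiv.subRight y).hasSum_iff] at this
    refine this.congr_fun fun z => ?_
    simp [sub_sub_sub_cancel_right]
  refine (hasSum_sum (s := hf.toFinset) fun y _ => h1 y).congr_fun fun z => ?_
  rw [zconv_eq_sum _ (S := hf.toFinset) (by simp), sum_mul]
  exact sum_congr rfl fun y _ => by ring

theorem VarBdd.max {p : ℝ} (hp : 0 ≤ p) {r : ℝ≥0∞} (hr : 1 ≤ r)
    {m : ℕ → EuclideanSpace ℝ (Fin d) → ℂ} {A : ℝ≥0∞} (h : VarBdd p r m A) (M : ℕ) :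
    VarBdd p r (fun n => m (max n M)) A := fun F hF => by
  refine le_trans (lintegral_mono fun x => ?_) (h F hF)
  exact ENNReal.rpow_le_rpow (variationNorm_max_le hr (fun n => TR (m n) F x) M) hp

theorem VarBdd.mono {p : ℝ} (hp : 0 ≤ p) {r : ℝ≥0∞} {m : ℕ → EuclideanSpace ℝ (Fin d) → ℂ}
    {A A' : ℝ≥0∞} (h : VarBdd p r m A) (hA : A ≤ A') : VarBdd p r m A' := fun F hF =>
  (h F hF).trans (mul_le_mul_left (ENNReal.rpow_le_rpow hA hp) _)

/-- The contribution of the frequencies below the separation of the denominators dividing `Q`. -/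
theorem exists_large_scales (d : ℕ) {p : ℝ} (hp : 1 < p) : ∃ C : ℝ, 0 < C ∧
    ∀ (Q N : ℕ) [NeZero Q] (r : ℝ≥0∞), 1 ≤ r → ∀ (m : ℕ → EuclideanSpace ℝ (Fin d) → ℂ) (τ : ℝ),
    0 < τ → 3 * τ ≤ 1 → 5 * τ < 2 / Q → (∀ n, CubeSymbol τ (m n)) →
    ∀ A L : ℝ, 0 ≤ L → VarBdd p r m (ENNReal.ofReal A) →
    ConvBdd (coef fun ξ => ∑ a ∈ smallOrder d Q N, eta τ (ξ - torusEmb d Q a)) p L →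
    ∀ f : (Fin d → ℤ) → ℂ, f.support.Finite →
      ∑' x, variationNorm r (fun n => zconv (coef fun ξ =>
        ∑ a ∈ smallOrder d Q N, m n (torusRep (ξ - torusEmb d Q a))) f x) ^ p ≤
        ENNReal.ofReal (C * A * L) ^ p * ∑' x, ‖f x‖ₑ ^ p := by
  obtain ⟨C, hC, h⟩ := exists_periodic_transference d hp
  have hp0 : 0 < p := by linarith
  refine ⟨C, hC, ?_⟩
  intro Q N _ r hr m τ h0 h1 hτ hm A L hL hA hconv f hf
  have hQ : (0 : ℝ) < Q := by exact_mod_cast NeZero.pos Q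
  have hQτ : Q * τ ≤ 1 := by
    rw [lt_div_iff₀ hQ] at hτ
    nlinarith
  have hG : ∀ n, BddMeas fun ξ : UnitAddTorus (Fin d) =>
      ∑ a, m n (torusRep (ξ - torusEmb d Q a)) := fun n => (hm n).bddMeas_torusRep.periodize _
  have hH := (bddMeas_eta (d := d) τ).periodize (smallOrder d Q N)
  -- The fully periodised operators act on the output of the scalar operator with the cutoff, which
  -- is not finitely supported.
  have key := tsum_variationNorm_le_of_hasSum hp0
    (h Q r hr m τ (by linarith) hQτ hm _ hA) fun n x => hasSum_zconv_mul (hG n) hH hf x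
  have e : ∀ n, (fun ξ => (∑ a, m n (torusRep (ξ - torusEmb d Q a))) *
      ∑ b ∈ smallOrder d Q N, eta τ (ξ - torusEmb d Q b)) =
      fun ξ => ∑ a ∈ smallOrder d Q N, m n (torusRep (ξ - torusEmb d Q a)) := fun n => by
    funext ξ
    exact periodize_mul_periodize_eta h0 h1 hτ (μ := fun ξ => m n (torusRep ξ))
      (fun ξ hξ => (hm n).norm_le_of_ne_zero h0.le hξ) _ ξ
  simp only [e] at key
  refine key.trans ((mul_le_mul_right (hconv f hf) _).trans (le_of_eq ?_))
  rw [← mul_assoc, ← ENNReal.mul_rpow_of_nonneg _ _ hp0.le, ← ENNReal.ofReal_mul hC.le,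
    ← ENNReal.ofReal_mul' hL]

end LargeScales

/-! ### Small scales -/

section SmallScales

open Finset

/-- A dyadic jump telescopes into consecutive differences over a left half interval. These intervals
are disjoint, so each `n` receives one sign, or `0` if it lies in a right half. -/
theorem sum_mul_dyadicJump_stopped (a : ℕ → ℂ) (M i : ℕ) (ω : ℕ → ℤˣ) :
    ∑ b ∈ range (M + 1), ((ω b : ℤ) : ℂ) * dyadicJump (fun n => a n - a (max n M)) i b =
      ∑ n ∈ range M, ((if n / 2 ^ i % 2 = 0 then (ω (n / 2 ^ i + 1) : ℤ) else 0 : ℤ) : ℂ) *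
        (a (n + 1) - a n) := by
  set c : ℕ → ℂ := fun n => a n - a (max n M) with hc
  have h2 : 0 < 2 ^ i := by positivity
  have hdiff : ∀ n, c (n + 1) - c n = if n < M then a (n + 1) - a n else 0 := by
    intro n
    split_ifs with h
    · simp only [hc, max_eq_right h.le, max_eq_right (Nat.succ_le_of_lt h)]
      ring
    · have h : M ≤ n := not_lt.1 h
      simp only [hc, max_eq_left h, max_eq_left (h.trans n.le_succ), sub_self]
  have hmap : ∀ n ∈ range M, n / 2 ^ i + 1 ∈ range (M + 1) := by
    intro n hn
    rw [mem_range] at hn ⊢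
    have := Nat.div_le_self n (2 ^ i)
    omega
  rw [← sum_fiberwise_of_maps_to hmap]
  refine sum_congr rfl fun b _ => ?_
  unfold dyadicJump
  split_ifs with hb
  · have hfil : ∀ n, n / 2 ^ i + 1 = b ↔ n ∈ Ico ((b - 1) * 2 ^ i) (b * 2 ^ i) := by
      intro n
      rw [mem_Ico, ← Nat.le_div_iff_mul_le h2, ← Nat.div_lt_iff_lt_mul h2]
      omega
    have hterm : ∀ n ∈ (range M).filter fun n => n / 2 ^ i + 1 = b,
        ((if n / 2 ^ i % 2 = 0 then (ω (n / 2 ^ i + 1) : ℤ) else 0 : ℤ) : ℂ) * (a (n + 1) - a n) =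
        ((ω b : ℤ) : ℂ) * (a (n + 1) - a n) := by
      intro n hn
      have hn := (mem_filter.1 hn).2
      rw [if_pos (by omega), hn]
    rw [sum_congr rfl hterm, ← mul_sum]
    congr 1
    rw [← sum_Ico_sub c (Nat.mul_le_mul_right _ (Nat.sub_le b 1)), sum_congr rfl fun n _ => hdiff n,
      ← sum_filter]
    refine sum_congr ?_ fun _ _ => rfl
    ext n
    rw [mem_filter, mem_filter, hfil, mem_range]
    tauto
  · rw [mul_zero]
    symm
    refine sum_eq_zero fun n hn => ?_
    have hn := (mem_filter.1 hn).2
    rw [if_neg (by omega)]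
    simp

/-- Rademacher–Menshov bounds the variation by `J` dyadic square functions and one value.
Khinchine's inequality reduces each square function to sums of differences with coefficients in
`{-1, 0, 1}`. -/
theorem tsum_variationNorm_stopped_le {X : Type*} {p : ℝ} (hp : 1 ≤ p) {r : ℝ≥0∞} (hr : 2 ≤ r)
    {a : ℕ → X → ℂ} {D : ℝ≥0∞} (hD : ∀ κ : ℕ → ℤ, (∀ n, |κ n| ≤ 1) → ∀ s : Finset ℕ,
      ∑' x, ‖∑ n ∈ s, (κ n : ℂ) * (a (n + 1) x - a n x)‖ₑ ^ p ≤ D) {M J : ℕ} (hJ : M ≤ 2 ^ J) :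
    ∑' x, variationNorm r (fun n => a n x - a (max n M) x) ^ p ≤
      (3 * (J + 1)) ^ p * (12 * D) := by
  have hp0 : 0 < p := by linarith
  set c : X → ℕ → ℂ := fun x n => a n x - a (max n M) x with hc
  have hc0 : ∀ x n, M ≤ n → c x n = 0 := fun x n h => by
    simp only [hc, max_eq_left h, sub_self]
  have hjump : ∀ i, ∑' x, seqL2 (dyadicJump (c x) i) ^ p ≤ 12 * D := by
    intro i
    refine tsum_seqL2_rpow_le hp0 (K := M + 1) (fun x b hb => ?_) fun ω => ?_
    · unfold dyadicJump
      have h1 : (b - 1) * 1 ≤ (b - 1) * 2 ^ i := Nat.mul_le_mul_left _ Nat.one_le_two_pow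
      have h2 : b * 1 ≤ b * 2 ^ i := Nat.mul_le_mul_left _ Nat.one_le_two_pow
      rw [hc0 x _ (by omega), hc0 x _ (by omega), sub_self, ite_self]
    · refine le_trans (le_of_eq ?_) (hD (fun n => if n / 2 ^ i % 2 = 0 then
        (ω (n / 2 ^ i + 1) : ℤ) else 0) (fun n => ?_) (range M))
      · refine tsum_congr fun x => ?_
        rw [← sum_mul_dyadicJump_stopped (fun n => a n x)]
      · split_ifs
        · rcases Int.units_eq_one_or (ω (n / 2 ^ i + 1)) with h | h <;> simp [h]
        · simp
  have hfirst : ∑' x, ‖c x 0‖ₑ ^ p ≤ 12 * D := by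
    refine le_trans (le_of_eq ?_) ((hD (fun _ => 1) (fun _ => by simp) (range M)).trans
      (le_mul_of_one_le_left' (by norm_num)))
    refine tsum_congr fun x => ?_
    simp only [Int.cast_one, one_mul]
    rw [sum_range_sub (fun n => a n x), ← enorm_neg]
    simp [hc]
  set y : X → ℕ → ℝ≥0∞ := fun x i => if i < J then seqL2 (dyadicJump (c x) i) else ‖c x 0‖ₑ with hy
  have hpt : ∀ x, variationNorm r (c x) ^ p ≤
      3 ^ p * (((J + 1 : ℕ) : ℝ≥0∞) ^ (p - 1) * ∑ i ∈ range (J + 1), y x i ^ p) := by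
    intro x
    have h1 := variationNorm_le_dyadic hr (c x) J fun n hn => hc0 x n (hJ.trans hn)
    have h2 : ∑ i ∈ range J, seqL2 (dyadicJump (c x) i) + ‖c x 0‖ₑ = ∑ i ∈ range (J + 1), y x i := by
      rw [sum_range_succ]
      congr 1
      · exact sum_congr rfl fun i hi => by simp only [hy, if_pos (mem_range.1 hi)]
      · simp [hy]
    rw [h2] at h1
    refine (ENNReal.rpow_le_rpow h1 hp0.le).trans ?_
    rw [ENNReal.mul_rpow_of_nonneg _ _ hp0.le]
    refine mul_le_mul_right ?_ _
    simpa using ENNReal.rpow_sum_le_const_mul_sum_rpow (range (J + 1)) (y x) hp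
  refine (ENNReal.tsum_le_tsum hpt).trans ?_
  rw [ENNReal.tsum_mul_left, ENNReal.tsum_mul_left,
    Summable.tsum_finsetSum fun _ _ => ENNReal.summable]
  have hsum : ∑ i ∈ range (J + 1), ∑' x, y x i ^ p ≤ ((J + 1 : ℕ) : ℝ≥0∞) * (12 * D) := by
    refine (sum_le_card_nsmul _ _ (12 * D) fun i hi => ?_).trans (by simp)
    by_cases h : i < J
    · simpa only [hy, if_pos h] using hjump i
    · simpa only [hy, if_neg h] using hfirst
  refine (mul_le_mul_right (mul_le_mul_right hsum _) _).trans (le_of_eq ?_)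
  rw [ENNReal.mul_rpow_of_nonneg _ _ hp0.le, mul_assoc (3 ^ p)]
  congr 1
  rw [← mul_assoc]
  congr 1
  have h3 : ((J + 1 : ℕ) : ℝ≥0∞) = (J : ℝ≥0∞) + 1 := by push_cast; rfl
  rw [h3]
  have h4 : ((J : ℝ≥0∞) + 1) ≠ 0 := by simp
  have h5 : ((J : ℝ≥0∞) + 1) ≠ ⊤ := by simp
  have h6 := ENNReal.rpow_sub p 1 h4 h5
  rw [ENNReal.rpow_one] at h6
  rw [h6, ENNReal.div_mul_cancel h4 h5]

variable {d Q : ℕ} [NeZero Q]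

theorem zconv_periodize_sum {ρ : ℝ} {m : ℕ → EuclideanSpace ℝ (Fin d) → ℂ}
    (hm : ∀ n, CubeSymbol ρ (m n)) (κ : ℕ → ℂ) (s : Finset ℕ) (t : Finset (Fin d → ZMod Q))
    {f : (Fin d → ℤ) → ℂ} (hf : f.support.Finite) (x : Fin d → ℤ) :
    zconv (coef fun ξ => ∑ a ∈ t, ∑ n ∈ s,
        κ n * (m (n + 1) - m n) (torusRep (ξ - torusEmb d Q a))) f x =
      ∑ n ∈ s, κ n * (zconv (coef fun ξ => ∑ a ∈ t, m (n + 1) (torusRep (ξ - torusEmb d Q a))) f x -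
        zconv (coef fun ξ => ∑ a ∈ t, m n (torusRep (ξ - torusEmb d Q a))) f x) := by
  have hG : ∀ n, BddMeas fun ξ : UnitAddTorus (Fin d) =>
      ∑ a ∈ t, m n (torusRep (ξ - torusEmb d Q a)) := fun n => (hm n).bddMeas_torusRep.periodize _
  have e : (fun ξ : UnitAddTorus (Fin d) => ∑ a ∈ t, ∑ n ∈ s,
      κ n * (m (n + 1) - m n) (torusRep (ξ - torusEmb d Q a))) =
      fun ξ => ∑ n ∈ s, (κ n * (∑ a ∈ t, m (n + 1) (torusRep (ξ - torusEmb d Q a))) +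
        -κ n * ∑ a ∈ t, m n (torusRep (ξ - torusEmb d Q a))) := by
    funext ξ
    rw [sum_comm]
    refine sum_congr rfl fun n _ => ?_
    rw [mul_sum, mul_sum, ← sum_add_distrib]
    refine sum_congr rfl fun a _ => ?_
    rw [Pi.sub_apply]; ring
  have hc : ∀ z, coef (fun ξ : UnitAddTorus (Fin d) => ∑ a ∈ t, ∑ n ∈ s,
      κ n * (m (n + 1) - m n) (torusRep (ξ - torusEmb d Q a))) z = ∑ n ∈ s, κ n *
      (coef (fun ξ => ∑ a ∈ t, m (n + 1) (torusRep (ξ - torusEmb d Q a))) z -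
        coef (fun ξ => ∑ a ∈ t, m n (torusRep (ξ - torusEmb d Q a))) z) := by
    intro z
    have hK : ∀ (n : ℕ) (c : ℂ), BddMeas fun ξ : UnitAddTorus (Fin d) =>
        c * ∑ a ∈ t, m n (torusRep (ξ - torusEmb d Q a)) := fun n c => (bddMeas_const c).mul (hG n)
    have hadd : ∀ n, coef (fun ξ : UnitAddTorus (Fin d) =>
        κ n * (∑ a ∈ t, m (n + 1) (torusRep (ξ - torusEmb d Q a))) +
        -κ n * ∑ a ∈ t, m n (torusRep (ξ - torusEmb d Q a))) z =
        coef (fun ξ => κ n * (∑ a ∈ t, m (n + 1) (torusRep (ξ - torusEmb d Q a)))) z +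
        coef (fun ξ => -κ n * ∑ a ∈ t, m n (torusRep (ξ - torusEmb d Q a))) z := by
      intro n
      have := coef_sum (univ : Finset (Fin 2)) (g := ![fun ξ : UnitAddTorus (Fin d) =>
        κ n * (∑ a ∈ t, m (n + 1) (torusRep (ξ - torusEmb d Q a))),
        fun ξ => -κ n * ∑ a ∈ t, m n (torusRep (ξ - torusEmb d Q a))])
        (fun i _ => by fin_cases i; exacts [hK _ _, hK _ _]) z
      simpa [Fin.sum_univ_two] using this
    have hbm : ∀ n, BddMeas fun ξ : UnitAddTorus (Fin d) =>
        κ n * (∑ a ∈ t, m (n + 1) (torusRep (ξ - torusEmb d Q a))) +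
        -κ n * ∑ a ∈ t, m n (torusRep (ξ - torusEmb d Q a)) := by
      intro n
      have := BddMeas.sum (univ : Finset (Fin 2)) (g := ![fun ξ : UnitAddTorus (Fin d) =>
        κ n * (∑ a ∈ t, m (n + 1) (torusRep (ξ - torusEmb d Q a))),
        fun ξ => -κ n * ∑ a ∈ t, m n (torusRep (ξ - torusEmb d Q a))])
        (fun i _ => by fin_cases i; exacts [hK _ _, hK _ _])
      simpa [Fin.sum_univ_two] using this
    rw [e, coef_sum _ fun n _ => hbm n]
    refine sum_congr rfl fun n _ => ?_
    rw [hadd, coef_const_mul, coef_const_mul]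
    ring
  simp only [zconv_eq_sum _ (show f.support ⊆ hf.toFinset by simp), hc]
  simp_rw [mul_sum]
  rw [sum_comm]
  refine sum_congr rfl fun n _ => ?_
  rw [← sum_sub_distrib, mul_sum]
  refine sum_congr rfl fun z _ => ?_
  ring

end SmallScales

/-! ### The discrete variational estimate -/

section Main

open Finset
open scoped Nat

/-- The case `Q = 1` of periodic transference, for a constant sequence. -/
theorem exists_convBdd_of_varBdd (d : ℕ) {p : ℝ} (hp : 1 < p) : ∃ C : ℝ, 0 < C ∧
    ∀ (m : EuclideanSpace ℝ (Fin d) → ℂ) (ρ : ℝ), ρ < 1 / 2 → CubeSymbol ρ m →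
    ∀ B : ℝ, VarBdd p ⊤ (fun _ => m) (ENNReal.ofReal B) →
      ConvBdd (coef fun ξ => m (torusRep ξ)) p (C * B) := by
  obtain ⟨C, hC, h⟩ := exists_periodic_transference d hp
  refine ⟨C, hC, fun m ρ hρ hm B hB f hf => ?_⟩
  have h1 := h 1 ⊤ le_top (fun _ => m) ρ hρ (by push_cast; linarith) (fun _ => hm) _ hB f hf
  have e : (fun ξ => ∑ a, m (torusRep (ξ - torusEmb d 1 a))) = fun ξ => m (torusRep ξ) := by
    funext ξ
    rw [Fintype.sum_subsingleton _ (0 : Fin d → ZMod 1), map_zero, sub_zero]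
  simp only [e, variationNorm_top_const] at h1
  rwa [ENNReal.ofReal_mul hC.le]

theorem TZper_canonicalFinset {d N Q : ℕ} [NeZero Q] (hQ : ∀ q, 1 ≤ q → q ≤ N → q ∣ Q) {ρ : ℝ}
    {m : EuclideanSpace ℝ (Fin d) → ℂ} (hm : CubeSymbol ρ m) {f : (Fin d → ℤ) → ℂ}
    (hf : f.support.Finite) (x : Fin d → ℤ) : TZper (canonicalFinset d N) m f x =
      zconv (coef fun ξ => ∑ a ∈ smallOrder d Q N, m (torusRep (ξ - torusEmb d Q a))) f x := by
  unfold TZper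
  rw [canonicalFinset_eq_map hQ]
  simp only [sum_map, Function.Embedding.coeFn_mk]
  exact TZ_eq_zconv (hm.bddMeas_torusRep.periodize _) hf x

/-- The sequence is the one frozen before `M = J₀ N²`, which has only very small supports, plus a
remainder that vanishes from `M` on. Both parts use the scalar theorem, at the cost `S^e`; the
remainder costs one more factor `S` for the dyadic levels. The exponent `e` depends on `k` alone, so
the final power of `N` is uniform in `p`, `d` and the lacunarity. -/
theorem exists_discrete_bound (k : ℕ) : ∃ e : ℕ, ∀ p : ℝ, Real.conjExponent (2 * (k + 1) : ℕ) ≤ p →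
    p ≤ (2 * (k + 1) : ℕ) → ∀ d J₀ : ℕ, ∃ K : ℝ, 0 < K ∧
    ∀ N : ℕ, 1 ≤ N → ∀ S : ℝ, 1 ≤ S → (∀ q, 1 ≤ q → q ≤ N → (smoothCount N q : ℝ) ≤ S) →
    (Nat.log 2 N + 1 : ℕ) ≤ S → ∀ r : ℝ≥0∞, 2 ≤ r → ∀ δ : ℝ,
    δ = (2 * ((2 * (k + 1) : ℕ) : ℝ) * (N : ℝ) ^ (2 * (k + 1)))⁻¹ →
    ∀ m : ℕ → EuclideanSpace ℝ (Fin d) → ℂ, (∀ n, CubeSymbol δ (m n)) →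
    (∀ n, J₀ * N ^ 2 ≤ n → CubeSymbol (δ / (4 * N !)) (m n)) →
    ∀ T : ℝ, 0 < T → VarBdd p r m (ENNReal.ofReal T) →
    (∀ κ : ℕ → ℤ, (∀ n, |κ n| ≤ 1) → ∀ s : Finset ℕ, VarBdd (2 * (k + 1) : ℕ) ⊤
      (fun _ ξ => ∑ n ∈ s, (κ n : ℂ) * (m (n + 1) - m n) ξ) (ENNReal.ofReal T)) →
    ∀ f : (Fin d → ℤ) → ℂ, f.support.Finite →
      ∑' x, variationNorm r (fun n => TZper (canonicalFinset d N) (m n) f x) ^ p ≤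
        ENNReal.ofReal (K * S ^ (e + 1) * T) ^ p * ∑' x, ‖f x‖ₑ ^ p := by
  obtain ⟨Cs, e, hCs, hscal⟩ := exists_convBdd_periodize k
  refine ⟨e, fun p hp1 hp2 d J₀ => ?_⟩
  have hp0 : (2 : ℝ) ≤ (2 * (k + 1) : ℕ) := by
    have : 2 ≤ 2 * (k + 1) := by omega
    exact_mod_cast this
  have hp : 1 < p :=
    (Real.HolderConjugate.conjExponent (by linarith : (1 : ℝ) < (2 * (k + 1) : ℕ))).symm.lt.trans_le hp1
  obtain ⟨Cl, hCl, hlarge⟩ := exists_large_scales d hp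
  obtain ⟨Ct, hCt, htrans⟩ := exists_convBdd_of_varBdd d
    (by linarith : (1 : ℝ) < (2 * (k + 1) : ℕ))
  set E : ℝ := Cs * (5 ^ d) ^ (2 * k) with hE
  have hE0 : 0 < E := by positivity
  refine ⟨2 * E * (Cl * 5 ^ d + 36 * (J₀ + 3) * Ct), by positivity, ?_⟩
  intro N hN S hS1 hS hlog r hr δ hδ m hm hmM T hT hA hB f hf
  have hN1 : (1 : ℝ) ≤ N := by exact_mod_cast hN
  have hNp : (1 : ℝ) ≤ (N : ℝ) ^ (2 * (k + 1)) := one_le_pow₀ hN1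
  have hδ0 : 0 < δ := by rw [hδ]; positivity
  have hδ4 : δ * 4 * (N : ℝ) ^ (2 * (k + 1)) ≤ 1 := by
    rw [hδ, inv_mul_eq_div, div_mul_eq_mul_div, div_le_one (by positivity)]
    gcongr
    linarith
  have hδp : ((2 * (k + 1) : ℕ) : ℝ) * δ * (N : ℝ) ^ (2 * (k + 1)) = 1 / 2 := by
    rw [hδ]; field_simp
  have hδ1 : δ * 4 ≤ 1 := by nlinarith
  have hN2 : (N : ℝ) ^ 2 ≤ (N : ℝ) ^ (2 * (k + 1)) := pow_le_pow_right₀ hN1 (by omega)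
  have h3 : 3 * δ ≤ 1 := by linarith
  have h3N : 3 * δ < 1 / (N : ℝ) ^ 2 := by
    rw [lt_div_iff₀ (by positivity)]
    nlinarith [mul_le_mul_of_nonneg_left hN2 hδ0.le]
  have hpN : (2 * (k + 1)) * δ < 1 / (N : ℝ) ^ (2 * (k + 1)) := by
    rw [lt_div_iff₀ (by positivity)]
    push_cast at hδp
    rw [hδp]; norm_num
  have : NeZero N ! := ⟨N.factorial_ne_zero⟩
  have hQ : ∀ q, 1 ≤ q → q ≤ N → q ∣ N ! := fun q h1 h2 => Nat.dvd_factorial h1 h2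
  have hF1 : (1 : ℝ) ≤ (N ! : ℕ) := by exact_mod_cast N.factorial_pos
  -- The modulus is `Q = N!`; `τ` is small enough to separate all points of `(1/N!)ℤ^d`. No other
  -- quantity depends on the size of `N!`.
  set τ : ℝ := δ / (4 * N !) with hτ
  have hτ0 : 0 < τ := by positivity
  have hτF : τ * (4 * N !) = δ := div_mul_cancel₀ _ (by positivity)
  have hτδ : 4 * τ ≤ δ := by nlinarith
  have hτ3 : 3 * τ ≤ 1 := by linarith
  have hτQ : 5 * τ < 2 / (N ! : ℕ) := by
    rw [lt_div_iff₀ (by positivity)]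
    nlinarith
  have hS0 : 0 < S := by linarith
  set a : ℕ → (Fin d → ℤ) → ℂ := fun n => zconv (coef fun ξ =>
    ∑ b ∈ smallOrder d N ! N, m n (torusRep (ξ - torusEmb d N ! b))) f with ha
  simp only [TZper_canonicalFinset hQ (hm _) hf]
  change ∑' x, variationNorm r (fun n => a n x) ^ p ≤ _
  set Φ : ℝ≥0∞ := ∑' x, ‖f x‖ₑ ^ p
  set M : ℕ := J₀ * N ^ 2 with hM
  -- The scalar theorem for the cutoff at scale `τ`: its support has radius `3τ/2 ≤ δ`, and its
  -- kernel has `ℓ¹` norm at most `5^d`.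
  have hetab : ConvBdd (coef fun ξ => ∑ b ∈ smallOrder d N ! N, eta τ (ξ - torusEmb d N ! b)) p
      (5 ^ d * (E * S ^ e)) :=
    hscal d N ! N δ S hδ0 h3 h3N hpN hS1 hS (eta τ) (bddMeas_eta τ)
      (fun ξ hξ => (norm_le_of_eta_ne_zero hξ).trans (by linarith)) (5 ^ d) (by positivity)
      (convBdd_eta hτ0 hτ3 (by linarith)) p hp1 hp2
  have hb := hlarge N ! N r (one_le_two.trans hr) (fun n => m (max n M)) τ hτ0 hτ3 hτQ
    (fun n => hmM _ (le_max_right _ _)) T _ (by positivity)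
    (hA.max (by linarith) (one_le_two.trans hr) M) hetab f hf
  have hsmall : ∀ κ : ℕ → ℤ, (∀ n, |κ n| ≤ 1) → ∀ s : Finset ℕ,
      ∑' x, ‖∑ n ∈ s, (κ n : ℂ) * (a (n + 1) x - a n x)‖ₑ ^ p ≤
        ENNReal.ofReal (Ct * T * (E * S ^ e)) ^ p * Φ := by
    intro κ hκ s
    have hcs : CubeSymbol δ fun ξ => ∑ n ∈ s, (κ n : ℂ) * (m (n + 1) - m n) ξ :=
      CubeSymbol.sum fun n => ((hm (n + 1)).sub (hm n)).const_mul _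
    have h1 := htrans _ δ (by linarith) hcs T (hB κ hκ s)
    have h2 := hscal d N ! N δ S hδ0 h3 h3N hpN hS1 hS _ hcs.bddMeas_torusRep
      (fun ξ hξ => hcs.norm_le_of_ne_zero hδ0.le hξ) _ (by positivity) h1 p hp1 hp2 f hf
    simpa only [zconv_periodize_sum hm (fun n => (κ n : ℂ)) s _ hf] using h2
  -- Enough levels for `M = J₀ N²`, yet `J + 1 ≤ (J₀ + 3) S` because `Nat.log 2 N + 1 ≤ S`.
  set J : ℕ := J₀ + 2 * (Nat.log 2 N + 1) with hJ
  have hMJ : M ≤ 2 ^ J := by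
    rw [hJ, pow_add, pow_mul', hM]
    exact Nat.mul_le_mul Nat.lt_two_pow_self.le
      (Nat.pow_le_pow_left (Nat.lt_pow_succ_log_self one_lt_two N).le 2)
  have hc := tsum_variationNorm_stopped_le hp.le hr hsmall hMJ
  have hJS : (J : ℝ) + 1 ≤ (J₀ + 3) * S := by
    have h1 : (J : ℝ) = J₀ + 2 * ((Nat.log 2 N + 1 : ℕ) : ℝ) := by rw [hJ]; push_cast; ring
    have h2 : (J₀ : ℝ) ≤ J₀ * S := le_mul_of_one_le_right (Nat.cast_nonneg _) hS1
    rw [h1]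
    linarith
  set X : ℝ := Cl * T * (5 ^ d * (E * S ^ e)) with hX
  set Y : ℝ := 36 * ((J₀ + 3) * S) * (Ct * T * (E * S ^ e)) with hY
  have hX0 : 0 ≤ X := by positivity
  have hY0 : 0 ≤ Y := by positivity
  have hpn : 0 ≤ p := by linarith
  have hc' : ∑' x, variationNorm r (fun n => a n x - a (max n M) x) ^ p ≤
      ENNReal.ofReal Y ^ p * Φ := by
    refine hc.trans ?_
    have hmul : ∀ a b c t : ℝ≥0∞, a ^ p * (b ^ p * (c ^ p * t)) = (a * b * c) ^ p * t := by
      intro a b c t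
      rw [ENNReal.mul_rpow_of_nonneg _ _ hpn, ENNReal.mul_rpow_of_nonneg _ _ hpn]
      ring
    have hYe : ENNReal.ofReal Y = ENNReal.ofReal (36 * ((J₀ + 3) * S)) *
        ENNReal.ofReal (Ct * T * (E * S ^ e)) := ENNReal.ofReal_mul (by positivity)
    have h12 : (12 : ℝ≥0∞) ≤ 12 ^ p := by
      simpa using ENNReal.rpow_le_rpow_of_exponent_le (by norm_num : (1 : ℝ≥0∞) ≤ 12) hp.le
    have hJE : (3 : ℝ≥0∞) * (J + 1) * 12 ≤ ENNReal.ofReal (36 * ((J₀ + 3) * S)) := by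
      have : (3 : ℝ≥0∞) * (J + 1) * 12 = ENNReal.ofReal (36 * (J + 1)) := by
        rw [ENNReal.ofReal_mul (by norm_num), ENNReal.ofReal_add (by positivity) (by norm_num),
          ENNReal.ofReal_natCast, ENNReal.ofReal_one, mul_right_comm]
        norm_num
      rw [this]
      exact ENNReal.ofReal_le_ofReal (by linarith)
    calc (3 * ((J : ℝ≥0∞) + 1)) ^ p * (12 * (ENNReal.ofReal (Ct * T * (E * S ^ e)) ^ p * Φ))
        ≤ (3 * ((J : ℝ≥0∞) + 1)) ^ p * (12 ^ p * (ENNReal.ofReal (Ct * T * (E * S ^ e)) ^ p * Φ)) := by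
          gcongr
      _ = (3 * ((J : ℝ≥0∞) + 1) * 12 * ENNReal.ofReal (Ct * T * (E * S ^ e))) ^ p * Φ := by
          exact hmul _ _ _ _
      _ ≤ _ := by
          rw [hYe]
          exact mul_le_mul_left (ENNReal.rpow_le_rpow (mul_le_mul_left hJE _) hpn) _
  have hpt : ∀ x, variationNorm r (fun n => a n x) ^ p ≤ 2 ^ (p - 1) *
      (variationNorm r (fun n => a (max n M) x) ^ p +
        variationNorm r (fun n => a n x - a (max n M) x) ^ p) := by
    intro x
    refine le_trans (ENNReal.rpow_le_rpow ?_ (by linarith))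
      (ENNReal.rpow_add_le_mul_rpow_add_rpow _ _ hp.le)
    have := variationNorm_add_le (one_le_two.trans hr) (fun n => a (max n M) x)
      fun n => a n x - a (max n M) x
    simpa using this
  refine (ENNReal.tsum_le_tsum hpt).trans ?_
  rw [ENNReal.tsum_mul_left, ENNReal.tsum_add]
  calc 2 ^ (p - 1) * (∑' x, variationNorm r (fun n => a (max n M) x) ^ p +
        ∑' x, variationNorm r (fun n => a n x - a (max n M) x) ^ p)
      ≤ 2 ^ p * (ENNReal.ofReal X ^ p * Φ + ENNReal.ofReal Y ^ p * Φ) := by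
        gcongr
        · norm_num
        · linarith
    _ ≤ 2 ^ p * ((ENNReal.ofReal X + ENNReal.ofReal Y) ^ p * Φ) := by
        rw [← add_mul]
        gcongr
        exact ENNReal.add_rpow_le_rpow_add _ _ hp.le
    _ = ENNReal.ofReal (2 * (X + Y)) ^ p * Φ := by
        have h2 : ENNReal.ofReal (2 * (X + Y)) = 2 * (ENNReal.ofReal X + ENNReal.ofReal Y) := by
          rw [ENNReal.ofReal_mul zero_le_two, ENNReal.ofReal_add hX0 hY0, ENNReal.ofReal_ofNat]
        rw [h2, ENNReal.mul_rpow_of_nonneg _ _ hpn, mul_assoc]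
    _ ≤ _ := by
        refine mul_le_mul_left (ENNReal.rpow_le_rpow (ENNReal.ofReal_le_ofReal ?_) hpn) _
        have h1 : X ≤ Cl * 5 ^ d * (T * E * S ^ e * S) := by
          rw [hX]
          have : T * E * S ^ e ≤ T * E * S ^ e * S := le_mul_of_one_le_right (by positivity) hS1
          calc Cl * T * (5 ^ d * (E * S ^ e)) = Cl * 5 ^ d * (T * E * S ^ e) := by ring
            _ ≤ _ := by gcongr
        have h2 : Y = 36 * (J₀ + 3) * Ct * (T * E * S ^ e * S) := by rw [hY]; ring
        rw [h2, pow_succ]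
        linarith

end Main

/-! ### Consequences of lacunarity and the choice of the threshold. -/

section Parameters

open scoped Nat

theorem IsLacunary.pow_le {lam : ℝ} (hlam : 0 ≤ lam) {l : ℕ → ℕ} (h : IsLacunary lam l) (n : ℕ) :
    lam ^ n ≤ l n := by
  induction n with
  | zero => simpa using h.1 0
  | succ n ih =>
    have h1 : (0 : ℝ) < l n := by exact_mod_cast h.1 n
    have h2 := h.2 n
    rw [le_div_iff₀ h1] at h2
    rw [pow_succ']
    exact (mul_le_mul_of_nonneg_left ih hlam).trans h2

theorem eight_mul_pow_mul_factorial_le {p₀ N : ℕ} (hN : 1 ≤ N) :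
    8 * p₀ * N ^ p₀ * N ! ≤ 2 ^ ((4 + 2 * p₀) * N ^ 2) := by
  have h1 : 8 * p₀ ≤ 2 ^ (3 + p₀) := by
    rw [pow_add]
    exact Nat.mul_le_mul (by norm_num) Nat.lt_two_pow_self.le
  have h2 : N ^ p₀ ≤ 2 ^ (N * p₀) := by
    rw [pow_mul]
    exact Nat.pow_le_pow_left Nat.lt_two_pow_self.le _
  have h3 : N ! ≤ 2 ^ (N * N) := by
    rw [pow_mul]
    exact N.factorial_le_pow.trans (Nat.pow_le_pow_left Nat.lt_two_pow_self.le _)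
  calc 8 * p₀ * N ^ p₀ * N ! ≤ 2 ^ (3 + p₀) * 2 ^ (N * p₀) * 2 ^ (N * N) :=
        Nat.mul_le_mul (Nat.mul_le_mul h1 h2) h3
    _ = 2 ^ (3 + p₀ + N * p₀ + N * N) := by rw [← pow_add, ← pow_add]
    _ ≤ _ := by
        refine Nat.pow_le_pow_right (by norm_num) ?_
        have h4 : 1 ≤ N ^ 2 := Nat.one_le_pow _ _ hN
        have h5 : N ≤ N ^ 2 := Nat.le_self_pow two_ne_zero N
        nlinarith [Nat.mul_le_mul_left p₀ h4, Nat.mul_le_mul_left p₀ h5]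

/-- With `lam^h ≥ 2`, growth at rate `lam^n` beats `8 p₀ N^p₀ N! ≤ 2^((4 + 2p₀) N²)` after a number
of steps quadratic in `N`. The threshold is polynomial in `N`, so its logarithm is only of order
`log N`. -/
theorem inv_le_of_lacunary {lam : ℝ} (hlam : 1 < lam) {h : ℕ} (hh : 2 ≤ lam ^ h) {l : ℕ → ℕ}
    (hl : IsLacunary lam l) {p₀ N n : ℕ} (hp₀ : 0 < p₀) (hN : 1 ≤ N)
    (hn : h * (4 + 2 * p₀) * N ^ 2 ≤ n) :
    (l n : ℝ)⁻¹ ≤ (2 * (p₀ : ℝ) * (N : ℝ) ^ p₀)⁻¹ / (4 * N !) := by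
  have hN0 : (0 : ℝ) < N := by exact_mod_cast hN
  have hp0 : (0 : ℝ) < p₀ := by exact_mod_cast hp₀
  have hF : (0 : ℝ) < (N ! : ℕ) := by exact_mod_cast N.factorial_pos
  rw [div_eq_mul_inv, ← mul_inv]
  refine inv_anti₀ (by positivity) ?_
  have h1 : ((8 * p₀ * N ^ p₀ * N ! : ℕ) : ℝ) ≤ ((2 ^ ((4 + 2 * p₀) * N ^ 2) : ℕ) : ℝ) :=
    Nat.cast_le.2 (eight_mul_pow_mul_factorial_le hN)
  push_cast at h1
  calc 2 * (p₀ : ℝ) * (N : ℝ) ^ p₀ * (4 * N !) = 8 * p₀ * N ^ p₀ * N ! := by ring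
    _ ≤ 2 ^ ((4 + 2 * p₀) * N ^ 2) := h1
    _ ≤ (lam ^ h) ^ ((4 + 2 * p₀) * N ^ 2) := by gcongr
    _ = lam ^ (h * (4 + 2 * p₀) * N ^ 2) := by rw [← pow_mul, mul_assoc]
    _ ≤ lam ^ n := pow_le_pow_right₀ hlam.le hn
    _ ≤ l n := hl.pow_le (by linarith) n

theorem discreteNorm_le_of_tsum_le {d N : ℕ} {p : ℝ} (hp : 0 < p) {r c : ℝ≥0∞}
    {m : ℕ → EuclideanSpace ℝ (Fin d) → ℂ}
    (h : ∀ f : (Fin d → ℤ) → ℂ, f.support.Finite →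
      ∑' x, variationNorm r (fun n => TZper (canonicalFinset d N) (m n) f x) ^ p ≤
        c ^ p * ∑' x, ‖f x‖ₑ ^ p) : discreteNorm N (ENNReal.ofReal p) r m ≤ c := by
  refine sInf_le fun f hf => ?_
  rw [← ENNReal.rpow_le_rpow_iff hp, ENNReal.mul_rpow_of_nonneg _ _ hp.le, eLpNorm_ofReal_rpow hp,
    eLpNorm_ofReal_rpow hp, lintegral_count, lintegral_count]
  simpa using h f hf

end Parameters

end IWVar

end

/-! ### Assembly of the constants. -/

open IWVar

theorem theorem3p11 (p₀ : ℕ) (hp₀ : 0 < p₀) (hp₀even : Even p₀) (r : ENNReal) (hr : 2 < r) :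
    ∃ C : ℝ, 0 < C ∧
      ∀ p : ℝ, (p₀ : ℝ) / ((p₀ : ℝ) - 1) ≤ p → p ≤ (p₀ : ℝ) →
      ∀ d : ℕ, 1 ≤ d → ∀ lam : ℝ, 1 < lam →
      ∃ K : ℝ, 0 < K ∧
        ∀ N : ℕ, 1 ≤ N →
        ∀ l : ℕ → ℕ, IWVar.IsLacunary lam l →
        ∀ ϑ : ℕ → ℝ,
          (∀ n, 0 < ϑ n ∧ ϑ n ≤ min (2 * (p₀ : ℝ) * (N : ℝ) ^ p₀)⁻¹ (l n : ℝ)⁻¹) →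
        ∀ m : ℕ → EuclideanSpace ℝ (Fin d) → ℂ,
          (∀ n, Measurable (m n)) →
          (∀ n, ∃ M : ℝ, ∀ ξ, ‖m n ξ‖ ≤ M) →
          (∀ n, Function.support (m n) ⊆ {ξ | ∀ i, |ξ i| ≤ ϑ n}) →
          IWVar.discreteNorm N (ENNReal.ofReal p) r m ≤
            ENNReal.ofReal (K * IWVar.growth C N) *
              (IWVar.constA (ENNReal.ofReal p) r m + IWVar.constB (p₀ : ENNReal) m) := by
  obtain ⟨k, rfl⟩ : ∃ k, p₀ = 2 * (k + 1) := by
    obtain ⟨j, hj⟩ := hp₀even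
    exact ⟨j - 1, by omega⟩
  obtain ⟨e, he⟩ := exists_discrete_bound k
  obtain ⟨K₁, hK₁, hsmooth⟩ := exists_smoothCount_le_growth
  -- There are `e + 1` factors `S`, each a constant times `growth 5 N`.
  refine ⟨((e + 1 : ℕ) : ℝ) * 5, by positivity, ?_⟩
  intro p hp1 hp2 d hd lam hlam
  have hp0 : (2 : ℝ) ≤ (2 * (k + 1) : ℕ) := by
    have : 2 ≤ 2 * (k + 1) := by omega
    exact_mod_cast this
  have hp : 1 < p := (Real.HolderConjugate.conjExponent
    (by linarith : (1 : ℝ) < (2 * (k + 1) : ℕ))).symm.lt.trans_le hp1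
  obtain ⟨h, hh⟩ := pow_unbounded_of_one_lt 2 hlam
  obtain ⟨K, hK, hbound⟩ := he p hp1 hp2 d (h * (4 + 2 * (2 * (k + 1))))
  refine ⟨K * K₁ ^ (e + 1), by positivity, ?_⟩
  intro N hN l hl ϑ hϑ m hmeas hbdd hsupp
  have hg : 0 < growth 5 N := growth_pos 5 hN
  set S : ℝ := K₁ * growth 5 N with hS
  have hcount : ∀ q, 1 ≤ q → q ≤ N → (smoothCount N q : ℝ) ≤ S := hsmooth N
  have hS1 : 1 ≤ S := by
    refine le_trans ?_ (hcount 1 le_rfl hN)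
    exact_mod_cast card_divisors_le_smoothCount le_rfl hN
  have hlog : ((Nat.log 2 N + 1 : ℕ) : ℝ) ≤ S := by
    rcases Nat.lt_or_ge N 2 with h2 | h2
    · rw [Nat.log_of_lt h2]; simpa using hS1
    · exact le_trans (by exact_mod_cast log_succ_le_smoothCount h2) (hcount 2 one_le_two h2)
  have hSpow : K * S ^ (e + 1) = K * K₁ ^ (e + 1) * growth (((e + 1 : ℕ) : ℝ) * 5) N := by
    rw [hS, mul_pow, growth_pow 5 hN, mul_assoc]
  rw [← hSpow]
  set c : ℝ≥0∞ := ENNReal.ofReal (K * S ^ (e + 1)) with hc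
  have hc0 : c ≠ 0 := by
    rw [hc, ne_eq, ENNReal.ofReal_eq_zero, not_le]; positivity
  have hct : c ≠ ⊤ := ENNReal.ofReal_ne_top
  set A := constA (ENNReal.ofReal p) r m with hA
  set B := constB ((2 * (k + 1) : ℕ) : ENNReal) m with hB
  -- As `c` is positive, an infinite norm makes the claim trivial; otherwise both norms yield
  -- genuine inequalities.
  by_cases hAB : A + B = ⊤
  · rw [hAB, ENNReal.mul_top hc0]; exact le_top
  obtain ⟨hAt, hBt⟩ := ENNReal.add_ne_top.1 hAB
  set δ : ℝ := (2 * ((2 * (k + 1) : ℕ) : ℝ) * (N : ℝ) ^ (2 * (k + 1)))⁻¹ with hδ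
  have hm : ∀ n, CubeSymbol (ϑ n) (m n) := fun n => ⟨hmeas n, hbdd n, fun ξ hξ => hsupp n hξ⟩
  have hϑδ : ∀ n, ϑ n ≤ δ := fun n => (hϑ n).2.trans (min_le_left _ _)
  have hϑl : ∀ n, ϑ n ≤ (l n : ℝ)⁻¹ := fun n => (hϑ n).2.trans (min_le_right _ _)
  have hϑlam : ∀ n, ϑ n ≤ lam⁻¹ ^ n := fun n => by
    refine (hϑl n).trans ?_
    rw [inv_pow]
    exact inv_anti₀ (by positivity) (hl.pow_le (by linarith) n)
  -- Here `d ≥ 1` matters: `ϑ n ^ d ≤ ϑ n`, which decays geometrically.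
  have hsum : Summable fun n => ϑ n ^ d := by
    refine Summable.of_nonneg_of_le (fun n => pow_nonneg (hϑ n).1.le _) (fun n => ?_)
      (summable_geometric_of_lt_one (by positivity) (inv_lt_one_of_one_lt₀ hlam))
    have h1 : ϑ n ≤ 1 := (hϑlam n).trans (pow_le_one₀ (by positivity) (inv_le_one_of_one_le₀ hlam.le))
    exact (pow_le_of_le_one (hϑ n).1.le h1 (by omega)).trans (hϑlam n)
  have hVA := varBdd_constA (by linarith) hAt
  have hB' : constB (ENNReal.ofReal ((2 * (k + 1) : ℕ) : ℝ)) m = B := by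
    rw [ENNReal.ofReal_natCast]
  have key : ∀ T : ℝ, 0 < T → A + B ≤ ENNReal.ofReal T →
      discreteNorm N (ENNReal.ofReal p) r m ≤ c * ENNReal.ofReal T := by
    intro T hT hABT
    rw [hc, ← ENNReal.ofReal_mul (by positivity)]
    refine discreteNorm_le_of_tsum_le (by linarith) ?_
    refine hbound N hN S hS1 hcount hlog r hr.le δ rfl m (fun n => (hm n).mono (hϑδ n))
      (fun n hn => (hm n).mono ((hϑl n).trans (inv_le_of_lacunary hlam hh.le hl hp₀ hN hn)))
      T hT (hVA.mono (by linarith) (le_self_add.trans hABT)) fun κ hκ s => ?_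
    have h1 := varBdd_sum_sub hp (by linarith : (1 : ℝ) ≤ ((2 * (k + 1) : ℕ) : ℝ))
      (fun n => (hϑ n).1) hϑδ hsum hm hAt hVA (by rwa [hB']) κ hκ s
    rw [hB'] at h1
    exact h1.mono (by linarith) (le_add_self.trans hABT)
  rw [mul_comm, ← ENNReal.div_le_iff hc0 hct]
  -- The discrete bound needs a positive real constant, while `A + B` may be `0`; so it is applied
  -- with every `t > A + B`.
  refine le_of_forall_gt_imp_ge_of_dense fun t ht => ?_
  rcases eq_or_ne t ⊤ with rfl | htt
  · exact le_top
  rw [ENNReal.div_le_iff hc0 hct, mul_comm, ← ENNReal.ofReal_toReal htt]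
  refine key t.toReal (ENNReal.toReal_pos (ne_bot_of_gt ht) htt) ?_
  rw [ENNReal.ofReal_toReal htt]
  exact ht.le
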